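/- Let $v\in\mathbb N$, $v'=\lfloor v/2\rfloor$. Let $N=N_{v,2}$ be the free two-step nilpotent Lie group on $v$ generators $X_1,\dots,X_v$; its points are written $n=\exp(X+A)$ with $X=\sum_i x_iX_i\in\mathbb R^v$ and $A=\sum_{i<j}a_{i,j}[X_i,X_j]$, and $A$ is identified with the antisymmetric matrix $(a_{i,j})\in\mathcal A_v$. The Haar measure is $dn=dX\,dA$ (Lebesgue measure in the coordinates $x_i$ and $a_{i,j}$, $i<j$). The group $O(v)$, with Haar measure $dk$ of mass $1$, acts on $N$ by automorphisms, $k.\exp(X+A)=\exp(kX+kAk^{-1})$; $O(v)$-invariant functions on $N$ are called radial. A spherical function is a continuous radial function $\Phi:N\to\mathbb C$ such that $f\mapsto\int_N f(n)\Phi(n^{-1})\,dn$ is a nonzero character of the convolution algebra of continuous compactly supported radial functions. Let $\Omega$ be the set of bounded spherical functions, with the topology of uniform convergence on compact sets and its Borel structure, and let $\langle f,\phi\rangle=\int_N f(n)\phi(n)\,dn$. A radial Plancherel measure is a Borel measure $\mu$ on $\Omega$ such that $\|f\|_{L^2(N)}=\|\langle f,\phi\rangle\|_{L^2(d\mu(\phi))}$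 for every radial $f\in L^1(N)\cap L^2(N)$. Let $\mathcal L=\{\Lambda\in\mathbb R^{v'}:\lambda_1>\dots>\lambda_{v'}>0\}$, and let $D_2(\Lambda)\in\mathcal A_v$ be the block-diagonal matrix with blocks $\lambda_j\begin{pmatrix}0&1\\-1&0\end{pmatrix}$, $j=1,\dots,v'$, followed by a zero row and column if $v$ is odd. Let $\mathcal P$ be the set of $(r,\Lambda,l)$ with $\Lambda\in\mathcal L$, $l\in\mathbb N^{v'}$ and $r\ge 0$, where $r=0$ if $v$ is even. For $(r,\Lambda,l)\in\mathcal P$ put $$\phi^{r,\Lambda,l}(n)=\int_{O(v)}\Theta^{r,\Lambda,l}(k.n)\,dk,\qquad \Theta^{r,\Lambda,l}(\exp(X+A))=e^{irx_v}\,e^{i\sum_{j}\lambda_ja_{2j-1,2j}}\prod_{j=1}^{v'}\mathcal L_{l_j}\Big(\frac{\lambda_j}{2}(x_{2j-1}^2+x_{2j}^2)\Big),$$ where $\mathcal L_n(x)=L_n(x)e^{-x/2}$ and $L_n$ is the Laguerre polynomial of degree $n$ and parameter $0$. Then the following hold. 1. There is a unique constant $c>0$ such that the measure $\eta$ on $\mathcal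 L$ given by $d\eta(\Lambda)=c\prod_{j<k}(\lambda_j^2-\lambda_k^2)^2\,d\Lambda$ if $v=2v'$, and $d\eta(\Lambda)=c\prod_i\lambda_i^2\prod_{j<k}(\lambda_j^2-\lambda_k^2)^2\,d\Lambda$ if $v=2v'+1$, satisfies $\int_{\mathcal A_v}g(A)\,dA=\int_{O(v)}\int_{\mathcal L}g(kD_2(\Lambda)k^{-1})\,d\eta(\Lambda)\,dk$ for all measurable $g\ge0$. With this $\eta$, let $m$ be the measure on $\mathcal P$ equal to $c(v)\,\big(\prod_j\lambda_j\,d\eta(\Lambda)\big)\otimes\sum_{l\in\mathbb N^{v'}}$ if $v=2v'$, and to $c(v)\,\big(\prod_j\lambda_j\,d\eta(\Lambda)\big)\otimes\sum_{l\in\mathbb N^{v'}}\otimes\,dr$ if $v=2v'+1$, where $\sum_{l\in\mathbb N^{v'}}$ denotes counting measure and $$c(v)=(2\pi)^{-\frac{v(v-1)}2-v'}\ \text{ if } v=2v',\qquad c(v)=2(2\pi)^{-\frac{v(v-1)}2-1-v'}\ \text{ if } v=2v'+1.$$ 2. Each $\phi^{r,\Lambda,l}$ with $(r,\Lambda,l)\in\mathcal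 P$ is a bounded spherical function, and $(r,\Lambda,l)\mapsto\phi^{r,\Lambda,l}$ is an injection $\mathcal P\to\Omega$ which is a Borel isomorphism onto a Borel subset of $\Omega$. 3. There is exactly one radial Plancherel measure: it is the image of $m$ under this map. In particular it is supported by $\{\phi^{r,\Lambda,l}:(r,\Lambda,l)\in\mathcal P\}$, i.e. the complement of this set has measure zero. 4. For every radial $f\in L^1(N)$ one has $\|f\|_{L^2(N)}=\|\langle f,\phi\rangle\|_{L^2(m)}$, as an equality in $[0,\infty]$. 5. There is a linear isometric bijection $F$ from the space $L^2(N)^\natural$ of radial square-integrable functions onto $L^2(\mathcal P,m)$ such that $Ff(r,\Lambda,l)=\langle f,\phi^{r,\Lambda,l}\rangle$ for $m$-almost every $(r,\Lambda,l)$ whenever $f\in L^1(N)\cap L^2(N)^\natural$. Every $f\in L^2(N)^\natural$ satisfies the inversion formula $f(n)=\int_{\mathcal P}\overline{\phi(n)}\,Ff(\phi)\,dm(\phi)$ in the $L^2$ sense, that is, $\int_N f\,\overline{h}\,dn=\int_{\mathcal P}Ff\;\overline{Fh}\,dm$ for all $h\in L^2(N)^\natural$; and if $Ff\in L^1(m)$,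 the formula holds for almost every $n$ with an absolutely convergent integral. -/

import Mathlib

open MeasureTheory Matrix TopologicalSpace
open scoped ENNReal ComplexConjugate

noncomputable section

namespace FreeNilpotent

/-! ### The group `N_{v,2}` in exponential coordinates -/

/-- Index set of the canonical basis `X_{i,j} = [X_i, X_j]`, `i < j`, of the centre. -/
abbrev Pairs (v : ℕ) : Type := {p : Fin v × Fin v // p.1 < p.2}

/-- The free two-step nilpotent Lie group on `v` generators: the point `(X, A)` is `exp (X + A)`
with `X = ∑ x_i X_i` and `A = ∑_{i<j} a_{i,j} [X_i, X_j]`. -/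
def N (v : ℕ) : Type := (Fin v → ℝ) × (Pairs v → ℝ)

variable {v : ℕ}

/-- `exp (X + A)`. -/
def N.mk (X : Fin v → ℝ) (A : Pairs v → ℝ) : N v := (X, A)

/-- The component of `n = exp (X + A)` along the generators. -/
def N.X (n : N v) : Fin v → ℝ := Prod.fst n

/-- The central component of `n = exp (X + A)`. -/
def N.A (n : N v) : Pairs v → ℝ := Prod.snd n

instance : TopologicalSpace (N v) :=
  inferInstanceAs (TopologicalSpace ((Fin v → ℝ) × (Pairs v → ℝ)))

/-- The Haar measure `dn = dX dA`: Lebesgue measure in the canonical coordinates. -/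
instance : MeasureSpace (N v) :=
  inferInstanceAs (MeasureSpace ((Fin v → ℝ) × (Pairs v → ℝ)))

/-- The Lie bracket of two elements of the span of the generators, in the basis `X_{i,j}`. -/
def bracket (X Y : Fin v → ℝ) : Pairs v → ℝ :=
  fun p => X p.1.1 * Y p.1.2 - X p.1.2 * Y p.1.1

/-- The group law given by the Baker-Campbell-Hausdorff formula in step two. -/
instance : Mul (N v) :=
  ⟨fun n n' => N.mk (n.X + n'.X) (n.A + n'.A + (1 / 2 : ℝ) • bracket n.X n'.X)⟩

instance : One (N v) := ⟨N.mk 0 0⟩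

instance : Inv (N v) := ⟨fun n => N.mk (-n.X) (-n.A)⟩

instance : Group (N v) :=
  Group.ofLeftAxioms
    (by
      intro a b c
      refine Prod.ext (funext fun i => ?_) (funext fun p => ?_)
      · change a.X i + b.X i + c.X i = a.X i + (b.X i + c.X i)
        ring
      · change a.A p + b.A p + (1 / 2 : ℝ) * bracket a.X b.X p + c.A p
            + (1 / 2 : ℝ) * bracket (a.X + b.X) c.X p
          = a.A p + (b.A p + c.A p + (1 / 2 : ℝ) * bracket b.X c.X p)
            + (1 / 2 : ℝ) * bracket a.X (b.X + c.X) p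
        simp only [bracket, Pi.add_apply]
        ring)
    (by
      intro a
      refine Prod.ext (funext fun i => ?_) (funext fun p => ?_)
      · change (0 : ℝ) + a.X i = a.X i
        ring
      · change (0 : ℝ) + a.A p + (1 / 2 : ℝ) * bracket (0 : Fin v → ℝ) a.X p = a.A p
        simp only [bracket, Pi.zero_apply]
        ring)
    (by
      intro a
      refine Prod.ext (funext fun i => ?_) (funext fun p => ?_)
      · change -a.X i + a.X i = 0
        ring
      · change -a.A p + a.A p + (1 / 2 : ℝ) * bracket (-a.X) a.X p = 0
        simp only [bracket, Pi.neg_apply]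
        ring)

/-! ### The orthogonal group, its Haar measure and its action -/

/-- The orthogonal group `O(v)`. -/
abbrev O (v : ℕ) : Type := Matrix.orthogonalGroup (Fin v) ℝ

instance : MeasurableSpace (O v) := borel _

instance : BorelSpace (O v) := ⟨rfl⟩

instance : CompactSpace (O v) := by
  refine isCompact_iff_compactSpace.mp ?_
  have hcl : IsClosed ((Matrix.orthogonalGroup (Fin v) ℝ : Set (Matrix (Fin v) (Fin v) ℝ))) := by
    have : (Matrix.orthogonalGroup (Fin v) ℝ : Set (Matrix (Fin v) (Fin v) ℝ))
        = {k | k * star k = 1} := by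
      ext k
      exact Matrix.mem_orthogonalGroup_iff (Fin v) ℝ
    rw [this]
    exact isClosed_eq (by fun_prop) continuous_const
  have hK : IsCompact (Set.pi Set.univ fun _ : Fin v =>
      Set.pi Set.univ fun _ : Fin v => Set.Icc (-1 : ℝ) 1) :=
    isCompact_univ_pi fun _ => isCompact_univ_pi fun _ => isCompact_Icc
  refine hK.of_isClosed_subset hcl fun k hk => ?_
  intro i _ j _
  have := entry_norm_bound_of_unitary (𝕜 := ℝ) hk i j
  exact abs_le.mp this

/-- The Haar measure of total mass one on `O(v)`. -/
def haarO (v : ℕ) : Measure (O v) := Measure.haarMeasure ⊤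

/-- The antisymmetric matrix with entries `a_{i,j}` above the diagonal. -/
def skew (a : Pairs v → ℝ) : Matrix (Fin v) (Fin v) ℝ := fun i j =>
  if h : i < j then a ⟨(i, j), h⟩ else if h : j < i then -a ⟨(j, i), h⟩ else 0

/-- The entries of a matrix above the diagonal. -/
def upper (M : Matrix (Fin v) (Fin v) ℝ) : Pairs v → ℝ := fun p => M p.1.1 p.1.2

/-- The action `k.A = k A k⁻¹` on antisymmetric matrices. -/
def actA (k : O v) (a : Pairs v → ℝ) : Pairs v → ℝ :=
  upper ((k : Matrix (Fin v) (Fin v) ℝ) * skew a * ((k⁻¹ : O v) : Matrix (Fin v) (Fin v) ℝ))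

/-- The action of `O(v)` on the group: `k.exp (X + A) = exp (k.X + k.A)`. -/
def act (k : O v) (n : N v) : N v :=
  N.mk ((k : Matrix (Fin v) (Fin v) ℝ) *ᵥ n.X) (actA k n.A)

/-- Radial functions: functions invariant under `O(v)`. -/
def Radial (f : N v → ℂ) : Prop := ∀ (k : O v) (n : N v), f (act k n) = f n

/-! ### Bounded spherical functions -/

/-- Convolution on the group. -/
def conv (f g : N v → ℂ) : N v → ℂ := fun n => ∫ m : N v, f m * g (m⁻¹ * n)

/-- The functional `χ_Φ : f ↦ ∫ f(n) Φ(n⁻¹) dn`. -/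
def chi (Φ : N v → ℂ) (f : N v → ℂ) : ℂ := ∫ n : N v, f n * Φ n⁻¹

/-- A continuous function `Φ` is spherical for `(N_{v,2}, O(v))` if it is radial and `χ_Φ` is a
nonzero character of the convolution algebra of radial continuous functions with compact
support. -/
structure IsSpherical (Φ : C(N v, ℂ)) : Prop where
  radial : Radial Φ
  mul : ∀ f g : N v → ℂ, Continuous f → HasCompactSupport f → Radial f →
    Continuous g → HasCompactSupport g → Radial g →
    chi Φ (conv f g) = chi Φ f * chi Φ g
  ne_zero : ∃ f : N v → ℂ, Continuous f ∧ HasCompactSupport f ∧ Radial f ∧ chi Φ f ≠ 0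

/-- The set `Ω` of bounded spherical functions, with the topology of uniform convergence on
compact sets (`C(N v, ℂ)` carries the compact-open topology) and its Borel structure. -/
def Omega (v : ℕ) : Type := {Φ : C(N v, ℂ) // IsSpherical Φ ∧ ∃ M : ℝ, ∀ n, ‖Φ n‖ ≤ M}

instance : TopologicalSpace (Omega v) :=
  inferInstanceAs (TopologicalSpace
    {Φ : C(N v, ℂ) // IsSpherical Φ ∧ ∃ M : ℝ, ∀ n, ‖Φ n‖ ≤ M})

instance : MeasurableSpace (Omega v) := borel _

/-- The function on the group underlying an element of `Ω`. -/
def Omega.fn (φ : Omega v) : N v → ℂ := (Subtype.val φ : C(N v, ℂ))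

/-- The pairing `⟨f, φ⟩ = ∫ f(n) φ(n) dn`. -/
def pairing (f φ : N v → ℂ) : ℂ := ∫ n : N v, f n * φ n

/-- A Borel measure `μ` on `Ω` is a radial Plancherel measure if `‖f‖₂ = ‖⟨f, φ⟩‖_{L²(dμ(φ))}`
for all radial `f`; the functions `f` are taken in `L¹ ∩ L²`, so that all terms are defined. -/
def IsRadialPlancherelMeasure (μ : Measure (Omega v)) : Prop :=
  ∀ f : N v → ℂ, Radial f → MemLp f 1 volume → MemLp f 2 volume →
    eLpNorm f 2 volume = eLpNorm (fun φ : Omega v => pairing f φ.fn) 2 μ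

/-! ### Parameters and the functions `φ^{r,Λ,l}` -/

/-- The open simplex `λ_1 > … > λ_{v'} > 0`, with `v' = ⌊v / 2⌋`. -/
def simplex (v : ℕ) : Set (Fin (v / 2) → ℝ) := {Λ | StrictAnti Λ ∧ ∀ j, 0 < Λ j}

/-- The coordinates above the diagonal of `D_2(Λ)`, the block-diagonal antisymmetric matrix with
blocks `λ_j J`, `J = [[0, 1], [-1, 0]]`, completed by a zero row and column if `v` is odd. -/
def D2 (Λ : Fin (v / 2) → ℝ) : Pairs v → ℝ := fun p =>
  ∑ j : Fin (v / 2), if (p.1.1 : ℕ) = 2 * j ∧ (p.1.2 : ℕ) = 2 * j + 1 then Λ j else 0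

/-- The Laguerre polynomial of degree `n` and parameter `0`. -/
def laguerre (n : ℕ) (x : ℝ) : ℝ :=
  ∑ i ∈ Finset.range (n + 1), (-1) ^ i * (n.choose i : ℝ) / (i.factorial : ℝ) * x ^ i

/-- The (normalised) Laguerre function of degree `n` and parameter `0`. -/
def laguerreFun (n : ℕ) (x : ℝ) : ℝ := laguerre n x * Real.exp (-x / 2)

/-- `|pr_j X|² = x_{2j-1}² + x_{2j}²` (coordinates numbered from one). -/
def planeSq (X : Fin v → ℝ) (j : Fin (v / 2)) : ℝ :=
  X ⟨2 * j, by omega⟩ ^ 2 + X ⟨2 * j + 1, by omega⟩ ^ 2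

/-- The last coordinate `⟨X_v^*, X⟩` (zero if `v = 0`). -/
def lastCoord (X : Fin v → ℝ) : ℝ := if h : 0 < v then X ⟨v - 1, by omega⟩ else 0

/-- The set `𝒫` of parameters `(r, Λ, l)`: `Λ` in the open simplex, `l ∈ ℕ^{v'}`, and `r ≥ 0`
with `r = 0` if `v` is even. -/
def Params (v : ℕ) : Set (ℝ × (Fin (v / 2) → ℝ) × (Fin (v / 2) → ℕ)) :=
  {p | 0 ≤ p.1 ∧ (Even v → p.1 = 0) ∧ p.2.1 ∈ simplex v}

/-- The function `Θ^{r,Λ,l}`, for `Λ` in the open simplex (there all multiplicities are one). -/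
def Theta (p : Params v) (n : N v) : ℂ :=
  Complex.exp (Complex.I * ((p.1.1 * lastCoord n.X : ℝ) : ℂ)) *
    Complex.exp (Complex.I * ((D2 p.1.2.1 ⬝ᵥ n.A : ℝ) : ℂ)) *
    ((∏ j : Fin (v / 2), laguerreFun (p.1.2.2 j) (p.1.2.1 j / 2 * planeSq n.X j) : ℝ) : ℂ)

/-- The function `φ^{r,Λ,l}(n) = ∫_{O(v)} Θ^{r,Λ,l}(k.n) dk`. -/
def phi (p : Params v) (n : N v) : ℂ := ∫ k : O v, Theta p (act k n) ∂(haarO v)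

/-! ### The measures `η`, `η'` and `m` -/

/-- The density of `η` up to its constant: `∏_{j<k} (λ_j² - λ_k²)²`, times `∏ λ_i²` if `v` is
odd. -/
def etaDensity (v : ℕ) (Λ : Fin (v / 2) → ℝ) : ℝ :=
  (if Even v then 1 else ∏ i, Λ i ^ 2) *
    ∏ j, ∏ k ∈ Finset.Ioi j, (Λ j ^ 2 - Λ k ^ 2) ^ 2

/-- The measure on the simplex with density `c * etaDensity`. -/
def eta (v : ℕ) (c : ℝ) : Measure (Fin (v / 2) → ℝ) :=
  (volume.restrict (simplex v)).withDensity fun Λ => ENNReal.ofReal (c * etaDensity v Λ)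

/-- `c` is the constant of the polar coordinates on antisymmetric matrices:
`∫ g(A) dA = ∫_{O(v)} ∫_𝓛 g(k.D_2(Λ)) dη(Λ) dk`. -/
def IsPolarConst (v : ℕ) (c : ℝ) : Prop :=
  0 < c ∧ ∀ g : (Pairs v → ℝ) → ℝ≥0∞, Measurable g →
    ∫⁻ a, g a = ∫⁻ k, ∫⁻ Λ, g (actA k (D2 Λ)) ∂(eta v c) ∂(haarO v)

/-- The measure `η' = (∏ λ_j) η`. -/
def eta' (v : ℕ) (c : ℝ) : Measure (Fin (v / 2) → ℝ) :=
  (eta v c).withDensity fun Λ => ENNReal.ofReal (∏ j, Λ j)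

/-- The normalisation constant `c(v)`. -/
def planchConst (v : ℕ) : ℝ :=
  if Even v then ((2 * Real.pi) ^ (v * (v - 1) / 2 + v / 2))⁻¹
  else 2 * ((2 * Real.pi) ^ (v * (v - 1) / 2 + 1 + v / 2))⁻¹

/-- The measure in the variable `r`: Lebesgue measure on `[0, ∞)` if `v` is odd; if `v` is even
the variable is absent, that is `r = 0`. -/
def rMeasure (v : ℕ) : Measure ℝ :=
  if Even v then Measure.dirac 0 else volume.restrict (Set.Ici 0)

/-- The measure `m = c(v) dr ⊗ η' ⊗ ∑` on `𝒫`, where `η` has the constant `c`. -/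
def mMeasure (v : ℕ) (c : ℝ) : Measure (Params v) :=
  (ENNReal.ofReal (planchConst v) •
    (rMeasure v).prod ((eta' v c).prod Measure.count)).comap Subtype.val

/-! ### Radial square-integrable functions -/

/-- The space of radial functions in `L²`: classes with a radial representative. -/
def radialL2 (v : ℕ) : Submodule ℂ (Lp ℂ 2 (volume : Measure (N v))) where
  carrier := {f | ∃ g : N v → ℂ, Radial g ∧ f =ᵐ[volume] g}
  zero_mem' := ⟨0, fun _ _ => rfl, Lp.coeFn_zero _ _ _⟩
  add_mem' := by
    rintro f₁ f₂ ⟨g₁, hg₁, h₁⟩ ⟨g₂, hg₂, h₂⟩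
    refine ⟨g₁ + g₂, fun k n => ?_, (Lp.coeFn_add f₁ f₂).trans (h₁.add h₂)⟩
    simp only [Pi.add_apply, hg₁ k n, hg₂ k n]
  smul_mem' := by
    rintro a f ⟨g, hg, h⟩
    refine ⟨a • g, fun k n => ?_, (Lp.coeFn_smul a f).trans (h.const_smul a)⟩
    simp only [Pi.smul_apply, hg k n]

end FreeNilpotent

end

noncomputable section

namespace FreeNilpotent

variable {v : ℕ}

/-! ### Antisymmetric matrices and coordinates above the diagonal -/

theorem skew_apply_lt (a : Pairs v → ℝ) {i j : Fin v} (h : i < j) : skew a i j = a ⟨(i, j), h⟩ := by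
  simp [skew, h]

theorem skew_apply_gt (a : Pairs v → ℝ) {i j : Fin v} (h : j < i) :
    skew a i j = -a ⟨(j, i), h⟩ := by
  simp [skew, h, h.le.not_gt]

theorem skew_apply_self (a : Pairs v → ℝ) (i : Fin v) : skew a i i = 0 := by
  simp [skew]

theorem skew_transpose (a : Pairs v → ℝ) : (skew a)ᵀ = -skew a := by
  ext i j
  rw [transpose_apply, Matrix.neg_apply]
  rcases lt_trichotomy i j with h | h | h
  · rw [skew_apply_lt a h, skew_apply_gt a h]
  · subst h; simp [skew_apply_self]
  · rw [skew_apply_lt a h, skew_apply_gt a h, neg_neg]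

theorem upper_skew (a : Pairs v → ℝ) : upper (skew a) = a := by
  funext p
  exact skew_apply_lt a p.2

theorem skew_upper {M : Matrix (Fin v) (Fin v) ℝ} (hM : Mᵀ = -M) : skew (upper M) = M := by
  have hM' : ∀ i j, M j i = -M i j := fun i j => by
    simpa using congrFun (congrFun hM i) j
  ext i j
  rcases lt_trichotomy i j with h | h | h
  · rw [skew_apply_lt _ h]; rfl
  · subst h
    have := hM' i i
    rw [skew_apply_self]; linarith
  · rw [skew_apply_gt _ h, hM' j i]; rfl

/-- `skew` as a linear map. -/
def skewₗ (v : ℕ) : (Pairs v → ℝ) →ₗ[ℝ] Matrix (Fin v) (Fin v) ℝ where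
  toFun := skew
  map_add' a b := by
    ext i j
    simp only [skew, Matrix.add_apply]
    split_ifs <;> simp [add_comm]
  map_smul' c a := by
    ext i j
    simp only [skew, Matrix.smul_apply, RingHom.id_apply]
    split_ifs <;> simp

@[simp] theorem skewₗ_apply (a : Pairs v → ℝ) : skewₗ v a = skew a := rfl

/-- `upper` as a linear map. -/
def upperₗ (v : ℕ) : Matrix (Fin v) (Fin v) ℝ →ₗ[ℝ] (Pairs v → ℝ) where
  toFun := upper
  map_add' _ _ := rfl
  map_smul' _ _ := rfl

@[simp] theorem upperₗ_apply (M : Matrix (Fin v) (Fin v) ℝ) : upperₗ v M = upper M := rfl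

theorem continuous_skew : Continuous (skew : (Pairs v → ℝ) → _) :=
  (skewₗ v).continuous_of_finiteDimensional

theorem continuous_upper : Continuous (upper : Matrix (Fin v) (Fin v) ℝ → _) :=
  (upperₗ v).continuous_of_finiteDimensional

theorem O_mul_transpose (k : O v) :
    (k : Matrix (Fin v) (Fin v) ℝ) * (k : Matrix (Fin v) (Fin v) ℝ)ᵀ = 1 :=
  (Matrix.mem_orthogonalGroup_iff (Fin v) ℝ).1 k.2

theorem O_transpose_mul (k : O v) :
    (k : Matrix (Fin v) (Fin v) ℝ)ᵀ * (k : Matrix (Fin v) (Fin v) ℝ) = 1 :=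
  (Matrix.mem_orthogonalGroup_iff' (Fin v) ℝ).1 k.2

theorem actA_eq (k : O v) (a : Pairs v → ℝ) : actA k a =
    upper ((k : Matrix (Fin v) (Fin v) ℝ) * skew a * (k : Matrix (Fin v) (Fin v) ℝ)ᵀ) := rfl

theorem skew_actA (k : O v) (a : Pairs v → ℝ) : skew (actA k a) =
    (k : Matrix (Fin v) (Fin v) ℝ) * skew a * (k : Matrix (Fin v) (Fin v) ℝ)ᵀ := by
  rw [actA_eq, skew_upper]
  simp [transpose_mul, skew_transpose, Matrix.mul_assoc]

theorem skew_injective : Function.Injective (skew : (Pairs v → ℝ) → _) :=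
  Function.LeftInverse.injective upper_skew

theorem actA_one (a : Pairs v → ℝ) : actA 1 a = a := by
  apply skew_injective; simp [skew_actA]

theorem actA_mul (k k' : O v) (a : Pairs v → ℝ) : actA (k * k') a = actA k (actA k' a) := by
  apply skew_injective
  simp [skew_actA, transpose_mul, Matrix.mul_assoc]

/-- `actA k` as a linear map. -/
def actAₗ (k : O v) : (Pairs v → ℝ) →ₗ[ℝ] (Pairs v → ℝ) where
  toFun := actA k
  map_add' a b := by
    apply skew_injective
    have h : ∀ a b : Pairs v → ℝ, skew (a + b) = skew a + skew b := (skewₗ v).map_add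
    simp [skew_actA, h, Matrix.mul_add, Matrix.add_mul]
  map_smul' c a := by
    apply skew_injective
    have h : ∀ (c : ℝ) (a : Pairs v → ℝ), skew (c • a) = c • skew a := (skewₗ v).map_smul
    simp [skew_actA, h]

@[simp] theorem actAₗ_apply (k : O v) (a : Pairs v → ℝ) : actAₗ k a = actA k a := rfl

theorem actA_add (k : O v) (a b : Pairs v → ℝ) : actA k (a + b) = actA k a + actA k b :=
  (actAₗ k).map_add a b

theorem actA_smul (k : O v) (c : ℝ) (a : Pairs v → ℝ) : actA k (c • a) = c • actA k a :=
  (actAₗ k).map_smul c a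

theorem actA_neg (k : O v) (a : Pairs v → ℝ) : actA k (-a) = -actA k a :=
  (actAₗ k).map_neg a

theorem continuous_actA : Continuous fun q : O v × (Pairs v → ℝ) => actA q.1 q.2 := by
  have h : Continuous fun q : O v × (Pairs v → ℝ) => (q.1 : Matrix (Fin v) (Fin v) ℝ) :=
    continuous_subtype_val.comp continuous_fst
  exact continuous_upper.comp
    ((h.matrix_mul (continuous_skew.comp continuous_snd)).matrix_mul h.matrix_transpose)

@[to_additive]
theorem prod_offDiag_eq {M : Type*} [CommMonoid M] (f : Fin v → Fin v → M)
    (hf : ∀ i, f i i = 1) :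
    ∏ i, ∏ j, f i j = ∏ p : Pairs v, (f p.1.1 p.1.2 * f p.1.2 p.1.1) := by
  rw [← Fintype.prod_prod_type' f]
  have h1 : ∏ x : Fin v × Fin v, f x.1 x.2 =
      (∏ x : Fin v × Fin v, (if x.1 < x.2 then f x.1 x.2 else 1)) *
      ∏ x : Fin v × Fin v, (if x.2 < x.1 then f x.1 x.2 else 1) := by
    rw [← Finset.prod_mul_distrib]
    refine Finset.prod_congr rfl fun x _ => ?_
    rcases lt_trichotomy x.1 x.2 with h | h | h
    · simp [h, h.le.not_gt]
    · simp [h, hf]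
    · simp [h, h.le.not_gt]
  have h2 : ∏ x : Fin v × Fin v, (if x.2 < x.1 then f x.1 x.2 else 1) =
      ∏ x : Fin v × Fin v, (if x.1 < x.2 then f x.2 x.1 else 1) :=
    Fintype.prod_equiv (Equiv.prodComm _ _) _ _ fun x => rfl
  rw [h1, h2, ← Finset.prod_mul_distrib, ← Finset.prod_filter_mul_prod_filter_not Finset.univ
    (fun x : Fin v × Fin v => x.1 < x.2)]
  rw [Finset.prod_eq_one (s := Finset.filter (fun x : Fin v × Fin v => ¬ x.1 < x.2) Finset.univ),
    mul_one]
  · rw [Finset.prod_subtype (p := fun x : Fin v × Fin v => x.1 < x.2) _ (by simp)]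
    exact Finset.prod_congr rfl fun p _ => by simp [p.2]
  · intro x hx
    simp [(Finset.mem_filter.1 hx).2]

theorem dotProduct_eq_trace (a b : Pairs v → ℝ) :
    a ⬝ᵥ b = -(1 / 2) * (skew a * skew b).trace := by
  have h : (skew a * skew b).trace = ∑ i, ∑ j, skew a i j * skew b j i := rfl
  rw [h, sum_offDiag_eq _ (fun i => by simp [skew_apply_self]), dotProduct, Finset.mul_sum]
  refine Finset.sum_congr rfl fun p _ => ?_
  rw [skew_apply_lt a p.2, skew_apply_lt b p.2, skew_apply_gt a p.2, skew_apply_gt b p.2]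
  ring

theorem actA_dotProduct_actA (k : O v) (a b : Pairs v → ℝ) :
    actA k a ⬝ᵥ actA k b = a ⬝ᵥ b := by
  rw [dotProduct_eq_trace, dotProduct_eq_trace, skew_actA, skew_actA]
  congr 1
  have : (k : Matrix (Fin v) (Fin v) ℝ) * skew a * (k : Matrix (Fin v) (Fin v) ℝ)ᵀ *
      ((k : Matrix (Fin v) (Fin v) ℝ) * skew b * (k : Matrix (Fin v) (Fin v) ℝ)ᵀ) =
      (k : Matrix (Fin v) (Fin v) ℝ) * (skew a * skew b) * (k : Matrix (Fin v) (Fin v) ℝ)ᵀ := by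
    calc _ = (k : Matrix (Fin v) (Fin v) ℝ) * skew a * ((k : Matrix (Fin v) (Fin v) ℝ)ᵀ *
      (k : Matrix (Fin v) (Fin v) ℝ)) * skew b * (k : Matrix (Fin v) (Fin v) ℝ)ᵀ := by
          simp only [Matrix.mul_assoc]
      _ = _ := by rw [O_transpose_mul]; simp only [Matrix.mul_assoc, Matrix.mul_one]
  rw [this, trace_mul_comm, ← Matrix.mul_assoc, O_transpose_mul, Matrix.one_mul]

theorem actA_dotProduct (k : O v) (a b : Pairs v → ℝ) :
    actA k a ⬝ᵥ b = a ⬝ᵥ actA k⁻¹ b := by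
  rw [← actA_dotProduct_actA k⁻¹, ← actA_mul, inv_mul_cancel, actA_one]

theorem mulVec_dotProduct_mulVec (k : O v) (x y : Fin v → ℝ) :
    ((k : Matrix (Fin v) (Fin v) ℝ) *ᵥ x) ⬝ᵥ ((k : Matrix (Fin v) (Fin v) ℝ) *ᵥ y) = x ⬝ᵥ y := by
  rw [dotProduct_mulVec, ← mulVec_transpose, mulVec_mulVec, O_transpose_mul, one_mulVec]

/-- A linear map preserving the dot product has determinant of absolute value one. -/
theorem abs_det_of_dotProduct {ι : Type*} [Fintype ι]
    (T : (ι → ℝ) →ₗ[ℝ] (ι → ℝ)) (hT : ∀ x y, T x ⬝ᵥ T y = x ⬝ᵥ y) : |LinearMap.det T| = 1 := by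
  classical
  have h : (LinearMap.toMatrix' T)ᵀ * LinearMap.toMatrix' T = 1 := by
    ext i j
    have := hT (Pi.single i 1) (Pi.single j 1)
    rw [single_one_dotProduct] at this
    rw [Matrix.mul_apply]
    simp only [transpose_apply, LinearMap.toMatrix'_apply, Matrix.one_apply]
    rw [dotProduct] at this
    rw [this, Pi.single_apply]
  have h2 := congrArg Matrix.det h
  rw [det_mul, det_transpose, det_one, LinearMap.det_toMatrix'] at h2
  rw [← abs_one, ← sq_eq_sq_iff_abs_eq_abs, one_pow, sq, h2]

theorem measurePreserving_of_dotProduct {ι : Type*} [Fintype ι]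
    (T : (ι → ℝ) →ₗ[ℝ] (ι → ℝ)) (hT : ∀ x y, T x ⬝ᵥ T y = x ⬝ᵥ y) :
    MeasurePreserving T volume volume := by
  have h := abs_det_of_dotProduct T hT
  have h0 : LinearMap.det T ≠ 0 := fun h' => by simp [h'] at h
  refine ⟨T.continuous_of_finiteDimensional.measurable, ?_⟩
  rw [Measure.map_linearMap_addHaar_eq_smul_addHaar _ h0, abs_inv, h]
  simp

theorem measurePreserving_actA (k : O v) : MeasurePreserving (actA k) volume volume :=
  measurePreserving_of_dotProduct (actAₗ k) (actA_dotProduct_actA k)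

theorem measurePreserving_mulVec (k : O v) :
    MeasurePreserving (fun x : Fin v → ℝ => (k : Matrix (Fin v) (Fin v) ℝ) *ᵥ x) volume volume :=
  measurePreserving_of_dotProduct (Matrix.mulVecLin (k : Matrix (Fin v) (Fin v) ℝ))
    (mulVec_dotProduct_mulVec k)

/-! ### The group and the action -/

theorem skew_bracket (X Y : Fin v → ℝ) :
    skew (bracket X Y) = vecMulVec X Y - vecMulVec Y X := by
  have : bracket X Y = upper (vecMulVec X Y - vecMulVec Y X) := by
    funext p
    simp only [bracket, upper, Matrix.sub_apply, vecMulVec_apply]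
    ring
  rw [this, skew_upper]
  simp [transpose_vecMulVec]

theorem bracket_mulVec (k : O v) (X Y : Fin v → ℝ) :
    bracket ((k : Matrix (Fin v) (Fin v) ℝ) *ᵥ X) ((k : Matrix (Fin v) (Fin v) ℝ) *ᵥ Y) =
      actA k (bracket X Y) := by
  apply skew_injective
  rw [skew_actA, skew_bracket, skew_bracket, Matrix.mul_sub, Matrix.sub_mul]
  simp [mul_vecMulVec, vecMulVec_mul, vecMul_transpose]

@[ext] theorem N.ext {n m : N v} (h1 : n.X = m.X) (h2 : n.A = m.A) : n = m := Prod.ext h1 h2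

@[simp] theorem N.X_mk (X : Fin v → ℝ) (A : Pairs v → ℝ) : (N.mk X A).X = X := rfl
@[simp] theorem N.A_mk (X : Fin v → ℝ) (A : Pairs v → ℝ) : (N.mk X A).A = A := rfl
@[simp] theorem N.X_mul (n m : N v) : (n * m).X = n.X + m.X := rfl
@[simp] theorem N.A_mul (n m : N v) :
    (n * m).A = n.A + m.A + (1 / 2 : ℝ) • bracket n.X m.X := rfl
@[simp] theorem N.X_inv (n : N v) : (n⁻¹).X = -n.X := rfl
@[simp] theorem N.A_inv (n : N v) : (n⁻¹).A = -n.A := rfl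
@[simp] theorem X_act (k : O v) (n : N v) :
    (act k n).X = (k : Matrix (Fin v) (Fin v) ℝ) *ᵥ n.X := rfl
@[simp] theorem A_act (k : O v) (n : N v) : (act k n).A = actA k n.A := rfl

theorem act_mul (k : O v) (n m : N v) : act k (n * m) = act k n * act k m := by
  ext1
  · simp [mulVec_add]
  · simp only [A_act, N.A_mul, X_act, bracket_mulVec, actA_add, actA_smul]

theorem act_inv (k : O v) (n : N v) : act k n⁻¹ = (act k n)⁻¹ := by
  ext1
  · simp [mulVec_neg]
  · simp [actA_neg]

theorem act_one (n : N v) : act 1 n = n := by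
  ext1 <;> simp [actA_one]

theorem act_act (k k' : O v) (n : N v) : act k (act k' n) = act (k * k') n := by
  ext1
  · simp [mulVec_mulVec]
  · simp [actA_mul]

theorem continuous_X : Continuous (N.X : N v → _) := continuous_fst
theorem continuous_A : Continuous (N.A : N v → _) := continuous_snd

theorem continuous_mk {α : Type*} [TopologicalSpace α] {f : α → Fin v → ℝ} {g : α → Pairs v → ℝ}
    (hf : Continuous f) (hg : Continuous g) : Continuous fun x => N.mk (f x) (g x) :=
  hf.prodMk hg

theorem continuous_bracket : Continuous fun q : (Fin v → ℝ) × (Fin v → ℝ) => bracket q.1 q.2 := by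
  unfold bracket
  fun_prop

instance : IsTopologicalGroup (N v) where
  continuous_mul := by
    have h1 : Continuous fun q : N v × N v => q.1.X := continuous_X.comp continuous_fst
    have h2 : Continuous fun q : N v × N v => q.2.X := continuous_X.comp continuous_snd
    have h3 : Continuous fun q : N v × N v => q.1.A := continuous_A.comp continuous_fst
    have h4 : Continuous fun q : N v × N v => q.2.A := continuous_A.comp continuous_snd
    have h5 : Continuous fun q : N v × N v => bracket q.1.X q.2.X :=
      continuous_bracket.comp (h1.prodMk h2)
    exact continuous_mk (h1.add h2) ((h3.add h4).add (h5.const_smul (1 / 2 : ℝ)))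
  continuous_inv := continuous_mk continuous_X.neg continuous_A.neg

theorem continuous_act : Continuous fun q : O v × N v => act q.1 q.2 := by
  have h1 : Continuous fun q : O v × N v => (q.1 : Matrix (Fin v) (Fin v) ℝ) :=
    continuous_subtype_val.comp continuous_fst
  exact continuous_mk (h1.matrix_mulVec (continuous_X.comp continuous_snd))
    (continuous_actA.comp (continuous_fst.prodMk (continuous_A.comp continuous_snd)))

instance : T2Space (N v) := inferInstanceAs (T2Space ((Fin v → ℝ) × (Pairs v → ℝ)))
instance : LocallyCompactSpace (N v) :=
  inferInstanceAs (LocallyCompactSpace ((Fin v → ℝ) × (Pairs v → ℝ)))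
instance : SecondCountableTopology (N v) :=
  inferInstanceAs (SecondCountableTopology ((Fin v → ℝ) × (Pairs v → ℝ)))
instance : BorelSpace (N v) := inferInstanceAs (BorelSpace ((Fin v → ℝ) × (Pairs v → ℝ)))
instance : SigmaFinite (volume : Measure (N v)) :=
  inferInstanceAs (SigmaFinite (volume : Measure ((Fin v → ℝ) × (Pairs v → ℝ))))
instance : IsFiniteMeasureOnCompacts (volume : Measure (N v)) :=
  inferInstanceAs (IsFiniteMeasureOnCompacts (volume : Measure ((Fin v → ℝ) × (Pairs v → ℝ))))
instance : (volume : Measure (N v)).IsOpenPosMeasure :=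
  inferInstanceAs ((volume : Measure ((Fin v → ℝ) × (Pairs v → ℝ))).IsOpenPosMeasure)

theorem measurePreserving_act (k : O v) : MeasurePreserving (act k : N v → N v) volume volume :=
  (measurePreserving_mulVec k).prod (measurePreserving_actA k)

instance : (volume : Measure (N v)).IsMulLeftInvariant where
  map_mul_left_eq_self g := by
    have : MeasurePreserving (fun q : (Fin v → ℝ) × (Pairs v → ℝ) =>
        ((g.X + q.1, (g.A + (1 / 2 : ℝ) • bracket g.X q.1) + q.2) :
          (Fin v → ℝ) × (Pairs v → ℝ))) (volume.prod volume) (volume.prod volume) := by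
      refine (measurePreserving_add_left volume g.X).skew_product
        (g := fun x a => (g.A + (1 / 2 : ℝ) • bracket g.X x) + a) ?_ ?_
      · have := (continuous_bracket (v := v)).comp
          ((continuous_const (y := g.X)).prodMk (continuous_fst (X := Fin v → ℝ) (Y := Pairs v → ℝ)))
        exact ((continuous_const.add (this.const_smul (1 / 2 : ℝ))).add continuous_snd).measurable
      · exact Filter.Eventually.of_forall fun x => map_add_left_eq_self _ _
    have h : (fun n : N v => g * n) = fun q : (Fin v → ℝ) × (Pairs v → ℝ) =>
        ((g.X + q.1, (g.A + (1 / 2 : ℝ) • bracket g.X q.1) + q.2) :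
          (Fin v → ℝ) × (Pairs v → ℝ)) :=
      funext fun q : N v => Prod.ext rfl (add_right_comm g.A q.A _)
    rw [h]
    exact this.map_eq

instance : (volume : Measure (N v)).IsInvInvariant where
  inv_eq_self := by
    have : MeasurePreserving (fun q : (Fin v → ℝ) × (Pairs v → ℝ) => (-q.1, -q.2))
        (volume.prod volume) (volume.prod volume) :=
      (Measure.measurePreserving_neg volume).prod (Measure.measurePreserving_neg volume)
    exact this.map_eq

/-! ### Haar measure on the orthogonal group -/

instance : (haarO v).IsHaarMeasure := by unfold haarO; infer_instance

instance : IsProbabilityMeasure (haarO v) := ⟨by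
  have := Measure.haarMeasure_self (K₀ := (⊤ : PositiveCompacts (O v)))
  simpa [haarO] using this⟩

instance : SecondCountableTopology (O v) :=
  haveI : SecondCountableTopology (Matrix (Fin v) (Fin v) ℝ) :=
    inferInstanceAs (SecondCountableTopology (Fin v → Fin v → ℝ))
  TopologicalSpace.Subtype.secondCountableTopology _

instance : (haarO v).IsMulRightInvariant where
  map_mul_right_eq_self g := by
    have : IsProbabilityMeasure ((haarO v).map (· * g)) :=
      Measure.isProbabilityMeasure_map (by fun_prop)
    exact Measure.isHaarMeasure_eq_of_isProbabilityMeasure _ _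

/-! ### The pairing of coordinates into planes -/

/-- Coordinates are grouped in consecutive pairs, with one remaining coordinate if `v` is odd. -/
def idx (v : ℕ) : (Fin (v / 2) × Fin 2) ⊕ Fin (v % 2) ≃ Fin v :=
  ((finProdFinEquiv.sumCongr (Equiv.refl _)).trans finSumFinEquiv).trans
    (finCongr (by omega : v / 2 * 2 + v % 2 = v))

theorem idx_inl_val (j : Fin (v / 2)) (i : Fin 2) : (idx v (Sum.inl (j, i)) : ℕ) = 2 * j + i := by
  simp [idx, finProdFinEquiv, add_comm]

theorem idx_inr_val (i : Fin (v % 2)) : (idx v (Sum.inr i) : ℕ) = v - 1 := by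
  have := i.2
  simp [idx]
  omega

/-- The other coordinate of the same plane (the last coordinate is fixed if `v` is odd). -/
def partner (a : Fin v) : Fin v :=
  if (a : ℕ) % 2 = 0 then (if h : (a : ℕ) + 1 < v then ⟨a + 1, h⟩ else a)
  else ⟨a - 1, by omega⟩

/-- The entry of `Λ` belonging to the plane of a coordinate, zero on the last one if `v` is odd. -/
def lam (Λ : Fin (v / 2) → ℝ) (a : Fin v) : ℝ := if h : (a : ℕ) / 2 < v / 2 then Λ ⟨a / 2, h⟩ else 0

/-- Orientation of a coordinate in its plane. -/
def sgn (a : Fin v) : ℝ := if (a : ℕ) % 2 = 0 then 1 else -1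

theorem partner_val (a : Fin v) : (partner a : ℕ) =
    if (a : ℕ) % 2 = 0 then (if (a : ℕ) + 1 < v then (a : ℕ) + 1 else a) else a - 1 := by
  unfold partner; split_ifs <;> rfl

@[simp] theorem partner_partner (a : Fin v) : partner (partner a) = a := by
  apply Fin.ext
  have := a.2
  rw [partner_val, partner_val]
  split_ifs <;> omega

theorem partner_div (a : Fin v) : (partner a : ℕ) / 2 = a / 2 := by
  rw [partner_val]; split_ifs <;> omega

@[simp] theorem lam_partner (Λ : Fin (v / 2) → ℝ) (a : Fin v) : lam Λ (partner a) = lam Λ a := by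
  simp only [lam, partner_div]

theorem sgn_sq (a : Fin v) : sgn a * sgn a = 1 := by
  unfold sgn; split_ifs <;> norm_num

theorem sgn_partner_mul_lam (Λ : Fin (v / 2) → ℝ) (a : Fin v) :
    sgn (partner a) * lam Λ a = -(sgn a * lam Λ a) := by
  by_cases h : (a : ℕ) / 2 < v / 2
  · have : sgn (partner a) = -sgn a := by
      have := a.2
      simp only [sgn, partner_val]
      split_ifs <;> first | omega | norm_num
    rw [this]; ring
  · simp [lam, h]

theorem lam_idx_inl (Λ : Fin (v / 2) → ℝ) (j : Fin (v / 2)) (i : Fin 2) :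
    lam Λ (idx v (Sum.inl (j, i))) = Λ j := by
  have h : (idx v (Sum.inl (j, i)) : ℕ) / 2 = j := by rw [idx_inl_val]; omega
  simp [lam, h]

theorem lam_idx_inr (Λ : Fin (v / 2) → ℝ) (i : Fin (v % 2)) : lam Λ (idx v (Sum.inr i)) = 0 := by
  have := i.2
  have h : ¬ (idx v (Sum.inr i) : ℕ) / 2 < v / 2 := by rw [idx_inr_val]; omega
  simp [lam, h]

theorem skew_D2 (Λ : Fin (v / 2) → ℝ) (a b : Fin v) :
    skew (D2 Λ) a b = if b = partner a then sgn a * lam Λ a else 0 := by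
  have key : ∀ a b : Fin v, (h : a < b) →
      D2 Λ ⟨(a, b), h⟩ = if b = partner a then sgn a * lam Λ a else 0 := by
    intro a b h
    have hab : (a : ℕ) < b := h
    have := b.2
    by_cases hb : b = partner a
    · have hb' := congrArg Fin.val hb
      rw [partner_val] at hb'
      split_ifs at hb' with h1 h2 <;> try omega
      have h3 : (a : ℕ) / 2 < v / 2 := by omega
      rw [if_pos hb, D2, Finset.sum_eq_single ⟨a / 2, h3⟩]
      · rw [if_pos]
        · simp [sgn, h1, lam, h3]
        · constructor <;> simp <;> omega
      · intro j _ hj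
        rw [if_neg]
        rintro ⟨h4, -⟩
        apply hj
        apply Fin.ext
        simp at h4 ⊢
        omega
      · simp
    · rw [if_neg hb, D2]
      refine Finset.sum_eq_zero fun j _ => if_neg ?_
      rintro ⟨h1, h2⟩
      simp only at h1 h2
      apply hb
      apply Fin.ext
      rw [partner_val]
      split_ifs <;> omega
  rcases lt_trichotomy a b with h | h | h
  · rw [skew_apply_lt _ h, key]
  · subst h
    rw [skew_apply_self]
    split_ifs with h
    · have h' := congrArg Fin.val h
      rw [partner_val] at h'
      have := a.2
      have h3 : ¬ (a : ℕ) / 2 < v / 2 := by split_ifs at h' <;> omega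
      simp [lam, h3]
    · rfl
  · rw [skew_apply_gt _ h, key]
    by_cases hb : b = partner a
    · subst hb
      simp only [partner_partner, if_true, lam_partner]
      rw [sgn_partner_mul_lam, neg_neg]
    · rw [if_neg hb, if_neg, neg_zero]
      rintro rfl
      simp at hb

/-- `D2` as a linear map. -/
def D2ₗ (v : ℕ) : (Fin (v / 2) → ℝ) →ₗ[ℝ] (Pairs v → ℝ) where
  toFun := D2
  map_add' a b := by
    funext p
    simp only [D2, Pi.add_apply, ← Finset.sum_add_distrib]
    refine Finset.sum_congr rfl fun j _ => ?_
    split_ifs <;> simp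
  map_smul' c a := by
    funext p
    simp only [D2, Pi.smul_apply, smul_eq_mul, RingHom.id_apply, Finset.mul_sum]
    refine Finset.sum_congr rfl fun j _ => ?_
    split_ifs <;> simp

theorem continuous_D2 : Continuous (D2 : (Fin (v / 2) → ℝ) → (Pairs v → ℝ)) :=
  (D2ₗ v).continuous_of_finiteDimensional

/-! ### Commuting with `D_2(Λ)` -/

theorem mul_skew_D2 (M : Matrix (Fin v) (Fin v) ℝ) (Λ : Fin (v / 2) → ℝ) (a b : Fin v) :
    (M * skew (D2 Λ)) a b = -(sgn b * lam Λ b) * M a (partner b) := by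
  rw [Matrix.mul_apply, Finset.sum_eq_single (partner b)]
  · rw [skew_D2, if_pos (by simp), lam_partner, sgn_partner_mul_lam]; ring
  · intro e _ he
    rw [skew_D2, if_neg, mul_zero]
    rintro rfl
    simp at he
  · simp

theorem skew_D2_mul (M : Matrix (Fin v) (Fin v) ℝ) (Λ : Fin (v / 2) → ℝ) (a b : Fin v) :
    (skew (D2 Λ) * M) a b = sgn a * lam Λ a * M (partner a) b := by
  rw [Matrix.mul_apply, Finset.sum_eq_single (partner a)]
  · rw [skew_D2, if_pos rfl]
  · intro e _ he
    rw [skew_D2, if_neg he, zero_mul]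
  · simp

theorem apply_mul_of_intertwine {M : Matrix (Fin v) (Fin v) ℝ} {Λ Λ' : Fin (v / 2) → ℝ}
    (h : M * skew (D2 Λ) = skew (D2 Λ') * M) (a b : Fin v) :
    M a b * (lam Λ b ^ 2 - lam Λ' a ^ 2) = 0 := by
  have h1 : ∀ a b, -(sgn b * lam Λ b) * M a (partner b) = sgn a * lam Λ' a * M (partner a) b :=
    fun a b => by rw [← mul_skew_D2, h, skew_D2_mul]
  have h2 := h1 a (partner b)
  have h3 := h1 (partner a) b
  simp only [partner_partner, lam_partner, sgn_partner_mul_lam, neg_neg] at h2 h3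
  have hb := sgn_sq b
  have ha := sgn_sq a
  have : M a b * (lam Λ b ^ 2 - lam Λ' a ^ 2) =
      (sgn b * lam Λ b * M a b) * (sgn b * lam Λ b) - (sgn a * lam Λ' a) * (sgn a * lam Λ' a * M a b)
      := by
    linear_combination (M a b * lam Λ' a ^ 2) * ha - (M a b * lam Λ b ^ 2) * hb
  rw [this, h2]
  linear_combination (-(sgn a * lam Λ' a)) * h3

theorem lam_nonneg {Λ : Fin (v / 2) → ℝ} (hΛ : Λ ∈ simplex v) (a : Fin v) : 0 ≤ lam Λ a := by
  unfold lam; split_ifs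
  exacts [(hΛ.2 _).le, le_rfl]

theorem div_eq_of_lam_sq_eq {Λ : Fin (v / 2) → ℝ} (hΛ : Λ ∈ simplex v) {a b : Fin v}
    (h : lam Λ b ^ 2 = lam Λ a ^ 2) : (a : ℕ) / 2 = b / 2 := by
  have h' : lam Λ b = lam Λ a := by
    rwa [sq_eq_sq₀ (lam_nonneg hΛ b) (lam_nonneg hΛ a)] at h
  unfold lam at h'
  have := a.2
  have := b.2
  split_ifs at h' with h1 h2 h2
  · have := hΛ.1.injective h'
    simpa using (congrArg Fin.val this).symm
  · exact absurd h' (hΛ.2 _).ne'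
  · exact absurd h'.symm (hΛ.2 _).ne'
  · omega

theorem apply_eq_zero_of_commute {M : Matrix (Fin v) (Fin v) ℝ} {Λ : Fin (v / 2) → ℝ}
    (hΛ : Λ ∈ simplex v) (h : M * skew (D2 Λ) = skew (D2 Λ) * M) {a b : Fin v}
    (hab : (a : ℕ) / 2 ≠ b / 2) : M a b = 0 := by
  rcases mul_eq_zero.1 (apply_mul_of_intertwine h a b) with h0 | h0
  · exact h0
  · exact absurd (div_eq_of_lam_sq_eq hΛ (sub_eq_zero.1 h0)) hab

theorem lam_eq_of_div_eq (Λ : Fin (v / 2) → ℝ) {a b : Fin v} (h : (a : ℕ) / 2 = b / 2) :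
    lam Λ a = lam Λ b := by
  simp only [lam, h]

theorem commute_D2 {M : Matrix (Fin v) (Fin v) ℝ} {Λ : Fin (v / 2) → ℝ}
    (hΛ : Λ ∈ simplex v) (h : M * skew (D2 Λ) = skew (D2 Λ) * M) (Λ' : Fin (v / 2) → ℝ) :
    M * skew (D2 Λ') = skew (D2 Λ') * M := by
  ext a b
  rw [mul_skew_D2, skew_D2_mul]
  by_cases hab : (a : ℕ) / 2 = b / 2
  · have h1 : -(sgn b * lam Λ b) * M a (partner b) = sgn a * lam Λ a * M (partner a) b := by
      rw [← mul_skew_D2, h, skew_D2_mul]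
    by_cases hb : (b : ℕ) / 2 < v / 2
    · have h0 : lam Λ b ≠ 0 := by
        simp only [lam, hb, dif_pos]; exact (hΛ.2 _).ne'
      rw [lam_eq_of_div_eq Λ hab] at h1
      rw [lam_eq_of_div_eq Λ' hab]
      have h2 : -sgn b * M a (partner b) = sgn a * M (partner a) b := by
        apply mul_left_cancel₀ h0
        linear_combination h1
      linear_combination (lam Λ' b) * h2
    · have h0 : lam Λ' b = 0 := by simp [lam, hb]
      simp [lam_eq_of_div_eq Λ' hab, h0]
  · rw [apply_eq_zero_of_commute hΛ h (a := a) (b := partner b) (by rwa [partner_div]),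
      apply_eq_zero_of_commute hΛ h (a := partner a) (b := b) (by rwa [partner_div])]
    simp

theorem actA_eq_iff (k : O v) (a b : Pairs v → ℝ) : actA k a = b ↔
    (k : Matrix (Fin v) (Fin v) ℝ) * skew a = skew b * (k : Matrix (Fin v) (Fin v) ℝ) := by
  rw [← skew_injective.eq_iff, skew_actA]
  constructor
  · intro h
    rw [← h, Matrix.mul_assoc, O_transpose_mul, Matrix.mul_one]
  · intro h
    rw [h, Matrix.mul_assoc, O_mul_transpose, Matrix.mul_one]

theorem exists_lam_sq_eq {Λ Λ' : Fin (v / 2) → ℝ} {k : O v} (h : actA k (D2 Λ) = D2 Λ')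
    (b : Fin v) : ∃ a, lam Λ b ^ 2 = lam Λ' a ^ 2 := by
  have h1 := (O_transpose_mul k)
  have h2 := congrFun (congrFun h1 b) b
  rw [Matrix.mul_apply, one_apply_eq] at h2
  obtain ⟨a, -, ha⟩ := Finset.exists_ne_zero_of_sum_ne_zero (h2 ▸ one_ne_zero)
  refine ⟨a, ?_⟩
  have h3 := apply_mul_of_intertwine ((actA_eq_iff _ _ _).1 h) a b
  rcases mul_eq_zero.1 h3 with h0 | h0
  · rw [transpose_apply] at ha; simp [h0] at ha
  · exact sub_eq_zero.1 h0

theorem range_subset_of_actA_D2 {Λ Λ' : Fin (v / 2) → ℝ} (hΛ : Λ ∈ simplex v)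
    (hΛ' : Λ' ∈ simplex v) {k : O v} (h : actA k (D2 Λ) = D2 Λ') :
    Set.range Λ ⊆ Set.range Λ' := by
  rintro _ ⟨j, rfl⟩
  obtain ⟨a, ha⟩ := exists_lam_sq_eq h (idx v (Sum.inl (j, 0)))
  rw [sq_eq_sq₀ (lam_nonneg hΛ _) (lam_nonneg hΛ' _), lam_idx_inl] at ha
  unfold lam at ha
  split_ifs at ha with h1
  · exact ⟨_, ha.symm⟩
  · exact absurd ha (hΛ.2 j).ne'

/-- The orbits through distinct points of the simplex are disjoint, and all points of the simplex
have the same stabiliser, which fixes every `D_2(M)`. -/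
theorem eq_and_fix_of_actA_D2 {Λ Λ' : Fin (v / 2) → ℝ} (hΛ : Λ ∈ simplex v)
    (hΛ' : Λ' ∈ simplex v) {k : O v} (h : actA k (D2 Λ) = D2 Λ') :
    Λ = Λ' ∧ ∀ M : Fin (v / 2) → ℝ, actA k (D2 M) = D2 M := by
  have h' : actA k⁻¹ (D2 Λ') = D2 Λ := by rw [← h, ← actA_mul, inv_mul_cancel, actA_one]
  have hr : Set.range Λ = Set.range Λ' :=
    (range_subset_of_actA_D2 hΛ hΛ' h).antisymm (range_subset_of_actA_D2 hΛ' hΛ h')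
  have he : Λ = Λ' := by
    have h1 : StrictMono fun j => -Λ j := fun i j hij => neg_lt_neg (hΛ.1 hij)
    have h2 : StrictMono fun j => -Λ' j := fun i j hij => neg_lt_neg (hΛ'.1 hij)
    have h3 : (fun j => -Λ j) = fun j => -Λ' j := by
      refine (StrictMono.range_inj h1 h2).1 ?_
      have : ∀ L : Fin (v / 2) → ℝ, (Set.range fun j => -L j) = Neg.neg '' Set.range L := fun L => by
        rw [← Set.range_comp]; rfl
      rw [this, this, hr]
    funext j
    exact neg_injective (congrFun h3 j)
  subst he
  exact ⟨rfl, fun M => (actA_eq_iff _ _ _).2 (commute_D2 hΛ ((actA_eq_iff _ _ _).1 h) M)⟩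

/-! ### Normal form of antisymmetric matrices -/

/-- The index of the entry `λ_j` of `D_2(Λ)`. -/
def pairIdx (j : Fin (v / 2)) : Pairs v :=
  ⟨(⟨2 * j, by omega⟩, ⟨2 * j + 1, by omega⟩), by simp⟩

theorem D2_pairIdx (Λ : Fin (v / 2) → ℝ) (j : Fin (v / 2)) : D2 Λ (pairIdx j) = Λ j := by
  unfold D2 pairIdx
  rw [Finset.sum_eq_single j]
  · simp
  · intro i _ hi
    rw [if_neg]
    rintro ⟨h, -⟩
    apply hi
    apply Fin.ext
    simp at h
    omega
  · simp

theorem pairIdx_injective : Function.Injective (pairIdx : Fin (v / 2) → Pairs v) := by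
  intro i j h
  have := congrArg (fun p : Pairs v => (p.1.1 : ℕ)) h
  simp only [pairIdx] at this
  apply Fin.ext; omega

theorem eq_pairIdx_iff (p : Pairs v) :
    (∃ j, p = pairIdx j) ↔ (p.1.1 : ℕ) / 2 = p.1.2 / 2 := by
  constructor
  · rintro ⟨j, rfl⟩
    simp only [pairIdx]; omega
  · intro h
    have h1 : (p.1.1 : ℕ) < p.1.2 := p.2
    have h2 := p.1.2.2
    refine ⟨⟨p.1.1 / 2, by omega⟩, Subtype.ext (Prod.ext (Fin.ext ?_) (Fin.ext ?_))⟩ <;>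
    simp only [pairIdx] <;> omega

theorem D2_apply_of_div_ne (Λ : Fin (v / 2) → ℝ) (p : Pairs v)
    (h : (p.1.1 : ℕ) / 2 ≠ p.1.2 / 2) : D2 Λ p = 0 := by
  unfold D2
  refine Finset.sum_eq_zero fun j _ => if_neg ?_
  rintro ⟨h1, h2⟩
  omega

theorem eq_D2_of_offDiag_eq_zero {a : Pairs v → ℝ}
    (h : ∀ p : Pairs v, (p.1.1 : ℕ) / 2 ≠ p.1.2 / 2 → a p = 0) :
    a = D2 fun j => a (pairIdx j) := by
  funext p
  by_cases hp : (p.1.1 : ℕ) / 2 = p.1.2 / 2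
  · obtain ⟨j, rfl⟩ := (eq_pairIdx_iff p).2 hp
    rw [D2_pairIdx]
  · rw [h p hp, D2_apply_of_div_ne _ _ hp]

theorem exists_mem_simplex (v : ℕ) : ∃ Λ, Λ ∈ simplex v :=
  ⟨fun j => (v : ℝ) - j, fun i j hij => by
    have : (i : ℝ) < j := by exact_mod_cast hij
    simp only; linarith, fun j => by
    have h : (j : ℕ) < v := by omega
    have : (j : ℝ) < v := by exact_mod_cast h
    simp only; linarith⟩

/-- The exponential of an antisymmetric matrix, in the orthogonal group. -/
def expO (y : Pairs v → ℝ) : O v :=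
  ⟨NormedSpace.exp (skew y), by
    rw [Matrix.mem_orthogonalGroup_iff]
    change NormedSpace.exp (skew y) * (NormedSpace.exp (skew y))ᵀ = 1
    rw [← Matrix.exp_transpose, skew_transpose, Matrix.exp_neg, Matrix.mul_nonsing_inv]
    exact (Matrix.isUnit_iff_isUnit_det _).1 (Matrix.isUnit_exp _)⟩

theorem coe_expO (y : Pairs v → ℝ) :
    (expO y : Matrix (Fin v) (Fin v) ℝ) = NormedSpace.exp (skew y) := rfl

theorem expO_zero : expO (0 : Pairs v → ℝ) = 1 := by
  apply Subtype.ext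
  have : skew (0 : Pairs v → ℝ) = 0 := (skewₗ v).map_zero
  rw [coe_expO, this, NormedSpace.exp_zero]
  rfl

section Exp

variable {R E : Type*} [NormedRing R] [NormedAlgebra ℝ R] [FiniteDimensional ℝ R]

theorem contDiff_exp_linearMap [NormedAddCommGroup E] [NormedSpace ℝ E] [FiniteDimensional ℝ E]
    (S : E →ₗ[ℝ] R) (ℓ : R →ₗ[ℝ] ℝ) : ContDiff ℝ ⊤ fun y : E => ℓ (NormedSpace.exp (S y)) := by
  have : CompleteSpace R := FiniteDimensional.complete ℝ R
  have h1 : ContDiff ℝ ⊤ (NormedSpace.exp : R → R) := by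
    rw [← contDiffOn_univ]
    refine AnalyticOnNhd.contDiffOn ?_ uniqueDiffOn_univ
    exact fun x _ => NormedSpace.exp_analytic x
  exact (LinearMap.toContinuousLinearMap ℓ).contDiff.comp
    (h1.comp (LinearMap.toContinuousLinearMap S).contDiff)

theorem hasDerivAt_linearMap_exp_smul (Y : R) (ℓ : R →ₗ[ℝ] ℝ) :
    HasDerivAt (fun t : ℝ => ℓ (NormedSpace.exp (t • Y))) (ℓ Y) 0 := by
  have : CompleteSpace R := FiniteDimensional.complete ℝ R
  have h1 := hasDerivAt_exp_smul_const (𝕂 := ℝ) Y (0 : ℝ)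
  rw [zero_smul, NormedSpace.exp_zero, one_mul] at h1
  exact (LinearMap.toContinuousLinearMap ℓ).hasFDerivAt.comp_hasDerivAt (0 : ℝ) h1

open scoped Matrix.Norms.Operator

theorem contDiff_expO_apply (i j : Fin v) :
    ContDiff ℝ ⊤ fun y : Pairs v → ℝ => (expO y : Matrix (Fin v) (Fin v) ℝ) i j :=
  contDiff_exp_linearMap (R := Matrix (Fin v) (Fin v) ℝ) (skewₗ v) (Matrix.entryLinearMap ℝ ℝ i j)

theorem hasDerivAt_exp_smul_apply (Y : Matrix (Fin v) (Fin v) ℝ) (i j : Fin v) :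
    HasDerivAt (fun t : ℝ => (NormedSpace.exp (t • Y) : Matrix (Fin v) (Fin v) ℝ) i j)
      (Y i j) 0 :=
  hasDerivAt_linearMap_exp_smul (R := Matrix (Fin v) (Fin v) ℝ) Y (Matrix.entryLinearMap ℝ ℝ i j)

end Exp

theorem hasDerivAt_matrix_mul {A B : ℝ → Matrix (Fin v) (Fin v) ℝ}
    {A' B' : Matrix (Fin v) (Fin v) ℝ} {t : ℝ}
    (hA : ∀ i j, HasDerivAt (fun s => A s i j) (A' i j) t)
    (hB : ∀ i j, HasDerivAt (fun s => B s i j) (B' i j) t) (i j : Fin v) :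
    HasDerivAt (fun s => (A s * B s) i j) ((A' * B t + A t * B') i j) t := by
  simp only [Matrix.add_apply, Matrix.mul_apply]
  rw [← Finset.sum_add_distrib]
  exact HasDerivAt.fun_sum fun e _ => (hA i e).mul (hB e j)

theorem exists_actA_eq_D2 (a : Pairs v → ℝ) : ∃ (k : O v) (M : Fin (v / 2) → ℝ),
    a = actA k (D2 M) := by
  obtain ⟨μ, hμ⟩ := exists_mem_simplex v
  have hcont : Continuous fun k : O v => D2 μ ⬝ᵥ actA k a := by
    refine continuous_const.dotProduct ?_
    exact continuous_actA.comp (continuous_id.prodMk continuous_const)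
  obtain ⟨k, -, hk⟩ := isCompact_univ.exists_isMaxOn ⟨1, trivial⟩ hcont.continuousOn
  set b := actA k a with hb
  set B := skew b with hB
  set D := skew (D2 μ) with hD
  set Y := B * D - D * B with hYdef
  have hY : Yᵀ = -Y := by
    simp [hYdef, transpose_mul, hB, hD, skew_transpose]
  let L : Matrix (Fin v) (Fin v) ℝ →ₗ[ℝ] ℝ :=
    (Matrix.traceLinearMap (Fin v) ℝ ℝ) ∘ₗ (LinearMap.mulLeft ℝ D)
  have hL : HasDerivAt (fun t : ℝ => L (NormedSpace.exp (t • Y) * B * (NormedSpace.exp (t • Y))ᵀ))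
      (L (Y * B - B * Y)) 0 := by
    have h1 := hasDerivAt_matrix_mul (hasDerivAt_matrix_mul (hasDerivAt_exp_smul_apply Y)
      (B := fun _ => B) (B' := 0) fun i j => hasDerivAt_const _ _)
      (B := fun t => (NormedSpace.exp (t • Y))ᵀ) (B' := Yᵀ)
      fun i j => hasDerivAt_exp_smul_apply Y j i
    have h2 := hasDerivAt_matrix_mul (A := fun _ => D) (A' := 0)
      (fun i j => hasDerivAt_const _ _) h1
    have h3 := HasDerivAt.fun_sum (u := (Finset.univ : Finset (Fin v)))
      fun i _ => h2 i i
    exact h3.congr_deriv (show _ = ∑ i, (D * (Y * B - B * Y)) i i from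
      Finset.sum_congr rfl fun i _ => by simp [hY, sub_eq_add_neg])
  have hmin : ∀ t : ℝ, L (NormedSpace.exp ((0 : ℝ) • Y) * B * (NormedSpace.exp ((0 : ℝ) • Y))ᵀ)
      ≤ L (NormedSpace.exp (t • Y) * B * (NormedSpace.exp (t • Y))ᵀ) := by
    have key : ∀ t : ℝ, D2 μ ⬝ᵥ actA (expO (t • upper Y) * k) a =
        -(1 / 2) * L (NormedSpace.exp (t • Y) * B * (NormedSpace.exp (t • Y))ᵀ) := by
      intro t
      have : skew (t • upper Y) = t • Y := by
        have := (skewₗ v).map_smul t (upper Y)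
        simp only [skewₗ_apply] at this
        rw [this, skew_upper hY]
      rw [actA_mul, dotProduct_eq_trace, skew_actA, coe_expO, this]
      rfl
    intro t
    have h1 := hk (Set.mem_univ (expO (t • upper Y) * k))
    have h2 : D2 μ ⬝ᵥ actA (expO ((0 : ℝ) • upper Y) * k) a = D2 μ ⬝ᵥ actA k a := by
      rw [zero_smul, expO_zero, one_mul]
    simp only [Set.mem_ofPred_eq] at h1
    rw [← h2, key, key] at h1
    linarith
  have h0 : L (Y * B - B * Y) = 0 :=
    IsLocalMin.hasDerivAt_eq_zero (Filter.Eventually.of_forall hmin) hL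
  have h1 : L (Y * B - B * Y) = (Y * Y).trace := by
    change (D * (Y * B - B * Y)).trace = _
    rw [Matrix.mul_sub, trace_sub, ← Matrix.mul_assoc, ← Matrix.mul_assoc, trace_mul_comm,
      ← Matrix.mul_assoc, trace_mul_comm (D * B) Y]
    rw [trace_mul_comm (B * D) Y, ← trace_sub, ← Matrix.mul_sub]
  have h2 : (Y * Yᵀ).trace = 0 := by
    rw [hY, Matrix.mul_neg, trace_neg, ← h1, h0, neg_zero]
  have h3 : Y = 0 := by
    rw [← conjTranspose_eq_transpose_of_trivial] at h2
    exact trace_mul_conjTranspose_self_eq_zero_iff.1 h2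
  have h4 : B * D = D * B := sub_eq_zero.1 h3
  have h5 : b = D2 fun j => b (pairIdx j) := by
    refine eq_D2_of_offDiag_eq_zero fun p hp => ?_
    rw [← skew_apply_lt b p.2]
    exact apply_eq_zero_of_commute hμ h4 hp
  refine ⟨k⁻¹, fun j => b (pairIdx j), ?_⟩
  rw [← h5, hb, ← actA_mul, inv_mul_cancel, actA_one]

/-- The orthogonal matrix of a permutation of the coordinates. -/
def permO (σ : Equiv.Perm (Fin v)) : O v :=
  ⟨σ.permMatrix ℝ, by
    rw [Matrix.mem_orthogonalGroup_iff]
    change σ.permMatrix ℝ * (σ.permMatrix ℝ)ᵀ = 1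
    rw [Matrix.transpose_permMatrix, ← Matrix.permMatrix_mul]
    simp⟩

theorem skew_actA_permO (σ : Equiv.Perm (Fin v)) (a : Pairs v → ℝ) (i j : Fin v) :
    skew (actA (permO σ) a) i j = skew a (σ i) (σ j) := by
  rw [skew_actA]
  change (σ.permMatrix ℝ * skew a * (σ.permMatrix ℝ)ᵀ) i j = _
  rw [Equiv.Perm.permMatrix, Matrix.mul_assoc]
  simp [PEquiv.toMatrix_toPEquiv_mul, ← PEquiv.toMatrix_symm, ← Equiv.toPEquiv_symm,
    PEquiv.mul_toMatrix_toPEquiv]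

theorem partner_idx_inl (j : Fin (v / 2)) (i : Fin 2) :
    partner (idx v (Sum.inl (j, i))) = idx v (Sum.inl (j, Equiv.swap 0 1 i)) := by
  apply Fin.ext
  have := j.2
  rw [partner_val, idx_inl_val, idx_inl_val]
  fin_cases i
  · simp; omega
  · simp [Nat.add_mod]

theorem sgn_idx_inl (j : Fin (v / 2)) (i : Fin 2) :
    sgn (idx v (Sum.inl (j, i))) = if i = 0 then 1 else -1 := by
  unfold sgn
  rw [idx_inl_val]
  fin_cases i
  · simp
  · simp [Nat.add_mod]

/-- Every antisymmetric matrix is orthogonally conjugate to some `D_2(M)` with `M` antitone and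
nonnegative. -/
theorem exists_actA_eq_D2_sorted (a : Pairs v → ℝ) : ∃ (k : O v) (M : Fin (v / 2) → ℝ),
    a = actA k (D2 M) ∧ Antitone M ∧ ∀ j, 0 ≤ M j := by
  obtain ⟨k, L, rfl⟩ := exists_actA_eq_D2 a
  let σ := Tuple.sort fun j => -|L j|
  let f : Fin (v / 2) → Equiv.Perm (Fin 2) := fun j =>
    if L (σ j) < 0 then Equiv.swap 0 1 else 1
  let π₀ : Equiv.Perm ((Fin (v / 2) × Fin 2) ⊕ Fin (v % 2)) :=
    Equiv.sumCongr (Equiv.prodShear σ f) (Equiv.refl _)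
  let π : Equiv.Perm (Fin v) := ((idx v).symm.trans π₀).trans (idx v)
  let M : Fin (v / 2) → ℝ := fun j => |L (σ j)|
  have hM : actA (permO π) (D2 L) = D2 M := by
    apply skew_injective
    ext x y
    rw [skew_actA_permO, skew_D2, skew_D2]
    obtain ⟨x, rfl⟩ := (idx v).surjective x
    obtain ⟨y, rfl⟩ := (idx v).surjective y
    have hπ : ∀ z, π (idx v z) = idx v (π₀ z) := fun z => by simp [π]
    rw [hπ, hπ]
    rcases x with ⟨j, i⟩ | i
    · have h1 : π₀ (Sum.inl (j, i)) = Sum.inl (σ j, f j i) := rfl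
      have h2 : Sum.inl (σ j, Equiv.swap 0 1 (f j i)) = π₀ (Sum.inl (j, Equiv.swap 0 1 i)) := by
        change _ = Sum.inl (σ j, f j (Equiv.swap 0 1 i))
        simp only [f]
        split_ifs <;> simp
      rw [h1, partner_idx_inl, partner_idx_inl, h2, lam_idx_inl, lam_idx_inl, sgn_idx_inl,
        sgn_idx_inl]
      refine if_congr (by simp) ?_ rfl
      simp only [M]
      by_cases hL : L (σ j) < 0
      · have hf : f j = Equiv.swap 0 1 := if_pos hL
        simp only [hf, abs_of_neg hL]
        fin_cases i <;> simp
      · have hf : f j = 1 := if_neg hL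
        simp only [hf, abs_of_nonneg (not_lt.1 hL)]
        fin_cases i <;> simp
    · have h1 : π₀ (Sum.inr i) = Sum.inr i := rfl
      rw [h1, lam_idx_inr, lam_idx_inr]
      simp
  refine ⟨k * (permO π)⁻¹, M, ?_, ?_, fun j => abs_nonneg _⟩
  · rw [← hM, ← actA_mul, mul_assoc, inv_mul_cancel, mul_one]
  · intro i j hij
    have := Tuple.monotone_sort (fun j => -|L j|) hij
    simpa [M, σ] using this

/-! ### The determinant of the infinitesimal action -/

/-- The entries outside the diagonal blocks. -/
def offₗ (v : ℕ) : (Pairs v → ℝ) →ₗ[ℝ] (Pairs v → ℝ) where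
  toFun a p := if (p.1.1 : ℕ) / 2 = p.1.2 / 2 then 0 else a p
  map_add' a b := by funext p; simp only [Pi.add_apply]; split_ifs <;> simp
  map_smul' c a := by
    funext p; simp only [Pi.smul_apply, RingHom.id_apply, smul_eq_mul]; split_ifs <;> simp

/-- The entries of the diagonal blocks. -/
def diagₗ (v : ℕ) : (Pairs v → ℝ) →ₗ[ℝ] (Fin (v / 2) → ℝ) where
  toFun a j := a (pairIdx j)
  map_add' _ _ := rfl
  map_smul' _ _ := rfl

theorem offₗ_apply (a : Pairs v → ℝ) (p : Pairs v) :
    offₗ v a p = if (p.1.1 : ℕ) / 2 = p.1.2 / 2 then 0 else a p := rfl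

theorem diagₗ_apply (a : Pairs v → ℝ) (j : Fin (v / 2)) : diagₗ v a j = a (pairIdx j) := rfl

theorem pairIdx_div (j : Fin (v / 2)) :
    ((pairIdx j).1.1 : ℕ) / 2 = ((pairIdx j).1.2 : ℕ) / 2 :=
  (eq_pairIdx_iff _).1 ⟨j, rfl⟩

theorem off_add_diag (a : Pairs v → ℝ) : offₗ v a + D2 (diagₗ v a) = a := by
  funext p
  rw [Pi.add_apply, offₗ_apply]
  split_ifs with h
  · obtain ⟨j, rfl⟩ := (eq_pairIdx_iff p).2 h
    rw [D2_pairIdx, zero_add, diagₗ_apply]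
  · rw [D2_apply_of_div_ne _ _ h, add_zero]

@[simp] theorem off_off (a : Pairs v → ℝ) : offₗ v (offₗ v a) = offₗ v a := by
  funext p; simp only [offₗ_apply]; split_ifs <;> rfl

@[simp] theorem off_D2 (M : Fin (v / 2) → ℝ) : offₗ v (D2 M) = 0 := by
  funext p
  rw [offₗ_apply]
  split_ifs with h
  · rfl
  · exact D2_apply_of_div_ne _ _ h

@[simp] theorem diag_off (a : Pairs v → ℝ) : diagₗ v (offₗ v a) = 0 := by
  funext j
  rw [diagₗ_apply, offₗ_apply, if_pos (pairIdx_div j)]; rfl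

@[simp] theorem diag_D2 (M : Fin (v / 2) → ℝ) : diagₗ v (D2 M) = M := by
  funext j
  rw [diagₗ_apply, D2_pairIdx]

theorem skew_add (a b : Pairs v → ℝ) : skew (a + b) = skew a + skew b := (skewₗ v).map_add a b

theorem skew_smul (c : ℝ) (a : Pairs v → ℝ) : skew (c • a) = c • skew a := (skewₗ v).map_smul c a

/-- `c ↦ [c, D_2(M)]` on the entries outside the diagonal blocks, the identity on the others. -/
def adₗ (M : Fin (v / 2) → ℝ) : (Pairs v → ℝ) →ₗ[ℝ] (Pairs v → ℝ) :=
  upperₗ v ∘ₗ (LinearMap.mulRight ℝ (skew (D2 M)) - LinearMap.mulLeft ℝ (skew (D2 M))) ∘ₗ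
    skewₗ v ∘ₗ offₗ v + D2ₗ v ∘ₗ diagₗ v

theorem adₗ_apply (M : Fin (v / 2) → ℝ) (c : Pairs v → ℝ) : adₗ M c =
    upper (skew (offₗ v c) * skew (D2 M) - skew (D2 M) * skew (offₗ v c)) + D2 (diagₗ v c) := rfl

theorem adₗ_apply_pairIdx (M : Fin (v / 2) → ℝ) (c : Pairs v → ℝ) (j : Fin (v / 2)) :
    adₗ M c (pairIdx j) = c (pairIdx j) := by
  have h1 : partner (pairIdx j).1.2 = (pairIdx j).1.1 := by
    apply Fin.ext
    rw [partner_val]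
    simp [pairIdx]
  have h2 : partner (pairIdx j).1.1 = (pairIdx j).1.2 := by rw [← h1, partner_partner]
  rw [adₗ_apply, Pi.add_apply, D2_pairIdx, diagₗ_apply, upper, Matrix.sub_apply, mul_skew_D2,
    skew_D2_mul, h1, h2, skew_apply_self, skew_apply_self]
  ring

theorem lt_of_div_lt {a b : Fin v} (h : (a : ℕ) / 2 < b / 2) : a < b := by
  rw [Fin.lt_def]; omega

theorem skew_off_apply (c : Pairs v → ℝ) {a b : Fin v} (h : (a : ℕ) / 2 < b / 2) :
    skew (offₗ v c) a b = c ⟨(a, b), lt_of_div_lt h⟩ := by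
  rw [skew_apply_lt _ (lt_of_div_lt h), offₗ_apply, if_neg h.ne]

theorem adₗ_apply_of_lt (M : Fin (v / 2) → ℝ) (c : Pairs v → ℝ) {a b : Fin v}
    (h : (a : ℕ) / 2 < b / 2) : adₗ M c ⟨(a, b), lt_of_div_lt h⟩ =
      -(sgn b * lam M b) * c ⟨(a, partner b), lt_of_div_lt (by rwa [partner_div])⟩
      - sgn a * lam M a * c ⟨(partner a, b), lt_of_div_lt (by rwa [partner_div])⟩ := by
  rw [adₗ_apply, Pi.add_apply, D2_apply_of_div_ne _ _ h.ne, upper, Matrix.sub_apply, mul_skew_D2,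
    skew_D2_mul, skew_off_apply (b := partner b) _ (by rwa [partner_div]),
    skew_off_apply (a := partner a) _ (by rwa [partner_div]), add_zero]

/-- Change of sign of the entries according to the orientation of their second coordinate. -/
def signₗ (v : ℕ) : (Pairs v → ℝ) →ₗ[ℝ] (Pairs v → ℝ) where
  toFun a p := sgn p.1.2 * a p
  map_add' a b := by funext p; simp [mul_add]
  map_smul' c a := by funext p; simp; ring

/-- The eigenvalues of `ad ∘ sign ∘ ad ∘ sign`. -/
def adEigen (M : Fin (v / 2) → ℝ) (p : Pairs v) : ℝ :=
  if (p.1.1 : ℕ) / 2 = p.1.2 / 2 then 1 else lam M p.1.2 ^ 2 - lam M p.1.1 ^ 2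

theorem signₗ_apply (a : Pairs v → ℝ) (p : Pairs v) : signₗ v a p = sgn p.1.2 * a p := rfl

theorem ad_sign_ad_sign (M : Fin (v / 2) → ℝ) (c : Pairs v → ℝ) (p : Pairs v) :
    adₗ M (signₗ v (adₗ M (signₗ v c))) p = adEigen M p * c p := by
  by_cases hp : (p.1.1 : ℕ) / 2 = p.1.2 / 2
  · rw [adEigen, if_pos hp, one_mul]
    obtain ⟨j, rfl⟩ := (eq_pairIdx_iff p).2 hp
    rw [adₗ_apply_pairIdx, signₗ_apply, adₗ_apply_pairIdx, signₗ_apply, ← mul_assoc, sgn_sq,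
      one_mul]
  · rw [adEigen, if_neg hp]
    obtain ⟨⟨a, b⟩, hab⟩ := p
    have h : (a : ℕ) / 2 < b / 2 := by
      have : (a : ℕ) < b := hab
      simp only at hp
      omega
    have h1 : (a : ℕ) / 2 < (partner b : ℕ) / 2 := by rwa [partner_div]
    have h2 : (partner a : ℕ) / 2 < (b : ℕ) / 2 := by rwa [partner_div]
    simp only [adₗ_apply_of_lt M _ h, adₗ_apply_of_lt M _ h1, adₗ_apply_of_lt M _ h2, signₗ_apply,
      partner_partner, lam_partner]
    have ea := sgn_partner_mul_lam M a
    have eb := sgn_partner_mul_lam M b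
    have sa := sgn_sq a
    have sb := sgn_sq b
    set x := c ⟨(a, b), hab⟩
    set y := c ⟨(partner a, partner b), lt_of_div_lt (by rwa [partner_div])⟩
    set A := lam M a
    set B := lam M b
    set s := sgn a
    set t := sgn b
    set s' := sgn (partner a)
    set t' := sgn (partner b)
    have h3 : -(t * B) * (t' * (-(t' * B) * (t * x) - s * A * (t' * y))) -
        s * A * (t * (-(t * B) * (t' * y) - s' * A * (t * x))) =
        (t * (t' * B)) * (t' * B) * t * x + t * (t' * B) * (s * A) * t' * y
        + s * A * (t * t) * (t' * B) * y + s * (s' * A) * A * (t * t) * x := by ring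
    rw [h3, ea, eb, sb]
    linear_combination (B ^ 2 * x * (t * t + 1)) * sb - A ^ 2 * x * sa
      - (s * A * y * t * t) * eb + (s * A * y * t * B) * sb

theorem det_sign_sq (v : ℕ) : LinearMap.det (signₗ v) * LinearMap.det (signₗ v) = 1 := by
  rw [← map_mul]
  have : signₗ v * signₗ v = 1 := by
    refine LinearMap.ext fun c => funext fun p => ?_
    change signₗ v (signₗ v _) p = _
    rw [signₗ_apply, signₗ_apply, ← mul_assoc, sgn_sq, one_mul]
    rfl
  rw [this, map_one]

theorem det_ad_sq (M : Fin (v / 2) → ℝ) : LinearMap.det (adₗ M) ^ 2 = ∏ p, adEigen M p := by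
  have h : adₗ M * signₗ v * (adₗ M * signₗ v) = Matrix.toLin' (Matrix.diagonal (adEigen M)) := by
    refine LinearMap.ext fun c => funext fun p => ?_
    rw [toLin'_apply, mulVec_diagonal]
    exact ad_sign_ad_sign M c p
  have h2 := congrArg LinearMap.det h
  rw [map_mul, map_mul, LinearMap.det_toLin', det_diagonal] at h2
  rw [← h2]
  linear_combination (-(LinearMap.det (adₗ M) ^ 2)) * det_sign_sq v

theorem etaDensity_nonneg (v : ℕ) (Λ : Fin (v / 2) → ℝ) : 0 ≤ etaDensity v Λ := by
  unfold etaDensity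
  refine mul_nonneg ?_ (Finset.prod_nonneg fun j _ => Finset.prod_nonneg fun k _ => sq_nonneg _)
  split_ifs
  · exact zero_le_one
  · exact Finset.prod_nonneg fun j _ => sq_nonneg _

theorem prod_Ioi_sq_eq (Λ : Fin (v / 2) → ℝ) :
    ∏ j, ∏ k ∈ Finset.Ioi j, (Λ j ^ 2 - Λ k ^ 2) ^ 2 =
      ∏ j, ∏ k, if j = k then 1 else |Λ j ^ 2 - Λ k ^ 2| := by
  have h := Finset.prod_prod_Ioi_mul_eq_prod_prod_off_diag
    (fun j k : Fin (v / 2) => |Λ k ^ 2 - Λ j ^ 2|)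
  have h1 : ∀ j k : Fin (v / 2), (Λ j ^ 2 - Λ k ^ 2) ^ 2 =
      |Λ j ^ 2 - Λ k ^ 2| * |Λ k ^ 2 - Λ j ^ 2| := fun j k => by
    rw [abs_sub_comm (Λ k ^ 2), ← sq, sq_abs]
  simp only [h1]
  rw [h]
  refine Finset.prod_congr rfl fun j _ => ?_
  rw [Finset.compl_eq_univ_sdiff, ← Finset.prod_sdiff (Finset.subset_univ ({j} : Finset _))]
  rw [Finset.prod_singleton, if_pos rfl, mul_one]
  refine Finset.prod_congr rfl fun k hk => ?_
  rw [if_neg]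
  rintro rfl
  simp at hk

theorem prod_adEigen_sq (M : Fin (v / 2) → ℝ) : (∏ p, |adEigen M p|) ^ 2 = etaDensity v M ^ 4 := by
  let f : Fin v → Fin v → ℝ := fun a b =>
    if (a : ℕ) / 2 = b / 2 then 1 else |lam M b ^ 2 - lam M a ^ 2|
  have h1 : (∏ p, |adEigen M p|) ^ 2 = ∏ a, ∏ b, f a b := by
    rw [prod_offDiag_eq f (fun i => by simp [f]), ← Finset.prod_pow]
    refine Finset.prod_congr rfl fun p _ => ?_
    simp only [adEigen, f, eq_comm (a := (p.1.2 : ℕ) / 2)]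
    split_ifs
    · simp
    · rw [abs_sub_comm (lam M p.1.1 ^ 2), sq]
  have hll : ∀ j i k i', f (idx v (Sum.inl (j, i))) (idx v (Sum.inl (k, i'))) =
      if j = k then 1 else |M j ^ 2 - M k ^ 2| := by
    intro j i k i'
    simp only [f, lam_idx_inl]
    have e1 : (idx v (Sum.inl (j, i)) : ℕ) / 2 = j := by rw [idx_inl_val]; omega
    have e2 : (idx v (Sum.inl (k, i')) : ℕ) / 2 = k := by rw [idx_inl_val]; omega
    rw [e1, e2, abs_sub_comm]
    simp only [Fin.ext_iff]
  have hne : ∀ j i r, (idx v (Sum.inl (j, i)) : ℕ) / 2 ≠ (idx v (Sum.inr r) : ℕ) / 2 := by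
    intro j i r
    rw [idx_inl_val, idx_inr_val]
    have := r.2
    omega
  have hlr : ∀ j i r, f (idx v (Sum.inl (j, i))) (idx v (Sum.inr r)) = M j ^ 2 := by
    intro j i r
    simp only [f, lam_idx_inl, lam_idx_inr, if_neg (hne j i r)]
    simp
  have hrl : ∀ j i r, f (idx v (Sum.inr r)) (idx v (Sum.inl (j, i))) = M j ^ 2 := by
    intro j i r
    simp only [f, lam_idx_inl, lam_idx_inr, if_neg (hne j i r).symm]
    simp
  have hrr : ∀ r r', f (idx v (Sum.inr r)) (idx v (Sum.inr r')) = 1 := by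
    intro r r'
    simp only [f, idx_inr_val, if_true]
  rw [h1, ← (idx v).prod_comp]
  simp only [← (idx v).prod_comp (fun b => f _ b), Fintype.prod_sum_type, Fintype.prod_prod_type,
    hll, hlr, hrl, hrr, Finset.prod_const, Finset.card_univ, Fintype.card_fin, Finset.prod_mul_distrib,
    Finset.prod_pow, mul_one, one_pow]
  unfold etaDensity
  rw [prod_Ioi_sq_eq]
  rcases Nat.even_or_odd v with he | ho
  · rw [if_pos he, Nat.even_iff.1 he]
    ring
  · rw [if_neg (Nat.not_even_iff_odd.2 ho), Nat.odd_iff.1 ho]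
    rw [Finset.prod_pow]
    ring

theorem abs_det_ad (M : Fin (v / 2) → ℝ) : |LinearMap.det (adₗ M)| = etaDensity v M := by
  have h := prod_adEigen_sq M
  rw [← Finset.abs_prod, ← det_ad_sq, abs_pow, ← pow_mul] at h
  exact (pow_left_inj₀ (abs_nonneg _) (etaDensity_nonneg v M) (by norm_num)).1 h

/-! ### Polar coordinates on antisymmetric matrices -/

/-- The map `(Y, Λ) ↦ exp(Y) D_2(Λ) exp(-Y)`, where `Y` is the part of the argument outside the
diagonal blocks and `Λ` its diagonal part. -/
def polarMap (a : Pairs v → ℝ) : Pairs v → ℝ := actA (expO (offₗ v a)) (D2 (diagₗ v a))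

/-- The derivative of the exponential, entrywise. -/
def dexp (y z : Pairs v → ℝ) : Matrix (Fin v) (Fin v) ℝ := fun i j =>
  fderiv ℝ (fun y : Pairs v → ℝ => (expO y : Matrix (Fin v) (Fin v) ℝ) i j) y z

theorem differentiableAt_expO_apply (i j : Fin v) (y : Pairs v → ℝ) : DifferentiableAt ℝ
    (fun y : Pairs v → ℝ => (expO y : Matrix (Fin v) (Fin v) ℝ) i j) y :=
  (contDiff_expO_apply i j).differentiable (by simp) y

theorem hasDerivAt_line {F : Type*} [NormedAddCommGroup F] [NormedSpace ℝ F]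
    {f : (Pairs v → ℝ) → F} {y : Pairs v → ℝ} (hf : DifferentiableAt ℝ f y) (z : Pairs v → ℝ) :
    HasDerivAt (fun t : ℝ => f (y + t • z)) (fderiv ℝ f y z) 0 := by
  have h1 : HasDerivAt (fun t : ℝ => y + t • z) z 0 := by
    simpa using ((hasDerivAt_id (0 : ℝ)).smul_const z).const_add y
  have h2 : HasFDerivAt f (fderiv ℝ f y) (y + (0 : ℝ) • z) := by
    simpa using hf.hasFDerivAt
  exact h2.comp_hasDerivAt (0 : ℝ) h1

theorem hasDerivAt_expO_line (y z : Pairs v → ℝ) (i j : Fin v) :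
    HasDerivAt (fun t : ℝ => (expO (y + t • z) : Matrix (Fin v) (Fin v) ℝ) i j) (dexp y z i j) 0 :=
  hasDerivAt_line (differentiableAt_expO_apply i j y) z

theorem dexp_zero (z : Pairs v → ℝ) : dexp 0 z = skew z := by
  ext i j
  have h := hasDerivAt_exp_smul_apply (skew z) i j
  have h' := hasDerivAt_expO_line 0 z i j
  simp only [zero_add, coe_expO, skew_smul] at h'
  exact h'.unique h

/-- The logarithmic derivative of the exponential. -/
def omegaExp (y z : Pairs v → ℝ) : Matrix (Fin v) (Fin v) ℝ :=
  (expO y : Matrix (Fin v) (Fin v) ℝ)ᵀ * dexp y z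

theorem omegaExp_transpose (y z : Pairs v → ℝ) : (omegaExp y z)ᵀ = -omegaExp y z := by
  have h := fun i j => hasDerivAt_matrix_mul
    (A := fun t => (expO (y + t • z) : Matrix (Fin v) (Fin v) ℝ)ᵀ)
    (A' := (dexp y z)ᵀ)
    (fun i j => hasDerivAt_expO_line y z j i) (hasDerivAt_expO_line y z) i j
  simp only [O_transpose_mul, zero_smul, add_zero] at h
  have h0 : (dexp y z)ᵀ * (expO y : Matrix (Fin v) (Fin v) ℝ) +
      (expO y : Matrix (Fin v) (Fin v) ℝ)ᵀ * dexp y z = 0 := by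
    ext i j
    exact (h i j).unique (hasDerivAt_const _ _)
  rw [omegaExp, transpose_mul, transpose_transpose]
  exact eq_neg_of_add_eq_zero_left h0

theorem mul_omegaExp (y z : Pairs v → ℝ) :
    (expO y : Matrix (Fin v) (Fin v) ℝ) * omegaExp y z = dexp y z := by
  rw [omegaExp, ← Matrix.mul_assoc, O_mul_transpose, Matrix.one_mul]

/-- The part of the derivative of `polarMap` which only depends on the orthogonal coordinate. -/
def orthₗ (y : Pairs v → ℝ) : (Pairs v → ℝ) →ₗ[ℝ] (Pairs v → ℝ) where
  toFun b := offₗ v (upper (omegaExp y (offₗ v b))) + D2 (diagₗ v b)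
  map_add' a b := by
    have h : omegaExp y (offₗ v (a + b)) = omegaExp y (offₗ v a) + omegaExp y (offₗ v b) := by
      simp only [omegaExp, ← Matrix.mul_add]
      congr 1
      ext i j
      simp [dexp]
    have h1 := (upperₗ v).map_add (omegaExp y (offₗ v a)) (omegaExp y (offₗ v b))
    have h2 := (D2ₗ v ∘ₗ diagₗ v).map_add a b
    simp only [upperₗ_apply] at h1
    change _ = _ at h2
    rw [h, h1, map_add]
    change _ + (D2ₗ v ∘ₗ diagₗ v) (a + b) = _
    rw [h2]
    exact add_add_add_comm _ _ _ _
  map_smul' c b := by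
    have h : omegaExp y (offₗ v (c • b)) = c • omegaExp y (offₗ v b) := by
      simp only [omegaExp, ← Matrix.mul_smul]
      congr 1
      ext i j
      simp [dexp]
    have h1 := (upperₗ v).map_smul c (omegaExp y (offₗ v b))
    have h2 := (D2ₗ v ∘ₗ diagₗ v).map_smul c b
    simp only [upperₗ_apply] at h1
    rw [h, h1, map_smul]
    change _ + (D2ₗ v ∘ₗ diagₗ v) (c • b) = _
    rw [h2, RingHom.id_apply, smul_add]
    rfl

theorem orthₗ_apply (y b : Pairs v → ℝ) : orthₗ y b =
    offₗ v (upper (omegaExp y (offₗ v b))) + D2 (diagₗ v b) := rfl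

theorem orthₗ_zero : orthₗ (0 : Pairs v → ℝ) = 1 := by
  refine LinearMap.ext fun b => ?_
  have : omegaExp 0 (offₗ v b) = skew (offₗ v b) := by
    rw [omegaExp, dexp_zero, expO_zero]
    simp
  rw [orthₗ_apply, this, upper_skew, off_off, off_add_diag]
  rfl

theorem skew_D2_comm (M M' : Fin (v / 2) → ℝ) :
    skew (D2 M) * skew (D2 M') = skew (D2 M') * skew (D2 M) := by
  ext a b
  rw [mul_skew_D2, skew_D2_mul, skew_D2, skew_D2]
  by_cases h : b = a
  · subst h
    have h1 := sgn_partner_mul_lam M b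
    simp only [if_true, partner_partner, lam_partner]
    linear_combination (-(sgn b * lam M' b)) * h1
  · have h1 : ¬ partner b = partner a := fun h' => h (by
      rw [← partner_partner b, h', partner_partner])
    have h2 : ¬ b = partner (partner a) := by rwa [partner_partner]
    rw [if_neg h1, if_neg h2]
    ring

theorem contDiff_polarMap : ContDiff ℝ 1 (polarMap : (Pairs v → ℝ) → _) := by
  rw [contDiff_pi]
  intro p
  have hk : ∀ i j, ContDiff ℝ 1 fun a : Pairs v → ℝ =>
      (expO (offₗ v a) : Matrix (Fin v) (Fin v) ℝ) i j := fun i j =>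
    ((contDiff_expO_apply i j).of_le le_top).comp
      (LinearMap.toContinuousLinearMap (offₗ v)).contDiff
  have hD : ∀ i j, ContDiff ℝ 1 fun a : Pairs v → ℝ => skew (D2 (diagₗ v a)) i j := fun i j =>
    (LinearMap.toContinuousLinearMap ((LinearMap.proj j) ∘ₗ (LinearMap.proj i) ∘ₗ skewₗ v ∘ₗ D2ₗ v ∘ₗ
      diagₗ v : (Pairs v → ℝ) →ₗ[ℝ] ℝ)).contDiff
  have : (fun a : Pairs v → ℝ => polarMap a p) = fun a => ∑ j, (∑ i,
      (expO (offₗ v a) : Matrix (Fin v) (Fin v) ℝ) p.1.1 i * skew (D2 (diagₗ v a)) i j) *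
      (expO (offₗ v a) : Matrix (Fin v) (Fin v) ℝ) p.1.2 j := by
    funext a
    rfl
  rw [this]
  exact ContDiff.sum fun j _ => (ContDiff.sum fun i _ => (hk _ _).mul (hD _ _)).mul (hk _ _)

theorem fderiv_polarMap_apply (a b : Pairs v → ℝ) : fderiv ℝ polarMap a b =
    actA (expO (offₗ v a)) (adₗ (diagₗ v a) (orthₗ (offₗ v a) b)) := by
  have h := hasDerivAt_line (contDiff_polarMap.differentiable (by simp) a) b
  rw [hasDerivAt_pi] at h
  funext p
  refine (h p).unique ?_
  set y := offₗ v a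
  set z := offₗ v b
  have hk := hasDerivAt_expO_line y z
  have hD : ∀ i j, HasDerivAt (fun t : ℝ => skew (D2 (diagₗ v a) + t • D2 (diagₗ v b)) i j)
      (skew (D2 (diagₗ v b)) i j) 0 := fun i j => by
    simp only [skew_add, skew_smul, Matrix.add_apply, Matrix.smul_apply, smul_eq_mul]
    simpa using ((hasDerivAt_id (0 : ℝ)).mul_const (skew (D2 (diagₗ v b)) i j)).const_add
      (skew (D2 (diagₗ v a)) i j)
  have h1 := hasDerivAt_matrix_mul (hasDerivAt_matrix_mul hk hD)
    (B := fun t => (expO (y + t • z) : Matrix (Fin v) (Fin v) ℝ)ᵀ)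
    (B' := (dexp y z)ᵀ) (fun i j => hk j i) p.1.1 p.1.2
  have h2 : (fun t : ℝ => polarMap (a + t • b) p) = fun t : ℝ =>
      ((expO (y + t • z) : Matrix (Fin v) (Fin v) ℝ) * skew (D2 (diagₗ v a) + t • D2 (diagₗ v b)) *
        (expO (y + t • z) : Matrix (Fin v) (Fin v) ℝ)ᵀ) p.1.1 p.1.2 := by
    funext t
    have e1 : offₗ v (a + t • b) = y + t • z := by simp [y, z]
    have e2 : D2 (diagₗ v (a + t • b)) = D2 (diagₗ v a) + t • D2 (diagₗ v b) := by
      have := (D2ₗ v ∘ₗ diagₗ v).map_add a (t • b)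
      rw [(D2ₗ v ∘ₗ diagₗ v).map_smul] at this
      exact this
    rw [polarMap, e1, e2]
    rfl
  rw [h2]
  refine h1.congr_deriv ?_
  simp only [zero_smul, add_zero]
  set k := expO y
  set D := skew (D2 (diagₗ v a))
  set ω := omegaExp y z with hω
  have h5 : dexp y z = k.1 * ω := (mul_omegaExp y z).symm
  rw [h5, transpose_mul, omegaExp_transpose, ← hω]
  have h3 : skew (adₗ (diagₗ v a) (orthₗ y b)) = ω * D - D * ω + skew (D2 (diagₗ v b)) := by
    have e0 : offₗ v (orthₗ y b) = offₗ v (upper ω) := by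
      rw [orthₗ_apply, map_add, off_off, off_D2, add_zero]
    have e1 : diagₗ v (orthₗ y b) = diagₗ v b := by
      rw [orthₗ_apply, map_add, diag_off, diag_D2, zero_add]
    have e2 : skew (upper ω) = skew (offₗ v (upper ω)) + skew (D2 (diagₗ v (upper ω))) := by
      rw [← skew_add, off_add_diag]
    have e3 : skew (upper ω) = ω := skew_upper (omegaExp_transpose y z)
    have e4 : skew (offₗ v (upper ω)) = ω - skew (D2 (diagₗ v (upper ω))) := by
      exact eq_sub_of_add_eq (e2.symm.trans e3)
    rw [adₗ_apply, e0, e1, skew_add, skew_upper]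
    · rw [e4, Matrix.sub_mul, Matrix.mul_sub, skew_D2_comm]
      congr 1
      abel
    · simp only [transpose_sub, transpose_mul, skew_transpose]
      simp
  have h4 : actA k (adₗ (diagₗ v a) (orthₗ y b)) p =
      (k.1 * (ω * D - D * ω + skew (D2 (diagₗ v b))) * k.1ᵀ) p.1.1 p.1.2 := by
    rw [actA_eq, h3]
    rfl
  rw [h4]
  refine congrFun (congrFun ?_ _) _
  simp only [Matrix.mul_add, Matrix.add_mul, Matrix.mul_sub, Matrix.sub_mul, Matrix.mul_assoc,
    Matrix.neg_mul, Matrix.mul_neg]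
  abel

theorem abs_det_fderiv_polarMap (a : Pairs v → ℝ) : |(fderiv ℝ polarMap a).det| =
    |LinearMap.det (orthₗ (offₗ v a))| * etaDensity v (diagₗ v a) := by
  have h : ((fderiv ℝ polarMap a : (Pairs v → ℝ) →L[ℝ] _) : (Pairs v → ℝ) →ₗ[ℝ] (Pairs v → ℝ)) =
      actAₗ (expO (offₗ v a)) ∘ₗ adₗ (diagₗ v a) ∘ₗ orthₗ (offₗ v a) :=
    LinearMap.ext fun b => fderiv_polarMap_apply a b
  rw [ContinuousLinearMap.det, h, LinearMap.det_comp, LinearMap.det_comp, abs_mul, abs_mul,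
    abs_det_of_dotProduct _ (actA_dotProduct_actA _), abs_det_ad, one_mul, mul_comm]

theorem continuous_det_orth : Continuous fun y : Pairs v → ℝ => LinearMap.det (orthₗ y) := by
  have h : (fun y : Pairs v → ℝ => LinearMap.det (orthₗ y)) =
      fun y => (LinearMap.toMatrix' (orthₗ y)).det := by
    funext y
    rw [LinearMap.det_toMatrix']
  rw [h]
  refine Continuous.matrix_det ?_
  refine continuous_matrix fun p q => ?_
  have h1 : ∀ i j, Continuous fun y : Pairs v → ℝ => (expO y : Matrix (Fin v) (Fin v) ℝ) i j :=
    fun i j => (contDiff_expO_apply i j).continuous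
  have h2 : ∀ (z : Pairs v → ℝ) i j, Continuous fun y : Pairs v → ℝ => dexp y z i j :=
    fun z i j => ((contDiff_expO_apply i j).continuous_fderiv (by simp)).clm_apply continuous_const
  simp only [LinearMap.toMatrix'_apply, orthₗ_apply, Pi.add_apply, offₗ_apply, upper, omegaExp,
    Matrix.mul_apply, transpose_apply]
  refine Continuous.add ?_ continuous_const
  split_ifs
  · exact continuous_const
  · exact continuous_finsetSum _ fun i _ => (h1 _ _).mul (h2 _ _ _)

open Topology in
theorem isOpen_simplex (v : ℕ) : IsOpen (simplex v) := by
  have : simplex v = (⋂ i, ⋂ j, ⋂ (_ : i < j), {Λ : Fin (v / 2) → ℝ | Λ j < Λ i}) ∩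
      ⋂ j, {Λ : Fin (v / 2) → ℝ | 0 < Λ j} := by
    ext Λ
    simp only [simplex, StrictAnti, Set.mem_inter_iff, Set.mem_iInter]
    rfl
  rw [this]
  refine IsOpen.inter ?_ ?_
  · exact isOpen_iInter_of_finite fun i => isOpen_iInter_of_finite fun j =>
      isOpen_iInter_of_finite fun _ => isOpen_lt (continuous_apply j) (continuous_apply i)
  · exact isOpen_iInter_of_finite fun j => isOpen_lt continuous_const (continuous_apply j)

theorem etaDensity_pos {Λ : Fin (v / 2) → ℝ} (hΛ : Λ ∈ simplex v) : 0 < etaDensity v Λ := by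
  unfold etaDensity
  refine mul_pos ?_ (Finset.prod_pos fun j _ => Finset.prod_pos fun k hk => ?_)
  · split_ifs
    · exact zero_lt_one
    · exact Finset.prod_pos fun j _ => pow_pos (hΛ.2 j) 2
  · have h1 := hΛ.1 (Finset.mem_Ioi.1 hk)
    have h2 := hΛ.2 k
    have : 0 < Λ j ^ 2 - Λ k ^ 2 := by nlinarith
    positivity

theorem continuous_etaDensity (v : ℕ) : Continuous (etaDensity v) := by
  unfold etaDensity
  split_ifs <;> fun_prop

/-- A neighbourhood of the simplex in the domain of `polarMap`. -/
def polarDomain (v : ℕ) (ε : ℝ) : Set (Pairs v → ℝ) := {a | ‖offₗ v a‖ < ε ∧ diagₗ v a ∈ simplex v}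

theorem isOpen_polarDomain (v : ℕ) (ε : ℝ) : IsOpen (polarDomain v ε) :=
  (isOpen_lt (offₗ v).continuous_of_finiteDimensional.norm continuous_const).inter
    ((isOpen_simplex v).preimage (diagₗ v).continuous_of_finiteDimensional)

theorem polarMap_D2 (Λ : Fin (v / 2) → ℝ) : polarMap (D2 Λ) = D2 Λ := by
  rw [polarMap, off_D2, diag_D2, expO_zero, actA_one]

theorem polarMap_off_add (a : Pairs v → ℝ) (Λ : Fin (v / 2) → ℝ) :
    polarMap (offₗ v a + D2 Λ) = actA (expO (offₗ v a)) (D2 Λ) := by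
  rw [polarMap, map_add, map_add, off_off, off_D2, diag_off, diag_D2, add_zero, zero_add]

theorem actA_eq_polarMap {Λ Λ₀ : Fin (v / 2) → ℝ} (hΛ : Λ ∈ simplex v)
    {k : O v} {a : Pairs v → ℝ} (ha : diagₗ v a ∈ simplex v) (h : actA k (D2 Λ) = polarMap a) :
    actA k (D2 Λ₀) = polarMap (offₗ v a + D2 Λ₀) := by
  rw [polarMap_off_add]
  have h1 : actA ((expO (offₗ v a))⁻¹ * k) (D2 Λ) = D2 (diagₗ v a) := by
    rw [actA_mul, h, polarMap, ← actA_mul, inv_mul_cancel, actA_one]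
  have h2 := (eq_and_fix_of_actA_D2 hΛ ha h1).2 Λ₀
  conv_rhs => rw [← h2, ← actA_mul, mul_inv_cancel_left]

theorem off_add_mem_polarDomain {ε : ℝ} {a : Pairs v → ℝ} (ha : a ∈ polarDomain v ε)
    {Λ : Fin (v / 2) → ℝ} (hΛ : Λ ∈ simplex v) : offₗ v a + D2 Λ ∈ polarDomain v ε := by
  constructor
  · rw [map_add, off_off, off_D2, add_zero]; exact ha.1
  · rw [map_add, diag_off, diag_D2, zero_add]; exact hΛ

theorem actA_mem_image_iff {ε : ℝ} {Λ Λ₀ : Fin (v / 2) → ℝ} (hΛ : Λ ∈ simplex v)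
    (hΛ₀ : Λ₀ ∈ simplex v) (k : O v) :
    actA k (D2 Λ) ∈ polarMap '' polarDomain v ε ↔ actA k (D2 Λ₀) ∈ polarMap '' polarDomain v ε := by
  have key : ∀ {Λ Λ₀ : Fin (v / 2) → ℝ}, Λ ∈ simplex v → Λ₀ ∈ simplex v →
      actA k (D2 Λ) ∈ polarMap '' polarDomain v ε →
      actA k (D2 Λ₀) ∈ polarMap '' polarDomain v ε := by
    rintro Λ Λ₀ h1 h2 ⟨a, ha, hab⟩
    exact ⟨_, off_add_mem_polarDomain ha h2, (actA_eq_polarMap h1 ha.2 hab.symm).symm⟩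
  exact ⟨key hΛ hΛ₀, key hΛ₀ hΛ⟩

open Topology in
/-- For small `ε` the map `polarMap` is injective, with controlled Jacobian, and its image contains
a neighbourhood of the simplex. -/
theorem exists_polarDomain (v : ℕ) : ∃ ε : ℝ, 0 < ε ∧
    Set.InjOn polarMap (polarDomain v ε) ∧
    (∀ y : Pairs v → ℝ, ‖y‖ < ε → |LinearMap.det (orthₗ y)| ∈ Set.Icc (1 / 2) 2) ∧
    ∀ Λ ∈ simplex v, {k : O v | actA k (D2 Λ) ∈ polarMap '' polarDomain v ε} ∈ 𝓝 1 := by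
  obtain ⟨Λ₀, hΛ₀⟩ := exists_mem_simplex v
  have hdet : (fderiv ℝ polarMap (D2 Λ₀)).det ≠ 0 := by
    rw [← abs_ne_zero, abs_det_fderiv_polarMap, off_D2, diag_D2, orthₗ_zero, map_one]
    simpa using (etaDensity_pos hΛ₀).ne'
  let e := (fderiv ℝ polarMap (D2 Λ₀)).toContinuousLinearEquivOfDetNeZero hdet
  have hstr : HasStrictFDerivAt polarMap (e : (Pairs v → ℝ) →L[ℝ] (Pairs v → ℝ)) (D2 Λ₀) :=
    contDiff_polarMap.contDiffAt.hasStrictFDerivAt (by simp)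
  let P := hstr.toOpenPartialHomeomorph polarMap
  obtain ⟨δ, hδ, hball⟩ := Metric.isOpen_iff.1 P.open_source _
    hstr.mem_toOpenPartialHomeomorph_source
  have hc : ∀ᶠ y in 𝓝 (0 : Pairs v → ℝ), |LinearMap.det (orthₗ y)| ∈ Set.Icc (1 / 2 : ℝ) 2 := by
    refine (continuous_det_orth.abs.tendsto (0 : Pairs v → ℝ)).eventually ?_
    rw [orthₗ_zero, map_one, abs_one]
    exact Icc_mem_nhds (by norm_num) (by norm_num)
  obtain ⟨δ', hδ', hball'⟩ := Metric.eventually_nhds_iff.1 hc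
  refine ⟨min δ δ', lt_min hδ hδ', ?_, ?_, ?_⟩
  · intro a ha b hb hab
    have h1 : actA ((expO (offₗ v b))⁻¹ * expO (offₗ v a)) (D2 (diagₗ v a)) = D2 (diagₗ v b) := by
      rw [actA_mul]
      change actA _ (polarMap a) = _
      rw [hab, polarMap, ← actA_mul, inv_mul_cancel, actA_one]
    obtain ⟨h2, -⟩ := eq_and_fix_of_actA_D2 ha.2 hb.2 h1
    have h3 : polarMap (offₗ v a + D2 Λ₀) = polarMap (offₗ v b + D2 Λ₀) := by
      rw [polarMap_off_add]
      exact actA_eq_polarMap ha.2 hb.2 hab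
    have hsrc : ∀ c ∈ polarDomain v (min δ δ'), offₗ v c + D2 Λ₀ ∈ P.source := fun c hc =>
      hball (by
        rw [Metric.mem_ball, dist_eq_norm, add_sub_cancel_right]
        exact hc.1.trans_le (min_le_left _ _))
    have h4 := P.injOn (hsrc a ha) (hsrc b hb) h3
    rw [← off_add_diag a, ← off_add_diag b, h2, add_right_cancel h4]
  · intro y hy
    exact hball' (by rw [dist_zero_right]; exact hy.trans_le (min_le_right _ _))
  · intro Λ hΛ
    have h1 : polarDomain v (min δ δ') ∈ 𝓝 (D2 Λ₀) :=
      (isOpen_polarDomain _ _).mem_nhds (by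
        constructor
        · rw [off_D2, norm_zero]; exact lt_min hδ hδ'
        · rwa [diag_D2])
    have h2 : polarMap '' polarDomain v (min δ δ') ∈ 𝓝 (D2 Λ₀) := by
      have := Filter.image_mem_map (m := polarMap) h1
      rwa [hstr.map_nhds_eq_of_equiv, polarMap_D2] at this
    have h3 : Continuous fun k : O v => actA k (D2 Λ₀) :=
      continuous_actA.comp (continuous_id.prodMk continuous_const)
    have h4 := h3.continuousAt (x := 1)
    rw [ContinuousAt, actA_one] at h4
    filter_upwards [h4 h2] with k hk
    exact (actA_mem_image_iff hΛ hΛ₀ k).2 hk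

theorem volume_ker_eq_zero (L : (Pairs v → ℝ) →ₗ[ℝ] ℝ) (hL : L ≠ 0) :
    volume {a | L a = 0} = 0 := by
  have := Measure.addHaar_submodule (volume : Measure (Pairs v → ℝ)) (LinearMap.ker L)
    (fun h => hL (LinearMap.ker_eq_top.1 h))
  exact this

theorem volume_wall (v : ℕ) : volume {a : Pairs v → ℝ | (∃ i j, i ≠ j ∧
    diagₗ v a i = diagₗ v a j) ∨ ∃ j, diagₗ v a j = 0} = 0 := by
  let P : Fin (v / 2) → (Pairs v → ℝ) →ₗ[ℝ] ℝ := fun j =>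
    LinearMap.proj (φ := fun _ : Pairs v => ℝ) (pairIdx j)
  have h : {a : Pairs v → ℝ | (∃ i j, i ≠ j ∧ diagₗ v a i = diagₗ v a j) ∨ ∃ j, diagₗ v a j = 0} ⊆
      (⋃ q : {q : Fin (v / 2) × Fin (v / 2) // q.1 ≠ q.2},
        {a : Pairs v → ℝ | (P q.1.1 - P q.1.2) a = 0}) ∪
      ⋃ j : Fin (v / 2), {a : Pairs v → ℝ | P j a = 0} := by
    rintro a (⟨i, j, hij, h⟩ | ⟨j, h⟩)
    · exact Or.inl (Set.mem_iUnion.2 ⟨⟨(i, j), hij⟩, sub_eq_zero.2 h⟩)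
    · exact Or.inr (Set.mem_iUnion.2 ⟨j, h⟩)
  refine measure_mono_null h (measure_union_null (measure_iUnion_null fun q => ?_)
    (measure_iUnion_null fun j => ?_))
  · refine volume_ker_eq_zero _ fun h => ?_
    have := LinearMap.congr_fun h (D2 (Pi.single q.1.1 1))
    simp [P, D2_pairIdx, q.2.symm] at this
  · refine volume_ker_eq_zero _ fun h => ?_
    have := LinearMap.congr_fun h (D2 (Pi.single j 1))
    simp [P, D2_pairIdx] at this

/-- Almost every antisymmetric matrix is conjugate to some `D_2(Λ)` with `Λ` in the simplex. -/
theorem ae_regular (v : ℕ) : ∀ᵐ a : Pairs v → ℝ, ∃ (k : O v) (Λ : Fin (v / 2) → ℝ),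
    Λ ∈ simplex v ∧ a = actA k (D2 Λ) := by
  obtain ⟨ε, hε, -, -, hnhds⟩ := exists_polarDomain v
  obtain ⟨Λ₀, hΛ₀⟩ := exists_mem_simplex v
  set V := {k : O v | actA k (D2 Λ₀) ∈ polarMap '' polarDomain v ε} with hV
  obtain ⟨t, ht⟩ := compact_covered_by_mul_left_translates (isCompact_univ (X := O v))
    (V := V) ⟨1, mem_interior_iff_mem_nhds.2 (hnhds Λ₀ hΛ₀)⟩
  set W := {a : Pairs v → ℝ | (∃ i j, i ≠ j ∧ diagₗ v a i = diagₗ v a j) ∨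
    ∃ j, diagₗ v a j = 0} with hW
  have hnull : volume (⋃ g ∈ t, actA g⁻¹ '' (polarMap '' W)) = 0 := by
    refine (measure_biUnion_null_iff t.countable_toSet).2 fun g _ => ?_
    have h1 : volume (polarMap '' W) = 0 :=
      addHaar_image_eq_zero_of_differentiableOn_of_addHaar_eq_zero volume
        (contDiff_polarMap.differentiable (by simp)).differentiableOn (volume_wall v)
    exact addHaar_image_eq_zero_of_differentiableOn_of_addHaar_eq_zero volume
      ((LinearMap.toContinuousLinearMap (actAₗ g⁻¹)).differentiable).differentiableOn h1
  refine measure_mono_null (fun a ha => ?_) hnull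
  obtain ⟨k, M, rfl, hanti, hpos⟩ := exists_actA_eq_D2_sorted a
  obtain ⟨g, hg, hgk⟩ := Set.mem_iUnion₂.1 (ht (Set.mem_univ k))
  obtain ⟨b, hb, hbk⟩ : actA (g * k) (D2 Λ₀) ∈ polarMap '' polarDomain v ε := hgk
  refine Set.mem_iUnion₂.2 ⟨g, hg, actA (g * k) (D2 M), ⟨offₗ v b + D2 M, ?_, ?_⟩, ?_⟩
  · rw [hW]
    by_contra hcon
    have hcon' : ¬ ((∃ i j, i ≠ j ∧ M i = M j) ∨ ∃ j, M j = 0) := by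
      intro h
      apply hcon
      change (∃ i j, i ≠ j ∧ diagₗ v (offₗ v b + D2 M) i = diagₗ v (offₗ v b + D2 M) j) ∨
        ∃ j, diagₗ v (offₗ v b + D2 M) j = 0
      rw [map_add, diag_off, diag_D2, zero_add]
      exact h
    push Not at hcon'
    apply ha
    refine ⟨k, M, ⟨hanti.strictAnti_of_injective fun i j hij => ?_, fun j =>
      (hpos j).lt_of_ne (hcon'.2 j).symm⟩, rfl⟩
    by_contra hne
    exact hcon'.1 i j hne hij
  · exact (actA_eq_polarMap hΛ₀ hb.2 hbk.symm).symm
  · rw [← actA_mul, inv_mul_cancel_left]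

/-- Fubini for the decomposition into diagonal and off-diagonal blocks. -/
theorem exists_lintegral_off_mul_diag (v : ℕ) (f : (Pairs v → ℝ) → ℝ≥0∞) (hf : Measurable f) {ε : ℝ}
    (hε : 0 < ε) (hpos : ∀ y, ‖y‖ < ε → 1 / 2 ≤ f y) (htop : ∀ y, ‖y‖ < ε → f y ≤ 2)
    (hzero : ∀ y, ¬ ‖y‖ < ε → f y = 0) :
    ∃ C : ℝ≥0∞, C ≠ 0 ∧ C ≠ ∞ ∧ ∀ g : (Fin (v / 2) → ℝ) → ℝ≥0∞, Measurable g →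
      ∫⁻ a, f (offₗ v a) * g (diagₗ v a) = C * ∫⁻ Λ, g Λ := by
  let S : Pairs v → Prop := fun p => (p.1.1 : ℕ) / 2 = p.1.2 / 2
  let e := MeasurableEquiv.piEquivPiSubtypeProd (fun _ : Pairs v => ℝ) S
  have he : MeasurePreserving e volume volume :=
    volume_preserving_piEquivPiSubtypeProd (fun _ : Pairs v => ℝ) S
  let τ : Fin (v / 2) ≃ {p : Pairs v // S p} :=
    Equiv.ofBijective (fun j => ⟨pairIdx j, pairIdx_div j⟩)
      ⟨fun i j h => pairIdx_injective (congrArg Subtype.val h), fun p => by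
        obtain ⟨j, hj⟩ := (eq_pairIdx_iff p.1).2 p.2
        exact ⟨j, Subtype.ext hj.symm⟩⟩
  let ι : ({p : Pairs v // ¬ S p} → ℝ) → (Pairs v → ℝ) := fun w p => if h : S p then 0 else w ⟨p, h⟩
  let ρ : ({p : Pairs v // S p} → ℝ) → (Fin (v / 2) → ℝ) := fun u j => u (τ j)
  have hι : Continuous ι := by
    refine continuous_pi fun p => ?_
    by_cases h : S p
    · simp only [ι, h, dif_pos]; exact continuous_const
    · simp only [ι, h, dif_neg, not_false_eq_true]; exact continuous_apply _
  have hρ : MeasurePreserving ρ volume volume := by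
    have := volume_measurePreserving_piCongrLeft (fun _ : Fin (v / 2) => ℝ) τ.symm
    convert this using 1
    funext u j
    obtain ⟨q, rfl⟩ := τ.symm.surjective j
    rw [MeasurableEquiv.coe_piCongrLeft, Equiv.piCongrLeft_apply_apply]
    simp [ρ]
  have hnorm : ∀ w : {p : Pairs v // ¬ S p} → ℝ, ‖ι w‖ = ‖w‖ := by
    intro w
    apply le_antisymm
    · refine (pi_norm_le_iff_of_nonneg (norm_nonneg w)).2 fun p => ?_
      by_cases h : S p
      · simp [ι, h]
      · simp only [ι, h, dif_neg, not_false_eq_true]; exact norm_le_pi_norm w _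
    · refine (pi_norm_le_iff_of_nonneg (norm_nonneg _)).2 fun p => ?_
      have := norm_le_pi_norm (ι w) p.1
      simpa only [ι, p.2, dif_neg, not_false_eq_true] using this
  have hoff : ∀ a, offₗ v a = ι (e a).2 := by
    intro a; funext p
    rw [offₗ_apply]
    by_cases h : S p
    · simp only [ι, dif_pos h]; exact if_pos h
    · simp only [ι, dif_neg h]; exact if_neg h
  have hdiag : ∀ a, diagₗ v a = ρ (e a).1 := fun a => rfl
  refine ⟨∫⁻ w, f (ι w), ?_, ?_, fun g hg => ?_⟩
  · have h1 : (1 / 2 : ℝ≥0∞) * volume (Metric.ball (0 : {p : Pairs v // ¬ S p} → ℝ) ε) ≤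
        ∫⁻ w, f (ι w) := by
      rw [← setLIntegral_const]
      refine (setLIntegral_mono' measurableSet_ball fun w hw => hpos _ ?_).trans
        (setLIntegral_le_lintegral _ _)
      rw [hnorm]; simpa using hw
    refine (lt_of_lt_of_le (ENNReal.mul_pos (by simp) ?_) h1).ne'
    exact (Metric.measure_ball_pos volume _ hε).ne'
  · have h1 : ∫⁻ w, f (ι w) ≤ 2 * volume (Metric.ball (0 : {p : Pairs v // ¬ S p} → ℝ) ε) := by
      rw [← setLIntegral_const, ← lintegral_indicator measurableSet_ball]
      refine lintegral_mono fun w => ?_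
      by_cases hw : w ∈ Metric.ball (0 : {p : Pairs v // ¬ S p} → ℝ) ε
      · rw [Set.indicator_of_mem hw]
        exact htop _ (by rw [hnorm]; simpa using hw)
      · rw [Set.indicator_of_notMem hw, hzero _ (by rw [hnorm]; simpa using hw)]
    exact (lt_of_le_of_lt h1 (ENNReal.mul_lt_top (by simp) measure_ball_lt_top)).ne
  · have h1 : ∫⁻ a, f (offₗ v a) * g (diagₗ v a) =
        ∫⁻ q : ({p : Pairs v // S p} → ℝ) × ({p : Pairs v // ¬ S p} → ℝ),
          g (ρ q.1) * f (ι q.2) := by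
      rw [← he.lintegral_comp_emb e.measurableEmbedding]
      refine lintegral_congr fun a => ?_
      rw [hoff, hdiag, mul_comm]
    have h2 : Measurable fun u => g (ρ u) := hg.comp hρ.measurable
    have h3 : Measurable fun w => f (ι w) := hf.comp hι.measurable
    rw [h1, Measure.volume_eq_prod, lintegral_prod_mul h2.aemeasurable h3.aemeasurable, mul_comm,
      hρ.lintegral_comp hg]

theorem eta_eq_smul (v : ℕ) {c : ℝ} (hc : 0 ≤ c) : eta v c = ENNReal.ofReal c • eta v 1 := by
  have hm : Measurable fun Λ => ENNReal.ofReal (1 * etaDensity v Λ) :=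
    ((continuous_etaDensity v).measurable.const_mul 1).ennreal_ofReal
  rw [eta, eta, ← withDensity_smul _ hm]
  congr 1
  funext Λ
  simp [ENNReal.ofReal_mul hc]

instance (v : ℕ) (c : ℝ) : SFinite (eta v c) := by unfold eta; infer_instance

theorem lintegral_eta_one (v : ℕ) {g : (Fin (v / 2) → ℝ) → ℝ≥0∞} (hg : Measurable g) :
    ∫⁻ Λ, g Λ ∂(eta v 1) =
      ∫⁻ Λ, (simplex v).indicator (fun Λ => ENNReal.ofReal (etaDensity v Λ) * g Λ) Λ := by
  have hm : Measurable fun Λ => ENNReal.ofReal (1 * etaDensity v Λ) :=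
    ((continuous_etaDensity v).measurable.const_mul 1).ennreal_ofReal
  rw [eta, lintegral_withDensity_eq_lintegral_mul _ hm hg,
    lintegral_indicator (isOpen_simplex v).measurableSet]
  simp

/-- Polar coordinates for invariant functions. -/
theorem exists_lintegral_invariant (v : ℕ) : ∃ c : ℝ, 0 < c ∧
    ∀ G : (Pairs v → ℝ) → ℝ≥0∞, Measurable G → (∀ k a, G (actA k a) = G a) →
      ∫⁻ a, G a = ENNReal.ofReal c * ∫⁻ Λ, G (D2 Λ) ∂(eta v 1) := by
  obtain ⟨ε, hε, hinj, hdet, hnhds⟩ := exists_polarDomain v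
  obtain ⟨Λ₀, hΛ₀⟩ := exists_mem_simplex v
  set S := polarMap '' polarDomain v ε with hS
  have hSm : MeasurableSet S :=
    (isOpen_polarDomain v ε).measurableSet.image_of_continuousOn_injOn
      contDiff_polarMap.continuous.continuousOn hinj
  set V := {k : O v | actA k (D2 Λ₀) ∈ S} with hV
  have hV0 : haarO v V ≠ 0 := (Measure.measure_pos_of_mem_nhds _ (hnhds Λ₀ hΛ₀)).ne'
  have hVtop : haarO v V ≠ ∞ := measure_ne_top _ _
  let f : (Pairs v → ℝ) → ℝ≥0∞ := (Metric.ball 0 ε).indicator fun y =>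
    ENNReal.ofReal |LinearMap.det (orthₗ y)|
  have hfm : Measurable f :=
    (continuous_det_orth.abs.measurable.ennreal_ofReal).indicator measurableSet_ball
  have hmem : ∀ y : Pairs v → ℝ, ‖y‖ < ε → f y = ENNReal.ofReal |LinearMap.det (orthₗ y)| :=
    fun y hy => Set.indicator_of_mem (by simpa using hy) _
  obtain ⟨C, hC0, hCtop, hC⟩ := exists_lintegral_off_mul_diag v f hfm hε
    (fun y hy => by
      rw [hmem y hy]
      refine le_trans ?_ (ENNReal.ofReal_le_ofReal (hdet y hy).1)
      rw [ENNReal.ofReal_div_of_pos (by norm_num)]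
      simp)
    (fun y hy => by
      rw [hmem y hy]
      refine (ENNReal.ofReal_le_ofReal (hdet y hy).2).trans ?_
      simp)
    (fun y hy => Set.indicator_of_notMem (by simpa using hy) _)
  have hact : ∀ a : Pairs v → ℝ, Continuous fun k : O v => actA k a := fun a =>
    continuous_actA.comp (continuous_id.prodMk continuous_const)
  have hVm : MeasurableSet V := (hact _).measurable hSm
  have key : ∀ G : (Pairs v → ℝ) → ℝ≥0∞, Measurable G → (∀ k a, G (actA k a) = G a) →
      haarO v V * ∫⁻ a, G a = C * ∫⁻ Λ, G (D2 Λ) ∂(eta v 1) := by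
    intro G hG hinv
    have hGD : Measurable fun Λ : Fin (v / 2) → ℝ => G (D2 Λ) := hG.comp continuous_D2.measurable
    have h1 : ∫⁻ a in S, G a = C * ∫⁻ Λ, G (D2 Λ) ∂(eta v 1) := by
      rw [hS, lintegral_image_eq_lintegral_abs_det_fderiv_mul volume
        (isOpen_polarDomain v ε).measurableSet
        (fun a _ => (contDiff_polarMap.differentiable (by simp) a).hasFDerivAt.hasFDerivWithinAt)
        hinj, ← lintegral_indicator (isOpen_polarDomain v ε).measurableSet, lintegral_eta_one v hGD,
        ← hC ((simplex v).indicator fun Λ => ENNReal.ofReal (etaDensity v Λ) * G (D2 Λ))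
          (((continuous_etaDensity v).measurable.ennreal_ofReal.mul hGD).indicator
          (isOpen_simplex v).measurableSet)]
      refine lintegral_congr fun a => ?_
      by_cases ha1 : ‖offₗ v a‖ < ε
      · by_cases ha2 : diagₗ v a ∈ simplex v
        · have ha : a ∈ polarDomain v ε := ⟨ha1, ha2⟩
          rw [Set.indicator_of_mem ha, Set.indicator_of_mem ha2,
            abs_det_fderiv_polarMap, ENNReal.ofReal_mul (abs_nonneg _), hmem _ ha1, polarMap, hinv,
            mul_assoc]
        · rw [Set.indicator_of_notMem (fun h : a ∈ polarDomain v ε => ha2 h.2),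
            Set.indicator_of_notMem ha2, mul_zero]
      · have : f (offₗ v a) = 0 := Set.indicator_of_notMem (by simpa using ha1) _
        rw [Set.indicator_of_notMem (fun h : a ∈ polarDomain v ε => ha1 h.1), this, zero_mul]
    have h2 : ∫⁻ a in S, G a = haarO v V * ∫⁻ a, G a := by
      have hmeas : Measurable fun q : O v × (Pairs v → ℝ) => S.indicator G (actA q.1 q.2) :=
        (hG.indicator hSm).comp continuous_actA.measurable
      calc ∫⁻ a in S, G a = ∫⁻ a, S.indicator G a := (lintegral_indicator hSm _).symm
        _ = ∫⁻ k : O v, ∫⁻ a, S.indicator G (actA k a) ∂volume ∂(haarO v) := by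
            simp only [(measurePreserving_actA _).lintegral_comp (hG.indicator hSm)]
            simp
        _ = ∫⁻ a, ∫⁻ k : O v, S.indicator G (actA k a) ∂(haarO v) :=
            lintegral_lintegral_swap hmeas.aemeasurable
        _ = ∫⁻ a, haarO v V * G a := by
            refine lintegral_congr_ae ?_
            filter_upwards [ae_regular v] with a ha
            obtain ⟨k₀, Λ, hΛ, rfl⟩ := ha
            have e1 : ∀ k : O v, S.indicator G (actA k (actA k₀ (D2 Λ))) =
                V.indicator (fun _ => G (actA k₀ (D2 Λ))) (k * k₀) := by
              intro k
              rw [← actA_mul]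
              have e2 : actA (k * k₀) (D2 Λ) ∈ S ↔ k * k₀ ∈ V := actA_mem_image_iff hΛ hΛ₀ _
              by_cases h : k * k₀ ∈ V
              · rw [Set.indicator_of_mem h, Set.indicator_of_mem (e2.2 h), hinv, hinv]
              · rw [Set.indicator_of_notMem h, Set.indicator_of_notMem (fun h' => h (e2.1 h'))]
            simp only [e1]
            rw [lintegral_mul_right_eq_self (fun k => V.indicator (fun _ => G (actA k₀ (D2 Λ))) k),
              lintegral_indicator_const hVm, mul_comm]
        _ = haarO v V * ∫⁻ a, G a := lintegral_const_mul _ hG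
    rw [← h2, h1]
  refine ⟨(C / haarO v V).toReal, ENNReal.toReal_pos (ENNReal.div_ne_zero.2 ⟨hC0, hVtop⟩)
    (ENNReal.div_ne_top hCtop hV0), fun G hG hinv => ?_⟩
  rw [ENNReal.ofReal_toReal (ENNReal.div_ne_top hCtop hV0), ENNReal.div_eq_inv_mul, mul_assoc,
    ← key G hG hinv, ← mul_assoc, ENNReal.inv_mul_cancel hV0 hVtop, one_mul]

theorem measurable_actA_D2 {g : (Pairs v → ℝ) → ℝ≥0∞} (hg : Measurable g) :
    Measurable fun q : O v × (Fin (v / 2) → ℝ) => g (actA q.1 (D2 q.2)) := by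
  have hc : Continuous fun q : O v × (Fin (v / 2) → ℝ) => actA q.1 (D2 q.2) :=
    continuous_actA.comp (continuous_fst.prodMk (continuous_D2.comp continuous_snd))
  exact hg.comp hc.measurable

theorem exists_isPolarConst (v : ℕ) : ∃ c : ℝ, IsPolarConst v c := by
  obtain ⟨c, hc, hG⟩ := exists_lintegral_invariant v
  refine ⟨c, hc, fun g hg => ?_⟩
  have hm : Measurable fun q : O v × (Pairs v → ℝ) => g (actA q.1 q.2) :=
    hg.comp continuous_actA.measurable
  have hm' : Measurable fun q : (Pairs v → ℝ) × O v => g (actA q.2 q.1) :=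
    hg.comp (continuous_actA.comp continuous_swap).measurable
  let G : (Pairs v → ℝ) → ℝ≥0∞ := fun a => ∫⁻ k, g (actA k a) ∂(haarO v)
  have hGm : Measurable G := hm'.lintegral_prod_right'
  have hinv : ∀ k a, G (actA k a) = G a := fun k a => by
    simp only [G, ← actA_mul]
    exact lintegral_mul_right_eq_self (fun k' => g (actA k' a)) k
  have h1 : ∫⁻ a, g a = ∫⁻ a, G a := by
    rw [← lintegral_lintegral_swap (f := fun (k : O v) a => g (actA k a)) hm.aemeasurable]
    simp only [(measurePreserving_actA _).lintegral_comp hg]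
    simp
  have h2 : ∫⁻ k, ∫⁻ Λ, g (actA k (D2 Λ)) ∂(eta v c) ∂(haarO v) =
      ∫⁻ Λ, G (D2 Λ) ∂(eta v c) :=
    lintegral_lintegral_swap (f := fun (k : O v) Λ => g (actA k (D2 Λ)))
      (measurable_actA_D2 hg).aemeasurable
  rw [h1, hG G hGm hinv, h2, eta_eq_smul v hc.le, lintegral_smul_measure, smul_eq_mul]

/-- Existence and uniqueness of the constant of the polar coordinates. -/
theorem existsUnique_isPolarConst (v : ℕ) : ∃! c : ℝ, IsPolarConst v c := by
  obtain ⟨c, hpolar⟩ := exists_isPolarConst v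
  refine ⟨c, hpolar, fun c' hc' => ?_⟩
  let g : (Pairs v → ℝ) → ℝ≥0∞ := (Metric.ball 0 1).indicator 1
  have hg : Measurable g := measurable_one.indicator measurableSet_ball
  have h1 := hpolar.2 g hg
  have h2 := hc'.2 g hg
  rw [eta_eq_smul v hpolar.1.le] at h1
  rw [eta_eq_smul v hc'.1.le] at h2
  have hm2 : Measurable fun k : O v => ∫⁻ Λ, g (actA k (D2 Λ)) ∂(eta v 1) :=
    Measurable.lintegral_prod_right' (measurable_actA_D2 hg)
  simp only [lintegral_smul_measure, smul_eq_mul] at h1 h2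
  rw [lintegral_const_mul _ hm2] at h1 h2
  have hb : ∫⁻ a, g a = volume (Metric.ball (0 : Pairs v → ℝ) 1) := by
    simp only [g]
    rw [lintegral_indicator_one measurableSet_ball]
  have hb0 : ∫⁻ a, g a ≠ 0 := by rw [hb]; exact (Metric.measure_ball_pos _ _ one_pos).ne'
  have hbt : ∫⁻ a, g a ≠ ∞ := by rw [hb]; exact measure_ball_lt_top.ne
  set I := ∫⁻ k, ∫⁻ Λ, g (actA k (D2 Λ)) ∂(eta v 1) ∂(haarO v)
  have hI0 : I ≠ 0 := fun h => hb0 (by rw [h1, h, mul_zero])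
  have hIt : I ≠ ∞ := fun h => hbt (by
    rw [h1, h, ENNReal.mul_top (by simpa using hpolar.1)])
  have h3 : ENNReal.ofReal c' = ENNReal.ofReal c :=
    (ENNReal.mul_left_inj hI0 hIt).1 (h2.symm.trans h1)
  exact (ENNReal.ofReal_eq_ofReal_iff hc'.1.le hpolar.1.le).1 h3

/-! ### The product formula for Laguerre functions -/

theorem hasSum_integral_mul_pow_div_factorial {X : Type*} [TopologicalSpace X] [CompactSpace X]
    [MeasurableSpace X] [OpensMeasurableSpace X] (μ : Measure X)
    [IsFiniteMeasure μ] {g h : X → ℂ} (hg : Continuous g) (hh : Continuous h) :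
    HasSum (fun n : ℕ => ∫ x, g x * (h x ^ n / n.factorial) ∂μ)
      (∫ x, g x * Complex.exp (h x) ∂μ) := by
  obtain ⟨A, hA⟩ := (isCompact_range hg).isBounded.exists_norm_le
  obtain ⟨B, hB⟩ := (isCompact_range hh).isBounded.exists_norm_le
  have hinteg : ∀ n : ℕ, Integrable (fun x => g x * (h x ^ n / n.factorial)) μ := fun n =>
    (by fun_prop : Continuous fun x => g x * (h x ^ n / n.factorial)).integrable_of_hasCompactSupport
      (HasCompactSupport.of_compactSpace _)
  have hle : ∀ (n : ℕ) (x : X), ‖g x * (h x ^ n / n.factorial)‖ ≤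
      |A| * (|B| ^ n / n.factorial) := fun n x => by
    rw [norm_mul, norm_div, norm_pow, Complex.norm_natCast]
    gcongr
    · exact (hA _ ⟨x, rfl⟩).trans (le_abs_self A)
    · exact (hB _ ⟨x, rfl⟩).trans (le_abs_self B)
  have hsum : Summable fun n : ℕ => ∫ x, ‖g x * (h x ^ n / n.factorial)‖ ∂μ := by
    refine Summable.of_nonneg_of_le (fun n => integral_nonneg fun x => norm_nonneg _)
      (fun n => ?_) ((Real.summable_pow_div_factorial |B|).mul_left (|A| * μ.real Set.univ))
    calc ∫ x, ‖g x * (h x ^ n / n.factorial)‖ ∂μ ≤ ∫ _, |A| * (|B| ^ n / n.factorial) ∂μ :=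
          integral_mono (hinteg n).norm (integrable_const _) (hle n)
      _ = _ := by rw [integral_const, smul_eq_mul]; ring
  have h1 := hasSum_integral_of_summable_integral_norm hinteg hsum
  have h2 : ∀ x, ∑' n : ℕ, g x * (h x ^ n / n.factorial) = g x * Complex.exp (h x) := fun x => by
    rw [tsum_mul_left, Complex.exp_eq_exp_ℂ, NormedSpace.exp_eq_tsum_div]
  simpa only [h2] using h1

instance : MeasurableSpace Circle := borel _

instance : BorelSpace Circle := ⟨rfl⟩

instance : SecondCountableTopology Circle :=
  inferInstanceAs (SecondCountableTopology (Metric.sphere (0 : ℂ) 1))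

/-- The inclusion of the circle in the complex numbers. -/
def unitC (u : Circle) : ℂ := u

@[fun_prop]
theorem continuous_unitC : Continuous unitC := continuous_subtype_val

theorem unitC_ne_zero (u : Circle) : unitC u ≠ 0 := u.coe_ne_zero

theorem unitC_mul (u w : Circle) : unitC (u * w) = unitC u * unitC w := rfl

theorem unitC_inv (u : Circle) : unitC u⁻¹ = (unitC u)⁻¹ := rfl

theorem conj_unitC (u : Circle) : conj (unitC u) = unitC u⁻¹ := (Circle.coe_inv_eq_conj u).symm

/-- The Haar measure of total mass one on the circle. -/
def haarCircle : Measure Circle := Measure.haarMeasure ⊤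

instance : haarCircle.IsHaarMeasure := by unfold haarCircle; infer_instance

instance : IsProbabilityMeasure haarCircle :=
  ⟨by simpa [haarCircle] using Measure.haarMeasure_self (K₀ := (⊤ : PositiveCompacts Circle))⟩

theorem integrable_of_continuous {X : Type*} [TopologicalSpace X] [CompactSpace X]
    [MeasurableSpace X] [OpensMeasurableSpace X] {μ : Measure X}
    [IsFiniteMeasure μ] {g : X → ℂ} (hg : Continuous g) : Integrable g μ :=
  hg.integrable_of_hasCompactSupport (HasCompactSupport.of_compactSpace _)

theorem integral_circle_zpow (n : ℤ) :
    ∫ u : Circle, unitC u ^ n ∂haarCircle = if n = 0 then 1 else 0 := by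
  split_ifs with h
  · simp [h]
  · have h1 := integral_mul_left_eq_self (μ := haarCircle) (fun u : Circle => unitC u ^ n)
      (Circle.exp (Real.pi / n))
    have h2 : unitC (Circle.exp (Real.pi / n)) ^ n = -1 := by
      rw [unitC, Circle.coe_exp, ← Complex.exp_int_mul, ← Complex.exp_pi_mul_I]
      congr 1
      have : (n : ℂ) ≠ 0 := by exact_mod_cast h
      push_cast
      field_simp
    simp only [unitC_mul, mul_zpow, h2, integral_const_mul] at h1
    have h3 : (2 : ℂ) * ∫ u : Circle, unitC u ^ n ∂haarCircle = 0 := by linear_combination -h1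
    simpa using h3

theorem integral_circle_inv_pow_mul_exp (n : ℕ) (x : ℂ) :
    ∫ u : Circle, (unitC u⁻¹) ^ n * Complex.exp (x * unitC u) ∂haarCircle = x ^ n / n.factorial := by
  have h := hasSum_integral_mul_pow_div_factorial haarCircle
    (g := fun u : Circle => (unitC u⁻¹) ^ n) (h := fun u : Circle => x * unitC u)
    (by fun_prop) (by fun_prop)
  refine h.unique ?_
  have h1 : ∀ m : ℕ, ∫ u : Circle, (unitC u⁻¹) ^ n * ((x * unitC u) ^ m / m.factorial) ∂haarCircle =
      if m = n then x ^ n / n.factorial else 0 := by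
    intro m
    have : ∀ u : Circle, (unitC u⁻¹) ^ n * ((x * unitC u) ^ m / m.factorial) =
        x ^ m / m.factorial * unitC u ^ ((m : ℤ) - n) := fun u => by
      rw [zpow_sub₀ (unitC_ne_zero u), mul_pow, unitC_inv]
      simp
      ring
    simp only [this, integral_const_mul, integral_circle_zpow, sub_eq_zero, Nat.cast_inj]
    split_ifs with h
    · rw [h, mul_one]
    · rw [mul_zero]
  simp only [h1]
  exact hasSum_ite_eq n _

/-- The Laguerre polynomial of degree `n` and parameter `0` on the complex numbers. -/
def laguerreC (n : ℕ) (x : ℂ) : ℂ :=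
  ∑ i ∈ Finset.range (n + 1), (-1) ^ i * (n.choose i : ℂ) / (i.factorial : ℂ) * x ^ i

theorem ofReal_laguerre (n : ℕ) (x : ℝ) : ((laguerre n x : ℝ) : ℂ) = laguerreC n x := by
  simp [laguerre, laguerreC]

theorem integral_circle_laguerreC (n : ℕ) (x y : ℂ) :
    ∫ u : Circle, (1 - y * unitC u⁻¹) ^ n * Complex.exp (x * unitC u) ∂haarCircle =
      laguerreC n (x * y) := by
  have h1 : ∀ u : Circle, (1 - y * unitC u⁻¹) ^ n * Complex.exp (x * unitC u) =
      ∑ i ∈ Finset.range (n + 1), ((-y) ^ i * (n.choose i : ℂ)) *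
        ((unitC u⁻¹) ^ i * Complex.exp (x * unitC u)) := by
    intro u
    rw [sub_eq_add_neg, add_comm, add_pow, Finset.sum_mul]
    refine Finset.sum_congr rfl fun i _ => ?_
    rw [← neg_mul, mul_pow]
    ring
  simp only [h1]
  rw [integral_finsetSum _ fun i _ => integrable_of_continuous (by fun_prop)]
  simp only [integral_const_mul, integral_circle_inv_pow_mul_exp, laguerreC]
  refine Finset.sum_congr rfl fun i _ => ?_
  rw [mul_pow, neg_pow]
  ring

theorem integral_circle_laguerreC_product (n : ℕ) (a b c d : ℂ) :
    ∫ e : Circle, laguerreC n ((a + unitC e * c) * (b + unitC e⁻¹ * d)) *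
      Complex.exp (-(a * d * unitC e⁻¹)) ∂haarCircle = laguerreC n (a * b) * laguerreC n (c * d) := by
  let H : Circle × Circle → ℂ := fun q => (unitC (q.2)⁻¹) ^ n * Complex.exp (unitC q.1 * c * unitC q.2) *
    (unitC q.2 - d * unitC (q.1)⁻¹ - b) ^ n
  have hHc : Continuous H := by fun_prop
  have h1 : ∫ e : Circle, laguerreC n ((a + unitC e * c) * (b + unitC e⁻¹ * d)) *
      Complex.exp (-(a * d * unitC e⁻¹)) ∂haarCircle =
      ∫ q : Circle × Circle, H q * Complex.exp (a * (unitC q.2 - d * unitC (q.1)⁻¹))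
        ∂(haarCircle.prod haarCircle) := by
    rw [integral_prod (fun q : Circle × Circle => H q *
      Complex.exp (a * (unitC q.2 - d * unitC (q.1)⁻¹))) (integrable_of_continuous (by fun_prop))]
    congr 1
    funext e
    rw [← integral_circle_laguerreC, ← integral_mul_const]
    congr 1
    funext u
    have hu := unitC_ne_zero u
    have e1 : (1 - (b + unitC e⁻¹ * d) * unitC u⁻¹) =
        unitC u⁻¹ * (unitC u - d * unitC e⁻¹ - b) := by
      rw [unitC_inv u]
      field_simp
      ring
    have e2 : Complex.exp ((a + unitC e * c) * unitC u) * Complex.exp (-(a * d * unitC e⁻¹)) =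
        Complex.exp (unitC e * c * unitC u) * Complex.exp (a * (unitC u - d * unitC e⁻¹)) := by
      rw [← Complex.exp_add, ← Complex.exp_add]
      congr 1
      ring
    simp only [H]
    rw [e1, mul_pow, mul_assoc, e2]
    ring
  rw [h1]
  have h2 := hasSum_integral_mul_pow_div_factorial (haarCircle.prod haarCircle) hHc
    (h := fun q => a * (unitC q.2 - d * unitC (q.1)⁻¹)) (by fun_prop)
  refine h2.unique ?_
  have h3 : ∀ m : ℕ, ∫ q : Circle × Circle, H q * ((a * (unitC q.2 - d * unitC (q.1)⁻¹)) ^ m /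
      m.factorial) ∂(haarCircle.prod haarCircle) =
      ∑ j ∈ Finset.range (n + 1), if m + j = n then
        ((n.choose j : ℂ) * (-b) ^ (n - j) * (a ^ m / m.factorial)) * laguerreC n (c * d)
        else 0 := by
    intro m
    have e1 : ∀ q : Circle × Circle, H q * ((a * (unitC q.2 - d * unitC (q.1)⁻¹)) ^ m /
        m.factorial) = ∑ j ∈ Finset.range (n + 1),
          ((n.choose j : ℂ) * (-b) ^ (n - j) * (a ^ m / m.factorial)) *
          ((unitC (q.2)⁻¹) ^ n * Complex.exp (unitC q.1 * c * unitC q.2) *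
            (unitC q.2 - d * unitC (q.1)⁻¹) ^ (m + j)) := by
      intro q
      simp only [H]
      rw [sub_eq_add_neg _ b, add_pow, Finset.mul_sum, Finset.sum_mul]
      refine Finset.sum_congr rfl fun j _ => ?_
      rw [mul_pow, pow_add]
      ring
    simp only [e1]
    rw [integral_finsetSum _ fun i _ => integrable_of_continuous (by fun_prop)]
    refine Finset.sum_congr rfl fun j _ => ?_
    rw [integral_const_mul, integral_prod_symm (fun q : Circle × Circle => (unitC (q.2)⁻¹) ^ n *
      Complex.exp (unitC q.1 * c * unitC q.2) * (unitC q.2 - d * unitC (q.1)⁻¹) ^ (m + j))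
      (integrable_of_continuous (by fun_prop))]
    have e2 : ∀ u : Circle, ∫ e : Circle, (unitC u⁻¹) ^ n * Complex.exp (unitC e * c * unitC u) *
        (unitC u - d * unitC e⁻¹) ^ (m + j) ∂haarCircle =
        laguerreC (m + j) (c * d) * unitC u ^ (((m + j : ℕ) : ℤ) - n) := by
      intro u
      have hu := unitC_ne_zero u
      have e3 : ∀ e : Circle, (unitC u⁻¹) ^ n * Complex.exp (unitC e * c * unitC u) *
          (unitC u - d * unitC e⁻¹) ^ (m + j) = unitC u ^ (((m + j : ℕ) : ℤ) - n) *
          ((1 - (d * unitC u⁻¹) * unitC e⁻¹) ^ (m + j) * Complex.exp ((c * unitC u) * unitC e)) := by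
        intro e
        have e4 : unitC u - d * unitC e⁻¹ = unitC u * (1 - (d * unitC u⁻¹) * unitC e⁻¹) := by
          rw [unitC_inv u]
          field_simp
        rw [e4, mul_pow, zpow_sub₀ hu, zpow_natCast, zpow_natCast, unitC_inv u, inv_pow,
          show unitC e * c * unitC u = c * unitC u * unitC e by ring]
        ring
      simp only [e3, integral_const_mul, integral_circle_laguerreC]
      rw [show c * unitC u * (d * unitC u⁻¹) = c * d by rw [unitC_inv]; field_simp]
      ring
    simp only [e2, integral_const_mul, integral_circle_zpow, sub_eq_zero, Nat.cast_inj]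
    split_ifs with h
    · rw [mul_one, h]
    · simp
  simp only [h3]
  have h4 : ∀ j ∈ Finset.range (n + 1), HasSum (fun m : ℕ => if m + j = n then
        ((n.choose j : ℂ) * (-b) ^ (n - j) * (a ^ m / m.factorial)) * laguerreC n (c * d)
        else 0) (((n.choose j : ℂ) * (-b) ^ (n - j) * (a ^ (n - j) / (n - j).factorial)) *
          laguerreC n (c * d)) := by
    intro j hj
    rw [Finset.mem_range] at hj
    convert hasSum_ite_eq (n - j) _ using 2 with m
    by_cases hm : m = n - j
    · rw [if_pos hm, if_pos (by omega), hm]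
    · rw [if_neg hm, if_neg (by omega)]
  convert hasSum_sum h4 using 1
  rw [← Finset.sum_mul, laguerreC, ← Finset.sum_range_reflect]
  congr 1
  refine Finset.sum_congr rfl fun j hj => ?_
  rw [Finset.mem_range] at hj
  rw [show n + 1 - 1 - j = n - j by omega, Nat.choose_symm (by omega), mul_pow, neg_pow b]
  ring

theorem integral_circle_laguerreFun (n : ℕ) (z w : ℂ) :
    ∫ e : Circle, (laguerreFun n (Complex.normSq (z + unitC e * w)) : ℂ) *
      Complex.exp (Complex.I * ((conj z * (unitC e * w)).im : ℝ)) ∂haarCircle =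
      (laguerreFun n (Complex.normSq z) : ℂ) * laguerreFun n (Complex.normSq w) := by
  have h := integral_circle_laguerreC_product n z (conj z) w (conj w)
  have h1 : ∀ e : Circle, (laguerreFun n (Complex.normSq (z + unitC e * w)) : ℂ) *
      Complex.exp (Complex.I * ((conj z * (unitC e * w)).im : ℝ)) =
      (Complex.exp (-Complex.normSq z / 2) * Complex.exp (-Complex.normSq w / 2)) *
      (laguerreC n ((z + unitC e * w) * (conj z + unitC e⁻¹ * conj w)) *
      Complex.exp (-(z * conj w * unitC e⁻¹))) := by
    intro e
    have he : conj (unitC e) = unitC e⁻¹ := conj_unitC e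
    have e1 : (z + unitC e * w) * (conj z + unitC e⁻¹ * conj w) = (Complex.normSq (z + unitC e * w) : ℂ) := by
      rw [← Complex.mul_conj]
      simp [he]
    have e2 : (((conj z * (unitC e * w)).im : ℝ) : ℂ) =
        (conj z * (unitC e * w) - z * (unitC e⁻¹ * conj w)) / (2 * Complex.I) := by
      rw [Complex.im_eq_sub_conj]
      simp [he]
    have e3 : Complex.exp ((-Complex.normSq (z + unitC e * w) / 2 : ℝ) : ℂ) *
        Complex.exp (Complex.I * ((conj z * (unitC e * w)).im : ℝ)) =
        Complex.exp (-Complex.normSq z / 2) * Complex.exp (-Complex.normSq w / 2) *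
        Complex.exp (-(z * conj w * unitC e⁻¹)) := by
      rw [← Complex.exp_add, ← Complex.exp_add, ← Complex.exp_add]
      congr 1
      rw [e2]
      push_cast
      rw [← e1, ← Complex.mul_conj, ← Complex.mul_conj, unitC_inv]
      have := unitC_ne_zero e
      field_simp
      ring
    rw [e1, ← ofReal_laguerre, laguerreFun, Complex.ofReal_mul, Complex.ofReal_exp, mul_assoc, e3]
    ring
  simp only [h1, integral_const_mul, h, Complex.mul_conj, ← ofReal_laguerre]
  simp only [laguerreFun]
  push_cast
  ring

/-! ### Integrable functions with vanishing transforms -/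

section Separation

variable {X : Type*} [MeasurableSpace X] {ν : Measure X}

theorem integrable_norm_mul_pow_mul_exp {w : X → ℂ} {u : X → ℝ} (hw : AEStronglyMeasurable w ν)
    (hu : AEMeasurable u ν) {c : ℝ} (hc : 0 < c)
    (hinteg : Integrable (fun x => ‖w x‖ * Real.exp (c * |u x|)) ν) (n : ℕ) :
    Integrable (fun x => ‖w x‖ * (|u x| ^ n * Real.exp (c / 2 * |u x|))) ν := by
  refine (hinteg.const_mul (n.factorial * (2 / c) ^ n)).mono' ?_ (.of_forall fun x => ?_)
  · exact (hw.norm.aemeasurable.mul (((hu.abs).pow_const n).mul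
      (Real.measurable_exp.comp_aemeasurable (hu.abs.const_mul _)))).aestronglyMeasurable
  have h := Real.pow_div_factorial_le_exp (c / 2 * |u x|) (by positivity) n
  rw [Real.norm_of_nonneg (by positivity)]
  have h1 : |u x| ^ n ≤ n.factorial * (2 / c) ^ n * Real.exp (c / 2 * |u x|) := by
    have : |u x| ^ n = n.factorial * (2 / c) ^ n * ((c / 2 * |u x|) ^ n / n.factorial) := by
      rw [mul_pow, div_pow, div_pow]
      field_simp
    rw [this]
    gcongr
  calc ‖w x‖ * (|u x| ^ n * Real.exp (c / 2 * |u x|))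
      ≤ ‖w x‖ * (n.factorial * (2 / c) ^ n * Real.exp (c / 2 * |u x|) *
        Real.exp (c / 2 * |u x|)) := by gcongr
    _ = n.factorial * (2 / c) ^ n * (‖w x‖ * Real.exp (c * |u x|)) := by
        rw [mul_assoc _ (Real.exp _), ← Real.exp_add, show c / 2 * |u x| + c / 2 * |u x| =
          c * |u x| by ring]
        ring

theorem integral_mul_exp_eq_zero {w : X → ℂ} {u : X → ℝ} (hw : AEStronglyMeasurable w ν)
    (hu : AEMeasurable u ν) {c : ℝ} (hc : 0 < c)
    (hinteg : Integrable (fun x => ‖w x‖ * Real.exp (c * |u x|)) ν)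
    (h : ∀ n : ℕ, ∫ x, w x * (u x : ℂ) ^ n ∂ν = 0) (s : ℝ) :
    ∫ x, w x * Complex.exp (Complex.I * ((s * u x : ℝ) : ℂ)) ∂ν = 0 := by
  have huC : AEMeasurable (fun x => (u x : ℂ)) ν := Complex.measurable_ofReal.comp_aemeasurable hu
  have hexp : ∀ s : ℝ, AEMeasurable (fun x => Complex.exp (Complex.I * ((s * u x : ℝ) : ℂ))) ν :=
    fun s => Complex.measurable_exp.comp_aemeasurable
      ((Complex.measurable_ofReal.comp_aemeasurable (hu.const_mul s)).const_mul _)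
  let Q : ℝ → Prop := fun s => ∀ n : ℕ,
    ∫ x, w x * ((u x : ℂ) ^ n * Complex.exp (Complex.I * ((s * u x : ℝ) : ℂ))) ∂ν = 0
  have step : ∀ s t : ℝ, |t| ≤ c / 2 → Q s → Q (s + t) := by
    intro s t ht hs n
    have hsum := hasSum_integral_of_dominated_convergence (μ := ν)
      (F := fun (m : ℕ) x => (w x * ((u x : ℂ) ^ n * Complex.exp (Complex.I * ((s * u x : ℝ) : ℂ)))) *
        ((Complex.I * ((t * u x : ℝ) : ℂ)) ^ m / m.factorial))
      (f := fun x => w x * ((u x : ℂ) ^ n * Complex.exp (Complex.I * (((s + t) * u x : ℝ) : ℂ))))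
      (fun m x => ‖w x‖ * |u x| ^ n * ((|t| * |u x|) ^ m / m.factorial))
      (fun m => (hw.mul ((huC.pow_const n).mul (hexp s)).aestronglyMeasurable).mul
        (((((Complex.measurable_ofReal.comp_aemeasurable (hu.const_mul t)).const_mul
          Complex.I).pow_const m).div_const _).aestronglyMeasurable))
      (fun m => .of_forall fun x => by
        simp only [norm_mul, norm_div, norm_pow, Complex.norm_real, Complex.norm_I, one_mul,
          Complex.norm_natCast, Real.norm_eq_abs]
        rw [mul_comm Complex.I, Complex.norm_exp_ofReal_mul_I, mul_one])
      (.of_forall fun x => (Real.summable_pow_div_factorial _).mul_left _)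
      (by
        refine (integrable_norm_mul_pow_mul_exp hw hu hc hinteg n).mono' ?_ (.of_forall fun x => ?_)
        · have : ∀ x, ∑' m : ℕ, ‖w x‖ * |u x| ^ n * ((|t| * |u x|) ^ m / m.factorial) =
              ‖w x‖ * |u x| ^ n * Real.exp (|t| * |u x|) := fun x => by
            rw [tsum_mul_left, Real.exp_eq_exp_ℝ, NormedSpace.exp_eq_tsum_div]
          simp only [this]
          exact ((hw.norm.aemeasurable.mul ((hu.abs).pow_const n)).mul
            (Real.measurable_exp.comp_aemeasurable (hu.abs.const_mul _))).aestronglyMeasurable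
        · rw [tsum_mul_left]
          have : ∑' m : ℕ, (|t| * |u x|) ^ m / m.factorial = Real.exp (|t| * |u x|) := by
            rw [Real.exp_eq_exp_ℝ, NormedSpace.exp_eq_tsum_div]
          rw [this, Real.norm_of_nonneg (by positivity), mul_assoc]
          gcongr)
      (.of_forall fun x => by
        have h1 : HasSum (fun m : ℕ => (Complex.I * ((t * u x : ℝ) : ℂ)) ^ m / m.factorial)
            (Complex.exp (Complex.I * ((t * u x : ℝ) : ℂ))) := by
          rw [Complex.exp_eq_exp_ℂ]
          exact NormedSpace.expSeries_div_hasSum_exp _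
        have h2 := h1.mul_left (w x * ((u x : ℂ) ^ n *
          Complex.exp (Complex.I * ((s * u x : ℝ) : ℂ))))
        have h3 : w x * ((u x : ℂ) ^ n * Complex.exp (Complex.I * (((s + t) * u x : ℝ) : ℂ))) =
            w x * ((u x : ℂ) ^ n * Complex.exp (Complex.I * ((s * u x : ℝ) : ℂ))) *
              Complex.exp (Complex.I * ((t * u x : ℝ) : ℂ)) := by
          rw [mul_assoc, mul_assoc, ← Complex.exp_add]
          congr 3
          push_cast
          ring
        rw [h3]
        exact h2)
    refine hsum.unique ?_
    convert hasSum_zero with m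
    have : ∀ x, (w x * ((u x : ℂ) ^ n * Complex.exp (Complex.I * ((s * u x : ℝ) : ℂ)))) *
        ((Complex.I * ((t * u x : ℝ) : ℂ)) ^ m / m.factorial) =
        (Complex.I * t) ^ m / m.factorial *
        (w x * ((u x : ℂ) ^ (n + m) * Complex.exp (Complex.I * ((s * u x : ℝ) : ℂ)))) := fun x => by
      push_cast
      rw [pow_add, mul_pow, mul_pow, mul_pow]
      ring
    simp only [this, integral_const_mul, hs (n + m), mul_zero]
  obtain ⟨K, hK⟩ := exists_nat_gt (|s| / (c / 2))
  have hK0 : (0 : ℝ) < K := lt_of_le_of_lt (by positivity) hK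
  have hstep : |s / K| ≤ c / 2 := by
    rw [abs_div, abs_of_pos hK0, div_le_iff₀ hK0]
    rw [div_lt_iff₀ (by positivity)] at hK
    linarith
  have hall : ∀ j : ℕ, Q (j * (s / K)) := by
    intro j
    induction j with
    | zero => intro n; simpa using h n
    | succ j ih =>
      have := step _ _ hstep ih
      rwa [show (j : ℝ) * (s / K) + s / K = ((j + 1 : ℕ) : ℝ) * (s / K) by push_cast; ring] at this
  have h1 := hall K 0
  rw [mul_div_cancel₀ _ hK0.ne'] at h1
  simpa using h1

theorem ae_eq_zero_of_forall_integral_ofReal_mul {ι : Type*} {e : ι → X → ℂ}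
    (he : ∀ i, Measurable (e i)) (hb : ∀ i x, ‖e i x‖ ≤ 1)
    (hsep : ∀ (μ μ' : Measure X) [IsFiniteMeasure μ] [IsFiniteMeasure μ'],
      (∀ i, ∫ x, e i x ∂μ = ∫ x, e i x ∂μ') → μ = μ')
    {r : X → ℝ} (hr : Integrable r ν) (h : ∀ i, ∫ x, (r x : ℂ) * e i x ∂ν = 0) : r =ᵐ[ν] 0 := by
  have hfin : ∀ r : X → ℝ, Integrable r ν → ∫⁻ x, ENNReal.ofReal (r x) ∂ν ≠ ∞ := fun r hr => by
    refine ((lintegral_mono fun x => ?_).trans_lt hr.2).ne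
    rw [← ofReal_norm]
    exact ENNReal.ofReal_le_ofReal (le_abs_self _)
  have : IsFiniteMeasure (ν.withDensity fun x => ENNReal.ofReal (r x)) :=
    isFiniteMeasure_withDensity (hfin r hr)
  have : IsFiniteMeasure (ν.withDensity fun x => ENNReal.ofReal (-r x)) :=
    isFiniteMeasure_withDensity (hfin _ hr.neg)
  have key := hsep (ν.withDensity fun x => ENNReal.ofReal (r x))
    (ν.withDensity fun x => ENNReal.ofReal (-r x)) fun i => by
    have hm := hr.1.aemeasurable
    have hm' : AEMeasurable (fun x => -r x) ν := hm.neg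
    rw [integral_withDensity_eq_integral_toReal_smul₀ hm.ennreal_ofReal
      (.of_forall fun _ => ENNReal.ofReal_lt_top),
      integral_withDensity_eq_integral_toReal_smul₀ hm'.ennreal_ofReal
      (.of_forall fun _ => ENNReal.ofReal_lt_top), ← sub_eq_zero, ← integral_sub, ← h i]
    · congr 1
      funext x
      rw [← sub_smul, Complex.real_smul, ENNReal.toReal_ofReal', ENNReal.toReal_ofReal',
        max_zero_sub_max_neg_zero_eq_self]
    all_goals simp only [ENNReal.toReal_ofReal', Complex.real_smul]
    · exact Integrable.mul_bdd (f := fun x => ((max (r x) 0 : ℝ) : ℂ)) hr.pos_part.ofReal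
        (he i).aestronglyMeasurable (.of_forall (hb i))
    · exact Integrable.mul_bdd (f := fun x => ((max (-r x) 0 : ℝ) : ℂ)) hr.neg_part.ofReal
        (he i).aestronglyMeasurable (.of_forall (hb i))
  have hm' : AEMeasurable (fun x => -r x) ν := hr.1.aemeasurable.neg
  rw [withDensity_eq_iff hr.1.aemeasurable.ennreal_ofReal hm'.ennreal_ofReal
    (hfin r hr)] at key
  filter_upwards [key] with x hx
  have h1 := congrArg ENNReal.toReal hx
  rw [ENNReal.toReal_ofReal', ENNReal.toReal_ofReal'] at h1
  rw [← max_zero_sub_max_neg_zero_eq_self (r x), h1, sub_self]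
  rfl

/-- A complex integrable function vanishes if its integrals against a conjugation-invariant family
of bounded functions separating finite measures do. -/
theorem ae_eq_zero_of_forall_integral_mul {ι : Type*} {e : ι → X → ℂ}
    (he : ∀ i, Measurable (e i)) (hb : ∀ i x, ‖e i x‖ ≤ 1)
    (hconj : ∀ i, ∃ j, ∀ x, e j x = conj (e i x))
    (hsep : ∀ (μ μ' : Measure X) [IsFiniteMeasure μ] [IsFiniteMeasure μ'],
      (∀ i, ∫ x, e i x ∂μ = ∫ x, e i x ∂μ') → μ = μ')
    {w : X → ℂ} (hw : Integrable w ν) (h : ∀ i, ∫ x, w x * e i x ∂ν = 0) : w =ᵐ[ν] 0 := by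
  have hi : ∀ i, Integrable (fun x => w x * e i x) ν := fun i =>
    hw.mul_bdd (he i).aestronglyMeasurable (.of_forall (hb i))
  have hi' : ∀ i, Integrable (fun x => conj (w x) * e i x) ν := fun i =>
    (Integrable.mul_bdd (f := fun x => conj (w x)) (Complex.conjLIE.toContinuousLinearEquiv.toContinuousLinearMap.integrable_comp hw)
      (he i).aestronglyMeasurable (.of_forall (hb i)))
  have h' : ∀ i, ∫ x, conj (w x) * e i x ∂ν = 0 := fun i => by
    obtain ⟨j, hj⟩ := hconj i
    rw [← map_zero (starRingEnd ℂ), ← h j, ← integral_conj]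
    congr 1
    funext x
    rw [hj, map_mul, Complex.conj_conj]
  have hre : (fun x => (w x).re) =ᵐ[ν] 0 :=
    ae_eq_zero_of_forall_integral_ofReal_mul he hb hsep hw.re fun i => by
      have : ∀ x, ((w x).re : ℂ) * e i x = (1 / 2) * (w x * e i x + conj (w x) * e i x) := fun x => by
        rw [Complex.re_eq_add_conj]; ring
      simp only [this]
      rw [integral_const_mul, integral_add (hi i) (hi' i), h, h', add_zero, mul_zero]
  have him : (fun x => (w x).im) =ᵐ[ν] 0 :=
    ae_eq_zero_of_forall_integral_ofReal_mul he hb hsep hw.im fun i => by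
      have : ∀ x, ((w x).im : ℂ) * e i x =
          (1 / (2 * Complex.I)) * (w x * e i x - conj (w x) * e i x) := fun x => by
        rw [Complex.im_eq_sub_conj]; ring
      simp only [this]
      rw [integral_const_mul, integral_sub (hi i) (hi' i), h, h', sub_zero, mul_zero]
  filter_upwards [hre, him] with x h1 h2
  exact Complex.ext h1 h2

end Separation

theorem ae_eq_zero_of_fourier_eq_zero {ι : Type*} [Fintype ι] {ν : Measure (ι → ℝ)} {w : (ι → ℝ) → ℂ}
    (hw : Integrable w ν)
    (h : ∀ t : ι → ℝ, ∫ x, w x * Complex.exp (Complex.I * ((t ⬝ᵥ x : ℝ) : ℂ)) ∂ν = 0) :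
    w =ᵐ[ν] 0 := by
  classical
  have hc : ∀ t : ι → ℝ, Continuous fun x : ι → ℝ =>
      Complex.exp (Complex.I * ((t ⬝ᵥ x : ℝ) : ℂ)) := fun t => by
    simp only [dotProduct]; fun_prop
  refine ae_eq_zero_of_forall_integral_mul
    (e := fun (t : ι → ℝ) x => Complex.exp (Complex.I * ((t ⬝ᵥ x : ℝ) : ℂ)))
    (fun t => (hc t).measurable) (fun t x => ?_) (fun t => ⟨-t, fun x => ?_⟩)
    (fun μ μ' _ _ hμ => ?_) hw h
  · rw [mul_comm, Complex.norm_exp_ofReal_mul_I]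
  · rw [← Complex.exp_conj]
    simp
  · refine Measure.ext_of_charFunDual (funext fun L => ?_)
    have hL : ∀ x, L x = (fun i => L (Pi.single i 1)) ⬝ᵥ x := fun x => by
      conv_lhs => rw [pi_eq_sum_univ' x]
      simp [dotProduct, mul_comm]
    have := hμ fun i => L (Pi.single i 1)
    simp only [← hL, mul_comm Complex.I] at this
    simpa only [charFunDual_apply] using this

/-! ### The Parseval formula for Laguerre functions -/

/-- Alternating sums of binomial coefficients. -/
def altChoose (n a k : ℕ) : ℝ :=
  ∑ i ∈ Finset.range (n + 1), (-1) ^ i * (n.choose i : ℝ) * ((a + i).choose k : ℝ)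

theorem altChoose_succ (n a k : ℕ) :
    altChoose (n + 1) a k = altChoose n a k - altChoose n (a + 1) k := by
  have h1 : altChoose n a k =
      ∑ i ∈ Finset.range (n + 2), (-1) ^ i * (n.choose i : ℝ) * ((a + i).choose k : ℝ) := by
    rw [Finset.sum_range_succ, Nat.choose_succ_self]
    simp [altChoose]
  rw [h1, altChoose, altChoose, Finset.sum_range_succ' _ (n + 1), Finset.sum_range_succ' _ (n + 1),
    add_sub_right_comm, ← Finset.sum_sub_distrib]
  simp only [Nat.choose_zero_right]
  congr 1
  refine Finset.sum_congr rfl fun i _ => ?_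
  rw [Nat.choose_succ_succ, show a + 1 + i = a + (i + 1) by ring]
  push_cast
  ring

theorem altChoose_succ_succ (n a k : ℕ) :
    altChoose (n + 1) a (k + 1) = -altChoose n a k := by
  rw [altChoose_succ, altChoose, altChoose, altChoose, ← Finset.sum_sub_distrib,
    ← Finset.sum_neg_distrib]
  refine Finset.sum_congr rfl fun i _ => ?_
  rw [show a + 1 + i = a + i + 1 by ring, Nat.choose_succ_succ (a + i) k]
  push_cast
  ring

theorem altChoose_add (n a k : ℕ) : altChoose n a (n + k) = (-1) ^ n * (a.choose k : ℝ) := by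
  induction n with
  | zero => simp [altChoose]
  | succ n ih =>
    rw [show n + 1 + k = n + k + 1 by ring, altChoose_succ_succ, ih, pow_succ]
    ring

theorem altChoose_of_lt {n k : ℕ} (a : ℕ) (h : k < n) : altChoose n a k = 0 := by
  induction n generalizing k with
  | zero => omega
  | succ n ih =>
    rcases k with _ | k
    · rw [altChoose_succ]
      simp [altChoose]
    · rw [altChoose_succ_succ, ih (by omega), neg_zero]

theorem integral_pow_mul_exp_neg (n : ℕ) :
    IntegrableOn (fun x : ℝ => x ^ n * Real.exp (-x)) (Set.Ioi 0) ∧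
      ∫ x in Set.Ioi (0 : ℝ), x ^ n * Real.exp (-x) = n.factorial := by
  have hs : (0 : ℝ) < n + 1 := by positivity
  have h1 := Real.GammaIntegral_convergent hs
  have h2 := Real.Gamma_eq_integral hs
  simp only [add_sub_cancel_right, Real.rpow_natCast] at h1 h2
  simp only [mul_comm (Real.exp _)] at h1 h2
  exact ⟨h1, by rw [← h2, Real.Gamma_nat_eq_factorial]⟩

theorem continuous_laguerre (n : ℕ) : Continuous (laguerre n) := by
  unfold laguerre; fun_prop

theorem continuous_laguerreFun (n : ℕ) : Continuous (laguerreFun n) := by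
  have := continuous_laguerre n
  unfold laguerreFun; fun_prop

theorem pow_mul_laguerre_mul_exp (k n : ℕ) (x : ℝ) : x ^ k * (laguerre n x * Real.exp (-x)) =
    ∑ i ∈ Finset.range (n + 1), (-1) ^ i * (n.choose i : ℝ) / (i.factorial : ℝ) *
      (x ^ (k + i) * Real.exp (-x)) := by
  rw [laguerre, Finset.sum_mul, Finset.mul_sum]
  refine Finset.sum_congr rfl fun i _ => ?_
  rw [pow_add]; ring

theorem integrableOn_pow_mul_laguerre (k n : ℕ) :
    IntegrableOn (fun x : ℝ => x ^ k * (laguerre n x * Real.exp (-x))) (Set.Ioi 0) := by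
  simp only [pow_mul_laguerre_mul_exp]
  exact integrable_finsetSum _ fun i _ => (integral_pow_mul_exp_neg _).1.const_mul _

theorem integral_pow_mul_laguerre (k n : ℕ) :
    ∫ x in Set.Ioi (0 : ℝ), x ^ k * (laguerre n x * Real.exp (-x)) =
      k.factorial * altChoose n k k := by
  simp only [pow_mul_laguerre_mul_exp]
  rw [integral_finsetSum _ fun i _ => (integral_pow_mul_exp_neg _).1.const_mul _, altChoose,
    Finset.mul_sum]
  refine Finset.sum_congr rfl fun i _ => ?_
  rw [integral_const_mul, (integral_pow_mul_exp_neg _).2, ← Nat.add_choose_mul_factorial_mul_factorial,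
    Nat.choose_symm_add]
  push_cast
  field_simp

theorem altChoose_diag (n k : ℕ) : altChoose n k k = (-1) ^ n * (k.choose n : ℝ) := by
  rcases lt_or_ge k n with h | h
  · rw [altChoose_of_lt _ h, Nat.choose_eq_zero_of_lt h]; simp
  · obtain ⟨j, rfl⟩ := Nat.exists_eq_add_of_le h
    rw [altChoose_add, Nat.choose_symm_add]

theorem laguerreFun_mul (m n : ℕ) (x : ℝ) : laguerreFun m x * laguerreFun n x =
    ∑ k ∈ Finset.range (m + 1), (-1) ^ k * (m.choose k : ℝ) / (k.factorial : ℝ) *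
      (x ^ k * (laguerre n x * Real.exp (-x))) := by
  have : Real.exp (-x) = Real.exp (-x / 2) * Real.exp (-x / 2) := by
    rw [← Real.exp_add]; ring_nf
  rw [laguerreFun, laguerreFun, laguerre.eq_def m, Finset.sum_mul, Finset.sum_mul, this]
  refine Finset.sum_congr rfl fun i _ => ?_
  ring

theorem integrableOn_laguerreFun_mul (m n : ℕ) :
    IntegrableOn (fun x => laguerreFun m x * laguerreFun n x) (Set.Ioi 0) := by
  simp only [laguerreFun_mul]
  exact integrable_finsetSum _ fun i _ => (integrableOn_pow_mul_laguerre _ _).const_mul _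

theorem integral_laguerreFun_mul (m n : ℕ) :
    ∫ x in Set.Ioi (0 : ℝ), laguerreFun m x * laguerreFun n x = if m = n then 1 else 0 := by
  simp only [laguerreFun_mul]
  rw [integral_finsetSum _ fun i _ => (integrableOn_pow_mul_laguerre _ _).const_mul _]
  have h : ∑ k ∈ Finset.range (m + 1), ∫ x in Set.Ioi (0 : ℝ),
      (-1) ^ k * (m.choose k : ℝ) / (k.factorial : ℝ) * (x ^ k * (laguerre n x * Real.exp (-x))) =
      (-1) ^ n * altChoose m 0 n := by
    rw [altChoose, Finset.mul_sum]
    refine Finset.sum_congr rfl fun k _ => ?_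
    rw [integral_const_mul, integral_pow_mul_laguerre, altChoose_diag, zero_add]
    field_simp
  rw [h]
  rcases lt_trichotomy n m with h | h | h
  · rw [altChoose_of_lt _ h, if_neg (by omega), mul_zero]
  · rw [if_pos h.symm, h, show altChoose m 0 m = altChoose m 0 (m + 0) by rfl, altChoose_add,
      ← mul_assoc, ← mul_pow]
    simp
  · obtain ⟨j, rfl⟩ := Nat.exists_eq_add_of_lt h
    rw [add_assoc, altChoose_add, if_neg (by omega), Nat.choose_zero_succ]
    simp

theorem pow_eq_sum_laguerre (k : ℕ) (x : ℝ) :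
    x ^ k = ∑ i ∈ Finset.range (k + 1), k.factorial * ((-1) ^ i * (k.choose i : ℝ)) * laguerre i x := by
  have h1 : ∀ i ∈ Finset.range (k + 1), (k.factorial : ℝ) * ((-1) ^ i * (k.choose i : ℝ)) *
      laguerre i x = ∑ j ∈ Finset.range (k + 1), k.factorial * ((-1) ^ j / j.factorial * x ^ j) *
        ((-1) ^ i * (k.choose i : ℝ) * ((0 + i).choose j : ℝ)) := by
    intro i hi
    rw [Finset.mem_range] at hi
    rw [laguerre, Finset.mul_sum]
    refine (Finset.sum_subset (Finset.range_mono (by omega)) fun j _ hj => ?_).trans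
      (Finset.sum_congr rfl fun j _ => ?_)
    · rw [Finset.mem_range, not_lt] at hj
      rw [Nat.choose_eq_zero_of_lt (show i < j by omega)]
      simp
    · rw [zero_add]; ring
  rw [Finset.sum_congr rfl h1, Finset.sum_comm]
  simp only [← Finset.mul_sum]
  change x ^ k = ∑ j ∈ Finset.range (k + 1), k.factorial * ((-1) ^ j / j.factorial * x ^ j) *
    altChoose k 0 j
  rw [Finset.sum_range_succ, Finset.sum_eq_zero fun j hj => by
      rw [altChoose_of_lt _ (Finset.mem_range.1 hj), mul_zero],
    show altChoose k 0 k = altChoose k 0 (k + 0) by rfl, altChoose_add]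
  have : (-1 : ℝ) ^ k * (-1) ^ k = 1 := by rw [← mul_pow]; simp
  simp only [Nat.choose_self, Nat.cast_one, mul_one, zero_add]
  field_simp
  linear_combination (-x ^ k) * this

section Multi

variable (ι : Type*) [Fintype ι]

/-- Lebesgue measure on the positive orthant. -/
def orthant : Measure (ι → ℝ) := Measure.pi fun _ => volume.restrict (Set.Ioi 0)

variable {ι}

/-- Products of Laguerre functions. -/
def lagProd (l : ι → ℕ) (x : ι → ℝ) : ℝ := ∏ j, laguerreFun (l j) (x j)

theorem continuous_lagProd (l : ι → ℕ) : Continuous (lagProd l) :=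
  continuous_finsetProd _ fun j _ => (continuous_laguerreFun _).comp (continuous_apply j)

theorem integrable_lagProd_mul (l l' : ι → ℕ) :
    Integrable (fun x => lagProd l x * lagProd l' x) (orthant ι) := by
  simp only [lagProd, ← Finset.prod_mul_distrib]
  exact Integrable.fintype_prod fun j => integrableOn_laguerreFun_mul (l j) (l' j)

theorem integral_lagProd_mul [DecidableEq ι] (l l' : ι → ℕ) :
    ∫ x, lagProd l x * lagProd l' x ∂(orthant ι) = if l = l' then 1 else 0 := by
  simp only [lagProd, ← Finset.prod_mul_distrib, orthant]
  rw [integral_fintype_prod_eq_prod (fun j x => laguerreFun (l j) x * laguerreFun (l' j) x)]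
  simp only [integral_laguerreFun_mul]
  rw [Finset.prod_ite_zero]
  simp [funext_iff]

theorem memLp_lagProd (l : ι → ℕ) : MemLp (fun x => (lagProd l x : ℂ)) 2 (orthant ι) := by
  have hc : Continuous fun x => (lagProd l x : ℂ) :=
    Complex.continuous_ofReal.comp (continuous_lagProd l)
  rw [memLp_two_iff_integrable_sq_norm hc.aestronglyMeasurable]
  refine (integrable_lagProd_mul l l).congr (.of_forall fun x => ?_)
  simp [pow_two]

theorem memLp_exp_neg (c : ℝ) (hc : 0 < c) :
    MemLp (fun x : ι → ℝ => Real.exp (-(c * ∑ j, |x j|))) 2 (orthant ι) := by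
  have hc : Continuous fun x : ι → ℝ => Real.exp (-(c * ∑ j, |x j|)) := by fun_prop
  rw [memLp_two_iff_integrable_sq hc.aestronglyMeasurable]
  have h : ∀ x : ι → ℝ, Real.exp (-(c * ∑ j, |x j|)) ^ 2 = ∏ j, Real.exp (-(2 * c) * |x j|) :=
    fun x => by
      rw [← Real.exp_sum, ← Real.exp_nat_mul, ← Finset.mul_sum]
      push_cast
      ring_nf
  simp only [h]
  refine Integrable.fintype_prod (f := fun _ y => Real.exp (-(2 * c) * |y|)) fun j => ?_
  have h1 : IntegrableOn (fun y : ℝ => Real.exp (-(2 * c) * y)) (Set.Ioi 0) :=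
    integrableOn_exp_mul_Ioi (by linarith) 0
  refine h1.congr_fun (fun y hy => ?_) measurableSet_Ioi
  rw [abs_of_pos hy]

/-- Completeness of the products of Laguerre functions. -/
theorem ae_eq_zero_of_integral_lagProd {G : (ι → ℝ) → ℂ} (hG : MemLp G 2 (orthant ι))
    (h : ∀ l : ι → ℕ, ∫ x, G x * lagProd l x ∂(orthant ι) = 0) : G =ᵐ[orthant ι] 0 := by
  classical
  have hpos : ∀ᵐ x ∂(orthant ι), ∀ j, 0 < x j := by
    rw [ae_all_iff]
    intro j
    have := (Measure.quasiMeasurePreserving_eval (μ := fun _ : ι => volume.restrict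
      (Set.Ioi (0 : ℝ))) j).ae (ae_restrict_mem measurableSet_Ioi)
    exact this
  have hGl : ∀ l : ι → ℕ, Integrable (fun x => G x * lagProd l x) (orthant ι) := fun l =>
    hG.integrable_mul (memLp_lagProd l)
  let E : (ι → ℝ) → ℝ := fun x => Real.exp (-(∑ j, x j) / 2)
  have hEc : Continuous E := by unfold E; fun_prop
  have hmono : ∀ α : ι → ℕ, ∫ x, (G x * E x) * ∏ j, ((x j : ℝ) : ℂ) ^ α j ∂(orthant ι) = 0 := by
    intro α
    have e1 : ∀ x : ι → ℝ, (G x * E x) * ∏ j, ((x j : ℝ) : ℂ) ^ α j =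
        ∑ p ∈ Fintype.piFinset fun j => Finset.range (α j + 1),
          (∏ j, ((((α j).factorial * ((-1) ^ p j * ((α j).choose (p j) : ℝ)) : ℝ) : ℂ))) *
          (G x * lagProd p x) := by
      intro x
      have e2 : ∏ j, x j ^ α j * Real.exp (-x j / 2) =
          ∑ p ∈ Fintype.piFinset fun j => Finset.range (α j + 1),
            (∏ j, ((α j).factorial * ((-1) ^ p j * ((α j).choose (p j) : ℝ)) : ℝ)) *
              lagProd p x := by
        have : ∀ j, x j ^ α j * Real.exp (-x j / 2) = ∑ i ∈ Finset.range (α j + 1),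
            ((α j).factorial * ((-1) ^ i * ((α j).choose i : ℝ))) * laguerreFun i (x j) := by
          intro j
          rw [pow_eq_sum_laguerre, Finset.sum_mul]
          exact Finset.sum_congr rfl fun i _ => by rw [laguerreFun]; ring
        simp only [this]
        rw [Finset.prod_univ_sum]
        simp only [lagProd, Finset.prod_mul_distrib]
      have e3 : E x = ∏ j, Real.exp (-x j / 2) := by
        rw [← Real.exp_sum, ← Finset.sum_div, Finset.sum_neg_distrib]
      rw [Finset.prod_mul_distrib, ← e3] at e2
      have e4 := congrArg (fun r : ℝ => G x * (r : ℂ)) e2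
      push_cast at e4 ⊢
      rw [mul_assoc, mul_comm (E x : ℂ), e4, Finset.mul_sum]
      exact Finset.sum_congr rfl fun p _ => by ring
    simp only [e1]
    rw [integral_finsetSum _ fun p _ => (hGl p).const_mul _]
    exact Finset.sum_eq_zero fun p _ => by rw [integral_const_mul, h, mul_zero]
  have hGE : ∀ c : ℝ, c < 1 / 2 → Integrable (fun x => ‖G x‖ * (E x * Real.exp (c * ∑ j, |x j|)))
      (orthant ι) := by
    intro c hc
    have h1 := hG.norm.integrable_mul (memLp_exp_neg (ι := ι) (1 / 2 - c) (by linarith))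
    refine h1.congr ?_
    filter_upwards [hpos] with x hx
    simp only [Pi.mul_apply, E]
    rw [← Real.exp_add]
    congr 2
    simp only [abs_of_pos (hx _)]
    ring
  have hmeas : AEStronglyMeasurable (fun x => G x * E x) (orthant ι) :=
    hG.1.mul (Complex.continuous_ofReal.comp hEc).aestronglyMeasurable
  have hnorm : ∀ x, ‖G x * E x‖ = ‖G x‖ * E x := fun x => by
    rw [norm_mul, Complex.norm_real, Real.norm_of_nonneg (Real.exp_pos _).le]
  have hinteg : Integrable (fun x => G x * E x) (orthant ι) := by
    rw [← integrable_norm_iff hmeas]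
    refine (hGE 0 (by norm_num)).congr (.of_forall fun x => ?_)
    simp only [hnorm, zero_mul, Real.exp_zero, mul_one]
  have hz : (fun x => G x * E x) =ᵐ[orthant ι] 0 := by
    refine ae_eq_zero_of_fourier_eq_zero hinteg fun t => ?_
    set T : ℝ := ∑ j, |t j| + 1 with hT
    have hTpos : 0 < T := by positivity
    have htT : ∀ j, |t j| ≤ T := fun j =>
      (Finset.single_le_sum (f := fun j => |t j|) (fun j _ => abs_nonneg _)
        (Finset.mem_univ j)).trans (by linarith)
    have hdot : Continuous fun x : ι → ℝ => t ⬝ᵥ x := by simp only [dotProduct]; fun_prop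
    have hle : ∀ x : ι → ℝ, |t ⬝ᵥ x| ≤ T * ∑ j, |x j| := fun x => by
      rw [dotProduct, Finset.mul_sum]
      refine (Finset.abs_sum_le_sum_abs _ _).trans (Finset.sum_le_sum fun j _ => ?_)
      rw [abs_mul]
      exact mul_le_mul_of_nonneg_right (htT j) (abs_nonneg _)
    have := integral_mul_exp_eq_zero (ν := orthant ι) (w := fun x => G x * E x)
      (u := fun x => t ⬝ᵥ x) hmeas hdot.measurable.aemeasurable (c := 1 / (4 * T)) (by positivity)
      ?_ (fun n => ?_) 1
    · simpa using this
    · refine (hGE (1 / 4) (by norm_num)).mono' (hmeas.norm.mul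
        (by fun_prop : Continuous fun x : ι → ℝ =>
          Real.exp (1 / (4 * T) * |t ⬝ᵥ x|)).aestronglyMeasurable) (.of_forall fun x => ?_)
      rw [Real.norm_of_nonneg (by positivity), hnorm, mul_assoc]
      have hE0 : 0 ≤ E x := (Real.exp_pos _).le
      refine mul_le_mul_of_nonneg_left (mul_le_mul_of_nonneg_left (Real.exp_le_exp.2 ?_) hE0)
        (norm_nonneg _)
      calc 1 / (4 * T) * |t ⬝ᵥ x| ≤ 1 / (4 * T) * (T * ∑ j, |x j|) := by gcongr; exact hle x
        _ = 1 / 4 * ∑ j, |x j| := by field_simp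
    · have e1 : ∀ x : ι → ℝ, (G x * E x) * ((t ⬝ᵥ x : ℝ) : ℂ) ^ n =
          ∑ p ∈ Finset.piAntidiag (Finset.univ : Finset ι) n,
            ((Nat.multinomial Finset.univ p : ℂ) * ∏ j, (t j : ℂ) ^ p j) *
              ((G x * E x) * ∏ j, ((x j : ℝ) : ℂ) ^ p j) := by
        intro x
        simp only [dotProduct, Complex.ofReal_sum, Complex.ofReal_mul]
        rw [Finset.sum_pow_eq_sum_piAntidiag, Finset.mul_sum]
        refine Finset.sum_congr rfl fun p _ => ?_
        simp only [mul_pow, Finset.prod_mul_distrib]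
        ring
      simp only [e1]
      rw [integral_finsetSum]
      · exact Finset.sum_eq_zero fun p _ => by rw [integral_const_mul, hmono, mul_zero]
      · intro p _
        refine Integrable.const_mul ?_ _
        have hm2 : Continuous fun x : ι → ℝ => ∏ j, ((x j : ℝ) : ℂ) ^ p j := by fun_prop
        have hb := integrable_norm_mul_pow_mul_exp (ν := orthant ι) (w := fun x => G x * E x)
          (u := fun x => ∑ j, |x j|) hmeas
          (by fun_prop : Continuous fun x : ι → ℝ => ∑ j, |x j|).measurable.aemeasurable
          (c := 1 / 4) (by norm_num) ?_ (∑ j, p j)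
        · refine hb.mono' (hmeas.mul hm2.aestronglyMeasurable) (.of_forall fun x => ?_)
          rw [norm_mul]
          gcongr
          have hs : 0 ≤ ∑ j, |x j| := Finset.sum_nonneg fun j _ => abs_nonneg _
          rw [norm_prod, abs_of_nonneg hs, ← Finset.prod_pow_eq_pow_sum]
          refine le_trans (Finset.prod_le_prod (fun j _ => norm_nonneg _) fun j _ => ?_)
            (le_mul_of_one_le_right (by positivity) (Real.one_le_exp (by positivity)))
          rw [norm_pow, Complex.norm_real, Real.norm_eq_abs]
          gcongr
          exact Finset.single_le_sum (f := fun j => |x j|) (fun j _ => abs_nonneg _)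
            (Finset.mem_univ j)
        · refine (hGE (1 / 4) (by norm_num)).congr (.of_forall fun x => ?_)
          have hs : 0 ≤ ∑ j, |x j| := Finset.sum_nonneg fun j _ => abs_nonneg _
          simp only [hnorm, abs_of_nonneg hs]
          ring
  filter_upwards [hz] with x hx
  have : (E x : ℂ) ≠ 0 := by exact_mod_cast (Real.exp_pos _).ne'
  exact (mul_eq_zero.1 hx).resolve_right this

/-- The Parseval formula for products of Laguerre functions. -/
theorem tsum_integral_lagProd {G : (ι → ℝ) → ℂ} (hG : MemLp G 2 (orthant ι)) :
    ∑' l : ι → ℕ, ‖∫ x, G x * lagProd l x ∂(orthant ι)‖ₑ ^ 2 = ∫⁻ x, ‖G x‖ₑ ^ 2 ∂(orthant ι) := by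
  classical
  let e : (ι → ℕ) → Lp ℂ 2 (orthant ι) := fun l => (memLp_lagProd l).toLp _
  have hinner : ∀ (l : ι → ℕ) (u : Lp ℂ 2 (orthant ι)), inner ℂ (e l) u =
      ∫ x, u x * lagProd l x ∂(orthant ι) := by
    intro l u
    rw [L2.inner_def]
    refine integral_congr_ae ?_
    filter_upwards [(memLp_lagProd l).coeFn_toLp] with x hx
    rw [hx, RCLike.inner_apply, Complex.conj_ofReal]
  have horth : Orthonormal ℂ e := by
    rw [orthonormal_iff_ite]
    intro l l'
    rw [hinner]
    have h1 : ∫ x, (e l') x * lagProd l x ∂(orthant ι) =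
        ((∫ x, lagProd l x * lagProd l' x ∂(orthant ι) : ℝ) : ℂ) := by
      refine (integral_congr_ae ?_).trans integral_complex_ofReal
      filter_upwards [(memLp_lagProd l').coeFn_toLp] with x hx
      rw [hx]
      push_cast
      ring
    rw [h1, integral_lagProd_mul]
    split_ifs <;> simp
  have hbot : (Submodule.span ℂ (Set.range e))ᗮ = ⊥ := by
    rw [Submodule.eq_bot_iff]
    intro u hu
    rw [Submodule.mem_orthogonal] at hu
    have h1 := ae_eq_zero_of_integral_lagProd (Lp.memLp u) fun l => by
      rw [← hinner]
      exact hu _ (Submodule.subset_span ⟨l, rfl⟩)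
    exact Lp.eq_zero_iff_ae_eq_zero.2 h1
  let b := HilbertBasis.mkOfOrthogonalEqBot horth hbot
  have hb : ∀ l, b l = e l := fun l => by
    rw [HilbertBasis.coe_mkOfOrthogonalEqBot]
  set u := hG.toLp G with hu
  have hcoef : ∀ l, inner ℂ (b l) u = ∫ x, G x * lagProd l x ∂(orthant ι) := fun l => by
    rw [hb, hinner]
    refine integral_congr_ae ?_
    filter_upwards [hG.coeFn_toLp] with x hx
    rw [hx]
  have h1 : HasSum (fun l => ‖∫ x, G x * lagProd l x ∂(orthant ι)‖ ^ 2) (‖u‖ ^ 2) := by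
    have h2 := (b.hasSum_inner_mul_inner u u).mapL Complex.reCLM
    convert h2 using 1
    · funext l
      rw [← hcoef, ← inner_conj_symm u, Complex.reCLM_apply, mul_comm, Complex.mul_conj,
        Complex.ofReal_re, Complex.normSq_eq_norm_sq]
    · rw [inner_self_eq_norm_sq_to_K]
      norm_cast
  have h3 : ∀ z : ℂ, ‖z‖ₑ ^ 2 = ENNReal.ofReal (‖z‖ ^ 2) := fun z => by
    rw [ENNReal.ofReal_pow (norm_nonneg _), ofReal_norm]
  simp only [h3]
  rw [← ENNReal.ofReal_tsum_of_nonneg (fun l => by positivity) h1.summable, h1.tsum_eq,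
    ← ofReal_integral_eq_lintegral_ofReal ((memLp_two_iff_integrable_sq_norm hG.1).1 hG)
      (.of_forall fun x => by positivity)]
  congr 1
  have h4 : ((‖u‖ ^ 2 : ℝ) : ℂ) = inner ℂ u u := by
    rw [inner_self_eq_norm_sq_to_K]; norm_cast
  have h5 : inner ℂ u u = ((∫ x, ‖G x‖ ^ 2 ∂(orthant ι) : ℝ) : ℂ) := by
    rw [L2.inner_def]
    refine (integral_congr_ae ?_).trans integral_complex_ofReal
    filter_upwards [hG.coeFn_toLp] with x hx
    rw [hx, inner_self_eq_norm_sq_to_K]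
    norm_cast
  exact_mod_cast h4.trans h5

end Multi

/-! ### Plancherel's formula for the Fourier transform on integrable functions -/

section Fourier

open FourierTransform Real SchwartzMap

variable {V : Type*} [NormedAddCommGroup V] [InnerProductSpace ℝ V] [FiniteDimensional ℝ V]
  [MeasurableSpace V] [BorelSpace V]

theorem continuous_fourier {f : V → ℂ} (hf : Integrable f) : Continuous (𝓕 f) :=
  VectorFourier.fourierIntegral_continuous Real.continuous_fourierChar
    (by exact continuous_inner) hf

theorem fourier_toLp_ae_eq {f : V → ℂ} (h1 : Integrable f) (h2 : MemLp f 2) :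
    (𝓕 (h2.toLp f) : Lp ℂ 2 (volume : Measure V)) =ᵐ[volume] 𝓕 f := by
  set U : Lp ℂ 2 (volume : Measure V) := 𝓕 (h2.toLp f) with hU
  refine ae_eq_of_integral_contDiff_smul_eq
    ((Lp.memLp U).locallyIntegrable (by norm_num)) (continuous_fourier h1).locallyIntegrable ?_
  intro g hg hgc
  have hgC : HasCompactSupport fun x => (g x : ℂ) := hgc.comp_left Complex.ofReal_zero
  have hgD : ContDiff ℝ (⊤ : ℕ∞) fun x => (g x : ℂ) := Complex.ofRealCLM.contDiff.comp hg
  let G : 𝓢(V, ℂ) := hgC.toSchwartzMap hgD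
  have hG : ∀ x, G x = (g x : ℂ) := fun x => rfl
  have e1 : Lp.toTemperedDistribution U G = ∫ x, g x • U x := by
    rw [Lp.toTemperedDistribution_apply]
    rfl
  rw [← e1, hU, ← Lp.fourier_toTemperedDistribution_eq, TemperedDistribution.fourier_apply,
    Lp.toTemperedDistribution_apply]
  have e2 := VectorFourier.integral_fourierIntegral_smul_eq_flip (L := innerₗ V)
    (μ := (volume : Measure V)) (ν := (volume : Measure V)) Real.continuous_fourierChar
    continuous_inner G.integrable h1
  rw [flip_innerₗ] at e2
  refine Eq.trans (integral_congr_ae ?_) e2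
  filter_upwards [h2.coeFn_toLp] with x hx
  rw [hx]
  rfl

theorem lintegral_fourier_sq {f : V → ℂ} (h1 : Integrable f) (h2 : MemLp f 2) :
    ∫⁻ x, ‖𝓕 f x‖ₑ ^ 2 = ∫⁻ x, ‖f x‖ₑ ^ 2 := by
  have hn : ∀ u : Lp ℂ 2 (volume : Measure V), ∫⁻ x, ‖u x‖ₑ ^ 2 = ‖u‖ₑ ^ 2 := fun u => by
    rw [Lp.enorm_def, eLpNorm_eq_lintegral_rpow_enorm_toReal (by norm_num) (by norm_num)]
    simp only [ENNReal.toReal_ofNat, ENNReal.rpow_ofNat]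
    rw [← ENNReal.rpow_ofNat, ← ENNReal.rpow_mul]
    simp
  have e1 : ∫⁻ x, ‖𝓕 f x‖ₑ ^ 2 =
      ∫⁻ x, ‖(𝓕 (h2.toLp f) : Lp ℂ 2 (volume : Measure V)) x‖ₑ ^ 2 := by
    refine lintegral_congr_ae ?_
    filter_upwards [fourier_toLp_ae_eq h1 h2] with x hx
    rw [hx]
  have e2 : ∫⁻ x, ‖f x‖ₑ ^ 2 = ∫⁻ x, ‖(h2.toLp f) x‖ₑ ^ 2 := by
    refine lintegral_congr_ae ?_
    filter_upwards [h2.coeFn_toLp] with x hx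
    rw [hx]
  have e3 : ‖(𝓕 (h2.toLp f) : Lp ℂ 2 (volume : Measure V))‖ₑ = ‖h2.toLp f‖ₑ := by
    rw [← ofReal_norm, ← ofReal_norm, Lp.norm_fourier_eq]
  rw [e1, e2, hn, hn, e3]

end Fourier

/-- The Fourier transform with the normalisation `∫ f(a) e^{i b·a} da`. -/
def fourierPi {ι : Type*} [Fintype ι] (f : (ι → ℝ) → ℂ) (b : ι → ℝ) : ℂ :=
  ∫ a, f a * Complex.exp (Complex.I * ((b ⬝ᵥ a : ℝ) : ℂ))

theorem lintegral_fourierPi_sq {ι : Type*} [Fintype ι] {f : (ι → ℝ) → ℂ} (h1 : Integrable f)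
    (h2 : MemLp f 2) :
    ∫⁻ a, ‖f a‖ₑ ^ 2 = ENNReal.ofReal (((2 * Real.pi) ^ Fintype.card ι)⁻¹) *
      ∫⁻ b, ‖fourierPi f b‖ₑ ^ 2 := by
  open FourierTransform in
  have hmp := PiLp.volume_preserving_ofLp ι
  have hemb : MeasurableEmbedding (WithLp.ofLp : EuclideanSpace ℝ ι → ι → ℝ) :=
    (MeasurableEquiv.toLp 2 (ι → ℝ)).symm.measurableEmbedding
  let g : EuclideanSpace ℝ ι → ℂ := fun x => f (WithLp.ofLp x)
  have g1 : Integrable g := (hmp.integrable_comp_emb hemb).2 h1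
  have g2 : MemLp g 2 := h2.comp_measurePreserving hmp
  have e1 : ∫⁻ a, ‖f a‖ₑ ^ 2 = ∫⁻ x, ‖g x‖ₑ ^ 2 :=
    (hmp.lintegral_comp_emb hemb fun a => ‖f a‖ₑ ^ 2).symm
  have e2 : ∀ x : EuclideanSpace ℝ ι, 𝓕 g x = fourierPi f ((-2 * Real.pi) • WithLp.ofLp x) := by
    intro x
    rw [Real.fourier_eq', fourierPi, ← hmp.integral_comp hemb]
    congr 1
    funext y
    rw [smul_eq_mul, mul_comm]
    congr 2
    rw [mul_comm]
    congr 2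
    rw [smul_dotProduct, EuclideanSpace.inner_eq_star_dotProduct, smul_eq_mul]
    simp
  have e3 : ∫⁻ x : EuclideanSpace ℝ ι, ‖𝓕 g x‖ₑ ^ 2 =
      ∫⁻ b : ι → ℝ, ‖fourierPi f ((-2 * Real.pi) • b)‖ₑ ^ 2 := by
    simp only [e2]
    exact hmp.lintegral_comp_emb hemb fun b => ‖fourierPi f ((-2 * Real.pi) • b)‖ₑ ^ 2
  have hr : (-2 * Real.pi : ℝ) ≠ 0 := by
    have := Real.pi_pos
    intro h; nlinarith
  have e4 : ∫⁻ b : ι → ℝ, ‖fourierPi f ((-2 * Real.pi) • b)‖ₑ ^ 2 =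
      ENNReal.ofReal (((2 * Real.pi) ^ Fintype.card ι)⁻¹) * ∫⁻ b, ‖fourierPi f b‖ₑ ^ 2 := by
    have h := (Homeomorph.smulOfNeZero (-2 * Real.pi : ℝ) hr).toMeasurableEquiv.measurableEmbedding.lintegral_map
      (μ := (volume : Measure (ι → ℝ))) (fun b => ‖fourierPi f b‖ₑ ^ 2)
    have h' : Measure.map (Homeomorph.smulOfNeZero (-2 * Real.pi : ℝ) hr).toMeasurableEquiv
        (volume : Measure (ι → ℝ)) = Measure.map (fun b : ι → ℝ => (-2 * Real.pi : ℝ) • b) volume := rfl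
    rw [h', Measure.map_addHaar_smul volume hr, lintegral_smul_measure] at h
    have h3 : ∫⁻ b : ι → ℝ, ‖fourierPi f ((-2 * Real.pi) • b)‖ₑ ^ 2 = _ := h.symm
    rw [h3, smul_eq_mul]
    congr 2
    rw [Module.finrank_fintype_fun_eq_card, abs_inv, abs_pow, abs_mul, abs_neg, abs_two,
      abs_of_pos Real.pi_pos]
  rw [e1, ← lintegral_fourier_sq g1 g2, e3, e4]

/-! ### The convolution algebra of radial functions -/

theorem continuous_integral_of_compact_support {X Y : Type*} [TopologicalSpace X]
    [TopologicalSpace Y] [MeasurableSpace Y] [OpensMeasurableSpace Y] {μ : Measure Y}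
    [IsFiniteMeasureOnCompacts μ] {f : X → Y → ℂ} {k : Set Y} (hk : IsCompact k)
    (hf : Continuous f.uncurry) (hfs : ∀ p x, x ∉ k → f p x = 0) :
    Continuous fun x => ∫ y, f x y ∂μ := by
  rw [← continuousOn_univ]
  exact continuousOn_integral_of_compact_support hk hf.continuousOn fun p x _ hx => hfs p x hx

/-- The homeomorphism of the group given by an orthogonal matrix. -/
def actHomeo (k : O v) : N v ≃ₜ N v where
  toFun := act k
  invFun := act k⁻¹
  left_inv n := by rw [act_act, inv_mul_cancel, act_one]
  right_inv n := by rw [act_act, mul_inv_cancel, act_one]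
  continuous_toFun := continuous_act.comp (continuous_const.prodMk continuous_id)
  continuous_invFun := continuous_act.comp (continuous_const.prodMk continuous_id)

theorem measurableEmbedding_act (k : O v) : MeasurableEmbedding (act k : N v → N v) :=
  (actHomeo k).measurableEmbedding

theorem integral_act (k : O v) (f : N v → ℂ) : ∫ n, f (act k n) = ∫ n, f n :=
  (measurePreserving_act k).integral_comp (measurableEmbedding_act k) f

/-- Radial continuous functions with compact support. -/
structure CcRad (f : N v → ℂ) : Prop where
  cont : Continuous f
  supp : HasCompactSupport f
  radial : Radial f

namespace CcRad

variable {f g h : N v → ℂ}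

theorem integrable (hf : CcRad f) : Integrable f :=
  hf.cont.integrable_of_hasCompactSupport hf.supp

theorem memLp (hf : CcRad f) (p : ℝ≥0∞) : MemLp f p :=
  hf.cont.memLp_of_hasCompactSupport hf.supp

theorem add (hf : CcRad f) (hg : CcRad g) : CcRad (f + g) :=
  ⟨hf.cont.add hg.cont, hf.supp.add hg.supp, fun k n => by
    simp only [Pi.add_apply, hf.radial k n, hg.radial k n]⟩

theorem smul (c : ℂ) (hf : CcRad f) : CcRad (c • f) :=
  ⟨hf.cont.const_smul c, hf.supp.smul_left (f := fun _ => c), fun k n => by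
    simp only [Pi.smul_apply, hf.radial k n]⟩

end CcRad

/-- The function `n ↦ f(n⁻¹)`. -/
def check (f : N v → ℂ) : N v → ℂ := fun n => f n⁻¹

/-- The adjoint `f^*(n) = conj f(n⁻¹)`. -/
def adj (f : N v → ℂ) : N v → ℂ := fun n => conj (f n⁻¹)

theorem check_check (f : N v → ℂ) : check (check f) = f := by
  funext n; simp [check]

namespace CcRad

variable {f g h : N v → ℂ}

theorem check (hf : CcRad f) : CcRad (check f) :=
  ⟨hf.cont.comp continuous_inv, hf.supp.comp_homeomorph (Homeomorph.inv (N v)), fun k n => by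
    simp only [FreeNilpotent.check, ← act_inv, hf.radial k]⟩

theorem adj (hf : CcRad f) : CcRad (adj f) :=
  ⟨Complex.continuous_conj.comp hf.check.cont, hf.check.supp.comp_left (map_zero _), fun k n => by
    simp only [FreeNilpotent.adj, ← act_inv, hf.radial k]⟩

theorem conv_joint (hf : CcRad f) (hg : CcRad g) :
    Continuous (fun q : N v × N v => f q.1 * g (q.1⁻¹ * q.2)) ∧
      HasCompactSupport (fun q : N v × N v => f q.1 * g (q.1⁻¹ * q.2)) := by
  refine ⟨(hf.cont.comp continuous_fst).mul (hg.cont.comp (by fun_prop)), ?_⟩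
  refine HasCompactSupport.intro
    (hf.supp.isCompact.prod (hf.supp.isCompact.mul hg.supp.isCompact)) fun q hq => ?_
  by_cases h1 : q.1 ∈ tsupport f
  · have h2 : q.1⁻¹ * q.2 ∉ tsupport g := fun h2 =>
      hq ⟨h1, Set.mem_mul.2 ⟨q.1, h1, _, h2, by group⟩⟩
    rw [image_eq_zero_of_notMem_tsupport h2, mul_zero]
  · rw [image_eq_zero_of_notMem_tsupport h1, zero_mul]

theorem conv (hf : CcRad f) (hg : CcRad g) : CcRad (conv f g) := by
  refine ⟨?_, ?_, fun k n => ?_⟩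
  · refine continuous_integral_of_compact_support hf.supp.isCompact
      (f := fun n m => f m * g (m⁻¹ * n)) ?_ fun n m hm => ?_
    · exact (hf.conv_joint hg).1.comp continuous_swap
    · rw [image_eq_zero_of_notMem_tsupport hm, zero_mul]
  · refine HasCompactSupport.intro (hf.supp.isCompact.mul hg.supp.isCompact) fun n hn => ?_
    rw [FreeNilpotent.conv, integral_eq_zero_of_ae (.of_forall fun m => ?_)]
    by_cases h1 : m ∈ tsupport f
    · have h2 : m⁻¹ * n ∉ tsupport g := fun h2 =>
        hn (Set.mem_mul.2 ⟨m, h1, _, h2, by group⟩)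
      simp only [image_eq_zero_of_notMem_tsupport h2, mul_zero, Pi.zero_apply]
    · simp only [image_eq_zero_of_notMem_tsupport h1, zero_mul, Pi.zero_apply]
  · simp only [FreeNilpotent.conv]
    rw [← integral_act k]
    simp only [← act_inv, ← act_mul, hf.radial k, hg.radial k]

theorem integrable_conv_mul (hf : CcRad f) (hg : CcRad g) {u : N v → ℂ} (hu : Continuous u) :
    Integrable (fun q : N v × N v => f q.1 * g (q.1⁻¹ * q.2) * u q.2) := by
  refine Continuous.integrable_of_hasCompactSupport
    ((hf.conv_joint hg).1.mul (hu.comp continuous_snd)) (hf.conv_joint hg).2.mul_right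

theorem integral_conv_mul_left (hf : CcRad f) (hg : CcRad g) {u : N v → ℂ} (hu : Continuous u) :
    ∫ n, FreeNilpotent.conv f g n * u n = ∫ m, f m * ∫ n, g (m⁻¹ * n) * u n := by
  simp only [FreeNilpotent.conv, ← integral_mul_const, ← integral_const_mul, ← mul_assoc]
  exact integral_integral_swap (hf.integrable_conv_mul hg hu).swap

theorem integral_conv_mul (hf : CcRad f) (hg : CcRad g) {u : N v → ℂ} (hu : Continuous u) :
    ∫ n, FreeNilpotent.conv f g n * u n = ∫ m, f m * ∫ n, g n * u (m * n) := by
  rw [hf.integral_conv_mul_left hg hu]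
  congr 1
  funext m
  rw [← integral_mul_left_eq_self (fun n => g (m⁻¹ * n) * u n) m]
  simp

theorem inner_conv (hf : CcRad f) (hg : CcRad g) (hh : CcRad h) :
    ∫ n, FreeNilpotent.conv f g n * conj (h n) =
      ∫ n, f n * conj (FreeNilpotent.conv h (FreeNilpotent.adj g) n) := by
  rw [hf.integral_conv_mul_left hg (u := fun n => conj (h n)) (Complex.continuous_conj.comp hh.cont)]
  congr 1
  funext m
  congr 1
  rw [FreeNilpotent.conv, ← integral_conj]
  congr 1
  funext n
  simp only [FreeNilpotent.adj, map_mul, Complex.conj_conj, _root_.mul_inv_rev, inv_inv]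
  ring

theorem integral_norm_conv_le (hf : CcRad f) (hg : CcRad g) :
    ∫ n, ‖FreeNilpotent.conv f g n‖ ≤ (∫ n, ‖f n‖) * ∫ n, ‖g n‖ := by
  have hfg := (hf.integrable_conv_mul hg (u := fun _ => 1) continuous_const).norm
  simp only [mul_one, norm_mul] at hfg
  calc ∫ n, ‖FreeNilpotent.conv f g n‖ ≤ ∫ n, ∫ m, ‖f m‖ * ‖g (m⁻¹ * n)‖ := by
        refine integral_mono (hf.conv hg).integrable.norm hfg.integral_prod_right fun n => ?_
        refine (norm_integral_le_integral_norm _).trans_eq ?_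
        simp only [norm_mul]
    _ = ∫ m, ∫ n, ‖f m‖ * ‖g (m⁻¹ * n)‖ := integral_integral_swap hfg.swap
    _ = _ := by
        simp only [integral_const_mul]
        simp only [integral_mul_left_eq_self (μ := (volume : Measure (N v))) (fun n => ‖g n‖)]
        rw [integral_mul_const]

end CcRad

theorem chi_eq_pairing (Φ f : N v → ℂ) : chi Φ f = pairing (check f) Φ := by
  rw [chi, pairing, ← integral_inv_eq_self]
  simp [check]

theorem check_conv (f g : N v → ℂ) : check (conv f g) = conv (check g) (check f) := by
  funext n
  simp only [check, conv]
  rw [← integral_mul_left_eq_self (fun m => g m⁻¹ * f (m⁻¹ * n)⁻¹) n]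
  congr 1
  funext m
  rw [mul_comm, show ((n * m)⁻¹ * n)⁻¹ = m by group, show (n * m)⁻¹ = m⁻¹ * n⁻¹ by group]

theorem Omega.continuous_fn (φ : Omega v) : Continuous φ.fn := (Subtype.val φ).continuous

theorem Omega.pairing_conv (φ : Omega v) {f g : N v → ℂ} (hf : CcRad f) (hg : CcRad g) :
    pairing (conv f g) φ.fn = pairing f φ.fn * pairing g φ.fn := by
  have h := (Subtype.property φ).1.mul (check g) (check f) hg.check.cont hg.check.supp
    hg.check.radial hf.check.cont hf.check.supp hf.check.radial
  simp only [chi_eq_pairing, check_conv, check_check] at h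
  rw [mul_comm]
  exact h

theorem Omega.exists_pairing_ne_zero (φ : Omega v) : ∃ f, CcRad f ∧ pairing f φ.fn ≠ 0 := by
  obtain ⟨f, h1, h2, h3, h4⟩ := (Subtype.property φ).1.ne_zero
  exact ⟨check f, CcRad.check ⟨h1, h2, h3⟩, by rwa [← chi_eq_pairing]⟩

/-- Convolution powers: `convPow g f n = f * g * … * g`. -/
def convPow (g f : N v → ℂ) : ℕ → N v → ℂ
  | 0 => f
  | n + 1 => conv (convPow g f n) g

theorem CcRad.convPow {f g : N v → ℂ} (hg : CcRad g) (hf : CcRad f) (n : ℕ) :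
    CcRad (convPow g f n) := by
  induction n with
  | zero => exact hf
  | succ n ih => exact ih.conv hg

theorem Omega.pairing_convPow (φ : Omega v) {f g : N v → ℂ} (hg : CcRad g) (hf : CcRad f) (n : ℕ) :
    pairing (convPow g f n) φ.fn = pairing f φ.fn * pairing g φ.fn ^ n := by
  induction n with
  | zero => simp [FreeNilpotent.convPow]
  | succ n ih =>
    rw [FreeNilpotent.convPow, φ.pairing_conv (hg.convPow hf n) hg, ih, pow_succ, mul_assoc]

theorem CcRad.integral_norm_convPow_le {f g : N v → ℂ} (hg : CcRad g) (hf : CcRad f) (n : ℕ) :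
    ∫ x, ‖FreeNilpotent.convPow g f n x‖ ≤ (∫ x, ‖f x‖) * (∫ x, ‖g x‖) ^ n := by
  induction n with
  | zero => simp [FreeNilpotent.convPow]
  | succ n ih =>
    refine ((hg.convPow hf n).integral_norm_conv_le hg).trans ?_
    rw [pow_succ, ← mul_assoc]
    exact mul_le_mul_of_nonneg_right ih (integral_nonneg fun _ => norm_nonneg _)

theorem norm_pairing_le_of_bound {f φ : N v → ℂ} (hf : Integrable f) {M : ℝ}
    (hM : ∀ n, ‖φ n‖ ≤ M) : ‖pairing f φ‖ ≤ M * ∫ n, ‖f n‖ := by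
  rw [← integral_const_mul]
  refine norm_integral_le_of_norm_le (hf.norm.const_mul M) (.of_forall fun n => ?_)
  rw [norm_mul, mul_comm]
  exact mul_le_mul_of_nonneg_right (hM n) (norm_nonneg _)

theorem Omega.norm_pairing_le (φ : Omega v) {g : N v → ℂ} (hg : CcRad g) :
    ‖pairing g φ.fn‖ ≤ ∫ n, ‖g n‖ := by
  obtain ⟨f, hf, hf0⟩ := φ.exists_pairing_ne_zero
  obtain ⟨M, hM⟩ := (Subtype.property φ).2
  set a := ‖pairing g φ.fn‖ with ha
  set b := ∫ n, ‖g n‖ with hb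
  have hb0 : 0 ≤ b := integral_nonneg fun _ => norm_nonneg _
  have hM0 : 0 ≤ M := (norm_nonneg _).trans (hM 1)
  by_contra! hlt
  have ha0 : 0 < a := lt_of_le_of_lt hb0 hlt
  have key : ∀ n : ℕ, ‖pairing f φ.fn‖ ≤ M * (∫ x, ‖f x‖) * (b / a) ^ n := by
    intro n
    have h1 := norm_pairing_le_of_bound (hg.convPow hf n).integrable hM
    have h2 := h1.trans (mul_le_mul_of_nonneg_left (hg.integral_norm_convPow_le hf n) hM0)
    change ‖pairing _ φ.fn‖ ≤ _ at h2
    rw [φ.pairing_convPow hg hf, norm_mul, norm_pow] at h2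
    rw [div_pow, mul_div_assoc', le_div_iff₀ (pow_pos ha0 n), mul_assoc M]
    exact h2
  have hlim := (tendsto_pow_atTop_nhds_zero_of_lt_one (div_nonneg hb0 ha0.le)
    ((div_lt_one ha0).2 hlt)).const_mul (M * (∫ x, ‖f x‖))
  rw [mul_zero] at hlim
  have := ge_of_tendsto' hlim key
  exact hf0 (norm_eq_zero.1 (le_antisymm this (norm_nonneg _)))

theorem continuous_pairing_continuousMap {g : N v → ℂ} (hg : Continuous g)
    (hg' : HasCompactSupport g) : Continuous fun φ : C(N v, ℂ) => pairing g φ := by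
  refine continuous_integral_of_compact_support hg'.isCompact (f := fun (φ : C(N v, ℂ)) n => g n * φ n)
    ?_ fun φ n hn => ?_
  · exact (hg.comp continuous_snd).mul (continuous_eval (F := C(N v, ℂ)))
  · rw [image_eq_zero_of_notMem_tsupport hn, zero_mul]

theorem continuous_pairing {g : N v → ℂ} (hg : CcRad g) :
    Continuous fun φ : Omega v => pairing g φ.fn :=
  (continuous_pairing_continuousMap hg.cont hg.supp).comp continuous_subtype_val

/-! ### The torus of rotations of the coordinate planes -/

/-- The component of a vector in the `j`-th coordinate plane, as a complex number. -/
def planeC (X : Fin v → ℝ) (j : Fin (v / 2)) : ℂ :=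
  ⟨X ⟨2 * j, by omega⟩, X ⟨2 * j + 1, by omega⟩⟩

theorem normSq_planeC (X : Fin v → ℝ) (j : Fin (v / 2)) :
    Complex.normSq (planeC X j) = planeSq X j := by
  simp [planeC, planeSq, Complex.normSq_apply, pow_two]

theorem planeC_add (X Y : Fin v → ℝ) (j : Fin (v / 2)) :
    planeC (X + Y) j = planeC X j + planeC Y j := rfl

theorem planeC_smul (c : ℝ) (X : Fin v → ℝ) (j : Fin (v / 2)) :
    planeC (c • X) j = c * planeC X j := by
  apply Complex.ext <;> simp [planeC]

/-- Rotation of the coordinate planes. -/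
def rotX (t : Fin (v / 2) → Circle) (X : Fin v → ℝ) : Fin v → ℝ := fun a =>
  if h : (a : ℕ) / 2 < v / 2 then
    if (a : ℕ) % 2 = 0 then (unitC (t ⟨a / 2, h⟩) * planeC X ⟨a / 2, h⟩).re
    else (unitC (t ⟨a / 2, h⟩) * planeC X ⟨a / 2, h⟩).im
  else X a

theorem planeC_rotX (t : Fin (v / 2) → Circle) (X : Fin v → ℝ) (j : Fin (v / 2)) :
    planeC (rotX t X) j = unitC (t j) * planeC X j := by
  have h1 : (2 * (j : ℕ)) / 2 = j := by omega
  have h2 : (2 * (j : ℕ) + 1) / 2 = j := by omega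
  have h4 : (2 * (j : ℕ)) % 2 = 0 := by omega
  apply Complex.ext
  · simp only [planeC, rotX]
    simp [h1, h4]
  · simp only [planeC, rotX]
    simp [h2]

theorem rotX_of_not_lt (t : Fin (v / 2) → Circle) (X : Fin v → ℝ) (a : Fin v)
    (h : ¬ (a : ℕ) / 2 < v / 2) : rotX t X a = X a := dif_neg h

theorem ext_planeC {X Y : Fin v → ℝ} (h : ∀ j, planeC X j = planeC Y j)
    (h' : ∀ a : Fin v, ¬ (a : ℕ) / 2 < v / 2 → X a = Y a) : X = Y := by
  funext a
  by_cases ha : (a : ℕ) / 2 < v / 2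
  · have h1 := h ⟨a / 2, ha⟩
    rw [planeC, planeC, Complex.mk.injEq] at h1
    rcases Nat.mod_two_eq_zero_or_one (a : ℕ) with h2 | h2
    · convert h1.1 using 2 <;> (apply Fin.ext; simp; omega)
    · convert h1.2 using 2 <;> (apply Fin.ext; simp; omega)
  · exact h' a ha

theorem dotProduct_eq_planeC (X Y : Fin v → ℝ) : X ⬝ᵥ Y =
    ∑ j, (conj (planeC X j) * planeC Y j).re +
      ∑ s : Fin (v % 2), X (idx v (Sum.inr s)) * Y (idx v (Sum.inr s)) := by
  have h0 : ∀ j : Fin (v / 2), idx v (Sum.inl (j, 0)) = ⟨2 * j, by omega⟩ := fun j =>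
    Fin.ext (by rw [idx_inl_val]; simp)
  have h1 : ∀ j : Fin (v / 2), idx v (Sum.inl (j, 1)) = ⟨2 * j + 1, by omega⟩ := fun j =>
    Fin.ext (by rw [idx_inl_val]; simp)
  rw [dotProduct, ← Equiv.sum_comp (idx v), Fintype.sum_sum_type, Fintype.sum_prod_type]
  congr 1
  refine Finset.sum_congr rfl fun j _ => ?_
  rw [Fin.sum_univ_two, h0, h1]
  simp [planeC]

/-- Rotation of the coordinate planes as a linear map. -/
def rotₗ (t : Fin (v / 2) → Circle) : (Fin v → ℝ) →ₗ[ℝ] (Fin v → ℝ) where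
  toFun := rotX t
  map_add' X Y := ext_planeC
    (fun j => by rw [planeC_add, planeC_rotX, planeC_rotX, planeC_rotX, planeC_add, mul_add])
    (fun a ha => by
      rw [Pi.add_apply, rotX_of_not_lt _ _ _ ha, rotX_of_not_lt _ _ _ ha, rotX_of_not_lt _ _ _ ha,
        Pi.add_apply])
  map_smul' c X := ext_planeC
    (fun j => by
      rw [RingHom.id_apply, planeC_smul, planeC_rotX, planeC_rotX, planeC_smul, mul_left_comm])
    (fun a ha => by
      rw [RingHom.id_apply, Pi.smul_apply, rotX_of_not_lt _ _ _ ha, rotX_of_not_lt _ _ _ ha,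
        Pi.smul_apply])

theorem idx_inr_not_lt (s : Fin (v % 2)) : ¬ (idx v (Sum.inr s) : ℕ) / 2 < v / 2 := by
  have := s.2
  rw [idx_inr_val]
  omega

theorem rotX_dotProduct_rotX (t : Fin (v / 2) → Circle) (X Y : Fin v → ℝ) :
    rotX t X ⬝ᵥ rotX t Y = X ⬝ᵥ Y := by
  rw [dotProduct_eq_planeC, dotProduct_eq_planeC]
  congr 1
  · refine Finset.sum_congr rfl fun j _ => ?_
    rw [planeC_rotX, planeC_rotX, map_mul, conj_unitC, unitC_inv]
    congr 1
    have := unitC_ne_zero (t j)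
    field_simp
  · refine Finset.sum_congr rfl fun s _ => ?_
    rw [rotX_of_not_lt _ _ _ (idx_inr_not_lt s), rotX_of_not_lt _ _ _ (idx_inr_not_lt s)]

theorem mem_orthogonalGroup_of_dotProduct {M : Matrix (Fin v) (Fin v) ℝ}
    (h : ∀ X Y, (M *ᵥ X) ⬝ᵥ (M *ᵥ Y) = X ⬝ᵥ Y) : M ∈ Matrix.orthogonalGroup (Fin v) ℝ := by
  rw [Matrix.mem_orthogonalGroup_iff']
  change Mᵀ * M = 1
  ext a b
  have := h (Pi.single a 1) (Pi.single b 1)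
  rw [Matrix.mulVec_single_one, Matrix.mulVec_single_one] at this
  rw [Matrix.mul_apply]
  simpa [dotProduct, Matrix.one_apply, Pi.single_apply, eq_comm] using this

/-- Rotation of the coordinate planes as an orthogonal matrix. -/
def rotO (t : Fin (v / 2) → Circle) : O v :=
  ⟨LinearMap.toMatrix' (rotₗ t), mem_orthogonalGroup_of_dotProduct fun X Y => by
    rw [LinearMap.toMatrix'_mulVec, LinearMap.toMatrix'_mulVec]
    exact rotX_dotProduct_rotX t X Y⟩

theorem rotO_mulVec (t : Fin (v / 2) → Circle) (X : Fin v → ℝ) :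
    (rotO t : Matrix (Fin v) (Fin v) ℝ) *ᵥ X = rotX t X :=
  LinearMap.toMatrix'_mulVec _ _

theorem continuous_rotO : Continuous (rotO : (Fin (v / 2) → Circle) → O v) := by
  refine Continuous.subtype_mk (continuous_matrix fun a b => ?_) _
  simp only [LinearMap.toMatrix'_apply]
  change Continuous fun t => rotX t _ a
  unfold rotX
  split_ifs <;> fun_prop

theorem skew_D2_mulVec (Λ : Fin (v / 2) → ℝ) (X : Fin v → ℝ) (a : Fin v) :
    (skew (D2 Λ) *ᵥ X) a = sgn a * lam Λ a * X (partner a) := by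
  rw [Matrix.mulVec, dotProduct]
  simp [skew_D2]

theorem planeC_skew_D2 (Λ : Fin (v / 2) → ℝ) (X : Fin v → ℝ) (j : Fin (v / 2)) :
    planeC (skew (D2 Λ) *ᵥ X) j = -Complex.I * Λ j * planeC X j := by
  have h1 : (2 * (j : ℕ)) / 2 = j := by omega
  have h2 : (2 * (j : ℕ) + 1) / 2 = j := by omega
  have h4 : (2 * (j : ℕ)) % 2 = 0 := by omega
  have p1 : partner (⟨2 * j, by omega⟩ : Fin v) = ⟨2 * j + 1, by omega⟩ :=
    Fin.ext (by rw [partner_val]; simp; omega)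
  have p2 : partner (⟨2 * j + 1, by omega⟩ : Fin v) = ⟨2 * j, by omega⟩ :=
    Fin.ext (by rw [partner_val]; simp)
  apply Complex.ext
  · simp only [planeC, skew_D2_mulVec, p1]
    simp [sgn, lam, h1, h4]
  · simp only [planeC, skew_D2_mulVec, p2]
    simp [sgn, lam, h2]

theorem skew_D2_mulVec_of_not_lt (Λ : Fin (v / 2) → ℝ) (X : Fin v → ℝ) (a : Fin v)
    (h : ¬ (a : ℕ) / 2 < v / 2) : (skew (D2 Λ) *ᵥ X) a = 0 := by
  rw [skew_D2_mulVec, lam, dif_neg h]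
  simp

theorem actA_rotO_D2 (t : Fin (v / 2) → Circle) (Λ : Fin (v / 2) → ℝ) :
    actA (rotO t) (D2 Λ) = D2 Λ := by
  apply skew_injective
  rw [skew_actA]
  have hcomm : (rotO t : Matrix (Fin v) (Fin v) ℝ) * skew (D2 Λ) =
      skew (D2 Λ) * (rotO t : Matrix (Fin v) (Fin v) ℝ) := by
    apply Matrix.toLin'.injective
    refine LinearMap.ext fun X => ?_
    rw [Matrix.toLin'_apply, Matrix.toLin'_apply, ← Matrix.mulVec_mulVec, ← Matrix.mulVec_mulVec,
      rotO_mulVec, rotO_mulVec]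
    refine ext_planeC (fun j => ?_) fun a ha => ?_
    · rw [planeC_rotX, planeC_skew_D2, planeC_skew_D2, planeC_rotX, mul_left_comm]
    · rw [rotX_of_not_lt _ _ _ ha, skew_D2_mulVec_of_not_lt _ _ _ ha,
        skew_D2_mulVec_of_not_lt _ _ _ ha]
  rw [hcomm, Matrix.mul_assoc, O_mul_transpose, Matrix.mul_one]

theorem D2_dotProduct (Λ : Fin (v / 2) → ℝ) (a : Pairs v → ℝ) :
    D2 Λ ⬝ᵥ a = ∑ j, Λ j * a (pairIdx j) := by
  simp only [dotProduct, D2, Finset.sum_mul, ite_mul, zero_mul]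
  rw [Finset.sum_comm]
  refine Finset.sum_congr rfl fun j _ => ?_
  rw [Finset.sum_eq_single (pairIdx j)]
  · simp [pairIdx]
  · intro p _ hp
    refine if_neg fun h => hp (Subtype.ext (Prod.ext (Fin.ext ?_) (Fin.ext ?_)))
    · exact h.1
    · exact h.2
  · simp

theorem D2_dotProduct_bracket (Λ : Fin (v / 2) → ℝ) (X Y : Fin v → ℝ) :
    D2 Λ ⬝ᵥ bracket X Y = ∑ j, Λ j * (conj (planeC X j) * planeC Y j).im := by
  rw [D2_dotProduct]
  refine Finset.sum_congr rfl fun j _ => ?_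
  simp only [bracket, planeC, pairIdx, Complex.mul_im, Complex.conj_re, Complex.conj_im]
  ring

theorem Params_mul_lastCoord (p : Params v) (t : Fin (v / 2) → Circle) (X : Fin v → ℝ) :
    p.1.1 * lastCoord (rotX t X) = p.1.1 * lastCoord X := by
  by_cases hv : Even v
  · rw [p.2.2.1 hv, zero_mul, zero_mul]
  · have h1 := Nat.not_even_iff.1 hv
    have h2 : 0 < v := by omega
    rw [lastCoord, lastCoord, dif_pos h2, dif_pos h2, rotX_of_not_lt]
    simp
    omega

/-- The Haar measure of total mass one on the torus. -/
def haarTorus (v : ℕ) : Measure (Fin (v / 2) → Circle) := Measure.pi fun _ => haarCircle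

instance : IsProbabilityMeasure (haarTorus v) := by unfold haarTorus; infer_instance

theorem lastCoord_add (X Y : Fin v → ℝ) : lastCoord (X + Y) = lastCoord X + lastCoord Y := by
  unfold lastCoord; split_ifs <;> simp

theorem integral_torus_Theta (p : Params v) (m n : N v) :
    ∫ t, Theta p (m * act (rotO t) n) ∂(haarTorus v) = Theta p m * Theta p n := by
  set Λ := p.1.2.1 with hΛ
  set l := p.1.2.2 with hl
  have hpos : ∀ j, 0 < Λ j := p.2.2.2.2
  let s : Fin (v / 2) → ℝ := fun j => √(Λ j / 2)
  have hs : ∀ j, s j ^ 2 = Λ j / 2 := fun j => Real.sq_sqrt (by have := hpos j; positivity)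
  let F : Fin (v / 2) → Circle → ℂ := fun j e =>
    (laguerreFun (l j) (Complex.normSq (s j * planeC m.X j + unitC e * (s j * planeC n.X j))) : ℂ) *
      Complex.exp (Complex.I * ((conj (s j * planeC m.X j : ℂ) *
        (unitC e * (s j * planeC n.X j))).im : ℝ))
  have key : ∀ t, Theta p (m * act (rotO t) n) =
      (Complex.exp (Complex.I * ((p.1.1 * (lastCoord m.X + lastCoord n.X) : ℝ) : ℂ)) *
        Complex.exp (Complex.I * ((D2 Λ ⬝ᵥ m.A + D2 Λ ⬝ᵥ n.A : ℝ) : ℂ))) * ∏ j, F j (t j) := by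
    intro t
    have hX : (m * act (rotO t) n).X = m.X + rotX t n.X := by
      rw [N.X_mul, X_act, rotO_mulVec]
    have hA : (D2 Λ ⬝ᵥ (m * act (rotO t) n).A : ℝ) = D2 Λ ⬝ᵥ m.A + D2 Λ ⬝ᵥ n.A +
        ∑ j, (conj (s j * planeC m.X j : ℂ) * (unitC (t j) * (s j * planeC n.X j))).im := by
      rw [N.A_mul, X_act, A_act, rotO_mulVec, dotProduct_add, dotProduct_add, dotProduct_smul,
        D2_dotProduct_bracket]
      have h1 : D2 Λ ⬝ᵥ actA (rotO t) n.A = D2 Λ ⬝ᵥ n.A := by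
        conv_lhs => rw [← actA_rotO_D2 t Λ]
        rw [actA_dotProduct_actA]
      rw [h1, Finset.smul_sum]
      congr 1
      refine Finset.sum_congr rfl fun j _ => ?_
      rw [planeC_rotX, smul_eq_mul, map_mul, Complex.conj_ofReal,
        show (s j : ℂ) * conj (planeC m.X j) * (unitC (t j) * (s j * planeC n.X j)) =
          ((s j ^ 2 : ℝ) : ℂ) * (conj (planeC m.X j) * (unitC (t j) * planeC n.X j)) by
            push_cast; ring, Complex.im_ofReal_mul, hs]
      ring
    have hL : ∀ j, Λ j / 2 * planeSq (m.X + rotX t n.X) j =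
        Complex.normSq (s j * planeC m.X j + unitC (t j) * (s j * planeC n.X j)) := fun j => by
      rw [← normSq_planeC, planeC_add, planeC_rotX, ← hs,
        show (s j : ℂ) * planeC m.X j + unitC (t j) * (s j * planeC n.X j) =
          s j * (planeC m.X j + unitC (t j) * planeC n.X j) by ring, Complex.normSq_mul,
        Complex.normSq_ofReal]
      ring
    have hr : p.1.1 * lastCoord (m.X + rotX t n.X) = p.1.1 * (lastCoord m.X + lastCoord n.X) := by
      rw [lastCoord_add, mul_add, Params_mul_lastCoord, mul_add]
    rw [Theta, ← hΛ, ← hl, hX, hA, hr]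
    simp only [hL, F, Finset.prod_mul_distrib]
    rw [← Complex.exp_sum, ← Finset.mul_sum]
    push_cast
    rw [mul_add _ (_ + _), Complex.exp_add]
    ring
  simp only [key, integral_const_mul]
  rw [haarTorus, integral_fintype_prod_eq_prod]
  have hF : ∀ j, ∫ e, F j e ∂haarCircle =
      (laguerreFun (l j) (Λ j / 2 * planeSq m.X j) : ℂ) *
        laguerreFun (l j) (Λ j / 2 * planeSq n.X j) := fun j => by
    have := integral_circle_laguerreFun (l j) (s j * planeC m.X j) (s j * planeC n.X j)
    rw [this, Complex.normSq_mul, Complex.normSq_mul, Complex.normSq_ofReal, normSq_planeC,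
      normSq_planeC, ← pow_two, hs]
  simp only [hF, Finset.prod_mul_distrib]
  rw [Theta, Theta, ← hΛ, ← hl, mul_add, Complex.ofReal_add, Complex.ofReal_add, mul_add, mul_add,
    Complex.exp_add, Complex.exp_add]
  push_cast
  ring

/-! ### The functions `φ^{r,Λ,l}` are bounded spherical functions -/

theorem abs_laguerreFun_le_one (n : ℕ) {x : ℝ} (hx : 0 ≤ x) : |laguerreFun n x| ≤ 1 := by
  let S : Set ℝ := Set.range fun z : ℂ => |laguerreFun n (Complex.normSq z)|
  have hbdd : BddAbove S := by
    refine ⟨∑ i ∈ Finset.range (n + 1), (n.choose i : ℝ) * 2 ^ i, ?_⟩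
    rintro _ ⟨z, rfl⟩
    set y := Complex.normSq z
    have hy : 0 ≤ y := Complex.normSq_nonneg z
    simp only [laguerreFun, laguerre]
    rw [abs_mul, abs_of_pos (Real.exp_pos _)]
    calc |∑ i ∈ Finset.range (n + 1), (-1) ^ i * (n.choose i : ℝ) / (i.factorial : ℝ) * y ^ i| *
          Real.exp (-y / 2) ≤ (∑ i ∈ Finset.range (n + 1),
            |(-1) ^ i * (n.choose i : ℝ) / (i.factorial : ℝ) * y ^ i|) * Real.exp (-y / 2) := by
          gcongr
          exact Finset.abs_sum_le_sum_abs _ _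
      _ ≤ _ := by
          rw [Finset.sum_mul]
          refine Finset.sum_le_sum fun i _ => ?_
          have h1 := Real.pow_div_factorial_le_exp (y / 2) (by positivity) i
          rw [abs_mul, abs_div, abs_mul, abs_pow, abs_neg, abs_one, one_pow, one_mul,
            abs_of_nonneg (by positivity : (0 : ℝ) ≤ y ^ i), Nat.abs_cast, Nat.abs_cast]
          have h2 : (n.choose i : ℝ) / i.factorial * y ^ i * Real.exp (-y / 2) =
              n.choose i * 2 ^ i * ((y / 2) ^ i / i.factorial * Real.exp (-y / 2)) := by
            rw [div_pow]; field_simp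
          rw [h2]
          refine mul_le_of_le_one_right (by positivity) ?_
          calc (y / 2) ^ i / i.factorial * Real.exp (-y / 2) ≤
                Real.exp (y / 2) * Real.exp (-y / 2) := by gcongr
            _ = 1 := by rw [← Real.exp_add]; ring_nf; exact Real.exp_zero
  have hne : S.Nonempty := ⟨_, 0, rfl⟩
  have hle : ∀ z, |laguerreFun n (Complex.normSq z)| ≤ sSup S := fun z => le_csSup hbdd ⟨z, rfl⟩
  have hsq : ∀ z, |laguerreFun n (Complex.normSq z)| ≤ √(sSup S) := by
    intro z
    refine Real.le_sqrt_of_sq_le ?_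
    have h1 := integral_circle_laguerreFun n z z
    have h2 : ‖∫ e : Circle, (laguerreFun n (Complex.normSq (z + unitC e * z)) : ℂ) *
        Complex.exp (Complex.I * ((conj z * (unitC e * z)).im : ℝ)) ∂haarCircle‖ ≤
        sSup S * haarCircle.real Set.univ := by
      refine norm_integral_le_of_norm_le_const (.of_forall fun e => ?_)
      rw [norm_mul, mul_comm Complex.I, Complex.norm_exp_ofReal_mul_I, mul_one, Complex.norm_real]
      exact hle _
    rw [h1, norm_mul, Complex.norm_real, Real.norm_eq_abs, probReal_univ, mul_one] at h2
    rw [pow_two]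
    exact h2
  have h3 : sSup S ≤ √(sSup S) := csSup_le hne (by rintro _ ⟨z, rfl⟩; exact hsq z)
  have h0 : 0 ≤ sSup S := (abs_nonneg _).trans (hle 0)
  have h4 : sSup S ≤ 1 := by
    by_contra! h
    have h5 : √(sSup S) < sSup S := by
      rw [Real.sqrt_lt' (by linarith)]
      nlinarith
    linarith
  have := (hle (√x : ℝ)).trans h4
  rwa [Complex.normSq_ofReal, Real.mul_self_sqrt hx] at this

theorem norm_Theta_le_one (p : Params v) (n : N v) : ‖Theta p n‖ ≤ 1 := by
  rw [Theta, norm_mul, norm_mul, mul_comm Complex.I, Complex.norm_exp_ofReal_mul_I,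
    mul_comm Complex.I, Complex.norm_exp_ofReal_mul_I, one_mul, one_mul, Complex.norm_real,
    Real.norm_eq_abs, Finset.abs_prod]
  refine Finset.prod_le_one (fun _ _ => abs_nonneg _) fun j _ => abs_laguerreFun_le_one _ ?_
  have h1 : 0 < p.1.2.1 j := p.2.2.2.2 j
  have h2 : 0 ≤ planeSq n.X j := by unfold planeSq; positivity
  positivity

theorem continuous_lastCoord : Continuous (lastCoord : (Fin v → ℝ) → ℝ) := by
  unfold lastCoord; split_ifs <;> fun_prop

theorem continuous_planeSq (j : Fin (v / 2)) :
    Continuous fun X : Fin v → ℝ => planeSq X j := by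
  unfold planeSq; fun_prop

theorem continuous_Theta : Continuous fun q : Params v × N v => Theta q.1 q.2 := by
  have hX : Continuous fun q : Params v × N v => q.2.X := continuous_X.comp continuous_snd
  have hA : Continuous fun q : Params v × N v => q.2.A := continuous_A.comp continuous_snd
  have hr : Continuous fun q : Params v × N v => q.1.1.1 := by fun_prop
  have hΛ : Continuous fun q : Params v × N v => q.1.1.2.1 := by fun_prop
  have hl : Continuous fun q : Params v × N v => q.1.1.2.2 := by fun_prop
  have hlag : Continuous fun q : ℕ × ℝ => laguerreFun q.1 q.2 :=
    continuous_prod_of_discrete_left.2 fun n => continuous_laguerreFun n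
  unfold Theta
  have h1 : Continuous fun q : Params v × N v => lastCoord q.2.X := continuous_lastCoord.comp hX
  have h2 : Continuous fun q : Params v × N v => D2 q.1.1.2.1 ⬝ᵥ q.2.A :=
    (continuous_D2.comp hΛ).dotProduct hA
  have h3 : ∀ j, Continuous fun q : Params v × N v =>
      laguerreFun (q.1.1.2.2 j) (q.1.1.2.1 j / 2 * planeSq q.2.X j) := by
    intro j
    have e1 : Continuous fun q : Params v × N v => q.1.1.2.2 j := (continuous_apply j).comp hl
    have e2 : Continuous fun q : Params v × N v => q.1.1.2.1 j := (continuous_apply j).comp hΛ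
    have e3 : Continuous fun q : Params v × N v => planeSq q.2.X j := (continuous_planeSq j).comp hX
    have e4 : Continuous fun q : Params v × N v => q.1.1.2.1 j / 2 * planeSq q.2.X j := by fun_prop
    have e5 := hlag.comp (e1.prodMk e4)
    exact e5
  have h4 : Continuous fun q : Params v × N v =>
      ∏ j, laguerreFun (q.1.1.2.2 j) (q.1.1.2.1 j / 2 * planeSq q.2.X j) :=
    continuous_finsetProd _ fun j _ => h3 j
  fun_prop

theorem continuous_Theta_comp {α : Type*} [TopologicalSpace α] {a : α → Params v} {b : α → N v}
    (ha : Continuous a) (hb : Continuous b) : Continuous fun x => Theta (a x) (b x) := by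
  have h := continuous_Theta.comp (ha.prodMk hb)
  exact h

theorem continuous_act_comp {α : Type*} [TopologicalSpace α] {a : α → O v} {b : α → N v}
    (ha : Continuous a) (hb : Continuous b) : Continuous fun x => act (a x) (b x) := by
  have h := continuous_act.comp (ha.prodMk hb)
  exact h

theorem continuous_phi : Continuous fun q : Params v × N v => phi q.1 q.2 := by
  refine continuous_integral_of_compact_support (k := Set.univ) isCompact_univ
    (f := fun (q : Params v × N v) (k : O v) => Theta q.1 (act k q.2)) ?_
    fun _ _ h => absurd (Set.mem_univ _) h
  exact continuous_Theta_comp (a := fun q : (Params v × N v) × O v => q.1.1)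
    (b := fun q => act q.2 q.1.2) (continuous_fst.comp continuous_fst)
    (continuous_act_comp continuous_snd (continuous_snd.comp continuous_fst))

theorem norm_phi_le_one (p : Params v) (n : N v) : ‖phi p n‖ ≤ 1 := by
  have := norm_integral_le_of_norm_le_const (μ := haarO v) (f := fun k => Theta p (act k n))
    (.of_forall fun k => norm_Theta_le_one p _)
  rwa [probReal_univ, mul_one] at this

theorem radial_phi (p : Params v) : Radial (phi p) := fun k n => by
  simp only [phi, act_act]
  exact integral_mul_right_eq_self (fun k' => Theta p (act k' n)) k

theorem continuous_Theta_act (p : Params v) :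
    Continuous fun q : N v × O v => Theta p (act q.2 q.1) :=
  continuous_Theta_comp continuous_const (continuous_act_comp continuous_snd continuous_fst)

theorem continuous_Theta_right (p : Params v) : Continuous (Theta p) :=
  continuous_Theta_comp continuous_const continuous_id

/-- For radial functions, pairing with `φ` is pairing with `Θ`. -/
theorem pairing_phi {f : N v → ℂ} (hf : Integrable f) (hr : Radial f) (p : Params v) :
    pairing f (phi p) = ∫ n, f n * Theta p n := by
  simp only [pairing, phi, ← integral_const_mul]
  rw [integral_integral_swap]
  · have : ∀ k : O v, ∫ n, f n * Theta p (act k n) = ∫ n, f n * Theta p n := fun k => by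
      rw [← integral_act k fun n => f n * Theta p n]
      simp only [hr k]
    simp [this]
  · refine Integrable.mul_bdd (c := 1) (hf.comp_fst _)
      (continuous_Theta_act p).aestronglyMeasurable (.of_forall fun q => norm_Theta_le_one p _)

/-- The spherical property of `Θ`. -/
theorem integral_mul_Theta_mul {f : N v → ℂ} (hf : CcRad f) (p : Params v) (m : N v) :
    ∫ n, f n * Theta p (m * n) = Theta p m * ∫ n, f n * Theta p n := by
  have h1 : ∀ t, ∫ n, f n * Theta p (m * act (rotO t) n) = ∫ n, f n * Theta p (m * n) := fun t => by
    rw [← integral_act (rotO t) fun n => f n * Theta p (m * n)]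
    simp only [hf.radial (rotO t)]
  have hc : Continuous fun q : (Fin (v / 2) → Circle) × N v => Theta p (m * act (rotO q.1) q.2) :=
    continuous_Theta_comp continuous_const (continuous_const.mul
      (continuous_act_comp (continuous_rotO.comp continuous_fst) continuous_snd))
  calc ∫ n, f n * Theta p (m * n)
      = ∫ t, ∫ n, f n * Theta p (m * act (rotO t) n) ∂volume ∂(haarTorus v) := by simp [h1]
    _ = ∫ n, ∫ t, f n * Theta p (m * act (rotO t) n) ∂(haarTorus v) := by
        refine integral_integral_swap ?_
        exact Integrable.mul_bdd (c := 1) (hf.integrable.comp_snd _)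
          hc.aestronglyMeasurable (.of_forall fun q => norm_Theta_le_one p _)
    _ = ∫ n, Theta p m * (f n * Theta p n) := by
        refine integral_congr_ae (.of_forall fun n => ?_)
        simp only [integral_const_mul, integral_torus_Theta]
        ring
    _ = _ := integral_const_mul _ _

/-- `φ^{r,Λ,l}` as a continuous function. -/
def phiC (p : Params v) : C(N v, ℂ) :=
  ⟨phi p, Continuous.comp (g := fun q : Params v × N v => phi q.1 q.2) (f := fun n => (p, n))
    continuous_phi (continuous_const.prodMk continuous_id)⟩

theorem pairing_conv_phi {f g : N v → ℂ} (hf : CcRad f) (hg : CcRad g) (p : Params v) :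
    pairing (conv f g) (phi p) = pairing f (phi p) * pairing g (phi p) := by
  rw [pairing_phi (hf.conv hg).integrable (hf.conv hg).radial, pairing_phi hf.integrable hf.radial,
    pairing_phi hg.integrable hg.radial, hf.integral_conv_mul hg (continuous_Theta_right p),
    ← integral_mul_const]
  congr 1
  funext m
  rw [integral_mul_Theta_mul hg, mul_assoc]

/-- A radial gauge on the group. -/
def gauge (n : N v) : ℝ := n.X ⬝ᵥ n.X + n.A ⬝ᵥ n.A

theorem gauge_act (k : O v) (n : N v) : gauge (act k n) = gauge n := by
  rw [gauge, X_act, A_act, mulVec_dotProduct_mulVec, actA_dotProduct_actA, gauge]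

theorem continuous_gauge : Continuous (gauge : N v → ℝ) :=
  (continuous_X.dotProduct continuous_X).add (continuous_A.dotProduct continuous_A)

theorem dotProduct_self_real_nonneg {ι : Type*} [Fintype ι] (x : ι → ℝ) : 0 ≤ x ⬝ᵥ x :=
  Finset.sum_nonneg fun i _ => mul_self_nonneg (x i)

theorem sq_le_dotProduct_self {ι : Type*} [Fintype ι] (x : ι → ℝ) (i : ι) : x i ^ 2 ≤ x ⬝ᵥ x := by
  rw [pow_two]
  exact Finset.single_le_sum (f := fun i => x i * x i) (fun j _ => mul_self_nonneg _)
    (Finset.mem_univ i)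

theorem isCompact_gauge_le (R : ℝ) : IsCompact {n : N v | gauge n ≤ R} := by
  have hK : IsCompact ((Set.pi Set.univ fun _ : Fin v => Set.Icc (-√R) √R) ×ˢ
      (Set.pi Set.univ fun _ : Pairs v => Set.Icc (-√R) √R)) :=
    (isCompact_univ_pi fun _ => isCompact_Icc).prod (isCompact_univ_pi fun _ => isCompact_Icc)
  refine IsCompact.of_isClosed_subset hK (isClosed_le continuous_gauge continuous_const) ?_
  intro n hn
  have hn' : n.X ⬝ᵥ n.X + n.A ⬝ᵥ n.A ≤ R := hn
  have h1 := dotProduct_self_real_nonneg n.X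
  have h2 := dotProduct_self_real_nonneg n.A
  refine ⟨fun i _ => abs_le.1 (Real.abs_le_sqrt ?_), fun i _ => abs_le.1 (Real.abs_le_sqrt ?_)⟩
  · exact (sq_le_dotProduct_self n.X i).trans (by linarith)
  · exact (sq_le_dotProduct_self n.A i).trans (by linarith)

/-- A radial cutoff function. -/
def cutoff (R : ℝ) (n : N v) : ℝ := max 0 (R - gauge n)

theorem continuous_cutoff (R : ℝ) : Continuous (cutoff R : N v → ℝ) :=
  continuous_const.max (continuous_const.sub continuous_gauge)

theorem cutoff_nonneg (R : ℝ) (n : N v) : 0 ≤ cutoff R n := le_max_left _ _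

theorem cutoff_eq_zero {R : ℝ} {n : N v} (h : R ≤ gauge n) : cutoff R n = 0 :=
  max_eq_left (by linarith)

theorem cutoff_pos {R : ℝ} {n : N v} (h : gauge n < R) : 0 < cutoff R n :=
  lt_max_of_lt_right (by linarith)

theorem hasCompactSupport_cutoff (R : ℝ) : HasCompactSupport (cutoff R : N v → ℝ) :=
  HasCompactSupport.intro (isCompact_gauge_le R) fun _ hn => cutoff_eq_zero (not_le.1 hn).le

theorem cutoff_act (R : ℝ) (k : O v) (n : N v) : cutoff R (act k n) = cutoff R n := by
  rw [cutoff, gauge_act, cutoff]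

theorem CcRad.mul_cutoff {f : N v → ℂ} (hf : Continuous f) (hr : Radial f) (R : ℝ) :
    CcRad fun n => f n * cutoff R n :=
  ⟨hf.mul (Complex.continuous_ofReal.comp (continuous_cutoff R)),
    ((hasCompactSupport_cutoff R).comp_left (g := fun x : ℝ => (x : ℂ)) Complex.ofReal_zero).mul_left,
    fun k n => by
      rw [hr k n, cutoff_act]⟩

theorem exists_pairing_ne_zero {φ : N v → ℂ} (hφ : Continuous φ) (hr : Radial φ) (h : φ ≠ 0) :
    ∃ f, CcRad f ∧ pairing f φ ≠ 0 := by
  obtain ⟨n₀, hn₀⟩ := Function.ne_iff.1 h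
  refine ⟨fun n => conj (φ n) * cutoff (gauge n₀ + 1) n,
    CcRad.mul_cutoff (Complex.continuous_conj.comp hφ) (fun k n => by
      change conj (φ (act k n)) = conj (φ n)
      rw [hr k n]) _, ?_⟩
  have h1 : ∀ n, conj (φ n) * cutoff (gauge n₀ + 1) n * φ n =
      ((‖φ n‖ ^ 2 * cutoff (gauge n₀ + 1) n : ℝ) : ℂ) := fun n => by
    push_cast
    rw [← Complex.mul_conj']
    ring
  simp only [pairing, h1]
  rw [integral_complex_ofReal]
  have h2 : 0 < ∫ n : N v, ‖φ n‖ ^ 2 * cutoff (gauge n₀ + 1) n :=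
    Continuous.integral_pos_of_hasCompactSupport_nonneg_nonzero (x := n₀)
      ((hφ.norm.pow 2).mul (continuous_cutoff _)) (hasCompactSupport_cutoff _).mul_left
      (fun n => mul_nonneg (by positivity) (cutoff_nonneg _ _))
      (mul_pos (by have := norm_pos_iff.2 hn₀; positivity) (cutoff_pos (by linarith))).ne'
  exact_mod_cast h2.ne'

theorem act_id (k : O v) : act k (1 : N v) = 1 :=
  N.ext (Matrix.mulVec_zero (k : Matrix (Fin v) (Fin v) ℝ)) (actAₗ k).map_zero

theorem Theta_one (p : Params v) : Theta p 1 = 1 := by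
  have h1 : (1 : N v).X = 0 := rfl
  have h2 : (1 : N v).A = 0 := rfl
  have h3 : ∀ n, laguerreFun n 0 = 1 := fun n => by
    simp [laguerreFun, laguerre, Finset.sum_range_succ']
  have h4 : lastCoord (0 : Fin v → ℝ) = 0 := by unfold lastCoord; split_ifs <;> simp
  have h5 : ∀ j, planeSq (0 : Fin v → ℝ) j = 0 := fun j => by simp [planeSq]
  simp [Theta, h1, h2, h3, h4, h5]

theorem isSpherical_phiC (p : Params v) : IsSpherical (phiC p) where
  radial := radial_phi p
  mul f g hf hf' hf'' hg hg' hg'' := by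
    have hF : CcRad f := ⟨hf, hf', hf''⟩
    have hG : CcRad g := ⟨hg, hg', hg''⟩
    rw [chi_eq_pairing, chi_eq_pairing, chi_eq_pairing, check_conv, mul_comm]
    exact pairing_conv_phi hG.check hF.check p
  ne_zero := by
    have hone : phi p 1 = 1 := by
      have : ∀ k : O v, Theta p (act k 1) = 1 := fun k => by rw [act_id, Theta_one]
      simp [phi, this]
    obtain ⟨f, hf, h⟩ := exists_pairing_ne_zero (phiC p).continuous (radial_phi p)
      (fun h => by have := congrFun h 1; change phi p 1 = 0 at this; simp [hone] at this)
    refine ⟨check f, hf.check.cont, hf.check.supp, hf.check.radial, ?_⟩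
    rwa [chi_eq_pairing, check_check]

/-- `φ^{r,Λ,l}` as a bounded spherical function. -/
def phiOmega (p : Params v) : Omega v := ⟨phiC p, isSpherical_phiC p, 1, norm_phi_le_one p⟩

theorem phiOmega_fn (p : Params v) : (phiOmega p).fn = phi p := rfl

theorem continuous_phiOmega : Continuous (phiOmega : Params v → Omega v) :=
  Continuous.subtype_mk (ContinuousMap.continuous_of_continuous_uncurry _ continuous_phi) _

/-! ### The functions `φ^{r,Λ,l}` are pairwise distinct -/

theorem setIntegral_preimage_eq_zero {K : Type*} [MeasurableSpace K] {μ : Measure K}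
    {ι : Type*} [Fintype ι] {b : K → ι → ℝ} (hb : Measurable b)
    {W : K → ℝ} (hWm : Measurable W) (hW : Integrable W μ)
    (h : ∀ A : ι → ℝ, ∫ k, (W k : ℂ) * Complex.exp (Complex.I * ((A ⬝ᵥ b k : ℝ) : ℂ)) ∂μ = 0)
    {B : Set (ι → ℝ)} (hB : MeasurableSet B) : ∫ k in b ⁻¹' B, W k ∂μ = 0 := by
  classical
  have hfin : ∀ r : K → ℝ, Integrable r μ → ∫⁻ x, ENNReal.ofReal (r x) ∂μ ≠ ∞ := fun r hr => by
    refine ((lintegral_mono fun x => ?_).trans_lt hr.2).ne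
    rw [← ofReal_norm]
    exact ENNReal.ofReal_le_ofReal (le_abs_self _)
  have i1 : IsFiniteMeasure (μ.withDensity fun x => ENNReal.ofReal (W x)) :=
    isFiniteMeasure_withDensity (hfin W hW)
  have i2 : IsFiniteMeasure (μ.withDensity fun x => ENNReal.ofReal (-W x)) :=
    isFiniteMeasure_withDensity (hfin _ hW.neg)
  have hWm' : Measurable fun x => -W x := hWm.neg
  have hexp : ∀ A : ι → ℝ, Measurable fun k => Complex.exp (Complex.I * ((A ⬝ᵥ b k : ℝ) : ℂ)) := by
    intro A
    have hc : Continuous fun x : ι → ℝ => Complex.exp (Complex.I * ((A ⬝ᵥ x : ℝ) : ℂ)) := by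
      simp only [dotProduct]; fun_prop
    exact hc.measurable.comp hb
  have key : (μ.withDensity fun x => ENNReal.ofReal (W x)).map b =
      (μ.withDensity fun x => ENNReal.ofReal (-W x)).map b := by
    refine Measure.ext_of_charFunDual (funext fun L => ?_)
    have hL : ∀ x, L x = (fun i => L (Pi.single i 1)) ⬝ᵥ x := fun x => by
      conv_lhs => rw [pi_eq_sum_univ' x]
      simp [dotProduct, mul_comm]
    set A : ι → ℝ := fun i => L (Pi.single i 1)
    have hLm : Measurable fun x => Complex.exp (L x * Complex.I) := by fun_prop
    rw [charFunDual_apply, charFunDual_apply,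
      integral_map hb.aemeasurable hLm.aestronglyMeasurable,
      integral_map hb.aemeasurable hLm.aestronglyMeasurable,
      integral_withDensity_eq_integral_toReal_smul₀ hWm.ennreal_ofReal.aemeasurable
      (.of_forall fun _ => ENNReal.ofReal_lt_top),
      integral_withDensity_eq_integral_toReal_smul₀ hWm'.ennreal_ofReal.aemeasurable
      (.of_forall fun _ => ENNReal.ofReal_lt_top), ← sub_eq_zero, ← integral_sub, ← h A]
    · congr 1
      funext k
      rw [← sub_smul, Complex.real_smul, ENNReal.toReal_ofReal', ENNReal.toReal_ofReal',
        max_zero_sub_max_neg_zero_eq_self, hL, mul_comm Complex.I]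
    all_goals
      simp only [ENNReal.toReal_ofReal', Complex.real_smul, hL, mul_comm _ Complex.I]
    · exact Integrable.mul_bdd (c := 1) (f := fun x => ((max (W x) 0 : ℝ) : ℂ)) hW.pos_part.ofReal
        (hexp A).aestronglyMeasurable (.of_forall fun k => by
          rw [mul_comm, Complex.norm_exp_ofReal_mul_I])
    · exact Integrable.mul_bdd (c := 1) (f := fun x => ((max (-W x) 0 : ℝ) : ℂ)) hW.neg_part.ofReal
        (hexp A).aestronglyMeasurable (.of_forall fun k => by
          rw [mul_comm, Complex.norm_exp_ofReal_mul_I])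
  have h1 := congrArg (fun ν : Measure (ι → ℝ) => ν B) key
  simp only [Measure.map_apply hb hB, withDensity_apply _ (hb hB)] at h1
  have h2 := integral_eq_lintegral_pos_part_sub_lintegral_neg_part
    (hW.integrableOn (s := b ⁻¹' B))
  rw [h2, h1, sub_self]

theorem exists_dist_lt_subset {K : Type*} [TopologicalSpace K] [CompactSpace K] {E : Type*}
    [PseudoMetricSpace E] {b : K → E} (hb : Continuous b) (b₀ : E) {U : Set K} (hU : IsOpen U)
    (h : ∀ k, dist (b k) b₀ = 0 → k ∈ U) : ∃ ε > 0, ∀ k, dist (b k) b₀ < ε → k ∈ U := by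
  by_cases hne : (Uᶜ : Set K).Nonempty
  · obtain ⟨k₀, hk₀, hmin⟩ := hU.isClosed_compl.isCompact.exists_isMinOn hne
      (f := fun k => dist (b k) b₀) (by fun_prop)
    refine ⟨dist (b k₀) b₀, lt_of_le_of_ne dist_nonneg fun h0 => hk₀ (h k₀ h0.symm), fun k hk => ?_⟩
    by_contra hkU
    exact absurd (hmin hkU) (not_le.2 hk)
  · exact ⟨1, one_pos, fun k _ => by
      by_contra hkU
      exact hne ⟨k, hkU⟩⟩

/-- The real part of `Θ` at central component zero. -/
def thetaRe (p : Params v) (X : Fin v → ℝ) : ℝ :=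
  Real.cos (p.1.1 * lastCoord X) *
    ∏ j : Fin (v / 2), laguerreFun (p.1.2.2 j) (p.1.2.1 j / 2 * planeSq X j)

theorem continuous_thetaRe (p : Params v) : Continuous (thetaRe p) := by
  have h1 := continuous_lastCoord (v := v)
  have h2 : ∀ j, Continuous fun X : Fin v → ℝ =>
      laguerreFun (p.1.2.2 j) (p.1.2.1 j / 2 * planeSq X j) := fun j =>
    (continuous_laguerreFun _).comp (continuous_const.mul (continuous_planeSq j))
  have h3 := continuous_finsetProd Finset.univ fun j _ => h2 j
  unfold thetaRe
  fun_prop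

theorem phi_add_phi_neg (p : Params v) (X : Fin v → ℝ) (A : Pairs v → ℝ) :
    phi p (N.mk X A) + phi p (N.mk (-X) A) = 2 * ∫ k : O v,
      (thetaRe p ((k : Matrix (Fin v) (Fin v) ℝ) *ᵥ X) : ℂ) *
        Complex.exp (Complex.I * ((A ⬝ᵥ actA k⁻¹ (D2 p.1.2.1) : ℝ) : ℂ)) ∂(haarO v) := by
  have hi : ∀ n, Integrable (fun k : O v => Theta p (act k n)) (haarO v) := fun n =>
    integrable_of_continuous
      (continuous_Theta_comp continuous_const (continuous_act_comp continuous_id continuous_const))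
  rw [phi, phi, ← integral_add (hi _) (hi _), ← integral_const_mul]
  congr 1
  funext k
  have h1 : ∀ Y : Fin v → ℝ, planeSq (-Y) = planeSq Y := fun Y => by funext j; simp [planeSq]
  have h2 : ∀ Y : Fin v → ℝ, lastCoord (-Y) = -lastCoord Y := fun Y => by
    unfold lastCoord; split_ifs <;> simp
  have h3 : D2 p.1.2.1 ⬝ᵥ actA k A = A ⬝ᵥ actA k⁻¹ (D2 p.1.2.1) := by
    rw [dotProduct_comm, actA_dotProduct]
  simp only [Theta, X_act, A_act, N.X_mk, N.A_mk, Matrix.mulVec_neg, h1, h2, h3, thetaRe]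
  rw [mul_neg, Complex.ofReal_neg, mul_neg, Complex.ofReal_mul (Real.cos _), Complex.ofReal_cos,
    Complex.cos, neg_mul, mul_comm _ Complex.I]
  ring

theorem dotProduct_skew_D2_self (M : Fin (v / 2) → ℝ) (X : Fin v → ℝ) :
    (skew (D2 M) *ᵥ X) ⬝ᵥ (skew (D2 M) *ᵥ X) = ∑ j, M j ^ 2 * planeSq X j := by
  rw [dotProduct_eq_planeC]
  have : ∀ s : Fin (v % 2), (skew (D2 M) *ᵥ X) (idx v (Sum.inr s)) = 0 := fun s =>
    skew_D2_mulVec_of_not_lt _ _ _ (idx_inr_not_lt s)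
  simp only [this, mul_zero, Finset.sum_const_zero, add_zero]
  refine Finset.sum_congr rfl fun j _ => ?_
  rw [← Complex.normSq_eq_conj_mul_self, Complex.ofReal_re, planeC_skew_D2, Complex.normSq_mul,
    Complex.normSq_mul, normSq_planeC, Complex.normSq_neg, Complex.normSq_I, Complex.normSq_ofReal]
  ring

/-- `Θ` is constant along the stabiliser of a regular diagonal element, up to the sign of `x_v`. -/
theorem thetaRe_stabiliser (p : Params v) {k : O v}
    (hk : ∀ M : Fin (v / 2) → ℝ, actA k (D2 M) = D2 M) (X : Fin v → ℝ) :
    thetaRe p ((k : Matrix (Fin v) (Fin v) ℝ) *ᵥ X) = thetaRe p X := by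
  set Y := (k : Matrix (Fin v) (Fin v) ℝ) *ᵥ X with hY
  have hcomm : ∀ M, skew (D2 M) *ᵥ Y = (k : Matrix (Fin v) (Fin v) ℝ) *ᵥ (skew (D2 M) *ᵥ X) := by
    intro M
    have h1 := skew_actA k (D2 M)
    rw [hk] at h1
    rw [hY, Matrix.mulVec_mulVec, Matrix.mulVec_mulVec]
    conv_lhs => rw [h1, Matrix.mul_assoc, O_transpose_mul, Matrix.mul_one]
  have hsq : planeSq Y = planeSq X := by
    funext j
    have h1 := dotProduct_skew_D2_self (Pi.single j 1) Y
    rw [hcomm, mulVec_dotProduct_mulVec, dotProduct_skew_D2_self] at h1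
    simpa [Pi.single_apply] using h1.symm
  have hlast : Real.cos (p.1.1 * lastCoord Y) = Real.cos (p.1.1 * lastCoord X) := by
    by_cases hv : Even v
    · rw [p.2.2.1 hv]; simp
    · have h1 := Nat.not_even_iff.1 hv
      have h2 : 0 < v := by omega
      have h3 : Y ⬝ᵥ Y = X ⬝ᵥ X := mulVec_dotProduct_mulVec k X X
      have h4 : ∀ Z : Fin v → ℝ, Z ⬝ᵥ Z = ∑ j, planeSq Z j + lastCoord Z ^ 2 := by
        intro Z
        rw [dotProduct_eq_planeC]
        congr 1
        · refine Finset.sum_congr rfl fun j _ => ?_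
          rw [← Complex.normSq_eq_conj_mul_self, Complex.ofReal_re, normSq_planeC]
        · have h5 : ∀ s : Fin (v % 2), idx v (Sum.inr s) = ⟨v - 1, by omega⟩ := fun s =>
            Fin.ext (idx_inr_val s)
          rw [lastCoord, dif_pos h2, pow_two]
          simp [h5, h1]
      rw [h4, h4, hsq] at h3
      have h6 : lastCoord Y ^ 2 = lastCoord X ^ 2 := by linarith
      rcases sq_eq_sq_iff_eq_or_eq_neg.1 h6 with h | h
      · rw [h]
      · rw [h, mul_neg, Real.cos_neg]
  rw [thetaRe, thetaRe, hsq, hlast]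

theorem laguerreFun_zero_right (n : ℕ) : laguerreFun n 0 = 1 := by
  simp [laguerreFun, laguerre, Finset.sum_range_succ']

theorem thetaRe_zero (p : Params v) : thetaRe p 0 = 1 := by
  have h1 : lastCoord (0 : Fin v → ℝ) = 0 := by unfold lastCoord; split_ifs <;> rfl
  have h2 : planeSq (0 : Fin v → ℝ) = 0 := by funext j; simp [planeSq]
  simp [thetaRe, h1, h2, laguerreFun_zero_right]

theorem continuous_actA_inv_D2 (Λ : Fin (v / 2) → ℝ) :
    Continuous fun k : O v => actA k⁻¹ (D2 Λ) := by
  have h1 : Continuous fun k : O v => actA k (D2 Λ) :=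
    continuous_actA.comp (continuous_id.prodMk continuous_const)
  have h2 : Continuous fun k : O v => k⁻¹ := continuous_inv
  exact h1.comp h2

theorem Lambda_eq_of_phi_eq {p q : Params v} (h : phi p = phi q) : p.1.2.1 = q.1.2.1 := by
  have hc := fun p : Params v => continuous_actA_inv_D2 p.1.2.1
  have hch : ∀ A : Pairs v → ℝ,
      ∫ k : O v, Complex.exp (Complex.I * ((A ⬝ᵥ actA k⁻¹ (D2 p.1.2.1) : ℝ) : ℂ)) ∂(haarO v) =
      ∫ k : O v, Complex.exp (Complex.I * ((A ⬝ᵥ actA k⁻¹ (D2 q.1.2.1) : ℝ) : ℂ)) ∂(haarO v) := by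
    intro A
    have h1 := phi_add_phi_neg p 0 A
    rw [h, phi_add_phi_neg q 0 A] at h1
    simpa [Matrix.mulVec_zero, thetaRe_zero] using h1.symm
  have key : (haarO v).map (fun k : O v => actA k⁻¹ (D2 p.1.2.1)) =
      (haarO v).map fun k : O v => actA k⁻¹ (D2 q.1.2.1) := by
    refine Measure.ext_of_charFunDual (funext fun L => ?_)
    have hL : ∀ x, L x = (fun i => L (Pi.single i 1)) ⬝ᵥ x := fun x => by
      conv_lhs => rw [pi_eq_sum_univ' x]
      simp [dotProduct, mul_comm]
    have hLm : Measurable fun x => Complex.exp (L x * Complex.I) := by fun_prop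
    rw [charFunDual_apply, charFunDual_apply,
      integral_map (hc p).aemeasurable hLm.aestronglyMeasurable,
      integral_map (hc q).aemeasurable hLm.aestronglyMeasurable]
    have h2 := hch fun i => L (Pi.single i 1)
    simp only [← hL] at h2
    simpa only [mul_comm Complex.I] using h2
  have hS : MeasurableSet (Set.range fun k : O v => actA k⁻¹ (D2 p.1.2.1)) :=
    (isCompact_range (hc p)).isClosed.measurableSet
  have h1 := congrArg (fun ν : Measure (Pairs v → ℝ) =>
    ν (Set.range fun k : O v => actA k⁻¹ (D2 p.1.2.1))) key
  simp only [Measure.map_apply (hc p).measurable hS, Measure.map_apply (hc q).measurable hS,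
    Set.preimage_range, measure_univ] at h1
  have h2 : ((fun k : O v => actA k⁻¹ (D2 q.1.2.1)) ⁻¹'
      Set.range fun k : O v => actA k⁻¹ (D2 p.1.2.1)).Nonempty := by
    refine nonempty_of_measure_ne_zero (μ := haarO v) ?_
    rw [← h1]; exact one_ne_zero
  obtain ⟨k, k', hk⟩ := h2
  dsimp only at hk
  refine (eq_and_fix_of_actA_D2 p.2.2.2 q.2.2.2 (k := k * k'⁻¹) ?_).1
  rw [actA_mul, hk, ← actA_mul, mul_inv_cancel, actA_one]

theorem thetaRe_le_of_phi_eq {p q : Params v} (h : phi p = phi q) (X : Fin v → ℝ) :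
    thetaRe p X ≤ thetaRe q X := by
  by_contra hlt
  rw [not_le] at hlt
  have hΛ := Lambda_eq_of_phi_eq h
  have hmul : Continuous fun k : O v => (k : Matrix (Fin v) (Fin v) ℝ) *ᵥ X :=
    continuous_subtype_val.matrix_mulVec continuous_const
  set W : O v → ℝ := fun k => thetaRe p ((k : Matrix (Fin v) (Fin v) ℝ) *ᵥ X) -
    thetaRe q ((k : Matrix (Fin v) (Fin v) ℝ) *ᵥ X) with hW
  have hWp := (continuous_thetaRe p).comp hmul
  have hWq := (continuous_thetaRe q).comp hmul
  have hWc : Continuous W := hWp.sub hWq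
  have hWi : Integrable W (haarO v) :=
    hWc.integrable_of_hasCompactSupport (HasCompactSupport.of_compactSpace _)
  have hb := continuous_actA_inv_D2 p.1.2.1
  have hzero : ∀ A : Pairs v → ℝ, ∫ k : O v, (W k : ℂ) *
      Complex.exp (Complex.I * ((A ⬝ᵥ actA k⁻¹ (D2 p.1.2.1) : ℝ) : ℂ)) ∂(haarO v) = 0 := by
    intro A
    have h1 := phi_add_phi_neg p X A
    rw [h, phi_add_phi_neg q X A, ← hΛ] at h1
    have h2 := mul_left_cancel₀ two_ne_zero h1
    have he : Continuous fun k : O v =>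
        Complex.exp (Complex.I * ((A ⬝ᵥ actA k⁻¹ (D2 p.1.2.1) : ℝ) : ℂ)) := by
      have : Continuous fun k : O v => A ⬝ᵥ actA k⁻¹ (D2 p.1.2.1) :=
        continuous_const.dotProduct hb
      fun_prop
    simp only [hW, Complex.ofReal_sub, sub_mul]
    rw [integral_sub, h2, sub_self]
    · exact integrable_of_continuous ((Complex.continuous_ofReal.comp hWp).mul he)
    · exact integrable_of_continuous ((Complex.continuous_ofReal.comp hWq).mul he)
  have hW1 : 0 < thetaRe p X - thetaRe q X := by linarith
  obtain ⟨ε, hε, hsub⟩ := exists_dist_lt_subset hb (D2 p.1.2.1)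
    (U := {k | (thetaRe p X - thetaRe q X) / 2 < W k}) (isOpen_lt continuous_const hWc) (by
      intro k hk
      have hk' := (eq_and_fix_of_actA_D2 p.2.2.2 p.2.2.2 (dist_eq_zero.1 hk)).2
      have hk2 : ∀ M, actA k (D2 M) = D2 M := fun M => by
        conv_lhs => rw [← hk' M, ← actA_mul, mul_inv_cancel, actA_one]
      rw [Set.mem_ofPred_eq, hW]
      dsimp only
      rw [thetaRe_stabiliser p hk2, thetaRe_stabiliser q hk2]
      linarith)
  have h0 := setIntegral_preimage_eq_zero (μ := haarO v) hb.measurable hWc.measurable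
    hWi hzero (B := Metric.ball (D2 p.1.2.1) ε)
    Metric.isOpen_ball.measurableSet
  set S := (fun k : O v => actA k⁻¹ (D2 p.1.2.1)) ⁻¹' Metric.ball (D2 p.1.2.1) ε with hS
  have hSo : IsOpen S := Metric.isOpen_ball.preimage hb
  have hpos : 0 < (haarO v).real S := by
    refine ENNReal.toReal_pos (hSo.measure_pos _ ⟨1, ?_⟩).ne' (measure_ne_top _ _)
    simp [hS, actA_one, hε]
  have hle : (haarO v).real S * ((thetaRe p X - thetaRe q X) / 2) ≤ ∫ k in S, W k ∂(haarO v) := by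
    rw [← smul_eq_mul, ← setIntegral_const]
    refine setIntegral_mono_on integrableOn_const
      hWi.integrableOn hSo.measurableSet fun k hk => ?_
    exact le_of_lt (hsub k hk)
  rw [h0] at hle
  have : 0 < (haarO v).real S * ((thetaRe p X - thetaRe q X) / 2) := by positivity
  linarith

theorem phi_injective : Function.Injective (phi : Params v → N v → ℂ) := by
  intro p q h
  have hΛ := Lambda_eq_of_phi_eq h
  have hth : ∀ X, thetaRe p X = thetaRe q X := fun X =>
    le_antisymm (thetaRe_le_of_phi_eq h X) (thetaRe_le_of_phi_eq h.symm X)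
  have hr : p.1.1 = q.1.1 := by
    by_cases hv : Even v
    · rw [p.2.2.1 hv, q.2.2.1 hv]
    · have h1 := Nat.not_even_iff.1 hv
      have hpos : 0 < v := by omega
      have hcos : ∀ x : ℝ, Real.cos (p.1.1 * x) = Real.cos (q.1.1 * x) := by
        intro x
        have h2 : lastCoord (Pi.single (⟨v - 1, by omega⟩ : Fin v) x) = x := by
          simp [lastCoord, hpos]
        have h3 : planeSq (Pi.single (⟨v - 1, by omega⟩ : Fin v) x) = 0 := by
          funext j
          have := j.2
          rw [planeSq, Pi.single_eq_of_ne, Pi.single_eq_of_ne]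
          · simp
          all_goals
            rw [ne_eq, Fin.ext_iff]
            dsimp only
            omega
        have h4 := hth (Pi.single (⟨v - 1, by omega⟩ : Fin v) x)
        simpa [thetaRe, h2, h3, laguerreFun_zero_right] using h4
      have hone : ∀ a b : ℝ, 0 ≤ a → a ≤ b → (∀ x, Real.cos (a * x) = Real.cos (b * x)) →
          a = b := by
        intro a b ha hab hx
        rcases (ha.trans hab).eq_or_lt with hb | hb
        · linarith
        · have h5 := hx (Real.pi / b)
          have h6 : b * (Real.pi / b) = Real.pi := by field_simp
          have h7 : a * (Real.pi / b) = a / b * Real.pi := by ring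
          rw [h6, h7] at h5
          have h8 : a / b ≤ 1 := (div_le_one hb).2 hab
          have h9 := Real.injOn_cos (x₁ := a / b * Real.pi) (x₂ := Real.pi)
            ⟨by positivity, by nlinarith [Real.pi_pos]⟩ ⟨Real.pi_pos.le, le_rfl⟩ h5
          have : a / b = 1 := mul_right_cancel₀ Real.pi_ne_zero (by rw [h9, one_mul])
          exact (div_eq_one_iff_eq hb.ne').1 this
      rcases le_total p.1.1 q.1.1 with h10 | h10
      · exact hone _ _ p.2.1 h10 hcos
      · exact (hone _ _ q.2.1 h10 fun x => (hcos x).symm).symm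
  have hl : p.1.2.2 = q.1.2.2 := by
    funext j
    have hfun : ∀ t : ℝ, 0 ≤ t → laguerreFun (p.1.2.2 j) t = laguerreFun (q.1.2.2 j) t := by
      intro t ht
      have hpos := p.2.2.2.2 j
      set x : ℝ := Real.sqrt (2 * t / p.1.2.1 j)
      have hx : x ^ 2 = 2 * t / p.1.2.1 j := Real.sq_sqrt (by positivity)
      set Y : Fin v → ℝ := Pi.single (⟨2 * j, by omega⟩ : Fin v) x with hY
      have h2 : p.1.1 * lastCoord Y = 0 := by
        by_cases hv : Even v
        · rw [p.2.2.1 hv, zero_mul]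
        · have h1 := Nat.not_even_iff.1 hv
          have hpos : 0 < v := by omega
          rw [lastCoord, dif_pos hpos, hY, Pi.single_eq_of_ne, mul_zero]
          rw [ne_eq, Fin.ext_iff]
          dsimp only
          omega
      have h3 : planeSq Y = Pi.single j (x ^ 2) := by
        funext i
        by_cases hij : i = j
        · subst hij
          rw [planeSq, hY, Pi.single_eq_same, Pi.single_eq_same, Pi.single_eq_of_ne]
          · simp
          rw [ne_eq, Fin.ext_iff]
          dsimp only
          omega
        · have : (i : ℕ) ≠ j := fun h => hij (Fin.ext h)
          rw [planeSq, hY, Pi.single_eq_of_ne hij, Pi.single_eq_of_ne, Pi.single_eq_of_ne]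
          · simp
          all_goals
            rw [ne_eq, Fin.ext_iff]
            dsimp only
            omega
      have h4 := hth Y
      rw [thetaRe, thetaRe, ← hr, h2, ← hΛ, h3] at h4
      have h5 : ∀ l : Fin (v / 2) → ℕ, ∏ i, laguerreFun (l i)
          (p.1.2.1 i / 2 * (Pi.single j (x ^ 2) : Fin (v / 2) → ℝ) i) = laguerreFun (l j) t := by
        intro l
        rw [Finset.prod_eq_single j, Pi.single_eq_same, hx]
        · congr 1; field_simp
        · intro i _ hi
          rw [Pi.single_eq_of_ne hi, mul_zero, laguerreFun_zero_right]
        · intro hj; exact absurd (Finset.mem_univ j) hj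
      rwa [h5, h5, Real.cos_zero, one_mul, one_mul] at h4
    by_contra hne
    have h6 := integral_laguerreFun_mul (p.1.2.2 j) (q.1.2.2 j)
    have h7 := integral_laguerreFun_mul (p.1.2.2 j) (p.1.2.2 j)
    rw [if_neg hne] at h6
    rw [if_pos rfl] at h7
    have h8 : ∫ x in Set.Ioi (0 : ℝ), laguerreFun (p.1.2.2 j) x * laguerreFun (p.1.2.2 j) x =
        ∫ x in Set.Ioi (0 : ℝ), laguerreFun (p.1.2.2 j) x * laguerreFun (q.1.2.2 j) x :=
      setIntegral_congr_fun measurableSet_Ioi fun x hx => by rw [← hfun x (le_of_lt hx)]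
    rw [h6, h7] at h8
    exact one_ne_zero h8
  exact Subtype.ext (Prod.ext hr (Prod.ext hΛ hl))

theorem phiOmega_injective : Function.Injective (phiOmega : Params v → Omega v) := fun p q h =>
  phi_injective (by
    have := congrArg Omega.fn h
    funext n
    have h2 := congrFun this n
    rwa [phiOmega_fn, phiOmega_fn] at h2)

instance : BorelSpace (Omega v) := ⟨rfl⟩

instance : T2Space (Omega v) := inferInstanceAs (T2Space
    {Φ : C(N v, ℂ) // IsSpherical Φ ∧ ∃ M : ℝ, ∀ n, ‖Φ n‖ ≤ M})

instance : SecondCountableTopology (Omega v) :=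
  inferInstanceAs (SecondCountableTopology
    ↥{Φ : C(N v, ℂ) | IsSpherical Φ ∧ ∃ M : ℝ, ∀ n, ‖Φ n‖ ≤ M})

theorem measurableSet_Params (v : ℕ) : MeasurableSet (Params v) := by
  have h1 : MeasurableSet {p : ℝ × (Fin (v / 2) → ℝ) × (Fin (v / 2) → ℕ) | 0 ≤ p.1} :=
    measurableSet_le measurable_const measurable_fst
  have h2 : MeasurableSet {p : ℝ × (Fin (v / 2) → ℝ) × (Fin (v / 2) → ℕ) | Even v → p.1 = 0} := by
    by_cases hv : Even v
    · simp only [hv, true_imp_iff]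
      exact measurableSet_eq_fun measurable_fst measurable_const
    · simp [hv]
  have h3 : MeasurableSet {p : ℝ × (Fin (v / 2) → ℝ) × (Fin (v / 2) → ℕ) | p.2.1 ∈ simplex v} :=
    (isOpen_simplex v).measurableSet.preimage (measurable_fst.comp measurable_snd)
  exact h1.inter (h2.inter h3)

theorem measurableEmbedding_phiOmega : MeasurableEmbedding (phiOmega : Params v → Omega v) := by
  have : StandardBorelSpace (Params v) := (measurableSet_Params v).standardBorel
  exact continuous_phiOmega.measurable.measurableEmbedding phiOmega_injective

/-! ### Plancherel formula for continuous radial functions with compact support -/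

theorem map_plane_volume {c : ℝ} (hc : 0 < c) :
    (volume : Measure (ℝ × ℝ)).map (fun z => c / 2 * (z.1 ^ 2 + z.2 ^ 2)) =
      ENNReal.ofReal (2 * Real.pi / c) • volume.restrict (Set.Ioi (0 : ℝ)) := by
  have hm : Measurable fun z : ℝ × ℝ => c / 2 * (z.1 ^ 2 + z.2 ^ 2) := by fun_prop
  refine Measure.ext_of_lintegral _ fun g hg => ?_
  rw [lintegral_map hg hm, lintegral_smul_measure, smul_eq_mul,
    ← lintegral_comp_polarCoord_symm fun z : ℝ × ℝ => g (c / 2 * (z.1 ^ 2 + z.2 ^ 2)),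
    polarCoord_target]
  have h1 : ∀ p : ℝ × ℝ, c / 2 * ((polarCoord.symm p).1 ^ 2 + (polarCoord.symm p).2 ^ 2) =
      c / 2 * p.1 ^ 2 := fun p => by
    rw [polarCoord_symm_apply, mul_pow, mul_pow, ← mul_add, Real.cos_sq_add_sin_sq, mul_one]
  simp only [h1, smul_eq_mul]
  have himg : (fun r : ℝ => c / 2 * r ^ 2) '' Set.Ioi 0 = Set.Ioi 0 := by
    ext t
    constructor
    · rintro ⟨r, hr, rfl⟩
      have : 0 < r := hr
      exact Set.mem_Ioi.2 (by positivity)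
    · intro ht
      have ht' : 0 < t := ht
      refine ⟨√(2 * t / c), Set.mem_Ioi.2 (Real.sqrt_pos.2 (by positivity)), ?_⟩
      dsimp only
      rw [Real.sq_sqrt (by positivity)]
      field_simp
  have h2 : ∫⁻ t in Set.Ioi (0 : ℝ), g t =
      ∫⁻ r in Set.Ioi (0 : ℝ), ENNReal.ofReal |c * r| * g (c / 2 * r ^ 2) := by
    conv_lhs => rw [← himg]
    refine lintegral_image_eq_lintegral_abs_deriv_mul measurableSet_Ioi (fun r _ => ?_)
      (fun a ha b hb hab => ?_) g
    · have := ((hasDerivAt_pow 2 r).const_mul (c / 2)).hasDerivWithinAt (s := Set.Ioi 0)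
      refine this.congr_deriv ?_
      simp; ring
    · have ha' : 0 < a := ha
      have hb' : 0 < b := hb
      have : a ^ 2 = b ^ 2 := mul_left_cancel₀ (by positivity : c / 2 ≠ 0) hab
      exact (sq_eq_sq₀ ha'.le hb'.le).1 this
  rw [h2, Measure.volume_eq_prod, ← Measure.prod_restrict,
    lintegral_prod _ (by fun_prop)]
  simp only [lintegral_const, Measure.restrict_apply_univ, Real.volume_Ioo]
  rw [lintegral_mul_const _ (by fun_prop), mul_comm, ← lintegral_const_mul _ (by fun_prop),
    ← lintegral_const_mul _ (by fun_prop)]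
  refine setLIntegral_congr_fun measurableSet_Ioi fun r hr => ?_
  have hr' : 0 < r := hr
  rw [abs_of_pos (by positivity), ← mul_assoc, ← mul_assoc, 
    ← ENNReal.ofReal_mul (by linarith [Real.pi_pos]), ← ENNReal.ofReal_mul (by positivity)]
  congr 2
  field_simp
  ring

instance (ι : Type*) [Fintype ι] : SigmaFinite (orthant ι) := by
  unfold orthant; infer_instance

theorem pi_smul_measure {ι : Type*} [Fintype ι] (c : ι → ℝ≥0∞) (hc : ∀ i, c i ≠ ∞)
    (μ : ι → Measure ℝ) [∀ i, SigmaFinite (μ i)] :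
    (Measure.pi fun i => c i • μ i) = (∏ i, c i) • Measure.pi μ := by
  have : ∀ i, SigmaFinite (c i • μ i) := fun i => by
    lift c i to NNReal using hc i with d
    exact inferInstanceAs (SigmaFinite (d • μ i))
  refine Measure.pi_eq fun s _ => ?_
  simp only [Measure.smul_apply, Measure.pi_pi, smul_eq_mul, Finset.prod_mul_distrib]

/-- Coordinates of a vector from its components in the planes and its last component. -/
def merge (z : (Fin (v / 2) → ℝ × ℝ) × (Fin (v % 2) → ℝ)) : Fin v → ℝ := fun a =>
  Sum.elim (fun q : Fin (v / 2) × Fin 2 => if q.2 = 0 then (z.1 q.1).1 else (z.1 q.1).2) z.2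
    ((idx v).symm a)

theorem merge_inl_zero (z : (Fin (v / 2) → ℝ × ℝ) × (Fin (v % 2) → ℝ)) (j : Fin (v / 2)) :
    merge z (idx v (Sum.inl (j, 0))) = (z.1 j).1 := by simp [merge]

theorem merge_inl_one (z : (Fin (v / 2) → ℝ × ℝ) × (Fin (v % 2) → ℝ)) (j : Fin (v / 2)) :
    merge z (idx v (Sum.inl (j, 1))) = (z.1 j).2 := by simp [merge]

theorem merge_inr (z : (Fin (v / 2) → ℝ × ℝ) × (Fin (v % 2) → ℝ)) (s : Fin (v % 2)) :
    merge z (idx v (Sum.inr s)) = z.2 s := by simp [merge]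

theorem continuous_merge :
    Continuous (merge : (Fin (v / 2) → ℝ × ℝ) × (Fin (v % 2) → ℝ) → Fin v → ℝ) := by
  refine continuous_pi fun a => ?_
  unfold merge
  rcases (idx v).symm a with ⟨j, i⟩ | s
  · simp only [Sum.elim_inl]
    split_ifs <;> fun_prop
  · simp only [Sum.elim_inr]
    fun_prop

theorem map_merge : (volume : Measure ((Fin (v / 2) → ℝ × ℝ) × (Fin (v % 2) → ℝ))).map merge =
    volume := by
  symm
  refine Measure.pi_eq fun s hs => ?_
  have hpre : merge ⁻¹' Set.pi Set.univ s =
      (Set.pi Set.univ fun j => s (idx v (Sum.inl (j, 0))) ×ˢ s (idx v (Sum.inl (j, 1)))) ×ˢ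
        (Set.pi Set.univ fun t => s (idx v (Sum.inr t))) := by
    ext z
    simp only [Set.mem_preimage, Set.mem_pi, Set.mem_univ, true_imp_iff, Set.mem_prod]
    constructor
    · intro h
      refine ⟨fun j => ⟨?_, ?_⟩, fun t => ?_⟩
      · rw [← merge_inl_zero]; exact h _
      · rw [← merge_inl_one]; exact h _
      · rw [← merge_inr z]; exact h _
    · rintro ⟨h1, h2⟩ a
      obtain ⟨b, rfl⟩ := (idx v).surjective a
      rcases b with ⟨j, i⟩ | t
      · fin_cases i
        · have := (h1 j).1
          rw [← merge_inl_zero] at this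
          exact this
        · have := (h1 j).2
          rw [← merge_inl_one] at this
          exact this
      · rw [merge_inr]; exact h2 t
  rw [Measure.map_apply continuous_merge.measurable (MeasurableSet.univ_pi hs), hpre,
    Measure.volume_eq_prod, Measure.prod_prod, volume_pi, volume_pi, Measure.pi_pi, Measure.pi_pi,
    ← (idx v).prod_comp, Fintype.prod_sum_type, Fintype.prod_prod_type]
  simp only [Measure.volume_eq_prod, Measure.prod_prod, Fin.prod_univ_two]

theorem planeSq_merge (z : (Fin (v / 2) → ℝ × ℝ) × (Fin (v % 2) → ℝ)) (j : Fin (v / 2)) :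
    planeSq (merge z) j = (z.1 j).1 ^ 2 + (z.1 j).2 ^ 2 := by
  have h0 : (⟨2 * j, by omega⟩ : Fin v) = idx v (Sum.inl (j, 0)) :=
    Fin.ext (by rw [idx_inl_val]; simp)
  have h1 : (⟨2 * j + 1, by omega⟩ : Fin v) = idx v (Sum.inl (j, 1)) :=
    Fin.ext (by rw [idx_inl_val]; simp)
  rw [planeSq, h0, h1, merge_inl_zero, merge_inl_one]

/-- Torus-invariant coordinates: the scaled squared norms of the plane components, and the
remaining coordinates. -/
def torusInv (Λ : Fin (v / 2) → ℝ) (X : Fin v → ℝ) : (Fin (v / 2) → ℝ) × (Fin (v % 2) → ℝ) :=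
  (fun j => Λ j / 2 * planeSq X j, fun s => X (idx v (Sum.inr s)))

theorem continuous_torusInv (Λ : Fin (v / 2) → ℝ) : Continuous (torusInv Λ) := by
  have := fun j => continuous_planeSq (v := v) j
  unfold torusInv
  fun_prop

theorem map_torusInv {Λ : Fin (v / 2) → ℝ} (hΛ : ∀ j, 0 < Λ j) :
    (volume : Measure (Fin v → ℝ)).map (torusInv Λ) =
      ENNReal.ofReal (∏ j, 2 * Real.pi / Λ j) • (orthant (Fin (v / 2))).prod volume := by
  have hq : MeasurePreserving (fun (z : Fin (v / 2) → ℝ × ℝ) j =>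
      Λ j / 2 * ((z j).1 ^ 2 + (z j).2 ^ 2)) volume
      (ENNReal.ofReal (∏ j, 2 * Real.pi / Λ j) • orthant (Fin (v / 2))) := by
    have : ∀ j, SigmaFinite (ENNReal.ofReal (2 * Real.pi / Λ j) •
        volume.restrict (Set.Ioi (0 : ℝ))) := fun j =>
      inferInstanceAs (SigmaFinite ((2 * Real.pi / Λ j).toNNReal • volume.restrict (Set.Ioi (0 : ℝ))))
    have h := measurePreserving_pi (fun _ : Fin (v / 2) => (volume : Measure (ℝ × ℝ)))
      (fun j => ENNReal.ofReal (2 * Real.pi / Λ j) • volume.restrict (Set.Ioi (0 : ℝ)))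
      (f := fun j z => Λ j / 2 * (z.1 ^ 2 + z.2 ^ 2))
      fun j => ⟨by fun_prop, map_plane_volume (hΛ j)⟩
    rw [pi_smul_measure _ (fun _ => ENNReal.ofReal_ne_top),
      ← ENNReal.ofReal_prod_of_nonneg fun j _ => by have := hΛ j; positivity] at h
    exact h
  have hcomp : torusInv Λ ∘ merge = Prod.map (fun (z : Fin (v / 2) → ℝ × ℝ) j =>
      Λ j / 2 * ((z j).1 ^ 2 + (z j).2 ^ 2)) id := by
    funext z
    refine Prod.ext (funext fun j => ?_) (funext fun s => ?_)
    · change Λ j / 2 * planeSq (merge z) j = _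
      rw [planeSq_merge]; rfl
    · exact merge_inr z s
  rw [← map_merge, Measure.map_map (continuous_torusInv Λ).measurable continuous_merge.measurable,
    hcomp, Measure.volume_eq_prod, ← Measure.map_prod_map _ _ hq.measurable measurable_id,
    Measure.map_id, hq.map_eq, Measure.prod_smul_left]

theorem eLpNorm_two_sq {α : Type*} [MeasurableSpace α] {μ : Measure α} (f : α → ℂ) :
    eLpNorm f 2 μ ^ 2 = ∫⁻ x, ‖f x‖ₑ ^ 2 ∂μ := by
  rw [eLpNorm_eq_lintegral_rpow_enorm_toReal (by norm_num) (by norm_num), ← ENNReal.rpow_natCast,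
    ← ENNReal.rpow_mul]
  simp

theorem memLp_two_iff_lintegral {α : Type*} [MeasurableSpace α] {μ : Measure α} {f : α → ℂ}
    (hf : AEStronglyMeasurable f μ) : MemLp f 2 μ ↔ ∫⁻ x, ‖f x‖ₑ ^ 2 ∂μ < ∞ := by
  rw [← eLpNorm_two_sq, ENNReal.pow_lt_top_iff]
  exact ⟨fun h => Or.inl h.2, fun h => ⟨hf, h.resolve_right two_ne_zero⟩⟩

theorem measurable_fourierPi {α ι : Type*} [MeasurableSpace α] [Fintype ι]
    {G : α × (ι → ℝ) → ℂ} (hm : StronglyMeasurable G) :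
    StronglyMeasurable fun q : α × (ι → ℝ) => fourierPi (fun a => G (q.1, a)) q.2 := by
  unfold fourierPi
  refine StronglyMeasurable.integral_prod_right
    (f := fun (q : α × (ι → ℝ)) a => G (q.1, a) * Complex.exp (Complex.I * ((q.2 ⬝ᵥ a : ℝ) : ℂ))) ?_
  have h1 : StronglyMeasurable fun q : (α × (ι → ℝ)) × (ι → ℝ) => G (q.1.1, q.2) :=
    hm.comp_measurable (by fun_prop)
  have h2 : Measurable fun q : (α × (ι → ℝ)) × (ι → ℝ) =>
      Complex.exp (Complex.I * ((q.1.2 ⬝ᵥ q.2 : ℝ) : ℂ)) := by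
    simp only [dotProduct]
    fun_prop
  exact h1.mul h2.stronglyMeasurable

/-- Parseval formula in the second variable of a product. -/
theorem lintegral_fourierPi_prod {α ι : Type*} [MeasurableSpace α] [Fintype ι] {μ : Measure α}
    [SFinite μ] {G : α × (ι → ℝ) → ℂ} (hm : StronglyMeasurable G)
    (h1 : Integrable G (μ.prod volume)) (h2 : MemLp G 2 (μ.prod volume)) :
    ∫⁻ z, ‖G z‖ₑ ^ 2 ∂(μ.prod volume) = ENNReal.ofReal (((2 * Real.pi) ^ Fintype.card ι)⁻¹) *
      ∫⁻ b, ∫⁻ x, ‖fourierPi (fun a => G (x, a)) b‖ₑ ^ 2 ∂μ := by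
  have hGm : Measurable fun z => ‖G z‖ₑ ^ 2 := hm.measurable.enorm.pow_const 2
  have hFm : Measurable fun q : α × (ι → ℝ) => ‖fourierPi (fun a => G (q.1, a)) q.2‖ₑ ^ 2 :=
    (measurable_fourierPi hm).measurable.enorm.pow_const 2
  rw [lintegral_prod _ hGm.aemeasurable]
  have hfin := (memLp_two_iff_lintegral h2.1).1 h2
  rw [lintegral_prod _ hGm.aemeasurable] at hfin
  have hae := ae_lt_top hGm.lintegral_prod_right' hfin.ne
  have e1 : ∀ᵐ x ∂μ, ∫⁻ a, ‖G (x, a)‖ₑ ^ 2 =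
      ENNReal.ofReal (((2 * Real.pi) ^ Fintype.card ι)⁻¹) *
        ∫⁻ b, ‖fourierPi (fun a => G (x, a)) b‖ₑ ^ 2 := by
    filter_upwards [h1.prod_right_ae, hae] with x hx1 hx2
    exact lintegral_fourierPi_sq hx1 ((memLp_two_iff_lintegral hx1.1).2 hx2)
  rw [lintegral_congr_ae e1, lintegral_const_mul _ hFm.lintegral_prod_right',
    lintegral_lintegral_swap hFm.aemeasurable]

/-- A vector with prescribed torus-invariant coordinates. -/
def torusSection (Λ : Fin (v / 2) → ℝ) (y : (Fin (v / 2) → ℝ) × (Fin (v % 2) → ℝ)) : Fin v → ℝ :=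
  merge (fun j => (√(2 * y.1 j / Λ j), 0), y.2)

theorem continuous_torusSection (Λ : Fin (v / 2) → ℝ) : Continuous (torusSection Λ) := by
  refine continuous_merge.comp (Continuous.prodMk (continuous_pi fun j => ?_) continuous_snd)
  fun_prop

theorem planeC_merge (z : (Fin (v / 2) → ℝ × ℝ) × (Fin (v % 2) → ℝ)) (j : Fin (v / 2)) :
    planeC (merge z) j = ⟨(z.1 j).1, (z.1 j).2⟩ := by
  have h0 : (⟨2 * j, by omega⟩ : Fin v) = idx v (Sum.inl (j, 0)) :=
    Fin.ext (by rw [idx_inl_val]; simp)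
  have h1 : (⟨2 * j + 1, by omega⟩ : Fin v) = idx v (Sum.inl (j, 1)) :=
    Fin.ext (by rw [idx_inl_val]; simp)
  rw [planeC, h0, h1, merge_inl_zero, merge_inl_one]

theorem exists_unitC_mul_eq_norm (z : ℂ) : ∃ u : Circle, unitC u * z = ‖z‖ := by
  by_cases hz : z = 0
  · exact ⟨1, by simp [hz]⟩
  · have hn : (‖z‖ : ℂ) ≠ 0 := by simpa using hz
    refine ⟨⟨conj z / ‖z‖, ?_⟩, ?_⟩
    · simp [Submonoid.unitSphere, hz]
    · change conj z / ‖z‖ * z = ‖z‖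
      rw [div_mul_eq_mul_div, mul_comm, Complex.mul_conj, Complex.normSq_eq_norm_sq]
      push_cast
      field_simp

theorem exists_rotX_eq_torusSection {Λ : Fin (v / 2) → ℝ} (hΛ : ∀ j, 0 < Λ j) (X : Fin v → ℝ) :
    ∃ t, torusSection Λ (torusInv Λ X) = rotX t X := by
  choose t ht using fun j => exists_unitC_mul_eq_norm (planeC X j)
  refine ⟨t, ext_planeC (fun j => ?_) fun a ha => ?_⟩
  · rw [planeC_rotX, ht, torusSection, planeC_merge]
    have h1 : 2 * (Λ j / 2 * planeSq X j) / Λ j = ‖planeC X j‖ ^ 2 := by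
      rw [← Complex.normSq_eq_norm_sq, normSq_planeC]
      have := (hΛ j).ne'
      field_simp
    dsimp only [torusInv]
    rw [h1, Real.sqrt_sq (norm_nonneg _)]
    rfl
  · rw [rotX_of_not_lt _ _ _ ha]
    obtain ⟨b, rfl⟩ := (idx v).surjective a
    rcases b with ⟨j, i⟩ | s
    · refine absurd ?_ ha
      rw [idx_inl_val]
      have := j.2
      have := i.2
      omega
    · rw [torusSection, merge_inr]
      rfl

/-- Plancherel formula for torus-invariant functions: Laguerre expansion in the planes, and Fourier
transform in the remaining coordinate. -/
theorem lintegral_torus_invariant {Λ : Fin (v / 2) → ℝ} (hΛ : ∀ j, 0 < Λ j) {F : (Fin v → ℝ) → ℂ}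
    (hF : Continuous F) (hs : HasCompactSupport F) (hinv : ∀ t X, F (rotX t X) = F X) :
    ∫⁻ X, ‖F X‖ₑ ^ 2 = ENNReal.ofReal (((2 * Real.pi) ^ (v % 2))⁻¹) *
      ENNReal.ofReal (∏ j, Λ j / (2 * Real.pi)) * ∫⁻ ρ : Fin (v % 2) → ℝ, ∑' l : Fin (v / 2) → ℕ,
        ‖∫ X, F X * (Complex.exp (Complex.I * ((ρ ⬝ᵥ (torusInv Λ X).2 : ℝ) : ℂ)) *
          lagProd l (torusInv Λ X).1)‖ₑ ^ 2 := by
  set T := torusInv Λ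
  have hT : Continuous T := continuous_torusInv Λ
  set C : ℝ := ∏ j, 2 * Real.pi / Λ j with hC
  have hCpos : 0 < C := Finset.prod_pos fun j _ => by have := hΛ j; positivity
  have hmap : (volume : Measure (Fin v → ℝ)).map T =
      ENNReal.ofReal C • (orthant (Fin (v / 2))).prod volume := map_torusInv hΛ
  have hC0 : ENNReal.ofReal C ≠ 0 := (ENNReal.ofReal_pos.2 hCpos).ne'
  set G : (Fin (v / 2) → ℝ) × (Fin (v % 2) → ℝ) → ℂ := fun y => F (torusSection Λ y) with hG
  have hGc : Continuous G := hF.comp (continuous_torusSection Λ)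
  have hGT : ∀ X, G (T X) = F X := fun X => by
    obtain ⟨t, ht⟩ := exists_rotX_eq_torusSection hΛ X
    rw [hG]
    dsimp only
    rw [ht, hinv]
  have hinteg : ∀ K : (Fin (v / 2) → ℝ) × (Fin (v % 2) → ℝ) → ℂ, Continuous K →
      Integrable (fun y => G y * K y) ((orthant (Fin (v / 2))).prod volume) ∧
      ∫ X, F X * K (T X) = C * ∫ y, G y * K y ∂((orthant (Fin (v / 2))).prod volume) := by
    intro K hK
    have hc : Continuous fun y => G y * K y := hGc.mul hK
    constructor
    · rw [← integrable_smul_measure hC0 ENNReal.ofReal_ne_top, ← hmap,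
        integrable_map_measure hc.aestronglyMeasurable hT.aemeasurable]
      have e : (fun y => G y * K y) ∘ T = fun X => F X * K (T X) := by
        funext X; simp only [Function.comp_apply, hGT]
      rw [e]
      exact (hF.mul (hK.comp hT)).integrable_of_hasCompactSupport hs.mul_right
    · have h1 := integral_map hT.aemeasurable (μ := volume) (f := fun y => G y * K y)
        hc.aestronglyMeasurable
      simp only [hGT] at h1
      rw [← h1, hmap, integral_smul_measure, ENNReal.toReal_ofReal hCpos.le, Complex.real_smul]
  have hG1 : Integrable G ((orthant (Fin (v / 2))).prod volume) := by
    simpa using (hinteg (fun _ => 1) continuous_const).1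
  have hnorm : ∫⁻ X, ‖F X‖ₑ ^ 2 =
      ENNReal.ofReal C * ∫⁻ y, ‖G y‖ₑ ^ 2 ∂((orthant (Fin (v / 2))).prod volume) := by
    have hm : Measurable fun y => ‖G y‖ₑ ^ 2 := hGc.measurable.enorm.pow_const 2
    have := lintegral_map (μ := volume) hm hT.measurable
    simp only [hGT] at this
    rw [← this, hmap, lintegral_smul_measure, smul_eq_mul]
  have hF2 : ∫⁻ X, ‖F X‖ₑ ^ 2 < ∞ :=
    (memLp_two_iff_lintegral hF.aestronglyMeasurable).1 (hF.memLp_of_hasCompactSupport hs)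
  have hG2 : ∫⁻ y, ‖G y‖ₑ ^ 2 ∂((orthant (Fin (v / 2))).prod volume) < ∞ := by
    rw [hnorm] at hF2
    exact ENNReal.lt_top_of_mul_ne_top_right hF2.ne hC0
  have hpars := lintegral_fourierPi_prod hGc.stronglyMeasurable hG1
    ((memLp_two_iff_lintegral hG1.1).2 hG2)
  rw [Fintype.card_fin] at hpars
  have hFm := measurable_fourierPi (hGc.stronglyMeasurable)
  have hae : ∀ᵐ ρ : Fin (v % 2) → ℝ,
      ∫⁻ x, ‖fourierPi (fun a => G (x, a)) ρ‖ₑ ^ 2 ∂(orthant (Fin (v / 2))) < ∞ := by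
    refine ae_lt_top (hFm.measurable.enorm.pow_const 2).lintegral_prod_left' ?_
    rw [hpars] at hG2
    exact (ENNReal.lt_top_of_mul_ne_top_right hG2.ne
      (ENNReal.ofReal_pos.2 (by positivity)).ne').ne
  have hpt : ∀ᵐ ρ : Fin (v % 2) → ℝ,
      ∫⁻ x, ‖fourierPi (fun a => G (x, a)) ρ‖ₑ ^ 2 ∂(orthant (Fin (v / 2))) =
      ENNReal.ofReal (C⁻¹ ^ 2) * ∑' l : Fin (v / 2) → ℕ,
        ‖∫ X, F X * (Complex.exp (Complex.I * ((ρ ⬝ᵥ (T X).2 : ℝ) : ℂ)) *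
          lagProd l (T X).1)‖ₑ ^ 2 := by
    filter_upwards [hae] with ρ hρ
    have hsm : StronglyMeasurable fun x => fourierPi (fun a => G (x, a)) ρ :=
      hFm.comp_measurable (measurable_id.prodMk measurable_const)
    rw [← tsum_integral_lagProd ((memLp_two_iff_lintegral hsm.aestronglyMeasurable).2 hρ),
      ← ENNReal.tsum_mul_left]
    congr 1
    funext l
    have hK : Continuous fun y : (Fin (v / 2) → ℝ) × (Fin (v % 2) → ℝ) =>
        Complex.exp (Complex.I * ((ρ ⬝ᵥ y.2 : ℝ) : ℂ)) * (lagProd l y.1 : ℂ) := by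
      have h1 : Continuous fun y : (Fin (v / 2) → ℝ) × (Fin (v % 2) → ℝ) => ρ ⬝ᵥ y.2 :=
        continuous_const.dotProduct continuous_snd
      have h2 : Continuous fun y : (Fin (v / 2) → ℝ) × (Fin (v % 2) → ℝ) => lagProd l y.1 :=
        (continuous_lagProd l).comp continuous_fst
      fun_prop
    obtain ⟨k1, k2⟩ := hinteg _ hK
    rw [k2, integral_prod _ k1, enorm_mul, mul_pow, ← mul_assoc]
    have h3 : ENNReal.ofReal (C⁻¹ ^ 2) * ‖(C : ℂ)‖ₑ ^ 2 = 1 := by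
      rw [← ofReal_norm, Complex.norm_real, Real.norm_of_nonneg hCpos.le,
        ← ENNReal.ofReal_pow hCpos.le, ← ENNReal.ofReal_mul (by positivity)]
      rw [← mul_pow, inv_mul_cancel₀ hCpos.ne', one_pow, ENNReal.ofReal_one]
    rw [h3, one_mul]
    congr 3
    funext x
    rw [fourierPi, ← integral_mul_const]
    congr 1
    funext a
    ring
  rw [hnorm, hpars, lintegral_congr_ae hpt, lintegral_const_mul' _ _ ENNReal.ofReal_ne_top,
    ← mul_assoc, ← mul_assoc]
  congr 1
  have h4 : ∏ j, Λ j / (2 * Real.pi) = C⁻¹ := by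
    rw [hC, ← Finset.prod_inv_distrib]
    exact Finset.prod_congr rfl fun j _ => by rw [inv_div]
  rw [h4, mul_right_comm, mul_comm, ← ENNReal.ofReal_mul hCpos.le]
  congr 2
  field_simp

/-- The function `Θ^{r,Λ,l}` for arbitrary parameters. -/
def thetaGen (q : ℝ × (Fin (v / 2) → ℝ) × (Fin (v / 2) → ℕ)) (n : N v) : ℂ :=
  Complex.exp (Complex.I * ((q.1 * lastCoord n.X : ℝ) : ℂ)) *
    Complex.exp (Complex.I * ((D2 q.2.1 ⬝ᵥ n.A : ℝ) : ℂ)) *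
    ((∏ j : Fin (v / 2), laguerreFun (q.2.2 j) (q.2.1 j / 2 * planeSq n.X j) : ℝ) : ℂ)

theorem continuous_thetaGen : Continuous
    fun q : (ℝ × (Fin (v / 2) → ℝ) × (Fin (v / 2) → ℕ)) × N v => thetaGen q.1 q.2 := by
  let Q := (ℝ × (Fin (v / 2) → ℝ) × (Fin (v / 2) → ℕ)) × N v
  have hX : Continuous fun q : Q => q.2.X := continuous_X.comp continuous_snd
  have hA : Continuous fun q : Q => q.2.A := continuous_A.comp continuous_snd
  have hr : Continuous fun q : Q => q.1.1 := by fun_prop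
  have hΛ : Continuous fun q : Q => q.1.2.1 := by fun_prop
  have hl : Continuous fun q : Q => q.1.2.2 := by fun_prop
  have hlag : Continuous fun q : ℕ × ℝ => laguerreFun q.1 q.2 :=
    continuous_prod_of_discrete_left.2 fun n => continuous_laguerreFun n
  unfold thetaGen
  have h1 : Continuous fun q : Q => lastCoord q.2.X := continuous_lastCoord.comp hX
  have h2 : Continuous fun q : Q => D2 q.1.2.1 ⬝ᵥ q.2.A :=
    (continuous_D2.comp hΛ).dotProduct hA
  have h3 : ∀ j, Continuous fun q : Q =>
      laguerreFun (q.1.2.2 j) (q.1.2.1 j / 2 * planeSq q.2.X j) := by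
    intro j
    have e1 : Continuous fun q : Q => q.1.2.2 j := (continuous_apply j).comp hl
    have e2 : Continuous fun q : Q => q.1.2.1 j := (continuous_apply j).comp hΛ
    have e3 : Continuous fun q : Q => planeSq q.2.X j := (continuous_planeSq j).comp hX
    have e4 : Continuous fun q : Q => q.1.2.1 j / 2 * planeSq q.2.X j := by fun_prop
    have e5 := hlag.comp (e1.prodMk e4)
    exact e5
  have h4 : Continuous fun q : Q =>
      ∏ j, laguerreFun (q.1.2.2 j) (q.1.2.1 j / 2 * planeSq q.2.X j) :=
    continuous_finsetProd _ fun j _ => h3 j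
  fun_prop

/-- The integral of a function against `Θ^{r,Λ,l}`. -/
def thetaTransform (f : N v → ℂ) (q : ℝ × (Fin (v / 2) → ℝ) × (Fin (v / 2) → ℕ)) : ℂ :=
  ∫ n, f n * thetaGen q n

theorem continuous_thetaTransform {f : N v → ℂ} (hf : CcRad f) :
    Continuous (thetaTransform f) := by
  refine continuous_integral_of_compact_support (k := tsupport f) hf.supp
    (f := fun (q : ℝ × (Fin (v / 2) → ℝ) × (Fin (v / 2) → ℕ)) n => f n * thetaGen q n)
    ((hf.cont.comp continuous_snd).mul continuous_thetaGen) fun q n hn => ?_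
  rw [image_eq_zero_of_notMem_tsupport hn, zero_mul]

theorem pairing_phi_eq_thetaTransform {f : N v → ℂ} (hf : CcRad f) (p : Params v) :
    pairing f (phi p) = thetaTransform f p.1 :=
  pairing_phi hf.integrable hf.radial p

theorem neg_one_mem_O : (-1 : Matrix (Fin v) (Fin v) ℝ) ∈ Matrix.orthogonalGroup (Fin v) ℝ := by
  rw [Matrix.mem_orthogonalGroup_iff]
  simp

theorem thetaTransform_neg {f : N v → ℂ} (hf : CcRad f) (r : ℝ)
    (q : (Fin (v / 2) → ℝ) × (Fin (v / 2) → ℕ)) :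
    thetaTransform f (-r, q) = thetaTransform f (r, q) := by
  let k : O v := ⟨-1, neg_one_mem_O⟩
  rw [thetaTransform, ← integral_act k, thetaTransform]
  congr 1
  funext n
  rw [hf.radial k n]
  have hX : (act k n).X = -n.X := by
    rw [X_act]
    change (-1 : Matrix (Fin v) (Fin v) ℝ) *ᵥ n.X = -n.X
    rw [Matrix.neg_mulVec, Matrix.one_mulVec]
  have hA : (act k n).A = n.A := by
    rw [A_act]
    apply skew_injective
    rw [skew_actA]
    change (-1 : Matrix (Fin v) (Fin v) ℝ) * skew n.A * (-1 : Matrix (Fin v) (Fin v) ℝ)ᵀ = skew n.A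
    simp
  have h1 : ∀ Y : Fin v → ℝ, planeSq (-Y) = planeSq Y := fun Y => by funext j; simp [planeSq]
  have h2 : ∀ Y : Fin v → ℝ, lastCoord (-Y) = -lastCoord Y := fun Y => by
    unfold lastCoord; split_ifs <;> simp
  simp only [thetaGen, hX, hA, h1, h2, neg_mul_neg]

theorem lintegral_last_eq (v : ℕ) {H : ℝ → ℝ≥0∞} (hH : Measurable H) (heven : ∀ r, H (-r) = H r) :
    ∫⁻ ρ : Fin (v % 2) → ℝ, H (∑ s, ρ s) =
      (if Even v then 1 else 2) * ∫⁻ r, H r ∂(rMeasure v) := by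
  by_cases hv : Even v
  · have h0 : v % 2 = 0 := Nat.even_iff.1 hv
    rw [if_pos hv, one_mul, rMeasure, if_pos hv, lintegral_dirac' _ hH]
    have : IsEmpty (Fin (v % 2)) := by rw [h0]; infer_instance
    simp only [Finset.univ_eq_empty, Finset.sum_empty, lintegral_const]
    rw [volume_pi, Measure.pi_of_empty _ default]
    simp
  · have h1 : v % 2 = 1 := Nat.not_even_iff.1 hv
    rw [if_neg hv, rMeasure, if_neg hv]
    have key : ∀ m, m = 1 → ∫⁻ ρ : Fin m → ℝ, H (∑ s, ρ s) = ∫⁻ r, H r := by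
      rintro _ rfl
      simp only [Finset.univ_unique, Finset.sum_singleton]
      exact (volume_preserving_funUnique (Fin 1) ℝ).lintegral_comp hH
    have h2 := key _ h1
    rw [h2, ← lintegral_add_compl H measurableSet_Ici (A := Set.Ici 0), two_mul]
    congr 1
    rw [Set.compl_Ici]
    have h3 := (Measure.measurePreserving_neg (volume : Measure ℝ)).setLIntegral_comp_preimage
      (measurableSet_Iio (a := (0 : ℝ))) hH
    rw [← h3]
    simp only [heven, Set.neg_preimage, Set.neg_Iio, neg_zero]
    exact setLIntegral_congr Ioi_ae_eq_Ici

instance (v : ℕ) : SFinite (rMeasure v) := by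
  unfold rMeasure; split_ifs <;> infer_instance

instance (v : ℕ) (c : ℝ) : SFinite (eta' v c) := by unfold eta'; infer_instance

theorem ae_mem_simplex (v : ℕ) (c : ℝ) : ∀ᵐ Λ ∂(eta v c), Λ ∈ simplex v :=
  (withDensity_absolutelyContinuous _ _).ae_le (ae_restrict_mem (isOpen_simplex v).measurableSet)

theorem ae_mem_Params (v : ℕ) (c : ℝ) :
    ∀ᵐ q ∂((rMeasure v).prod ((eta' v c).prod (Measure.count : Measure (Fin (v / 2) → ℕ)))),
      q ∈ Params v := by
  have h1 : ∀ᵐ r ∂(rMeasure v), r ∈ {r : ℝ | 0 ≤ r ∧ (Even v → r = 0)} := by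
    unfold rMeasure
    split_ifs with hv
    · rw [ae_dirac_eq]
      exact ⟨le_rfl, fun _ => rfl⟩
    · filter_upwards [ae_restrict_mem measurableSet_Ici] with r hr
      exact ⟨hr, fun h => absurd h hv⟩
  have h2 : ∀ᵐ Λ ∂(eta' v c), Λ ∈ simplex v :=
    (withDensity_absolutelyContinuous _ _).ae_le (ae_mem_simplex v c)
  have h3 : ∀ᵐ q ∂((eta' v c).prod (Measure.count : Measure (Fin (v / 2) → ℕ))), q.1 ∈ simplex v :=
    Measure.quasiMeasurePreserving_fst.ae h2
  filter_upwards [Measure.quasiMeasurePreserving_fst.ae h1,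
    Measure.quasiMeasurePreserving_snd.ae h3] with q hq1 hq2
  exact ⟨hq1.1, hq1.2, hq2⟩

theorem lintegral_mMeasure (v : ℕ) (c : ℝ)
    {H : ℝ × (Fin (v / 2) → ℝ) × (Fin (v / 2) → ℕ) → ℝ≥0∞} (hH : Measurable H) :
    ∫⁻ p, H p.1 ∂(mMeasure v c) = ENNReal.ofReal (planchConst v) *
      ∫⁻ Λ, ENNReal.ofReal (∏ j, Λ j) * ∫⁻ r, ∑' l, H (r, Λ, l) ∂(rMeasure v) ∂(eta v c) := by
  rw [mMeasure, lintegral_subtype_comap (measurableSet_Params v), Measure.restrict_smul,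
    lintegral_smul_measure, smul_eq_mul, Measure.restrict_eq_self_of_ae_mem (ae_mem_Params v c),
    lintegral_prod _ hH.aemeasurable]
  congr 1
  have hs : Measurable fun q : ℝ × (Fin (v / 2) → ℝ) => ∑' l, H (q.1, q.2, l) :=
    Measurable.tsum fun l => hH.comp (by fun_prop)
  have h1 : ∀ r, ∫⁻ y, H (r, y) ∂((eta' v c).prod (Measure.count : Measure (Fin (v / 2) → ℕ))) =
      ∫⁻ Λ, ∑' l, H (r, Λ, l) ∂(eta' v c) := fun r => by
    have hm : Measurable fun y : (Fin (v / 2) → ℝ) × (Fin (v / 2) → ℕ) => H (r, y) :=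
      hH.comp (by fun_prop)
    rw [lintegral_prod _ hm.aemeasurable]
    simp only [lintegral_count]
  simp only [h1]
  rw [lintegral_lintegral_swap hs.aemeasurable, eta', lintegral_withDensity_eq_lintegral_mul]
  · rfl
  · have : Continuous fun Λ : Fin (v / 2) → ℝ => ∏ j, Λ j := by fun_prop
    exact this.measurable.ennreal_ofReal
  · exact hs.lintegral_prod_left'

/-- The partial Fourier transform in the central variables. -/
def centralFourier (f : N v → ℂ) (X : Fin v → ℝ) (B : Pairs v → ℝ) : ℂ :=
  fourierPi (fun A => f (N.mk X A)) B

theorem centralFourier_act {f : N v → ℂ} (hf : Radial f) (k : O v) (X : Fin v → ℝ)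
    (B : Pairs v → ℝ) :
    centralFourier f ((k : Matrix (Fin v) (Fin v) ℝ) *ᵥ X) (actA k B) = centralFourier f X B := by
  have hemb : MeasurableEmbedding (actA k : (Pairs v → ℝ) → Pairs v → ℝ) := by
    have hc : ∀ k : O v, Continuous (actA k) := fun k =>
      continuous_actA.comp (continuous_const.prodMk continuous_id)
    let e : (Pairs v → ℝ) ≃ₜ (Pairs v → ℝ) :=
      { toFun := actA k
        invFun := actA k⁻¹
        left_inv := fun a => by rw [← actA_mul, inv_mul_cancel, actA_one]
        right_inv := fun a => by rw [← actA_mul, mul_inv_cancel, actA_one]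
        continuous_toFun := hc k
        continuous_invFun := hc k⁻¹ }
    exact e.measurableEmbedding
  rw [centralFourier, fourierPi, ← (measurePreserving_actA k).integral_comp hemb, centralFourier,
    fourierPi]
  congr 1
  funext A
  rw [actA_dotProduct_actA]
  congr 1
  exact hf k (N.mk X A)

theorem continuous_centralFourier {f : N v → ℂ} (hf : CcRad f) (B : Pairs v → ℝ) :
    Continuous fun X => centralFourier f X B := by
  unfold centralFourier fourierPi
  refine continuous_integral_of_compact_support (k := N.A '' tsupport f)
    (hf.supp.isCompact.image continuous_A)
    (f := fun X A => f (N.mk X A) * Complex.exp (Complex.I * ((B ⬝ᵥ A : ℝ) : ℂ))) ?_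
    fun X A hA => ?_
  · have h1 : Continuous fun q : (Fin v → ℝ) × (Pairs v → ℝ) => f (N.mk q.1 q.2) :=
      hf.cont.comp (continuous_mk continuous_fst continuous_snd)
    have h2 : Continuous fun q : (Fin v → ℝ) × (Pairs v → ℝ) => B ⬝ᵥ q.2 :=
      continuous_const.dotProduct continuous_snd
    exact h1.mul (by fun_prop)
  · rw [image_eq_zero_of_notMem_tsupport fun h => hA ⟨_, h, rfl⟩, zero_mul]

theorem hasCompactSupport_centralFourier {f : N v → ℂ} (hf : CcRad f) (B : Pairs v → ℝ) :
    HasCompactSupport fun X => centralFourier f X B := by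
  refine HasCompactSupport.intro (K := N.X '' tsupport f) (hf.supp.isCompact.image continuous_X)
    fun X hX => ?_
  rw [centralFourier, fourierPi]
  refine integral_eq_zero_of_ae (.of_forall fun A => ?_)
  dsimp only
  rw [image_eq_zero_of_notMem_tsupport fun h => hX ⟨_, h, rfl⟩, zero_mul]
  rfl

theorem sum_mul_lastCoord (ρ : Fin (v % 2) → ℝ) (X : Fin v → ℝ) :
    (∑ s, ρ s) * lastCoord X = ρ ⬝ᵥ fun s => X (idx v (Sum.inr s)) := by
  rw [dotProduct, Finset.sum_mul]
  refine Finset.sum_congr rfl fun s _ => ?_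
  have := s.2
  have hv : 0 < v := by omega
  have h : idx v (Sum.inr s) = ⟨v - 1, by omega⟩ := Fin.ext (idx_inr_val s)
  rw [lastCoord, dif_pos hv, h]

theorem integral_centralFourier {f : N v → ℂ} (hf : CcRad f) (ρ : Fin (v % 2) → ℝ)
    (Λ : Fin (v / 2) → ℝ) (l : Fin (v / 2) → ℕ) :
    ∫ X, centralFourier f X (D2 Λ) *
      (Complex.exp (Complex.I * ((ρ ⬝ᵥ (torusInv Λ X).2 : ℝ) : ℂ)) * lagProd l (torusInv Λ X).1) =
      thetaTransform f (∑ s, ρ s, Λ, l) := by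
  have hθ : Continuous fun n : N v => thetaGen (∑ s, ρ s, Λ, l) n := by
    have h := continuous_thetaGen.comp
      ((continuous_const (y := ((∑ s, ρ s, Λ, l) : ℝ × (Fin (v / 2) → ℝ) × (Fin (v / 2) → ℕ)))).prodMk
        (continuous_id (X := N v)))
    exact h
  have hc : Continuous fun n : N v => f n * thetaGen (∑ s, ρ s, Λ, l) n := hf.cont.mul hθ
  have hi : Integrable (fun n : N v => f n * thetaGen (∑ s, ρ s, Λ, l) n) :=
    hc.integrable_of_hasCompactSupport hf.supp.mul_right
  have h1 := integral_prod (μ := (volume : Measure (Fin v → ℝ)))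
    (ν := (volume : Measure (Pairs v → ℝ))) (f := fun n : N v => f n * thetaGen (∑ s, ρ s, Λ, l) n) hi
  refine Eq.trans ?_ h1.symm
  congr 1
  funext X
  rw [centralFourier, fourierPi, ← integral_mul_const]
  congr 1
  funext A
  change _ = f (N.mk X A) * thetaGen (∑ s, ρ s, Λ, l) (N.mk X A)
  rw [thetaGen]
  dsimp only
  rw [N.X_mk, N.A_mk, sum_mul_lastCoord]
  simp only [torusInv, lagProd]
  ring

theorem card_Pairs (v : ℕ) : Fintype.card (Pairs v) = v * (v - 1) / 2 := by
  rw [Fintype.card_subtype, Finset.card_filter, Fintype.sum_prod_type_right]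
  have : ∀ y : Fin v, ∑ x : Fin v, (if x < y then 1 else 0) = (y : ℕ) := fun y => by
    rw [← Finset.card_filter, ← Fin.card_Iio y]
    congr 1
    ext x
    simp
  simp only [this]
  rw [Fin.sum_univ_eq_sum_range (fun i => i) v, Finset.sum_range_id]

theorem plancherel_of_ccRad {c : ℝ} (hc : IsPolarConst v c) {f : N v → ℂ} (hf : CcRad f) :
    ∫⁻ n, ‖f n‖ₑ ^ 2 = ∫⁻ p, ‖pairing f (phi p)‖ₑ ^ 2 ∂(mMeasure v c) := by
  set J : ℝ × (Fin (v / 2) → ℝ) × (Fin (v / 2) → ℕ) → ℝ≥0∞ := fun q => ‖thetaTransform f q‖ₑ ^ 2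
  have hJ : Measurable J := (continuous_thetaTransform hf).measurable.enorm.pow_const 2
  have hR : ∫⁻ p, ‖pairing f (phi p)‖ₑ ^ 2 ∂(mMeasure v c) = ∫⁻ p, J p.1 ∂(mMeasure v c) := by
    congr 1
    funext p
    rw [pairing_phi_eq_thetaTransform hf]
  rw [hR, lintegral_mMeasure v c hJ]
  set S : (Pairs v → ℝ) → ℝ≥0∞ := fun B => ∫⁻ X, ‖centralFourier f X B‖ₑ ^ 2 with hS
  have hsm := measurable_fourierPi (G := fun q : (Fin v → ℝ) × (Pairs v → ℝ) => f (N.mk q.1 q.2))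
    (hf.cont.comp (continuous_mk continuous_fst continuous_snd)).stronglyMeasurable
  have hSm : Measurable S := (hsm.measurable.enorm.pow_const 2).lintegral_prod_left'
  have h1 : ∫⁻ n, ‖f n‖ₑ ^ 2 = ENNReal.ofReal (((2 * Real.pi) ^ Fintype.card (Pairs v))⁻¹) *
      ∫⁻ B, S B :=
    lintegral_fourierPi_prod (μ := (volume : Measure (Fin v → ℝ)))
      (G := fun q : (Fin v → ℝ) × (Pairs v → ℝ) => f (N.mk q.1 q.2))
      (hf.cont.comp (continuous_mk continuous_fst continuous_snd)).stronglyMeasurable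
      hf.integrable (hf.memLp 2)
  have hSinv : ∀ (k : O v) B, S (actA k B) = S B := fun k B => by
    rw [hS]
    dsimp only
    have hm : Measurable fun X => ‖centralFourier f X (actA k B)‖ₑ ^ 2 :=
      (continuous_centralFourier hf _).measurable.enorm.pow_const 2
    rw [← (measurePreserving_mulVec k).lintegral_comp hm]
    simp only [centralFourier_act hf.radial]
  rw [h1, hc.2 S hSm]
  simp only [hSinv, lintegral_const, measure_univ, mul_one]
  have h2 : ∀ᵐ Λ ∂(eta v c), S (D2 Λ) = ENNReal.ofReal (((2 * Real.pi) ^ (v % 2))⁻¹) *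
      ENNReal.ofReal (((2 * Real.pi) ^ (v / 2))⁻¹) * (if Even v then 1 else 2) *
      (ENNReal.ofReal (∏ j, Λ j) * ∫⁻ r, ∑' l, J (r, Λ, l) ∂(rMeasure v)) := by
    filter_upwards [ae_mem_simplex v c] with Λ hΛ
    rw [hS]
    dsimp only
    rw [lintegral_torus_invariant hΛ.2 (continuous_centralFourier hf _)
      (hasCompactSupport_centralFourier hf _) fun t X => by
        have := centralFourier_act hf.radial (rotO t) X (D2 Λ)
        rwa [rotO_mulVec, actA_rotO_D2] at this]
    simp only [integral_centralFourier hf]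
    have h3 := lintegral_last_eq v (H := fun r => ∑' l, J (r, Λ, l))
      (Measurable.tsum fun l => hJ.comp (by fun_prop)) fun r => by
        simp only [J, thetaTransform_neg hf]
    rw [h3, Finset.prod_div_distrib, Finset.prod_const, Finset.card_univ, Fintype.card_fin,
      div_eq_mul_inv, ENNReal.ofReal_mul (Finset.prod_nonneg fun j _ => (hΛ.2 j).le)]
    ring
  rw [lintegral_congr_ae h2, lintegral_const_mul' _ _ (by
    split_ifs <;> simp [ENNReal.mul_eq_top]), ← mul_assoc]
  congr 1
  rw [card_Pairs, planchConst]
  split_ifs with hv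
  · rw [Nat.even_iff.1 hv, pow_zero, inv_one, ENNReal.ofReal_one, one_mul, mul_one,
      ← ENNReal.ofReal_mul (by positivity), ← mul_inv, ← pow_add]
  · have h2 : (2 : ℝ≥0∞) = ENNReal.ofReal 2 := by simp
    rw [Nat.not_even_iff.1 hv, h2, ← ENNReal.ofReal_mul (by positivity),
      ← ENNReal.ofReal_mul (by positivity), ← ENNReal.ofReal_mul (by positivity)]
    congr 1
    rw [pow_add, pow_add]
    field_simp

/-! ### Spherical transforms determine measures on `Ω` -/

/-- Continuous radial functions. -/
def radialC (v : ℕ) : Submodule ℝ C(N v, ℂ) where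
  carrier := {φ | Radial φ}
  zero_mem' := fun _ _ => rfl
  add_mem' := fun {φ ψ} hφ hψ k n => by
    simp only [ContinuousMap.add_apply, hφ k n, hψ k n]
  smul_mem' := fun a φ hφ k n => by
    simp only [ContinuousMap.smul_apply, hφ k n]

theorem isClosed_radialC : IsClosed (radialC v : Set C(N v, ℂ)) := by
  have : (radialC v : Set C(N v, ℂ)) = ⋂ (k : O v) (n : N v), {φ | φ (act k n) = φ n} := by
    ext φ
    simp only [Set.mem_iInter]
    rfl
  rw [this]
  exact isClosed_iInter fun k => isClosed_iInter fun n =>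
    isClosed_eq (continuous_eval_const _) (continuous_eval_const _)

/-- Radial continuous functions with compact support, as a real vector space. -/
def ccRadial (v : ℕ) : Submodule ℝ (N v → ℂ) where
  carrier := {f | CcRad f}
  zero_mem' := ⟨continuous_const, HasCompactSupport.zero, fun _ _ => rfl⟩
  add_mem' := fun hf hg => hf.add hg
  smul_mem' := fun a f hf => by
    have := hf.smul (a : ℂ)
    have e : ((a : ℂ) • f) = a • f := by funext n; simp
    rwa [e] at this

theorem integrable_mul_of_continuous {f φ : N v → ℂ} (hf : CcRad f) (hφ : Continuous φ) :
    Integrable fun n => f n * φ n :=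
  (hf.cont.mul hφ).integrable_of_hasCompactSupport hf.supp.mul_right

theorem pairing_add_left {f g φ : N v → ℂ} (hf : CcRad f) (hg : CcRad g) (hφ : Continuous φ) :
    pairing (f + g) φ = pairing f φ + pairing g φ := by
  simp only [pairing, Pi.add_apply, add_mul]
  exact integral_add (integrable_mul_of_continuous hf hφ) (integrable_mul_of_continuous hg hφ)

theorem pairing_smul_left (c : ℂ) (f φ : N v → ℂ) : pairing (c • f) φ = c * pairing f φ := by
  simp only [pairing, Pi.smul_apply, smul_eq_mul, mul_assoc, integral_const_mul]

/-- The real part of the pairing, as a bilinear form. -/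
def pairingRe (v : ℕ) : radialC v →ₗ[ℝ] ccRadial v →ₗ[ℝ] ℝ :=
  LinearMap.mk₂ ℝ (fun φ f => (pairing (f : N v → ℂ) (φ : C(N v, ℂ))).re)
    (fun φ ψ f => by
      have hf : CcRad (f : N v → ℂ) := f.2
      rw [← Complex.add_re, pairing, pairing, pairing, ← integral_add
        (integrable_mul_of_continuous hf φ.1.continuous)
        (integrable_mul_of_continuous hf ψ.1.continuous)]
      congr 2
      funext n
      rw [← mul_add]
      rfl)
    (fun c φ f => by
      rw [smul_eq_mul, ← Complex.re_ofReal_mul, pairing, pairing, ← integral_const_mul]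
      congr 2
      funext n
      change (f : N v → ℂ) n * (c • (φ : C(N v, ℂ)) n) = _
      rw [Complex.real_smul]
      ring)
    (fun φ f g => by
      have hf : CcRad (f : N v → ℂ) := f.2
      have hg : CcRad (g : N v → ℂ) := g.2
      rw [← Complex.add_re, Submodule.coe_add, pairing_add_left hf hg φ.1.continuous])
    (fun c φ f => by
      have e : ((c • f : ccRadial v) : N v → ℂ) = (c : ℂ) • (f : N v → ℂ) := by
        funext n; simp
      rw [e, pairing_smul_left, smul_eq_mul, Complex.re_ofReal_mul])

theorem pairingRe_apply (φ : radialC v) (f : ccRadial v) :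
    pairingRe v φ f = (pairing (f : N v → ℂ) (φ : C(N v, ℂ))).re := rfl

theorem pairingRe_ne_zero (φ : radialC v) (h : φ ≠ 0) : pairingRe v φ ≠ 0 := by
  intro h0
  have hne : ((φ : C(N v, ℂ)) : N v → ℂ) ≠ 0 := fun h1 => h (Subtype.ext (DFunLike.ext' h1))
  obtain ⟨f, hf, hf0⟩ := exists_pairing_ne_zero φ.1.continuous φ.2 hne
  have h1 := congrArg (fun L => L (⟨f, hf⟩ : ccRadial v)) h0
  have h2 := congrArg (fun L => L (⟨(-Complex.I) • f, hf.smul _⟩ : ccRadial v)) h0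
  simp only [pairingRe_apply, pairing_smul_left, LinearMap.zero_apply] at h1 h2
  refine hf0 (Complex.ext h1 ?_)
  simpa using h2

instance : MeasurableSpace (radialC v) := borel _
instance : BorelSpace (radialC v) := ⟨rfl⟩

theorem measure_radialC_ext {P P' : Measure (radialC v)} [IsFiniteMeasure P] [IsFiniteMeasure P']
    (h : ∀ f : ccRadial v, ∫ φ, Complex.exp (Complex.I * (pairingRe v φ f : ℂ)) ∂P =
      ∫ φ, Complex.exp (Complex.I * (pairingRe v φ f : ℂ)) ∂P') : P = P' := by
  let : TopologicalSpace (ccRadial v) := ⊥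
  have : DiscreteTopology (ccRadial v) := ⟨rfl⟩
  have : (_root_.uniformity (radialC v)).IsCountablyGenerated := by
    have h : (_root_.uniformity C(N v, ℂ)).IsCountablyGenerated := inferInstance
    exact Filter.comap.isCountablyGenerated _ _
  let : PseudoMetricSpace (radialC v) := UniformSpace.pseudoMetricSpace _
  have : CompleteSpace (radialC v) := isClosed_radialC.completeSpace_coe
  have hL : Continuous fun q : radialC v × ccRadial v => pairingRe v q.1 q.2 := by
    refine continuous_prod_of_discrete_right.2 fun f => ?_
    have hf : CcRad (f : N v → ℂ) := f.2
    exact Complex.continuous_re.comp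
      ((continuous_pairing_continuousMap hf.cont hf.supp).comp continuous_subtype_val)
  refine ext_of_integral_char_eq (V := radialC v) (W := ccRadial v)
    Real.continuous_probChar Real.probChar_ne_one pairingRe_ne_zero hL fun f => ?_
  simpa only [BoundedContinuousFunction.char_apply, Real.probChar_apply, mul_comm _ Complex.I]
    using h f

/-- An element of `Ω` as a continuous radial function. -/
def Omega.toRadialC (φ : Omega v) : radialC v := ⟨Subtype.val φ, (Subtype.property φ).1.radial⟩

theorem measurableSpace_Omega_eq : (inferInstance : MeasurableSpace (Omega v)) =
    MeasurableSpace.comap Omega.toRadialC inferInstance := by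
  have h : (inferInstance : TopologicalSpace (Omega v)) =
      TopologicalSpace.induced Omega.toRadialC inferInstance := by
    change TopologicalSpace.induced _ _ = TopologicalSpace.induced _ (TopologicalSpace.induced _ _)
    rw [induced_compose]
    rfl
  change @borel _ (inferInstance : TopologicalSpace (Omega v)) = _
  rw [h, borel_comap]
  rfl

theorem measurable_toRadialC : Measurable (Omega.toRadialC : Omega v → radialC v) := by
  rw [measurable_iff_comap_le, ← measurableSpace_Omega_eq]

section Separation

variable {Y : Type*} [MeasurableSpace Y] {Ψ : Y → Omega v}

theorem measurable_pairing_comp (hΨ : MeasurableEmbedding Ψ) {g : N v → ℂ} (hg : CcRad g) :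
    Measurable fun y => pairing g (Ψ y).fn :=
  (continuous_pairing hg).measurable.comp hΨ.measurable

theorem measure_ext_of_pairing (hΨ : MeasurableEmbedding Ψ) (μ μ' : Measure Y) [IsFiniteMeasure μ]
    [IsFiniteMeasure μ'] (h : ∀ f : ccRadial v,
      ∫ y, Complex.exp (Complex.I * ((pairing (f : N v → ℂ) (Ψ y).fn).re : ℂ)) ∂μ =
      ∫ y, Complex.exp (Complex.I * ((pairing (f : N v → ℂ) (Ψ y).fn).re : ℂ)) ∂μ') : μ = μ' := by
  have hm : Measurable fun y => (Ψ y).toRadialC := measurable_toRadialC.comp hΨ.measurable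
  have key : μ.map (fun y => (Ψ y).toRadialC) = μ'.map fun y => (Ψ y).toRadialC := by
    refine measure_radialC_ext fun f => ?_
    have hf : CcRad (f : N v → ℂ) := f.2
    have hc : Continuous fun φ : radialC v => Complex.exp (Complex.I * (pairingRe v φ f : ℂ)) := by
      have h1 : Continuous fun φ : radialC v => pairingRe v φ f := Complex.continuous_re.comp
        ((continuous_pairing_continuousMap hf.cont hf.supp).comp continuous_subtype_val)
      fun_prop
    rw [integral_map hm.aemeasurable hc.aestronglyMeasurable,
      integral_map hm.aemeasurable hc.aestronglyMeasurable]
    exact h f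
  ext S hS
  have h1 := hΨ.measurableSet_image.2 hS
  obtain ⟨T, hT, hTS⟩ := measurableSpace_Omega_eq.le _ h1
  have h2 : S = (fun y => (Ψ y).toRadialC) ⁻¹' T := by
    rw [← Set.preimage_image_eq S hΨ.injective, ← hTS]
    rfl
  rw [h2, ← Measure.map_apply hm hT, ← Measure.map_apply hm hT, key]

/-- An integrable function is determined by its integrals against powers of the real parts of the
transforms. -/
theorem ae_eq_zero_of_integral_mul_re_pow (hΨ : MeasurableEmbedding Ψ) {ν : Measure Y}
    {w : Y → ℂ} (hw : Integrable w ν)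
    (h : ∀ g, CcRad g → ∀ n : ℕ, ∫ y, w y * ((pairing g (Ψ y).fn).re : ℂ) ^ n ∂ν = 0) :
    w =ᵐ[ν] 0 := by
  refine ae_eq_zero_of_forall_integral_mul
    (e := fun (f : ccRadial v) y =>
      Complex.exp (Complex.I * ((pairing (f : N v → ℂ) (Ψ y).fn).re : ℂ))) (fun f => ?_)
    (fun f y => ?_) (fun f => ⟨-f, fun y => ?_⟩)
    (fun μ μ' _ _ hμ => measure_ext_of_pairing hΨ μ μ' hμ) hw fun f => ?_
  · have hf : CcRad (f : N v → ℂ) := f.2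
    have := measurable_pairing_comp hΨ hf
    fun_prop
  · rw [mul_comm, Complex.norm_exp_ofReal_mul_I]
  · have e : ((-f : ccRadial v) : N v → ℂ) = (-1 : ℂ) • (f : N v → ℂ) := by
      funext n; simp
    rw [e, pairing_smul_left, ← Complex.exp_conj]
    simp
  · have hf : CcRad (f : N v → ℂ) := f.2
    have hm := measurable_pairing_comp hΨ hf
    set u : Y → ℝ := fun y => (pairing (f : N v → ℂ) (Ψ y).fn).re
    have hum : Measurable u := Complex.measurable_re.comp hm
    set M : ℝ := ∫ n, ‖(f : N v → ℂ) n‖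
    have hub : ∀ y, |u y| ≤ M := fun y =>
      (Complex.abs_re_le_norm _).trans ((Ψ y).norm_pairing_le hf)
    have key := integral_mul_exp_eq_zero (ν := ν) (w := w) (u := u) hw.1 hum.aemeasurable
      (c := 1) one_pos ?_ ?_ 1
    · simpa only [one_mul] using key
    · refine Integrable.mul_bdd (c := Real.exp M) hw.norm (by fun_prop) (.of_forall fun y => ?_)
      rw [Real.norm_of_nonneg (Real.exp_pos _).le, one_mul]
      exact Real.exp_le_exp.2 (hub y)
    · exact h _ hf

/-- An integrable function is determined by its integrals against powers of the transforms. -/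
theorem ae_eq_zero_of_integral_mul_pairing_pow (hΨ : MeasurableEmbedding Ψ) {ν : Measure Y}
    (hadj : ∀ g, CcRad g → ∀ᵐ y ∂ν, pairing (adj g) (Ψ y).fn = conj (pairing g (Ψ y).fn))
    {w : Y → ℂ} (hw : Integrable w ν)
    (h : ∀ g, CcRad g → ∀ n : ℕ, ∫ y, w y * pairing g (Ψ y).fn ^ n ∂ν = 0) : w =ᵐ[ν] 0 := by
  refine ae_eq_zero_of_integral_mul_re_pow hΨ hw fun f hf n => ?_
  rw [← h _ ((hf.add hf.adj).smul (1 / 2)) n]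
  refine integral_congr_ae ?_
  filter_upwards [hadj _ hf] with y hy
  rw [pairing_smul_left, pairing_add_left hf hf.adj (Ψ y).continuous_fn, hy, Complex.add_conj]
  push_cast
  congr 2
  ring

end Separation

/-! ### Uniqueness of the Plancherel measure -/

/-- Finitely or countably many transforms without common zero. -/
theorem exists_countable_cover (v : ℕ) : ∃ T : Set (ccRadial v), T.Countable ∧
    ∀ φ : Omega v, ∃ f ∈ T, pairing (f : N v → ℂ) φ.fn ≠ 0 := by
  have hopen : ∀ f : ccRadial v, IsOpen {φ : Omega v | pairing (f : N v → ℂ) φ.fn ≠ 0} := fun f =>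
    isOpen_ne.preimage (continuous_pairing f.2)
  obtain ⟨T, hT, hU⟩ := TopologicalSpace.isOpen_iUnion_countable _ hopen
  refine ⟨T, hT, fun φ => ?_⟩
  obtain ⟨f, hf, h⟩ := φ.exists_pairing_ne_zero
  have h1 : φ ∈ ⋃ f : ccRadial v, {φ : Omega v | pairing (f : N v → ℂ) φ.fn ≠ 0} :=
    Set.mem_iUnion.2 ⟨⟨f, hf⟩, h⟩
  rw [← hU] at h1
  simpa using h1

section Abstract

variable {Y : Type*} [MeasurableSpace Y] {Ψ : Y → Omega v} {ν : Measure Y}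

theorem ae_eq_zero_of_forall_mul_pairing {w : Y → ℂ}
    (h : ∀ f, CcRad f → ∀ᵐ y ∂ν, w y * pairing f (Ψ y).fn = 0) : w =ᵐ[ν] 0 := by
  obtain ⟨T, hT, hcov⟩ := exists_countable_cover v
  have : ∀ᵐ y ∂ν, ∀ f ∈ T, w y * pairing (f : N v → ℂ) (Ψ y).fn = 0 :=
    (ae_ball_iff hT).2 fun f _ => h f f.2
  filter_upwards [this] with y hy
  obtain ⟨f, hf, hne⟩ := hcov (Ψ y)
  exact (mul_eq_zero.1 (hy f hf)).resolve_right hne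

/-- The Plancherel formula on the convolution algebra of radial functions. -/
def IsPlancherel (Ψ : Y → Omega v) (ν : Measure Y) : Prop :=
  ∀ f, CcRad f → ∫⁻ n, ‖f n‖ₑ ^ 2 = ∫⁻ y, ‖pairing f (Ψ y).fn‖ₑ ^ 2 ∂ν

theorem IsPlancherel.memLp (hΨ : MeasurableEmbedding Ψ) (hν : IsPlancherel Ψ ν)
    {f : N v → ℂ} (hf : CcRad f) :
    MemLp (fun y => pairing f (Ψ y).fn) 2 ν := by
  rw [memLp_two_iff_lintegral (measurable_pairing_comp hΨ hf).aestronglyMeasurable, ← hν f hf,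
    ← memLp_two_iff_lintegral hf.cont.aestronglyMeasurable]
  exact hf.memLp 2

theorem IsPlancherel.norm_toLp (hΨ : MeasurableEmbedding Ψ) (hν : IsPlancherel Ψ ν)
    {f : N v → ℂ} (hf : CcRad f) :
    ‖(hν.memLp hΨ hf).toLp _‖ = ‖(hf.memLp 2).toLp _‖ := by
  rw [Lp.norm_toLp, Lp.norm_toLp]
  congr 1
  have h := hν f hf
  rw [← eLpNorm_two_sq, ← eLpNorm_two_sq] at h
  exact (ENNReal.pow_right_strictMono two_ne_zero).injective h.symm

theorem IsPlancherel.integral_mul_conj (hΨ : MeasurableEmbedding Ψ) (hν : IsPlancherel Ψ ν)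
    {f h : N v → ℂ} (hf : CcRad f) (hh : CcRad h) :
    ∫ n, f n * conj (h n) = ∫ y, pairing f (Ψ y).fn * conj (pairing h (Ψ y).fn) ∂ν := by
  have key : inner ℂ ((hh.memLp 2).toLp h) ((hf.memLp 2).toLp f) =
      inner ℂ ((hν.memLp hΨ hh).toLp _) ((hν.memLp hΨ hf).toLp _) := by
    have hlin : ∀ c : ℂ, ‖(hh.memLp 2).toLp h + c • (hf.memLp 2).toLp f‖ =
        ‖(hν.memLp hΨ hh).toLp _ + c • (hν.memLp hΨ hf).toLp _‖ := by
      intro c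
      have h1 := hν.norm_toLp hΨ (hh.add (hf.smul c))
      rw [← MemLp.toLp_const_smul, ← MemLp.toLp_const_smul, ← MemLp.toLp_add, ← MemLp.toLp_add]
      refine Eq.trans h1.symm ?_
      congr 2
      funext y
      rw [pairing_add_left hh (hf.smul c) (Ψ y).continuous_fn, pairing_smul_left]
      rfl
    have h1 := hlin 1
    have h2 := hlin (-1)
    have h3 := hlin Complex.I
    have h4 := hlin (-Complex.I)
    simp only [one_smul, neg_smul, ← sub_eq_add_neg] at h1 h2 h3 h4
    rw [inner_eq_sum_norm_sq_div_four, inner_eq_sum_norm_sq_div_four (𝕜 := ℂ) (E := Lp ℂ 2 ν)]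
    simp only [RCLike.I_to_complex] at *
    rw [h1, h2, h3, h4]
  rw [L2.inner_def, L2.inner_def] at key
  refine Eq.trans (integral_congr_ae ?_) (key.trans (integral_congr_ae ?_))
  · filter_upwards [(hh.memLp 2).coeFn_toLp, (hf.memLp 2).coeFn_toLp] with n h1 h2
    rw [h1, h2, RCLike.inner_apply]
  · filter_upwards [(hν.memLp hΨ hh).coeFn_toLp, (hν.memLp hΨ hf).coeFn_toLp] with n h1 h2
    rw [h1, h2, RCLike.inner_apply]

theorem IsPlancherel.integrable_mul_conj (hΨ : MeasurableEmbedding Ψ) (hν : IsPlancherel Ψ ν)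
    {f h : N v → ℂ} (hf : CcRad f) (hh : CcRad h) :
    Integrable (fun y => pairing f (Ψ y).fn * conj (pairing h (Ψ y).fn)) ν :=
  (hν.memLp hΨ hf).integrable_mul (hν.memLp hΨ hh).star

/-- The transforms form an involutive algebra, almost everywhere. -/
theorem IsPlancherel.pairing_adj (hΨ : MeasurableEmbedding Ψ) (hν : IsPlancherel Ψ ν)
    {g : N v → ℂ} (hg : CcRad g) :
    ∀ᵐ y ∂ν, pairing (adj g) (Ψ y).fn = conj (pairing g (Ψ y).fn) := by
  set D : Y → ℂ := fun y => pairing g (Ψ y).fn - conj (pairing (adj g) (Ψ y).fn) with hD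
  have hDm : Measurable D := (measurable_pairing_comp hΨ hg).sub
    (Complex.continuous_conj.measurable.comp (measurable_pairing_comp hΨ hg.adj))
  have hDb : ∀ y, ‖D y‖ ≤ (∫ n, ‖g n‖) + ∫ n, ‖adj g n‖ := fun y =>
    (norm_sub_le _ _).trans (add_le_add ((Ψ y).norm_pairing_le hg)
      (by rw [RCLike.norm_conj]; exact (Ψ y).norm_pairing_le hg.adj))
  have hinteg : ∀ f h, CcRad f → CcRad h →
      Integrable (fun y => pairing f (Ψ y).fn * conj (pairing h (Ψ y).fn) * D y) ν :=
    fun f h hf hh => (hν.integrable_mul_conj hΨ hf hh).mul_bdd hDm.aestronglyMeasurable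
      (.of_forall hDb)
  have hzero : ∀ f h, CcRad f → CcRad h →
      ∫ y, pairing f (Ψ y).fn * conj (pairing h (Ψ y).fn) * D y ∂ν = 0 := by
    intro f h hf hh
    have h1 := hf.inner_conv hg hh
    rw [hν.integral_mul_conj hΨ (hf.conv hg) hh, hν.integral_mul_conj hΨ hf (hh.conv hg.adj),
      ← sub_eq_zero, ← integral_sub (hν.integrable_mul_conj hΨ (hf.conv hg) hh)
        (hν.integrable_mul_conj hΨ hf (hh.conv hg.adj))] at h1
    rw [← h1]
    congr 1
    funext y
    rw [(Ψ y).pairing_conv hf hg, (Ψ y).pairing_conv hh hg.adj, map_mul, hD]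
    ring
  have hae : ∀ f, CcRad f → ∀ᵐ y ∂ν, D y * pairing f (Ψ y).fn = 0 := by
    intro f hf
    have hw := ae_eq_zero_of_integral_mul_re_pow hΨ (hinteg f f hf hf) fun s hs n => by
      have e : ∀ y, pairing f (Ψ y).fn * conj (pairing f (Ψ y).fn) * D y *
          ((pairing s (Ψ y).fn).re : ℂ) ^ n =
          ∑ m ∈ Finset.range (n + 1), (1 / 2) ^ n * (n.choose m : ℂ) *
            (pairing (convPow s f m) (Ψ y).fn *
              conj (pairing (convPow s f (n - m)) (Ψ y).fn) * D y) := by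
        intro y
        have : ((pairing s (Ψ y).fn).re : ℂ) =
            (1 / 2) * (pairing s (Ψ y).fn + conj (pairing s (Ψ y).fn)) := by
          rw [Complex.add_conj]; push_cast; ring
        rw [this, mul_pow, add_pow, Finset.mul_sum, Finset.mul_sum]
        refine Finset.sum_congr rfl fun m _ => ?_
        rw [(Ψ y).pairing_convPow hs hf, (Ψ y).pairing_convPow hs hf, map_mul, map_pow]
        ring
      simp only [e]
      rw [integral_finsetSum _ fun m _ => (hinteg _ _ (hs.convPow hf m)
        (hs.convPow hf (n - m))).const_mul _]
      refine Finset.sum_eq_zero fun m _ => ?_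
      rw [integral_const_mul, hzero _ _ (hs.convPow hf m) (hs.convPow hf (n - m)), mul_zero]
    filter_upwards [hw] with y hy
    have hy' : pairing f (Ψ y).fn * conj (pairing f (Ψ y).fn) * D y = 0 := hy
    rw [mul_eq_zero, Complex.mul_conj] at hy'
    rcases hy' with h | h
    · rw [Complex.ofReal_eq_zero, Complex.normSq_eq_zero] at h
      rw [h, mul_zero]
    · rw [h, zero_mul]
  filter_upwards [ae_eq_zero_of_forall_mul_pairing hae] with y hy
  have h1 : pairing g (Ψ y).fn - conj (pairing (adj g) (Ψ y).fn) = 0 := hy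
  rw [sub_eq_zero.1 h1, Complex.conj_conj]

end Abstract

theorem integral_exp_eq_of_moments {Y : Type*} [MeasurableSpace Y] {ρ ρ' : Measure Y}
    [IsFiniteMeasure ρ] [IsFiniteMeasure ρ'] {u : Y → ℝ} (hu : Measurable u) {M : ℝ}
    (hM : ∀ y, |u y| ≤ M) (h : ∀ n : ℕ, ∫ y, (u y : ℂ) ^ n ∂ρ = ∫ y, (u y : ℂ) ^ n ∂ρ') :
    ∫ y, Complex.exp (Complex.I * (u y : ℂ)) ∂ρ = ∫ y, Complex.exp (Complex.I * (u y : ℂ)) ∂ρ' := by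
  have key : ∀ (ρ : Measure Y) [IsFiniteMeasure ρ],
      HasSum (fun n : ℕ => Complex.I ^ n / n.factorial * ∫ y, (u y : ℂ) ^ n ∂ρ)
        (∫ y, Complex.exp (Complex.I * (u y : ℂ)) ∂ρ) := by
    intro ρ _
    have hs : ∀ _ : Y, Summable fun n : ℕ => M ^ n / n.factorial := fun _ =>
      Real.summable_pow_div_factorial M
    have := hasSum_integral_of_dominated_convergence (μ := ρ)
      (F := fun (n : ℕ) y => Complex.I ^ n / n.factorial * (u y : ℂ) ^ n)
      (f := fun y => Complex.exp (Complex.I * (u y : ℂ)))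
      (fun (n : ℕ) _ => M ^ n / n.factorial)
      (fun n => (by fun_prop : Measurable fun y =>
        Complex.I ^ n / n.factorial * (u y : ℂ) ^ n).aestronglyMeasurable)
      (fun n => .of_forall fun y => by
        rw [norm_mul, norm_div, norm_pow, Complex.norm_I, one_pow, norm_pow, Complex.norm_real,
          Complex.norm_natCast, div_mul_eq_mul_div, one_mul]
        have := hM y
        gcongr
        exact this)
      (.of_forall hs) (integrable_const _) (.of_forall fun y => by
        have h1 := NormedSpace.expSeries_div_hasSum_exp (𝔸 := ℂ) (Complex.I * (u y : ℂ))
        rw [← Complex.exp_eq_exp_ℂ] at h1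
        simpa only [mul_pow, mul_div_right_comm] using h1)
    simpa only [integral_const_mul] using this
  refine (key ρ).unique ?_
  have h2 := key ρ'
  simpa only [h] using h2

theorem isPlancherel_unique {μ μ' : Measure (Omega v)} (hμ : IsPlancherel id μ)
    (hμ' : IsPlancherel id μ') : μ = μ' := by
  obtain ⟨T, hT, hcov⟩ := exists_countable_cover v
  have hid : MeasurableEmbedding (id : Omega v → Omega v) := MeasurableEmbedding.id
  have : Countable T := hT
  refine (Measure.ext_iff_of_iUnion_eq_univ
    (s := fun f : T => {φ : Omega v | pairing (f : N v → ℂ) φ.fn ≠ 0}) ?_).2 fun f => ?_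
  · refine Set.eq_univ_of_forall fun φ => ?_
    obtain ⟨f, hf, h⟩ := hcov φ
    exact Set.mem_iUnion.2 ⟨⟨f, hf⟩, h⟩
  have hf : CcRad (f : N v → ℂ) := f.1.2
  have hfm : Measurable fun φ : Omega v => pairing (f : N v → ℂ) φ.fn :=
    measurable_pairing_comp hid hf
  set q : Omega v → ℝ≥0∞ := fun φ => ‖pairing (f : N v → ℂ) φ.fn‖ₑ ^ 2 with hq
  have hqm : Measurable q := hfm.enorm.pow_const 2
  have hqt : ∀ φ, q φ < ∞ := fun φ => ENNReal.pow_lt_top enorm_lt_top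
  have hfin : ∀ μ : Measure (Omega v), IsPlancherel id μ → IsFiniteMeasure (μ.withDensity q) :=
    fun μ hμ => isFiniteMeasure_withDensity
      ((memLp_two_iff_lintegral hfm.aestronglyMeasurable).1 (hμ.memLp hid hf)).ne
  have hmom : ∀ μ : Measure (Omega v), IsPlancherel id μ → ∀ g, CcRad g → ∀ n : ℕ,
      ∫ φ, ((pairing g φ.fn).re : ℂ) ^ n ∂(μ.withDensity q) =
        ∫ x, convPow ((1 / 2 : ℂ) • (g + adj g)) f n x * conj ((f : N v → ℂ) x) := by
    intro μ hμ g hg n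
    have hs := (hg.add hg.adj).smul (1 / 2)
    rw [integral_withDensity_eq_integral_toReal_smul₀ hqm.aemeasurable (.of_forall hqt),
      hμ.integral_mul_conj hid (hs.convPow hf n) hf]
    refine integral_congr_ae ?_
    filter_upwards [hμ.pairing_adj hid hg] with φ hφ
    rw [Omega.pairing_convPow _ hs hf, pairing_smul_left,
      pairing_add_left hg hg.adj (id φ).continuous_fn, hφ, Complex.add_conj]
    simp only [id, hq, ENNReal.toReal_pow, toReal_enorm, Complex.real_smul]
    rw [mul_right_comm, Complex.mul_conj, Complex.normSq_eq_norm_sq]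
    push_cast
    ring
  have hρ : μ.withDensity q = μ'.withDensity q := by
    have := hfin μ hμ
    have := hfin μ' hμ'
    refine measure_ext_of_pairing hid _ _ fun g => ?_
    have hg : CcRad (g : N v → ℂ) := g.2
    exact integral_exp_eq_of_moments 
      (u := fun φ : Omega v => (pairing (g : N v → ℂ) φ.fn).re)
      (Complex.measurable_re.comp (measurable_pairing_comp hid hg))
      (fun φ => (Complex.abs_re_le_norm _).trans (φ.norm_pairing_le hg))
      fun n => (hmom μ hμ g hg n).trans (hmom μ' hμ' g hg n).symm
  set S := {φ : Omega v | pairing (f : N v → ℂ) φ.fn ≠ 0} with hS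
  have hSm : MeasurableSet S := hfm (measurableSet_singleton 0).compl
  have hback : ∀ μ : Measure (Omega v), μ.restrict S =
      ((μ.withDensity q).restrict S).withDensity fun φ => (q φ)⁻¹ := by
    intro μ
    rw [restrict_withDensity hSm]
    symm
    refine withDensity_inv_same hqm ?_ (.of_forall fun φ => (hqt φ).ne)
    filter_upwards [ae_restrict_mem hSm] with φ hφ
    have hφ' : pairing (f : N v → ℂ) φ.fn ≠ 0 := hφ
    simpa [hq] using hφ'
  rw [hback μ, hback μ', hρ]

/-! ### Square-integrable radial functions -/

theorem exists_ccRad_average {g : N v → ℂ} (hg : Continuous g) (hs : HasCompactSupport g) :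
    CcRad (fun n => ∫ k : O v, g (act k n) ∂(haarO v)) ∧
    ∀ u : N v → ℂ, Radial u → LocallyIntegrable u →
      ∫ n, u n * g n = ∫ n, u n * ∫ k : O v, g (act k n) ∂(haarO v) := by
  have hac : Continuous fun q : N v × O v => g (act q.2 q.1) :=
    hg.comp (continuous_act_comp continuous_snd continuous_fst)
  set K : Set (N v) := (fun q : O v × N v => act q.1⁻¹ q.2) '' (Set.univ ×ˢ tsupport g) with hK
  have hinv : Continuous fun q : O v × N v => q.1⁻¹ := by
    have h1 : Continuous fun k : O v => k⁻¹ := continuous_inv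
    exact h1.comp continuous_fst
  have hKc : IsCompact K :=
    (isCompact_univ.prod hs.isCompact).image (continuous_act_comp hinv continuous_snd)
  have hKz : ∀ k : O v, ∀ n, n ∉ K → g (act k n) = 0 := fun k n hn => by
    refine image_eq_zero_of_notMem_tsupport fun h => hn ⟨(k, act k n), ⟨Set.mem_univ _, h⟩, ?_⟩
    dsimp only
    rw [act_act, inv_mul_cancel, act_one]
  refine ⟨⟨?_, ?_, fun k' n => ?_⟩, fun u hu hul => ?_⟩
  · exact continuous_integral_of_compact_support (k := Set.univ) isCompact_univ
      (f := fun (n : N v) (k : O v) => g (act k n)) hac fun _ _ h => absurd (Set.mem_univ _) h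
  · refine HasCompactSupport.intro hKc fun n hn => ?_
    simp only [hKz _ n hn, integral_zero]
  · simp only [act_act]
    exact integral_mul_right_eq_self (fun k : O v => g (act k n)) k'
  · have hKm := hKc.measurableSet
    have hi : Integrable (K.indicator u) :=
      (integrable_indicator_iff hKm).2 (hul.integrableOn_isCompact hKc)
    obtain ⟨C, hC⟩ := hs.exists_bound_of_continuous hg
    have hprod : Integrable (fun q : N v × O v => K.indicator u q.1 * g (act q.2 q.1))
        (volume.prod (haarO v)) :=
      (hi.comp_fst (haarO v)).mul_bdd hac.aestronglyMeasurable (.of_forall fun q => hC _)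
    have e : ∀ (k : O v) n, u n * g (act k n) = K.indicator u n * g (act k n) := fun k n => by
      by_cases hn : n ∈ K
      · rw [Set.indicator_of_mem hn]
      · rw [hKz k n hn, mul_zero, mul_zero]
    simp only [← integral_const_mul, e]
    rw [integral_integral_swap hprod]
    have h1 : ∀ k : O v, ∫ n, K.indicator u n * g (act k n) = ∫ n, u n * g n := fun k => by
      rw [← integral_act k fun n => u n * g n]
      congr 1
      funext n
      rw [← e, hu k n]
    simp only [h1, integral_const, probReal_univ, one_smul]

/-- A locally integrable radial function is determined by its integrals against continuous radial
functions with compact support. -/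
theorem ae_eq_zero_of_integral_mul_ccRad {u : N v → ℂ} (hu : Radial u) (hul : LocallyIntegrable u)
    (h : ∀ g, CcRad g → ∫ n, u n * g n = 0) : u =ᵐ[volume] 0 := by
  refine ae_eq_zero_of_integral_contDiff_smul_eq_zero (E := (Fin v → ℝ) × (Pairs v → ℝ))
    (μ := volume) (f := u) hul fun g hg hs => ?_
  have hgc : Continuous fun n : N v => (g n : ℂ) := Complex.continuous_ofReal.comp hg.continuous
  have hgs : HasCompactSupport fun n : N v => (g n : ℂ) :=
    HasCompactSupport.comp_left (g := fun x : ℝ => (x : ℂ)) hs Complex.ofReal_zero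
  obtain ⟨h1, h2⟩ := exists_ccRad_average hgc hgs
  have h3 := (h2 u hu hul).trans (h _ h1)
  rw [← h3]
  congr 1
  funext n
  rw [Complex.real_smul, mul_comm]

theorem isClosed_radialL2 : IsClosed (radialL2 v : Set (Lp ℂ 2 (volume : Measure (N v)))) := by
  refine isClosed_of_closure_subset fun f hf => ?_
  obtain ⟨s, hs, hlim⟩ := mem_closure_iff_seq_limit.1 hf
  choose g hgr hg using hs
  have h1 := tendstoInMeasure_of_tendsto_Lp hlim
  obtain ⟨ns, -, hns⟩ := h1.exists_seq_tendsto_ae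
  refine ⟨fun n => Filter.limUnder Filter.atTop fun i => g (ns i) n, fun k n => ?_, ?_⟩
  · simp only [hgr _ k n]
  · have h2 : ∀ᵐ n, ∀ i, s i n = g i n := ae_all_iff.2 hg
    filter_upwards [hns, h2] with n hn h2n
    simp only [h2n] at hn
    exact hn.limUnder_eq.symm

instance : CompleteSpace (radialL2 v) := isClosed_radialL2.completeSpace_coe

/-- Radial continuous functions with compact support. -/
def ccSpace (v : ℕ) : Submodule ℂ (N v → ℂ) where
  carrier := {f | CcRad f}
  zero_mem' := ⟨continuous_const, HasCompactSupport.zero, fun _ _ => rfl⟩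
  add_mem' := fun hf hg => hf.add hg
  smul_mem' := fun a _ hf => hf.smul a

theorem CcRad.conj {f : N v → ℂ} (hf : CcRad f) : CcRad fun n => conj (f n) := by
  have h := hf.check.adj
  have e : FreeNilpotent.adj (FreeNilpotent.check f) = fun n => (starRingEnd ℂ) (f n) := by
    funext n
    simp [FreeNilpotent.adj, FreeNilpotent.check]
  rwa [e] at h

/-- The inclusion of `C_c(N)^♮` into `L²(N)^♮`. -/
def ccToL2 (v : ℕ) : ccSpace v →ₗ[ℂ] radialL2 v where
  toFun f := ⟨(CcRad.memLp f.2 2).toLp f, f, CcRad.radial f.2, (CcRad.memLp f.2 2).coeFn_toLp⟩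
  map_add' _ _ := rfl
  map_smul' _ _ := rfl

theorem ccToL2_coe (f : ccSpace v) : ((ccToL2 v f : Lp ℂ 2 (volume : Measure (N v))) : N v → ℂ)
    =ᵐ[volume] f := (CcRad.memLp f.2 2).coeFn_toLp

theorem denseRange_of_inner_eq_zero {E H : Type*} [AddCommGroup E] [Module ℂ E]
    [NormedAddCommGroup H] [InnerProductSpace ℂ H] [CompleteSpace H] (e : E →ₗ[ℂ] H)
    (h : ∀ x : H, (∀ y, inner ℂ (e y) x = 0) → x = 0) : DenseRange e := by
  have h1 : (LinearMap.range e).topologicalClosure = ⊤ := by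
    rw [Submodule.topologicalClosure_eq_top_iff, Submodule.eq_bot_iff]
    intro x hx
    exact h x fun y => (Submodule.mem_orthogonal _ _).1 hx _ (LinearMap.mem_range_self e y)
  have h2 := Submodule.dense_iff_topologicalClosure_eq_top.2 h1
  exact h2

theorem locallyIntegrable_Lp (f : Lp ℂ 2 (volume : Measure (N v))) :
    LocallyIntegrable f := (Lp.memLp f).locallyIntegrable (by norm_num)

theorem denseRange_ccToL2 : DenseRange (ccToL2 v) := by
  refine denseRange_of_inner_eq_zero _ fun f hf => ?_
  obtain ⟨g, hgr, hg⟩ := f.2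
  have h0 : g =ᵐ[volume] 0 := by
    refine ae_eq_zero_of_integral_mul_ccRad hgr
      ((locallyIntegrable_Lp (f : Lp ℂ 2 (volume : Measure (N v)))).congr hg) fun h hh => ?_
    have h1 := hf ⟨_, hh.conj⟩
    rw [Submodule.coe_inner, L2.inner_def] at h1
    rw [← h1]
    refine integral_congr_ae ?_
    filter_upwards [hg, ccToL2_coe ⟨_, hh.conj⟩] with n h2 h3
    rw [h2, h3, RCLike.inner_apply, Complex.conj_conj]
  exact Subtype.ext ((Lp.eq_zero_iff_ae_eq_zero).2 (hg.trans h0))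

section Abstract

variable {Y : Type*} [MeasurableSpace Y] {Ψ : Y → Omega v} {ν : Measure Y}

/-- The spherical transform on `C_c(N)^♮`. -/
def IsPlancherel.transform (hΨ : MeasurableEmbedding Ψ) (hν : IsPlancherel Ψ ν) :
    ccSpace v →ₗ[ℂ] Lp ℂ 2 ν where
  toFun f := (hν.memLp hΨ f.2).toLp _
  map_add' f g := by
    rw [← MemLp.toLp_add]
    congr 1
    funext y
    exact pairing_add_left f.2 g.2 (Ψ y).continuous_fn
  map_smul' c f := by
    rw [RingHom.id_apply, ← MemLp.toLp_const_smul]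
    congr 1
    funext y
    exact pairing_smul_left c _ _

theorem IsPlancherel.transform_coe (hΨ : MeasurableEmbedding Ψ) (hν : IsPlancherel Ψ ν)
    (f : ccSpace v) : hν.transform hΨ f =ᵐ[ν] fun y => pairing (f : N v → ℂ) (Ψ y).fn :=
  (hν.memLp hΨ f.2).coeFn_toLp

theorem IsPlancherel.norm_transform (hΨ : MeasurableEmbedding Ψ) (hν : IsPlancherel Ψ ν)
    (f : ccSpace v) : ‖hν.transform hΨ f‖ = ‖ccToL2 v f‖ :=
  hν.norm_toLp hΨ f.2

theorem IsPlancherel.mul_pairing_ae_eq_zero (hΨ : MeasurableEmbedding Ψ) (hν : IsPlancherel Ψ ν)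
    {w : Y → ℂ} {f : N v → ℂ} (hf : CcRad f)
    (hw : Integrable (fun y => w y * conj (pairing f (Ψ y).fn)) ν)
    (h : ∀ g, CcRad g → ∀ n, ∫ y, w y * conj (pairing (convPow g f n) (Ψ y).fn) ∂ν = 0) :
    ∀ᵐ y ∂ν, w y * pairing f (Ψ y).fn = 0 := by
  have h0 := ae_eq_zero_of_integral_mul_pairing_pow hΨ (fun g hg => hν.pairing_adj hΨ hg) hw
    fun g hg n => by
      rw [← h _ hg.adj n]
      refine integral_congr_ae ?_
      filter_upwards [hν.pairing_adj hΨ hg] with y hy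
      rw [(Ψ y).pairing_convPow hg.adj hf, hy, map_mul, map_pow, Complex.conj_conj, mul_assoc]
  filter_upwards [h0] with y hy
  rcases mul_eq_zero.1 hy with h1 | h1
  · rw [h1, zero_mul]
  · rw [(map_eq_zero _).1 h1, mul_zero]

theorem IsPlancherel.denseRange_transform (hΨ : MeasurableEmbedding Ψ) (hν : IsPlancherel Ψ ν) :
    DenseRange (hν.transform hΨ) := by
  refine denseRange_of_inner_eq_zero _ fun w hw => ?_
  refine (Lp.eq_zero_iff_ae_eq_zero).2 (ae_eq_zero_of_forall_mul_pairing fun f hf =>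
    hν.mul_pairing_ae_eq_zero hΨ hf
      ((Lp.memLp w).integrable_mul (hν.memLp hΨ hf).star) fun g hg n => ?_)
  have h1 := hw ⟨_, hg.convPow hf n⟩
  rw [L2.inner_def] at h1
  rw [← h1]
  refine integral_congr_ae ?_
  filter_upwards [hν.transform_coe hΨ ⟨_, hg.convPow hf n⟩] with y hy
  rw [hy, RCLike.inner_apply]

/-- The spherical transform on `L²(N)^♮`. -/
def IsPlancherel.transformL2 (hΨ : MeasurableEmbedding Ψ) (hν : IsPlancherel Ψ ν) :
    radialL2 v ≃ₗᵢ[ℂ] Lp ℂ 2 ν :=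
  (LinearEquiv.refl ℂ (ccSpace v)).extendOfIsometry (ccToL2 v) (hν.transform hΨ)
    denseRange_ccToL2 (hν.denseRange_transform hΨ) (hν.norm_transform hΨ)

theorem IsPlancherel.transformL2_ccToL2 (hΨ : MeasurableEmbedding Ψ) (hν : IsPlancherel Ψ ν)
    (f : ccSpace v) : hν.transformL2 hΨ (ccToL2 v f) = hν.transform hΨ f :=
  LinearEquiv.extendOfIsometry_eq _ _ _ _ _ _ f

theorem IsPlancherel.integral_transformL2 (hΨ : MeasurableEmbedding Ψ) (hν : IsPlancherel Ψ ν)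
    (f h : radialL2 v) :
    ∫ n, (f : Lp ℂ 2 (volume : Measure (N v))) n *
        conj ((h : Lp ℂ 2 (volume : Measure (N v))) n) =
      ∫ y, hν.transformL2 hΨ f y * conj (hν.transformL2 hΨ h y) ∂ν := by
  have h1 := (hν.transformL2 hΨ).inner_map_map h f
  rw [Submodule.coe_inner, L2.inner_def, L2.inner_def] at h1
  simpa only [RCLike.inner_apply] using h1.symm

theorem IsPlancherel.integral_mul_conj_ccRad (hΨ : MeasurableEmbedding Ψ) (hν : IsPlancherel Ψ ν)
    (f : radialL2 v) {h : N v → ℂ} (hh : CcRad h) :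
    ∫ n, (f : Lp ℂ 2 (volume : Measure (N v))) n * conj (h n) =
      ∫ y, hν.transformL2 hΨ f y * conj (pairing h (Ψ y).fn) ∂ν := by
  have h1 := hν.integral_transformL2 hΨ f (ccToL2 v ⟨h, hh⟩)
  rw [hν.transformL2_ccToL2 hΨ] at h1
  refine Eq.trans (integral_congr_ae ?_) (h1.trans (integral_congr_ae ?_))
  · filter_upwards [ccToL2_coe ⟨h, hh⟩] with n hn
    rw [hn]
  · filter_upwards [hν.transform_coe hΨ ⟨h, hh⟩] with y hy
    rw [hy]

end Abstract

/-! ### Inversion and the Plancherel formula for integrable functions -/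

theorem sFinite_comap_subtype {α : Type*} [MeasurableSpace α] {s : Set α} (hs : MeasurableSet s)
    (μ : Measure α) [SFinite μ] : SFinite (μ.comap (Subtype.val : s → α)) := by
  refine ⟨fun i => (sfiniteSeq μ i).comap Subtype.val, fun i => ⟨?_⟩, ?_⟩
  · rw [comap_subtype_coe_apply hs]
    exact measure_lt_top _ _
  · ext t ht
    rw [Measure.sum_apply _ ht, comap_subtype_coe_apply hs]
    conv_lhs => rw [← sum_sfiniteSeq μ, Measure.sum_apply _ (hs.subtype_image ht)]
    simp only [comap_subtype_coe_apply hs]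

instance (v : ℕ) (c : ℝ) : SFinite (mMeasure v c) :=
  sFinite_comap_subtype (measurableSet_Params v) _

theorem integrable_conj {α : Type*} [MeasurableSpace α] {μ : Measure α} {W : α → ℂ}
    (hW : Integrable W μ) : Integrable (fun p => conj (W p)) μ :=
  memLp_one_iff_integrable.1 (memLp_one_iff_integrable.2 hW).star

theorem isPlancherel_phiOmega {c : ℝ} (hc : IsPolarConst v c) :
    IsPlancherel (phiOmega : Params v → Omega v) (mMeasure v c) := fun _ hf =>
  plancherel_of_ccRad hc hf

theorem continuous_phi_right (p : Params v) : Continuous (phi p) := (phiC p).continuous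

theorem continuous_phi_left (n : N v) : Continuous fun p : Params v => phi p n := by
  have h := continuous_phi.comp ((continuous_id (X := Params v)).prodMk (continuous_const (y := n)))
  exact h

theorem continuous_pairing_phi {f : N v → ℂ} (hf : Integrable f) :
    Continuous fun p : Params v => pairing f (phi p) := by
  unfold pairing
  refine continuous_of_dominated (bound := fun n => ‖f n‖)
    (fun p => hf.1.mul (continuous_phi_right p).aestronglyMeasurable)
    (fun p => .of_forall fun n => ?_) hf.norm (.of_forall fun n =>
      continuous_const.mul (continuous_phi_left n))
  rw [norm_mul]
  exact mul_le_of_le_one_right (norm_nonneg _) (norm_phi_le_one p n)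

theorem norm_pairing_phi_le {f : N v → ℂ} (hf : Integrable f) (p : Params v) :
    ‖pairing f (phi p)‖ ≤ ∫ n, ‖f n‖ := by
  simpa using norm_pairing_le_of_bound hf (norm_phi_le_one p)

/-- The inverse spherical transform. -/
def invTransform (m : Measure (Params v)) (W : Params v → ℂ) (n : N v) : ℂ :=
  ∫ p, conj (phi p n) * W p ∂m

section Inverse

variable {m : Measure (Params v)} {W : Params v → ℂ}

theorem continuous_invTransform (hW : Integrable W m) : Continuous (invTransform m W) := by
  unfold invTransform
  refine continuous_of_dominated (bound := fun p => ‖W p‖)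
    (fun n => (Complex.continuous_conj.comp (continuous_phi_left n)).aestronglyMeasurable.mul hW.1)
    (fun n => .of_forall fun p => ?_) hW.norm (.of_forall fun p =>
      (Complex.continuous_conj.comp (continuous_phi_right p)).mul continuous_const)
  rw [norm_mul, RCLike.norm_conj]
  exact mul_le_of_le_one_left (norm_nonneg _) (norm_phi_le_one p n)

theorem radial_invTransform (m : Measure (Params v)) (W : Params v → ℂ) :
    Radial (invTransform m W) := fun k n => by
  have h : ∀ p, phi p (act k n) = phi p n := fun p => radial_phi p k n
  simp only [invTransform, h]

theorem integral_mul_conj_invTransform [SFinite m] {g : N v → ℂ} (hg : Integrable g)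
    (hW : Integrable W m) :
    ∫ n, g n * conj (invTransform m W n) = ∫ p, pairing g (phi p) * conj (W p) ∂m := by
  have hWc : Integrable (fun p => conj (W p)) m := integrable_conj hW
  have hphi : Continuous fun q : N v × Params v => phi q.2 q.1 := by
    have h := continuous_phi.comp (continuous_swap (X := N v) (Y := Params v))
    exact h
  have hi : Integrable (fun q : N v × Params v => g q.1 * conj (W q.2) * phi q.2 q.1)
      (volume.prod m) :=
    (hg.mul_prod hWc).mul_bdd (c := 1) hphi.aestronglyMeasurable
      (.of_forall fun q => norm_phi_le_one _ _)
  have h1 : ∀ n, g n * conj (invTransform m W n) = ∫ p, g n * conj (W p) * phi p n ∂m := fun n => by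
    rw [invTransform, ← integral_conj, ← integral_const_mul]
    congr 1
    funext p
    rw [map_mul, Complex.conj_conj]
    ring
  simp only [h1]
  rw [integral_integral_swap hi]
  congr 1
  funext p
  rw [pairing, ← integral_mul_const]
  congr 1
  funext n
  ring

end Inverse

/-- Inversion formula. -/
theorem IsPlancherel.ae_eq_invTransform {m : Measure (Params v)} [SFinite m]
    (hm : IsPlancherel phiOmega m) (f : radialL2 v)
    (hf : Integrable (hm.transformL2 measurableEmbedding_phiOmega f) m) :
    (f : Lp ℂ 2 (volume : Measure (N v))) =ᵐ[volume]
      invTransform m (hm.transformL2 measurableEmbedding_phiOmega f) := by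
  set hΨ := measurableEmbedding_phiOmega (v := v)
  set W := hm.transformL2 hΨ f
  have hc := continuous_invTransform hf
  obtain ⟨g, hgr, hg⟩ := f.2
  have hgl : LocallyIntegrable g :=
    (locallyIntegrable_Lp (f : Lp ℂ 2 (volume : Measure (N v)))).congr hg
  have h0 : (fun n => g n - invTransform m W n) =ᵐ[volume] 0 := by
    refine ae_eq_zero_of_integral_mul_ccRad (fun k n => ?_) (hgl.sub hc.locallyIntegrable)
      fun h hh => ?_
    · rw [hgr k n, radial_invTransform m W k n]
    · have h1 := hm.integral_mul_conj_ccRad hΨ f hh.conj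
      simp only [Complex.conj_conj] at h1
      have h2 := integral_mul_conj_invTransform hh.conj.integrable hf
      have h3 := congrArg conj h2
      rw [← integral_conj, ← integral_conj] at h3
      simp only [map_mul, Complex.conj_conj] at h3
      have e1 : ∫ n, g n * h n = ∫ n, (f : Lp ℂ 2 (volume : Measure (N v))) n * h n :=
        integral_congr_ae (by filter_upwards [hg] with n hn; rw [hn])
      have i1 : Integrable fun n => g n * h n := by
        refine hgl.integrable_smul_right_of_hasCompactSupport hh.cont hh.supp
      have i2 : Integrable fun n => invTransform m W n * h n :=
        (hc.mul hh.cont).integrable_of_hasCompactSupport hh.supp.mul_left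
      simp only [sub_mul]
      rw [integral_sub i1 i2, e1, h1, sub_eq_zero]
      refine Eq.trans ?_ (h3.symm.trans ?_)
      · exact integral_congr_ae (.of_forall fun p => mul_comm _ _)
      · exact integral_congr_ae (.of_forall fun p => mul_comm _ _)
  filter_upwards [hg, h0] with n h1 h2
  rw [h1]
  exact sub_eq_zero.1 h2

theorem IsPlancherel.integral_mul_conj_conv {m : Measure (Params v)} [SFinite m]
    (hm : IsPlancherel phiOmega m) {f a b : N v → ℂ} (hf : Integrable f) (ha : CcRad a)
    (hb : CcRad b) : Integrable (fun p => pairing (conv a b) (phi p)) m ∧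
      ∫ n, f n * conj (conv a b n) =
        ∫ p, pairing f (phi p) * conj (pairing (conv a b) (phi p)) ∂m := by
  set hΨ := measurableEmbedding_phiOmega (v := v)
  have hab := ha.conv hb
  have hi : Integrable (fun p => pairing (conv a b) (phi p)) m := by
    have h1 := (hm.memLp hΨ ha).integrable_mul (hm.memLp hΨ hb)
    refine h1.congr (.of_forall fun p => ?_)
    exact ((phiOmega p).pairing_conv ha hb).symm
  have hT : hm.transformL2 hΨ (ccToL2 v ⟨_, hab⟩) =ᵐ[m] fun p => pairing (conv a b) (phi p) := by
    rw [hm.transformL2_ccToL2 hΨ]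
    exact hm.transform_coe hΨ _
  have h2 := hm.ae_eq_invTransform (ccToL2 v ⟨_, hab⟩) (hi.congr hT.symm)
  refine ⟨hi, ?_⟩
  rw [← integral_mul_conj_invTransform hf hi]
  refine integral_congr_ae ?_
  filter_upwards [h2, ccToL2_coe ⟨_, hab⟩] with n h3 h4
  rw [h4] at h3
  change conv a b n = _ at h3
  rw [h3]
  congr 2
  exact integral_congr_ae (by filter_upwards [hT] with p hp; rw [hp])

/-- The transform of an integrable and square-integrable function. -/
theorem IsPlancherel.transformL2_ae_eq {m : Measure (Params v)} [SFinite m]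
    (hm : IsPlancherel phiOmega m) (f : radialL2 v)
    (hf : Integrable (f : Lp ℂ 2 (volume : Measure (N v)))) :
    hm.transformL2 measurableEmbedding_phiOmega f =ᵐ[m]
      fun p => pairing (f : Lp ℂ 2 (volume : Measure (N v))) (phi p) := by
  set hΨ := measurableEmbedding_phiOmega (v := v)
  set W := hm.transformL2 hΨ f
  set w : Params v → ℂ := fun p => W p - pairing (f : Lp ℂ 2 (volume : Measure (N v))) (phi p)
  have hsub : ∀ a b, CcRad a → CcRad b →
      Integrable (fun p => w p * conj (pairing (conv a b) (phi p))) m ∧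
      ∫ p, w p * conj (pairing (conv a b) (phi p)) ∂m = 0 := by
    intro a b ha hb
    obtain ⟨h1, h2⟩ := hm.integral_mul_conj_conv hf ha hb
    have i1 : Integrable (fun p => W p * conj (pairing (conv a b) (phi p))) m :=
      (Lp.memLp W).integrable_mul (hm.memLp hΨ (ha.conv hb)).star
    have i2 : Integrable (fun p => pairing (f : Lp ℂ 2 (volume : Measure (N v))) (phi p) *
        conj (pairing (conv a b) (phi p))) m :=
      (integrable_conj h1).bdd_mul (c := ∫ n, ‖(f : Lp ℂ 2 (volume : Measure (N v))) n‖)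
        (continuous_pairing_phi hf).aestronglyMeasurable (.of_forall (norm_pairing_phi_le hf))
    have h3 := hm.integral_mul_conj_ccRad hΨ f (ha.conv hb)
    simp only [w, sub_mul]
    refine ⟨i1.sub i2, ?_⟩
    rw [integral_sub i1 i2, ← h2, h3, sub_eq_zero]
    rfl
  have h0 : w =ᵐ[m] 0 := by
    refine ae_eq_zero_of_forall_mul_pairing (Ψ := phiOmega) fun h hh => ?_
    have h1 := hm.mul_pairing_ae_eq_zero hΨ (w := w) (hh.conv hh) (hsub h h hh hh).1 fun g hg n => by
      cases n with
      | zero => exact (hsub h h hh hh).2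
      | succ n => exact (hsub _ g (hg.convPow (hh.conv hh) n) hg).2
    filter_upwards [h1] with p hp
    rw [(phiOmega p).pairing_conv hh hh, ← mul_assoc, mul_eq_zero] at hp
    rcases hp with h | h
    · exact h
    · rw [h, mul_zero]
  filter_upwards [h0] with p hp
  exact sub_eq_zero.1 hp

theorem integral_mul_eq_zero_of_conv {u : N v → ℂ} (hu : Radial u) (hul : LocallyIntegrable u)
    (h : ∀ a b, CcRad a → CcRad b → ∫ n, u n * conv a b n = 0) {b : N v → ℂ} (hb : CcRad b) :
    ∫ n, u n * b n = 0 := by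
  set K : Set (N v) := {n | gauge n ≤ 1}
  have h1K : (1 : N v) ∈ K := by
    change gauge (1 : N v) ≤ 1
    have : gauge (1 : N v) = 0 := by
      change (0 : Fin v → ℝ) ⬝ᵥ 0 + (0 : Pairs v → ℝ) ⬝ᵥ 0 = 0
      simp
    rw [this]; exact zero_le_one
  obtain ⟨R, hR⟩ := (((isCompact_gauge_le (v := v) 1).mul hb.supp.isCompact).image
    continuous_gauge).bddAbove
  set S : Set (N v) := {n | gauge n ≤ R}
  have hSc : IsCompact S := isCompact_gauge_le R
  have hKS : ∀ m ∈ K, ∀ n, n ∉ S → b (m⁻¹ * n) = 0 := by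
    intro m hm n hn
    refine image_eq_zero_of_notMem_tsupport fun hmem => hn (hR ⟨n, ?_, rfl⟩)
    exact ⟨m, hm, m⁻¹ * n, hmem, by simp⟩
  set u' : N v → ℂ := S.indicator u
  have hin : ∀ n ∈ S, u' n = u n := fun n hn => Set.indicator_of_mem hn _
  have hout : ∀ n, n ∉ S → u' n = 0 := fun n hn => Set.indicator_of_notMem hn _
  have hu'i : Integrable u' :=
    (integrable_indicator_iff hSc.measurableSet).2 (hul.integrableOn_isCompact hSc)
  have hu'r : Radial u' := fun k n => by
    have hiff : act k n ∈ S ↔ n ∈ S := by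
      change gauge (act k n) ≤ R ↔ gauge n ≤ R
      rw [gauge_act]
    by_cases hn : n ∈ S
    · rw [hin _ hn, hin _ (hiff.2 hn), hu k n]
    · rw [hout _ hn, hout _ fun h => hn (hiff.1 h)]
  obtain ⟨C, hC⟩ := hb.supp.exists_bound_of_continuous hb.cont
  set B : N v → ℂ := fun m => ∫ n, u' n * b (m⁻¹ * n) with hB
  have hbc : Continuous fun q : N v × N v => b (q.1⁻¹ * q.2) := hb.cont.comp (by fun_prop)
  have hBc : Continuous B := by
    refine continuous_of_dominated (bound := fun n => ‖u' n‖ * C)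
      (fun m => hu'i.1.mul (hbc.comp (Continuous.prodMk_right m)).aestronglyMeasurable)
      (fun m => .of_forall fun n => ?_) (hu'i.norm.mul_const C) (.of_forall fun n =>
        continuous_const.mul (hbc.comp (Continuous.prodMk_left n)))
    rw [norm_mul]
    exact mul_le_mul_of_nonneg_left (hC _) (norm_nonneg _)
  have hBr : Radial B := fun k m => by
    simp only [hB]
    rw [← integral_act k]
    congr 1
    funext n
    rw [hu'r k n, ← act_inv, ← act_mul, hb.radial k]
  have ha : CcRad fun m => conj (B m) * cutoff 1 m :=
    CcRad.mul_cutoff (Complex.continuous_conj.comp hBc) (fun k n => by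
      change conj (B (act k n)) = conj (B n)
      rw [hBr k n]) 1
  have h0 := h _ _ ha hb
  have e1 : ∀ n, u n * conv (fun m => conj (B m) * cutoff 1 m) b n =
      ∫ m, u' n * (conj (B m) * cutoff 1 m) * b (m⁻¹ * n) := by
    intro n
    simp only [mul_assoc, integral_const_mul]
    by_cases hn : n ∈ S
    · simp only [hin n hn, conv, mul_assoc]
    · rw [hout n hn, zero_mul, conv]
      have : ∀ m, conj (B m) * cutoff 1 m * b (m⁻¹ * n) = 0 := fun m => by
        by_cases hm : m ∈ K
        · rw [hKS m hm n hn, mul_zero]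
        · rw [cutoff_eq_zero (not_le.1 hm).le, Complex.ofReal_zero, mul_zero, zero_mul]
      simp only [this, integral_zero, mul_zero]
  have hprod : Integrable (fun q : N v × N v =>
      u' q.1 * (conj (B q.2) * cutoff 1 q.2) * b (q.2⁻¹ * q.1)) (volume.prod volume) :=
    (hu'i.mul_prod ha.integrable).mul_bdd (c := C)
      (hbc.comp continuous_swap).aestronglyMeasurable (.of_forall fun q => hC _)
  simp only [e1] at h0
  rw [integral_integral_swap hprod] at h0
  have e2 : ∀ m, ∫ n, u' n * (conj (B m) * cutoff 1 m) * b (m⁻¹ * n) =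
      ((Complex.normSq (B m) * cutoff 1 m : ℝ) : ℂ) := by
    intro m
    have : ∀ n, u' n * (conj (B m) * cutoff 1 m) * b (m⁻¹ * n) =
        conj (B m) * cutoff 1 m * (u' n * b (m⁻¹ * n)) := fun n => by ring
    simp only [this, integral_const_mul]
    change conj (B m) * cutoff 1 m * B m = _
    rw [mul_right_comm, mul_comm (conj _), Complex.mul_conj, Complex.ofReal_mul]
  simp only [e2] at h0
  rw [integral_complex_ofReal, Complex.ofReal_eq_zero] at h0
  have hB1 : B 1 = 0 := by
    by_contra hne
    have hpos := Continuous.integral_pos_of_hasCompactSupport_nonneg_nonzero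
      (μ := (volume : Measure (N v))) (f := fun m => Complex.normSq (B m) * cutoff 1 m) (x := 1)
      ((Complex.continuous_normSq.comp hBc).mul (continuous_cutoff 1))
      (hasCompactSupport_cutoff 1).mul_left
      (fun m => mul_nonneg (Complex.normSq_nonneg _) (cutoff_nonneg _ _)) (by
        refine mul_ne_zero (fun h => hne (Complex.normSq_eq_zero.1 h)) (cutoff_pos ?_).ne'
        have : gauge (1 : N v) = 0 := by
          change (0 : Fin v → ℝ) ⬝ᵥ 0 + (0 : Pairs v → ℝ) ⬝ᵥ 0 = 0
          simp
        rw [this]; exact zero_lt_one)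
    exact hpos.ne' h0
  rw [← hB1]
  congr 1
  funext n
  rw [inv_one, one_mul]
  by_cases hn : n ∈ S
  · rw [hin n hn]
  · have := hKS 1 h1K n hn
    rw [inv_one, one_mul] at this
    rw [this, mul_zero, mul_zero]

theorem conj_conv (a b : N v → ℂ) (n : N v) :
    conj (conv a b n) = conv (fun n => conj (a n)) (fun n => conj (b n)) n := by
  simp only [conv, ← integral_conj, map_mul]

theorem ae_eq_zero_of_integral_mul_conj_conv {u : N v → ℂ} (hu : Radial u)
    (hul : LocallyIntegrable u)
    (h : ∀ a b, CcRad a → CcRad b → ∫ n, u n * conj (conv a b n) = 0) : u =ᵐ[volume] 0 := by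
  refine ae_eq_zero_of_integral_mul_ccRad hu hul fun g hg =>
    integral_mul_eq_zero_of_conv hu hul (fun a b ha hb => ?_) hg
  rw [← h _ _ ha.conj hb.conj]
  simp only [conj_conv, Complex.conj_conj]

/-- The class in `L²(N)^♮` of a radial square-integrable function. -/
def toRadialL2 {f : N v → ℂ} (hr : Radial f) (hf : MemLp f 2 (volume : Measure (N v))) :
    radialL2 v := ⟨hf.toLp f, f, hr, hf.coeFn_toLp⟩

theorem IsPlancherel.eLpNorm_eq_of_memLp {m : Measure (Params v)} [SFinite m]
    (hm : IsPlancherel phiOmega m) {f : N v → ℂ} (hr : Radial f) (h1 : Integrable f)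
    (h2 : MemLp f 2 (volume : Measure (N v))) :
    eLpNorm f 2 volume = eLpNorm (fun p => pairing f (phi p)) 2 m := by
  set hΨ := measurableEmbedding_phiOmega (v := v)
  have hcoe : ((toRadialL2 hr h2 : Lp ℂ 2 (volume : Measure (N v))) : N v → ℂ) =ᵐ[volume] f :=
    h2.coeFn_toLp
  have h3 := hm.transformL2_ae_eq (toRadialL2 hr h2) (h1.congr hcoe.symm)
  have h4 : ∀ p, pairing (toRadialL2 hr h2 : Lp ℂ 2 (volume : Measure (N v))) (phi p) =
      pairing f (phi p) := fun p =>
    integral_congr_ae (by filter_upwards [hcoe] with n hn; rw [hn])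
  simp only [h4] at h3
  rw [← eLpNorm_congr_ae h3, ← Lp.enorm_def, ← ofReal_norm, LinearIsometryEquiv.norm_map,
    ← eLpNorm_congr_ae hcoe, ← Lp.enorm_def, ← ofReal_norm]
  rfl

theorem IsPlancherel.eLpNorm_eq {m : Measure (Params v)} [SFinite m]
    (hm : IsPlancherel phiOmega m) {f : N v → ℂ} (hr : Radial f) (h1 : Integrable f) :
    eLpNorm f 2 volume = eLpNorm (fun p => pairing f (phi p)) 2 m := by
  by_cases h2 : MemLp f 2 (volume : Measure (N v))
  · exact hm.eLpNorm_eq_of_memLp hr h1 h2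
  · have htop : eLpNorm f 2 (volume : Measure (N v)) = ∞ := by
      by_contra hne
      exact h2 ⟨h1.1, lt_top_iff_ne_top.2 hne⟩
    rw [htop]
    by_contra hne
    set hΨ := measurableEmbedding_phiOmega (v := v)
    have hmem : MemLp (fun p => pairing f (phi p)) 2 m :=
      ⟨(continuous_pairing_phi h1).aestronglyMeasurable, lt_top_iff_ne_top.2 (Ne.symm hne)⟩
    set g : radialL2 v := (hm.transformL2 hΨ).symm (hmem.toLp _)
    have hg : hm.transformL2 hΨ g = hmem.toLp _ := LinearIsometryEquiv.apply_symm_apply _ _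
    obtain ⟨k, hkr, hk⟩ := g.2
    have hkl : LocallyIntegrable k :=
      (locallyIntegrable_Lp (g : Lp ℂ 2 (volume : Measure (N v)))).congr hk
    have h0 : (fun n => f n - k n) =ᵐ[volume] 0 := by
      refine ae_eq_zero_of_integral_mul_conj_conv (fun l n => ?_) (h1.locallyIntegrable.sub hkl)
        fun a b ha hb => ?_
      · rw [hr l n, hkr l n]
      · have hab := ha.conv hb
        have e1 := (hm.integral_mul_conj_conv h1 ha hb).2
        have e2 := hm.integral_mul_conj_ccRad hΨ g hab
        rw [hg] at e2
        have e3 : ∫ n, k n * conj (conv a b n) =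
            ∫ n, (g : Lp ℂ 2 (volume : Measure (N v))) n * conj (conv a b n) :=
          integral_congr_ae (by filter_upwards [hk] with n hn; rw [hn])
        have e4 : ∫ p, hmem.toLp _ p * conj (pairing (conv a b) (phiOmega p).fn) ∂m =
            ∫ p, pairing f (phi p) * conj (pairing (conv a b) (phi p)) ∂m :=
          integral_congr_ae (by filter_upwards [hmem.coeFn_toLp] with p hp; rw [hp, phiOmega_fn])
        have i1 : Integrable fun n => f n * conj (conv a b n) :=
          h1.locallyIntegrable.integrable_smul_right_of_hasCompactSupport hab.conj.cont hab.conj.supp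
        have i2 : Integrable fun n => k n * conj (conv a b n) :=
          hkl.integrable_smul_right_of_hasCompactSupport hab.conj.cont hab.conj.supp
        simp only [sub_mul]
        rw [integral_sub i1 i2, e1, e3, e2, e4, sub_self]
    refine h2 ((memLp_congr_ae ?_).1 (Lp.memLp (g : Lp ℂ 2 (volume : Measure (N v)))))
    filter_upwards [hk, h0] with n h3 h4
    rw [h3]
    exact (sub_eq_zero.1 h4).symm

theorem IsRadialPlancherelMeasure.isPlancherel {μ : Measure (Omega v)}
    (hμ : IsRadialPlancherelMeasure μ) : IsPlancherel id μ := fun f hf => by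
  rw [← eLpNorm_two_sq, ← eLpNorm_two_sq, hμ f hf.radial (hf.memLp 1) (hf.memLp 2)]
  rfl

theorem IsPlancherel.map {m : Measure (Params v)} (hm : IsPlancherel phiOmega m) :
    IsPlancherel id (m.map phiOmega) := fun f hf => by
  rw [hm f hf, measurableEmbedding_phiOmega.lintegral_map]
  rfl

/-- The spherical transform carries the Plancherel measure to the parameters. -/
theorem isRadialPlancherelMeasure_iff {c : ℝ} (hc : IsPolarConst v c) (μ : Measure (Omega v)) :
    IsRadialPlancherelMeasure μ ↔ μ = (mMeasure v c).map phiOmega := by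
  have hm := isPlancherel_phiOmega hc
  refine ⟨fun hμ => isPlancherel_unique hμ.isPlancherel hm.map, ?_⟩
  rintro rfl f hr h1 -
  rw [hm.eLpNorm_eq hr (memLp_one_iff_integrable.1 h1),
    measurableEmbedding_phiOmega.eLpNorm_map_measure]
  rfl

end FreeNilpotent

end

theorem mainTheorem4 (v : ℕ) :
    -- the constant of the measure `η` exists and is unique
    (∃! c : ℝ, FreeNilpotent.IsPolarConst v c) ∧
    ∀ c : ℝ, FreeNilpotent.IsPolarConst v c →
      -- the functions `φ^{r,Λ,l}` are bounded spherical functions, identified with the parameters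
      ∃ Φ : FreeNilpotent.Params v → FreeNilpotent.Omega v,
        (∀ p n, (Φ p).fn n = FreeNilpotent.phi p n) ∧
        MeasurableEmbedding Φ ∧
        -- the image of `m` is the radial Plancherel measure, and it is supported by `𝒫`
        (∀ μ : Measure (FreeNilpotent.Omega v),
          FreeNilpotent.IsRadialPlancherelMeasure μ ↔
            μ = (FreeNilpotent.mMeasure v c).map Φ) ∧
        (∀ μ : Measure (FreeNilpotent.Omega v),
          FreeNilpotent.IsRadialPlancherelMeasure μ → μ (Set.range Φ)ᶜ = 0) ∧
        -- radial Plancherel formula for integrable functions, both sides in `[0, ∞]`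
        (∀ f : FreeNilpotent.N v → ℂ, FreeNilpotent.Radial f → MemLp f 1 volume →
          eLpNorm f 2 volume =
            eLpNorm (fun p => FreeNilpotent.pairing f (FreeNilpotent.phi p)) 2
              (FreeNilpotent.mMeasure v c)) ∧
        -- extension to radial `L²` functions and inversion
        ∃ F : FreeNilpotent.radialL2 v ≃ₗᵢ[ℂ] Lp ℂ 2 (FreeNilpotent.mMeasure v c),
          (∀ f : FreeNilpotent.radialL2 v,
            Integrable (f : Lp ℂ 2 (volume : Measure (FreeNilpotent.N v))) volume →
            F f =ᵐ[FreeNilpotent.mMeasure v c] fun p =>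
              FreeNilpotent.pairing (f : Lp ℂ 2 (volume : Measure (FreeNilpotent.N v)))
                (FreeNilpotent.phi p)) ∧
          (∀ f h : FreeNilpotent.radialL2 v,
            ∫ n, (f : Lp ℂ 2 (volume : Measure (FreeNilpotent.N v))) n *
                conj ((h : Lp ℂ 2 (volume : Measure (FreeNilpotent.N v))) n) =
              ∫ p, F f p * conj (F h p) ∂(FreeNilpotent.mMeasure v c)) ∧
          (∀ f : FreeNilpotent.radialL2 v,
            Integrable (F f) (FreeNilpotent.mMeasure v c) →
            (f : Lp ℂ 2 (volume : Measure (FreeNilpotent.N v))) =ᵐ[volume] fun n =>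
              ∫ p, conj (FreeNilpotent.phi p n) * F f p ∂(FreeNilpotent.mMeasure v c)) := by
  refine ⟨FreeNilpotent.existsUnique_isPolarConst v, fun c hc => ?_⟩
  have hm := FreeNilpotent.isPlancherel_phiOmega hc
  have hΨ := FreeNilpotent.measurableEmbedding_phiOmega (v := v)
  refine ⟨FreeNilpotent.phiOmega, fun p n => rfl, hΨ,
    FreeNilpotent.isRadialPlancherelMeasure_iff hc, fun μ hμ => ?_,
    fun f hr h1 => hm.eLpNorm_eq hr (memLp_one_iff_integrable.1 h1),
    hm.transformL2 hΨ, hm.transformL2_ae_eq, hm.integral_transformL2 hΨ, hm.ae_eq_invTransform⟩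
  rw [(FreeNilpotent.isRadialPlancherelMeasure_iff hc μ).1 hμ,
    Measure.map_apply hΨ.measurable hΨ.measurableSet_range.compl, Set.preimage_compl,
    Set.preimage_range, Set.compl_univ, measure_empty]
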